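/- **Setting.** For $i=1,2,\dots$ and $t=1,2,\dots$ let $x_{it}=\lambda_{ji}^{0\prime}f_t^0+e_{it}$ if $z_t=j$, where $z_t\in\{1,\dots,J^0\}$ is an unobserved regime, $\lambda_{ji}^0\in\mathbb R^{r_j}$ are nonrandom loadings, $f_t^0\in\mathbb R^{r_{z_t}}$ are factors ($f_t^0=f_{j,t}$ when $z_t=j$; if all $r_j$ agree one may take $f_{j,t}$ not depending on $j$), and the process $(z_t)$ is independent of $(f_{j,t},e_{it})_{j,i,t}$. Put $\Lambda_j^0=(\lambda_{j1}^0,\dots,\lambda_{jN}^0)'$, $x_t=(x_{1t},\dots,x_{Nt})'$, $M_A=I-A(A'A)^{-1}A'$, $\delta_{NT}=\min\{\sqrt N,\sqrt T\}$. Norms of vectors are Euclidean, those of matrices Frobenius. $M$ denotes a finite constant not depending on $N,T,i,k,s,t,j$; $\alpha>16$ and $\beta\ge2$ are fixed. **Assumptions.** 1. (Factors) $\frac1{Tq_j^0}\sum_{t\le T}f_t^0f_t^{0\prime}1_{z_t=j}\to_p\Sigma_{F_j}$ with $\Sigma_{F_j}$ positive definite; for every $c>0$ there is $\kappa>0$ such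 that, with probability tending to one as $T\to\infty$, every $A\subseteq\{t\le T:z_t=j\}$ with $|A|\ge cT$ has $\frac1{|A|}\sum_{t\in A}f_t^0f_t^{0\prime}\ge\kappa I$; and $E\|f_t^0\|^\alpha\le M$. 2. (Loadings) $\frac1N\Lambda_j^{0\prime}\Lambda_j^0\to\Sigma_{\Lambda_j}$ positive definite, $\|\lambda_{ji}^0\|\le M$; there is $C>0$ such that for all large $N$, almost surely, $\frac1N\|M_{\Lambda_k^0}\Lambda_{z_t}^0f_t^0\|^2\ge C$ for all $t$ and all $k\ne z_t$. 3. (Errors) $E e_{it}=0$, $E|e_{it}|^\alpha\le M$; $|E(e_{it}e_{kt})|\le\tau_{ik}$ for all $t$ with $\sum_{k\le N}\tau_{ik}\le M$; $|E(e_{it}e_{is})|\le\gamma_{ts}$ for all $i$ with $\sum_{s\le T}\gamma_{ts}\le M$; $E\big|\frac1{\sqrt T}\sum_{t\le T}(e_{it}e_{kt}-E(e_{it}e_{kt}))1_{z_t=j}\big|^2\le M$. 4. (States) $\frac1T\sum_{t\le T}1_{z_t=j}\to_pq_j^0\in(0,1)$. 5. $E\|\frac1{\sqrt N}\sum_{i\le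 N}\lambda_{ji}^0e_{it}\|^\beta\le M$ and $E\|\frac1{\sqrt T}\sum_{t\le T}f_t^0e_{it}1_{z_t=j}\|^2\le M$. 6. The eigenvalues of $\Sigma_{\Lambda_j}^{1/2}\Sigma_{F_j}\Sigma_{\Lambda_j}^{1/2}$ are distinct. Let $V_j$ be the diagonal matrix of these eigenvalues in descending order and $\Upsilon_j$ an orthogonal matrix of corresponding eigenvectors. 7. $E\|\frac1{\sqrt{NT}}\sum_{k\le N}\sum_{t\le T}\lambda_{jk}^0(e_{it}e_{kt}-E(e_{it}e_{kt}))1_{z_t=j}\|^2\le M$ for $i\le N$; $E\|\frac1{\sqrt{NT}}\sum_{i\le N}\sum_{t\le T}(e_{it}e_{is}-E(e_{it}e_{is}))f_t^01_{z_t=j}\|^2\le M$ for $s\le T$; $E\|\frac1{\sqrt{NT}}\sum_{k\le N}\sum_{t\le T}\lambda_{jk}^0f_t^{0\prime}e_{kt}1_{z_t=j}\|^2\le M$; and for all $j,t$, $\frac1N\sum_{i,k\le N}\lambda_{ji}^0\lambda_{jk}^{0\prime}E(e_{it}e_{kt})\to\Gamma_{jt}$ and $\frac1{\sqrt N}\sum_{i\le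 N}\lambda_{ji}^0e_{it}\to_d\mathcal N(0,\Gamma_{jt})$. **Estimators.** Let $L(x;\Lambda_j,\sigma^2)$ be the $\mathcal N(0,\Lambda_j\Lambda_j'+\sigma^2I_N)$ density. Given weights $q_j$ (possibly depending on the data, $\sum_jq_j=1$, bounded below by a positive constant) and any random $\hat\sigma^2\in[C^{-2},C^2]$ for some fixed $C>0$, the matrices $\hat\Lambda_j$ ($N\times r_j$, $j=1,\dots,J^0$) maximize $\sum_{t\le T}\log\sum_jq_jL(x_t;\Lambda_j,\hat\sigma^2)$ over $(\Lambda_1,\dots,\Lambda_{J^0})$, normalized so that each $\hat\Lambda_j'\hat\Lambda_j$ is diagonal with nonincreasing diagonal. The estimated regimes are numbered so that $\sum_j\|M_{\hat\Lambda_j}\Lambda_j^0\|^2$ is minimal among renumberings that preserve the numbers of factors, and the signs of the columns of $\hat\Lambda_j$ are chosen so that $\Upsilon_j'\Sigma_{\Lambda_j}^{-1/2}\Lambda_j^{0\prime}\hat\Lambda_j$ has nonnegative diagonal. Put $\hat p_{tj}=q_jL(x_t;\hat\Lambda_j,\hat\sigma^2)/\sum_kq_kL(x_t;\hat\Lambda_k,\hat\sigma^2)$,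 $$\hat f_t=\sum_j\hat p_{tj}\hat\Lambda_j'(\hat\Lambda_j\hat\Lambda_j'+\hat\sigma^2I_N)^{-1}x_t,$$ $W_{jNT}=\big(\frac{\hat\Lambda_j'\hat\Lambda_j}N+\frac{\hat\sigma^2}NI_{r_j}\big)\frac1T\sum_{t\le T}\hat p_{tj}$ and $H_j=\frac{\sum_{t\le T}f_t^0f_t^{0\prime}1_{z_t=j}}T\,\frac{\Lambda_j^{0\prime}\hat\Lambda_j}N\,W_{jNT}^{-1}$. If the $r_j$ differ, vectors in $\mathbb R^{r_j}$ are read as vectors in $\mathbb R^{\max_kr_k}$ by appending zeros. **Theorem.** Under these assumptions, as $(N,T)\to\infty$ jointly with $\sqrt N/T\to0$, $T^{16/\alpha}/N\to0$ and $T^{2/\alpha+2/\beta}/N\to0$, each $H_j$ is invertible with probability tending to one, and (1) $\frac1T\sum_{t\le T}\|\hat f_t-H_{z_t}^{-1}f_t^0\|^2=O_p(\delta_{NT}^{-2})$; (2) for each fixed $t$, $\sqrt N(\hat f_t-H_{z_t}^{-1}f_t^0)$ is asymptotically mixed normal: for each $j$ with $\Pr(z_t=j)>0$, its distribution conditional on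 $z_t=j$ converges weakly to $$\mathcal N\big(0,\;V_j^{-1/2}\Upsilon_j'\Sigma_{\Lambda_j}^{-1/2}\Gamma_{jt}\Sigma_{\Lambda_j}^{-1/2}\Upsilon_jV_j^{-1/2}\big).$$ -/

import Mathlib

open MeasureTheory ProbabilityTheory Filter Topology Matrix
open scoped MatrixOrder Matrix.Norms.L2Operator

noncomputable section

namespace SwitchingFactor

/-! ### General notions -/

/-- `X n = O_p (a n)` as `n → ∞`. -/
def IsBigOp {Ω : Type*} [MeasurableSpace Ω] (μ : Measure Ω) (X : ℕ → Ω → ℝ) (a : ℕ → ℝ) : Prop :=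
  ∀ ε : ℝ, 0 < ε → ∃ K : ℝ, ∀ᶠ n in atTop, μ {ω | K * a n < |X n ω|} ≤ ENNReal.ofReal ε

/-- `E |X| ^ p ≤ M`, the expectation being taken in `[0, ∞]` (so that finiteness is part of
the claim). -/
def MomentLE {Ω : Type*} [MeasurableSpace Ω] (μ : Measure Ω) (X : Ω → ℝ) (p M : ℝ) : Prop :=
  ∫⁻ ω, ENNReal.ofReal (|X ω| ^ p) ∂μ ≤ ENNReal.ofReal M

/-- Euclidean norm of a vector. -/
def enorm2 {k : ℕ} (v : Fin k → ℝ) : ℝ := ‖WithLp.toLp 2 v‖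

/-- Squared Frobenius norm of a matrix. -/
def frobSq {k l : ℕ} (A : Matrix (Fin k) (Fin l) ℝ) : ℝ := ∑ i, ∑ a, A i a ^ 2

/-- `M_A = I - A (A' A)⁻¹ A'`. -/
def annihilator {k l : ℕ} (A : Matrix (Fin k) (Fin l) ℝ) : Matrix (Fin k) (Fin k) ℝ :=
  1 - A * (Aᵀ * A)⁻¹ * Aᵀ

/-- The inclusion `ℝ^k ⊆ ℝ^R` onto the first `k` coordinates, for `k ≤ R`
(the remaining coordinates are set to zero). -/
def pad {k : ℕ} (R : ℕ) (v : Fin k → ℝ) : EuclideanSpace ℝ (Fin R) :=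
  WithLp.toLp 2 fun a => if h : (a : ℕ) < k then v ⟨a, h⟩ else 0

/-- `δ_NT = min (√N, √T)`. -/
def delta (N T : ℕ) : ℝ := min (Real.sqrt N) (Real.sqrt T)

/-! ### The model -/

/-- The random and deterministic ingredients of a factor model with regime switching.
Cross-sectional units `i` and dates `t` are numbered from `0`; a sample of size `(N, T)` consists
of `i < N`, `t < T`. The factor vector of date `t` is `f (z t) t`, a vector whose dimension
`r (z t)` may depend on the regime; when all `r j` agree, `f j` may be the same process for
all `j`. -/
structure Model (Ω : Type*) [MeasurableSpace Ω] where
  /-- number of regimes -/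
  J : ℕ
  /-- number of factors in each regime -/
  r : Fin J → ℕ
  /-- true loadings of regime `j` and unit `i` -/
  lam : (j : Fin J) → ℕ → Fin (r j) → ℝ
  /-- true factors -/
  f : (j : Fin J) → ℕ → Ω → Fin (r j) → ℝ
  /-- regime of date `t` -/
  z : ℕ → Ω → Fin J
  /-- error of unit `i` at date `t` -/
  e : ℕ → ℕ → Ω → ℝ
  measurable_f : ∀ j t, Measurable (f j t)
  measurable_z : ∀ t, Measurable (z t)
  measurable_e : ∀ i t, Measurable (e i t)

variable {Ω : Type*} [MeasurableSpace Ω]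

/-- The `N × r j` matrix of true loadings of regime `j`. -/
def Model.Lam (m : Model Ω) (N : ℕ) (j : Fin m.J) : Matrix (Fin N) (Fin (m.r j)) ℝ :=
  Matrix.of fun i a => m.lam j i a

/-- The indicator of `z t = j`. -/
def Model.ind (m : Model Ω) (j : Fin m.J) (t : ℕ) (ω : Ω) : ℝ := if m.z t ω = j then 1 else 0

/-- The vector of observations `x_t`. -/
def Model.x (m : Model Ω) (N : ℕ) (ω : Ω) (t : ℕ) : Fin N → ℝ :=
  fun i => (∑ a, m.lam (m.z t ω) i a * m.f (m.z t ω) t ω a) + m.e i t ω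

/-- The largest number of factors over the regimes. -/
def Model.R (m : Model Ω) : ℕ := Finset.univ.sup m.r

/-! ### The Gaussian mixture quasi-likelihood and the estimators -/

/-- `Σ_j = Λ_j Λ_j' + σ² I`. -/
def covMat {N k : ℕ} (L : Matrix (Fin N) (Fin k) ℝ) (s2 : ℝ) : Matrix (Fin N) (Fin N) ℝ :=
  L * Lᵀ + s2 • 1

/-- The `N (0, Λ_j Λ_j' + σ² I)` density. -/
def dens {N k : ℕ} (L : Matrix (Fin N) (Fin k) ℝ) (s2 : ℝ) (x : Fin N → ℝ) : ℝ :=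
  (2 * Real.pi) ^ (-(N : ℝ) / 2) * (covMat L s2).det ^ (-(1 / 2) : ℝ) *
    Real.exp (-(1 / 2) * (x ⬝ᵥ (covMat L s2)⁻¹ *ᵥ x))

/-- The log-likelihood of the sample `x 0, …, x (T - 1)`. -/
def logLik {J N : ℕ} {r : Fin J → ℕ} (x : ℕ → Fin N → ℝ) (T : ℕ)
    (L : (j : Fin J) → Matrix (Fin N) (Fin (r j)) ℝ) (s2 : ℝ) (q : Fin J → ℝ) : ℝ :=
  ∑ t ∈ Finset.range T, Real.log (∑ j, q j * dens (L j) s2 (x t))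

/-- The conditional probability of regime `j` given `x`. -/
def post {J N : ℕ} {r : Fin J → ℕ} (L : (j : Fin J) → Matrix (Fin N) (Fin (r j)) ℝ)
    (s2 : ℝ) (q : Fin J → ℝ) (x : Fin N → ℝ) (j : Fin J) : ℝ :=
  q j * dens (L j) s2 x / ∑ k, q k * dens (L k) s2 x

/-- Loadings `L` that maximize the log-likelihood of the sample of size `(N, T)` for the given
`σ²` and `q`, among all matrices of the given format, normalized so that each `Λ_j' Λ_j` is
diagonal with nonincreasing diagonal entries. -/
structure IsQuasiMLE (m : Model Ω) (N T : ℕ) (ω : Ω)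
    (L : (j : Fin m.J) → Matrix (Fin N) (Fin (m.r j)) ℝ) (s2 : ℝ) (q : Fin m.J → ℝ) : Prop where
  maximal : ∀ L' : (j : Fin m.J) → Matrix (Fin N) (Fin (m.r j)) ℝ,
    logLik (m.x N ω) T L' s2 q ≤ logLik (m.x N ω) T L s2 q
  diagonal : ∀ j a b, a ≠ b → ((L j)ᵀ * L j) a b = 0
  ordered : ∀ j, Antitone fun a => ((L j)ᵀ * L j) a a

/-- The estimated regimes are numbered so that they match the true ones best, among all
renumberings that preserve the number of factors. -/
def IsLabelled (m : Model Ω) (N : ℕ) (L : (j : Fin m.J) → Matrix (Fin N) (Fin (m.r j)) ℝ) : Prop :=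
  ∀ π : Equiv.Perm (Fin m.J), (∀ j, m.r (π j) = m.r j) →
    ∑ j, frobSq (annihilator (L j) * m.Lam N j) ≤ ∑ j, frobSq (annihilator (L (π j)) * m.Lam N j)

/-- `f̂_t = ∑_j p̂_tj Λ_j' (Λ_j Λ_j' + σ² I)⁻¹ x_t`, as a vector in `ℝ^R`. -/
def fhat (m : Model Ω) (N : ℕ) (ω : Ω) (L : (j : Fin m.J) → Matrix (Fin N) (Fin (m.r j)) ℝ)
    (s2 : ℝ) (q : Fin m.J → ℝ) (t : ℕ) : EuclideanSpace ℝ (Fin m.R) :=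
  ∑ j, post L s2 q (m.x N ω t) j •
    pad m.R ((L j)ᵀ *ᵥ ((covMat (L j) s2)⁻¹ *ᵥ m.x N ω t))

/-- `W_jNT = (Λ̂_j' Λ̂_j / N + σ̂² / N I) (T⁻¹ ∑_t p̂_tj)`. -/
def Wmat (m : Model Ω) (N T : ℕ) (ω : Ω) (L : (j : Fin m.J) → Matrix (Fin N) (Fin (m.r j)) ℝ)
    (s2 : ℝ) (q : Fin m.J → ℝ) (j : Fin m.J) : Matrix (Fin (m.r j)) (Fin (m.r j)) ℝ :=
  ((T : ℝ)⁻¹ * ∑ t ∈ Finset.range T, post L s2 q (m.x N ω t) j) •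
    ((N : ℝ)⁻¹ • ((L j)ᵀ * L j) + (s2 / N) • 1)

/-- `∑_{t < T} f_t f_t' 1{z_t = j}`. -/
def sumFF (m : Model Ω) (T : ℕ) (ω : Ω) (j : Fin m.J) : Matrix (Fin (m.r j)) (Fin (m.r j)) ℝ :=
  Matrix.of fun a b => ∑ t ∈ Finset.range T, m.f j t ω a * m.f j t ω b * m.ind j t ω

/-- `H_j = (T⁻¹ ∑_t f_t f_t' 1{z_t = j}) (Λ_j⁰' Λ̂_j / N) W_jNT⁻¹`. -/
def Hmat (m : Model Ω) (N T : ℕ) (ω : Ω) (L : (j : Fin m.J) → Matrix (Fin N) (Fin (m.r j)) ℝ)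
    (s2 : ℝ) (q : Fin m.J → ℝ) (j : Fin m.J) : Matrix (Fin (m.r j)) (Fin (m.r j)) ℝ :=
  ((T : ℝ)⁻¹ • sumFF m T ω j) * ((N : ℝ)⁻¹ • ((m.Lam N j)ᵀ * L j)) * (Wmat m N T ω L s2 q j)⁻¹

/-- `f̂_t - H_{z_t}⁻¹ f_t⁰`, as a vector in `ℝ^R`. -/
def factorError (m : Model Ω) (N T : ℕ) (ω : Ω)
    (L : (j : Fin m.J) → Matrix (Fin N) (Fin (m.r j)) ℝ)
    (s2 : ℝ) (q : Fin m.J → ℝ) (t : ℕ) : EuclideanSpace ℝ (Fin m.R) :=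
  fhat m N ω L s2 q t -
    pad m.R ((Hmat m N T ω L s2 q (m.z t ω))⁻¹ *ᵥ m.f (m.z t ω) t ω)

/-- Estimators along a sequence of sample sizes: estimated loadings, `σ̂²` and the regime weights
used in the likelihood. -/
structure Estimators (m : Model Ω) where
  N : ℕ → ℕ
  T : ℕ → ℕ
  L : (n : ℕ) → Ω → (j : Fin m.J) → Matrix (Fin (N n)) (Fin (m.r j)) ℝ
  s2 : ℕ → Ω → ℝ
  q : ℕ → Ω → Fin m.J → ℝ
  measurable_L : ∀ n j i a, Measurable fun ω => L n ω j i a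
  measurable_s2 : ∀ n, Measurable (s2 n)
  measurable_q : ∀ n j, Measurable fun ω => q n ω j

/-- `H_j` at the `n`-th sample size. -/
def Estimators.H {m : Model Ω} (E : Estimators m) (n : ℕ) (ω : Ω) (j : Fin m.J) :
    Matrix (Fin (m.r j)) (Fin (m.r j)) ℝ :=
  Hmat m (E.N n) (E.T n) ω (E.L n ω) (E.s2 n ω) (E.q n ω) j

/-- `f̂_t - H_{z_t}⁻¹ f_t⁰` at the `n`-th sample size. -/
def Estimators.err {m : Model Ω} (E : Estimators m) (n t : ℕ) (ω : Ω) :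
    EuclideanSpace ℝ (Fin m.R) :=
  factorError m (E.N n) (E.T n) ω (E.L n ω) (E.s2 n ω) (E.q n ω) t

/-! ### Limit quantities -/

/-- The limits of second moments: `SigF j` of the factors in regime `j`, `SigL j` of the loadings,
`Gam j t` of the scaled cross-sectional sums of loadings times errors; and the spectral
decomposition of `SigL^{1/2} SigF SigL^{1/2}`, with eigenvalues `v j` and eigenvectors the columns
of `Ups j`. -/
structure Limits (m : Model Ω) where
  q0 : Fin m.J → ℝ
  SigF : (j : Fin m.J) → Matrix (Fin (m.r j)) (Fin (m.r j)) ℝ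
  SigL : (j : Fin m.J) → Matrix (Fin (m.r j)) (Fin (m.r j)) ℝ
  Gam : (j : Fin m.J) → ℕ → Matrix (Fin (m.r j)) (Fin (m.r j)) ℝ
  v : (j : Fin m.J) → Fin (m.r j) → ℝ
  Ups : (j : Fin m.J) → Matrix (Fin (m.r j)) (Fin (m.r j)) ℝ

/-- The positive definite square root of `SigL j`. -/
def Limits.root {m : Model Ω} (l : Limits m) (j : Fin m.J) :
    Matrix (Fin (m.r j)) (Fin (m.r j)) ℝ := CFC.sqrt (l.SigL j)

/-- `V_j^{-1/2}` where `V_j` is the diagonal matrix of eigenvalues. -/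
def Limits.VInvSqrt {m : Model Ω} (l : Limits m) (j : Fin m.J) :
    Matrix (Fin (m.r j)) (Fin (m.r j)) ℝ := Matrix.diagonal fun a => (Real.sqrt (l.v j a))⁻¹

/-- The asymptotic covariance
`V_j^{-1/2} Υ_j' Σ_Λj^{-1/2} Γ_jt Σ_Λj^{-1/2} Υ_j V_j^{-1/2}`. -/
def Limits.asyCov {m : Model Ω} (l : Limits m) (j : Fin m.J) (t : ℕ) :
    Matrix (Fin (m.r j)) (Fin (m.r j)) ℝ :=
  l.VInvSqrt j * (l.Ups j)ᵀ * (l.root j)⁻¹ * l.Gam j t * (l.root j)⁻¹ * l.Ups j * l.VInvSqrt j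

/-- The signs of the columns of the estimated loadings are chosen in accordance with the signs of
the eigenvectors in `Ups`. -/
def IsSigned {m : Model Ω} (l : Limits m) (N : ℕ)
    (L : (j : Fin m.J) → Matrix (Fin N) (Fin (m.r j)) ℝ) : Prop :=
  ∀ j a, 0 ≤ ((l.Ups j)ᵀ * (l.root j)⁻¹ * (m.Lam N j)ᵀ * L j) a a

/-! ### Assumptions -/

/-- The state process is independent of the factors and the errors. -/
def StateIndep (m : Model Ω) (μ : Measure Ω) : Prop :=
  IndepFun (fun ω t => m.z t ω)
    (fun ω => ((fun j t => m.f j t ω, fun i t => m.e i t ω) :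
      ((j : Fin m.J) → ℕ → Fin (m.r j) → ℝ) × (ℕ → ℕ → ℝ))) μ

/-- Factors. The second field says that the second moment matrix of the factors over any
(possibly data-dependent) set of a nonvanishing fraction of the dates of a regime stays uniformly
positive definite with probability approaching one. -/
structure FactorAssumption (m : Model Ω) (μ : Measure Ω) (l : Limits m) (α : ℝ) : Prop where
  posDef : ∀ j, (l.SigF j).PosDef
  plim : ∀ j a b, TendstoInMeasure μ
    (fun (T : ℕ) ω => ((T : ℝ) * l.q0 j)⁻¹ * sumFF m T ω j a b) atTop (fun _ => l.SigF j a b)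
  subsets : ∀ j, ∀ c : ℝ, 0 < c → ∃ κ : ℝ, 0 < κ ∧
    Tendsto (fun T : ℕ => μ {ω | ∃ A ⊆ Finset.range T, (∀ t ∈ A, m.z t ω = j) ∧
      c * T ≤ (A.card : ℝ) ∧ ∃ u : Fin (m.r j) → ℝ,
        (A.card : ℝ)⁻¹ * ∑ t ∈ A, (u ⬝ᵥ m.f j t ω) ^ 2 < κ * ∑ a, u a ^ 2}) atTop (𝓝 0)
  moment : ∃ M : ℝ, ∀ t, MomentLE μ (fun ω => enorm2 (m.f (m.z t ω) t ω)) α M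

/-- Loadings. -/
structure LoadingAssumption (m : Model Ω) (μ : Measure Ω) (l : Limits m) : Prop where
  posDef : ∀ j, (l.SigL j).PosDef
  lim : ∀ j a b, Tendsto (fun N : ℕ => (N : ℝ)⁻¹ * ((m.Lam N j)ᵀ * m.Lam N j) a b) atTop
    (𝓝 (l.SigL j a b))
  bounded : ∃ M : ℝ, ∀ j i, enorm2 (m.lam j i) ≤ M
  separation : ∃ C : ℝ, 0 < C ∧ ∀ᶠ N : ℕ in atTop, ∀ᵐ ω ∂μ, ∀ t k, k ≠ m.z t ω →
    C ≤ (N : ℝ)⁻¹ *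
      enorm2 (annihilator (m.Lam N k) *ᵥ (m.Lam N (m.z t ω) *ᵥ m.f (m.z t ω) t ω)) ^ 2

/-- `E (e_it e_ks)`. -/
def Model.ecov (m : Model Ω) (μ : Measure Ω) (i t k s : ℕ) : ℝ := ∫ ω, m.e i t ω * m.e k s ω ∂μ

/-- Errors. -/
structure ErrorAssumption (m : Model Ω) (μ : Measure Ω) (α : ℝ) : Prop where
  mean : ∀ i t, ∫ ω, m.e i t ω ∂μ = 0
  moment : ∃ M : ℝ, ∀ i t, MomentLE μ (m.e i t) α M
  cross : ∃ M : ℝ, ∃ τ : ℕ → ℕ → ℝ, (∀ i k t, |m.ecov μ i t k t| ≤ τ i k) ∧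
    ∀ N : ℕ, ∀ i < N, ∑ k ∈ Finset.range N, τ i k ≤ M
  serial : ∃ M : ℝ, ∃ γ : ℕ → ℕ → ℝ, (∀ i t s, |m.ecov μ i t i s| ≤ γ t s) ∧
    ∀ T : ℕ, ∀ t < T, ∑ s ∈ Finset.range T, γ t s ≤ M
  products : ∃ M : ℝ, ∀ (T i k : ℕ) (j : Fin m.J), MomentLE μ (fun ω => (Real.sqrt T)⁻¹ *
    ∑ t ∈ Finset.range T, (m.e i t ω * m.e k t ω - m.ecov μ i t k t) * m.ind j t ω) 2 M

/-- States. -/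
structure StateAssumption (m : Model Ω) (μ : Measure Ω) (l : Limits m) : Prop where
  pos : ∀ j, 0 < l.q0 j
  lt_one : ∀ j, l.q0 j < 1
  freq : ∀ j, TendstoInMeasure μ
    (fun (T : ℕ) ω => (T : ℝ)⁻¹ * ∑ t ∈ Finset.range T, m.ind j t ω) atTop (fun _ => l.q0 j)

/-- Moments of weighted sums of errors. -/
structure MomentAssumption (m : Model Ω) (μ : Measure Ω) (β : ℝ) : Prop where
  cross : ∃ M : ℝ, ∀ (N : ℕ) (j : Fin m.J) (t : ℕ), MomentLE μ (fun ω =>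
    enorm2 fun a => (Real.sqrt N)⁻¹ * ∑ i ∈ Finset.range N, m.lam j i a * m.e i t ω) β M
  serial : ∃ M : ℝ, ∀ (T : ℕ) (j : Fin m.J) (i : ℕ), MomentLE μ (fun ω =>
    enorm2 fun a => (Real.sqrt T)⁻¹ *
      ∑ t ∈ Finset.range T, m.f j t ω a * m.e i t ω * m.ind j t ω) 2 M

/-- The eigenvalues of `SigL^{1/2} SigF SigL^{1/2}` are distinct; `v j` lists them in
descending order, and the columns of `Ups j` are corresponding orthonormal eigenvectors. -/
structure EigenAssumption {m : Model Ω} (l : Limits m) : Prop where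
  orthogonal : ∀ j, (l.Ups j)ᵀ * l.Ups j = 1
  spectral : ∀ j, l.root j * l.SigF j * l.root j =
    l.Ups j * Matrix.diagonal (l.v j) * (l.Ups j)ᵀ
  descending : ∀ j, StrictAnti (l.v j)

/-- Second moments of double sums, and the cross-sectional central limit theorem. -/
structure DistAssumption (m : Model Ω) (μ : Measure Ω) [IsProbabilityMeasure μ] (l : Limits m) :
    Prop where
  double_lam : ∃ M : ℝ, ∀ (N T : ℕ) (j : Fin m.J), ∀ i < N, MomentLE μ (fun ω =>
    enorm2 fun a => (Real.sqrt (N * T))⁻¹ * ∑ k ∈ Finset.range N, ∑ t ∈ Finset.range T,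
      m.lam j k a * (m.e i t ω * m.e k t ω - m.ecov μ i t k t) * m.ind j t ω) 2 M
  double_f : ∃ M : ℝ, ∀ (N T : ℕ) (j : Fin m.J), ∀ s < T, MomentLE μ (fun ω =>
    enorm2 fun a => (Real.sqrt (N * T))⁻¹ * ∑ i ∈ Finset.range N, ∑ t ∈ Finset.range T,
      (m.e i t ω * m.e i s ω - m.ecov μ i t i s) * m.f j t ω a * m.ind j t ω) 2 M
  double_lam_f : ∃ M : ℝ, ∀ (N T : ℕ) (j : Fin m.J), MomentLE μ (fun ω =>
    Real.sqrt (frobSq (Matrix.of fun a b => (Real.sqrt (N * T))⁻¹ *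
      ∑ k ∈ Finset.range N, ∑ t ∈ Finset.range T,
        m.lam j k a * m.f j t ω b * m.e k t ω * m.ind j t ω))) 2 M
  gam : ∀ j t a b, Tendsto (fun N : ℕ => (N : ℝ)⁻¹ *
    ∑ i ∈ Finset.range N, ∑ k ∈ Finset.range N, m.lam j i a * m.lam j k b * m.ecov μ i t k t)
    atTop (𝓝 (l.Gam j t a b))
  clt : ∀ j t, TendstoInDistribution
    (fun (N : ℕ) ω => (WithLp.toLp 2 fun a =>
      (Real.sqrt N)⁻¹ * ∑ i ∈ Finset.range N, m.lam j i a * m.e i t ω :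
        EuclideanSpace ℝ (Fin (m.r j))))
    atTop id (fun _ => μ) (multivariateGaussian 0 (l.Gam j t))

/-- The estimators are quasi maximum likelihood estimators of the loadings, for weights that are
positive (uniformly) and sum to one and some `σ̂² ∈ [C⁻², C²]`, normalized, labelled
and signed. -/
structure EstimatorAssumption {m : Model Ω} (μ : Measure Ω) (l : Limits m) (E : Estimators m) :
    Prop where
  weights : ∃ c : ℝ, 0 < c ∧ ∀ n, ∀ᵐ ω ∂μ, (∀ j, c ≤ E.q n ω j) ∧ ∑ j, E.q n ω j = 1
  variance : ∃ C : ℝ, 0 < C ∧ ∀ n, ∀ᵐ ω ∂μ, E.s2 n ω ∈ Set.Icc (1 / C ^ 2) (C ^ 2)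
  mle : ∀ n, ∀ᵐ ω ∂μ, IsQuasiMLE m (E.N n) (E.T n) ω (E.L n ω) (E.s2 n ω) (E.q n ω)
  labelled : ∀ n, ∀ᵐ ω ∂μ, IsLabelled m (E.N n) (E.L n ω)
  signed : ∀ n, ∀ᵐ ω ∂μ, IsSigned l (E.N n) (E.L n ω)

end SwitchingFactor

end

noncomputable section

namespace SwitchingFactor

variable {Ω : Type*} [MeasurableSpace Ω]

/-! ### Stochastic orders -/

/-! Minus twice the Gaussian log density of an observation is, up to a constant, the objective of a
ridge regression. With `s = σ̂²`, `B = L'L + s I` and the smoother `G = L B⁻¹ L'` it equals `cost =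
s⁻¹ x'(I - G)x + log det (I + s⁻¹ L'L)`. As the weights lie between `c` and one, the log of the
mixture differs from minus half the smallest cost by a bounded amount.

Consistency. The maximizer does at least as well as the true loadings with the true regimes. In this
comparison the squared errors cancel, and what is left says that the parts of the common components
not explained by the best fitting estimated regime sum to `O_p(NT/√δ)` (`sum_unexplained_le`,
`op_slack`). The essential input is the operator norm of the error matrix, whose square is
`O_p(NT/δ)`. By the pigeonhole principle a fixed fraction of the dates of each true regime is fitted
by one estimated regime, and the condition on subsets of dates turns the bound into closeness of
loading spaces (`Regular.exists_counterpart`). A smoother of trace at most `r k` that explains the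
loadings of regime `j` up to `o(N)` forces `r j ≤ r k`, and for equal ranks it is close to the
projection on these loadings, which therefore determines `j`. A counting argument and the labelling
rule make the correspondence the identity (`rank_eq_of_matching`, `matching_eq_id`).

Classification. The estimated smoothers are now within `ρ = O_p(δ^{-1/4})` of the true projections.
The separation of the regimes is of order `N`, while the perturbations of the cost, maximized over
all `T` dates, are `o_p(N)` by the moment bounds; this is what the conditions on `T^{16/α}/N` and
`T^{2/α+2/β}/N` are for. So the posterior probability of a wrong regime is at most `exp(-aN)` at all
dates at once (`cost_gap`, `Setting.exists_classification`).

Principal components. Concavity of the logarithm makes each block of the maximizer a minimizer of an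
average cost with posterior weights, hence a solution of the eigenvalue equation `S L̂ = w L̂ (L̂'L̂
+ s I)` for the weighted second moment matrix `S` (`first_order_condition`, `wSecond_mul_eq`). By
the classification, `S` is `ΛΦΛ'` plus noise, up to a negligible misfit, as if the regimes were
observed. Distinct eigenvalues together with the ordering and the signs identify the limit, and `H`
tends to the invertible matrix `Σ_Λ^{-1/2} Υ V^{1/2}` (`tendsto_one_of_intertwining`,
`Asymptotics.tendsto_H`).

Rates. The form of `H` is the one for which `L̂ - ΛH` is exactly `N⁻¹` times (noise + misfit) `L̂
W⁻¹`. Its norm is `O_p(√N/δ)`, and inserting `L̂ = ΛH + (L̂ - ΛH)` back into the right side gives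
the sharper `Λ'(L̂ - ΛH) = O_p(N/δ²)`. Ridge algebra then yields `f̂ - H⁻¹f = B⁻¹(H'Λ'e + (L̂ -
ΛH)'e - s H⁻¹f - L̂'(L̂ - ΛH)H⁻¹f)` up to misclassification (`coef_mulVec_sub`). Averaging squares
gives the rate `δ⁻²`. At a fixed date the first term has order `N^{-1/2}`, the others are smaller
because `√N/T → 0`, and the central limit theorem holds conditionally on the regime by independence
of the states.

Events of probability tending to one form the filter `wpo`, so that probabilistic limits become
limits along a filter; `Op` tests a bound in probability against every sequence tending to infinity,
which makes it stable under products. -/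

/-- The filter of sets of pairs `(n, ω)` that occur with probability tending to one. -/
def wpo (μ : Measure Ω) : Filter (ℕ × Ω) where
  sets := {A | Tendsto (fun n => μ {ω | (n, ω) ∉ A}) atTop (𝓝 0)}
  univ_sets := by simp
  sets_of_superset := by
    intro A B hA hAB
    refine tendsto_of_tendsto_of_tendsto_of_le_of_le tendsto_const_nhds hA (fun _ => zero_le) ?_
    exact fun n => measure_mono fun ω h h' => h (hAB h')
  inter_sets := by
    intro A B hA hB
    have h := Tendsto.add hA hB
    rw [add_zero] at h
    refine tendsto_of_tendsto_of_tendsto_of_le_of_le tendsto_const_nhds h (fun _ => zero_le) ?_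
    intro n
    refine le_trans (measure_mono ?_) (measure_union_le _ _)
    intro ω hω
    by_contra hc
    simp only [Set.mem_union, Set.mem_ofPred_eq, not_or, not_not] at hc
    exact hω hc

theorem eventually_wpo {μ : Measure Ω} {P : ℕ × Ω → Prop} :
    (∀ᶠ p in wpo μ, P p) ↔ Tendsto (fun n => μ {ω | ¬ P (n, ω)}) atTop (𝓝 0) := Iff.rfl

theorem tendsto_fst_wpo (μ : Measure Ω) : Tendsto Prod.fst (wpo μ) atTop := by
  intro A hA
  change Tendsto (fun n => μ {ω : Ω | ¬ n ∈ A}) atTop (𝓝 0)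
  refine tendsto_const_nhds.congr' ?_
  filter_upwards [hA] with n hn
  simp [hn]

theorem eventually_wpo_of_atTop {μ : Measure Ω} {Q : ℕ → Prop} (h : ∀ᶠ n in atTop, Q n) :
    ∀ᶠ p in wpo μ, Q p.1 := (tendsto_fst_wpo μ).eventually h

theorem eventually_wpo_of_ae {μ : Measure Ω} {P : ℕ × Ω → Prop}
    (h : ∀ᶠ n in atTop, ∀ᵐ ω ∂μ, P (n, ω)) : ∀ᶠ p in wpo μ, P p := by
  rw [eventually_wpo]
  refine tendsto_const_nhds.congr' ?_
  filter_upwards [h] with n hn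
  exact (ae_iff.1 hn).symm

theorem tendsto_wpo_of_tendstoInMeasure {μ : Measure Ω} {X : ℕ → Ω → ℝ} {c : ℝ} {T : ℕ → ℕ}
    (h : TendstoInMeasure μ X atTop fun _ => c) (hT : Tendsto T atTop atTop) :
    Tendsto (fun p : ℕ × Ω => X (T p.1) p.2) (wpo μ) (𝓝 c) := by
  rw [tendstoInMeasure_iff_dist] at h
  rw [Metric.tendsto_nhds]
  intro ε hε
  rw [eventually_wpo]
  have := (h ε hε).comp hT
  refine this.congr fun n => ?_
  simp

/-- `X = O_p (a)`, tested against arbitrary deterministic sequences tending to infinity. -/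
def Op (μ : Measure Ω) (X : ℕ × Ω → ℝ) (a : ℕ → ℝ) : Prop :=
  ∀ b : ℕ → ℝ, Tendsto b atTop atTop → ∀ᶠ p in wpo μ, |X p| ≤ b p.1 * a p.1

/-! ### Calculus of stochastic orders. -/

section OpCalculus

variable {μ : Measure Ω} {X Y : ℕ × Ω → ℝ} {a c : ℕ → ℝ}

/-- A diagonal argument. If no constant works for some `ε`, then for every `k` the bound with
constant `k` fails with probability above `ε` at arbitrarily late `n`. Choosing such times `s k`
increasingly gives one slowly growing sequence against which the test in `Op` fails. -/
theorem Op.isBigOp {X : ℕ → Ω → ℝ} (h : Op μ (fun p => X p.1 p.2) a) :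
    IsBigOp μ X a := by
  intro ε hε
  classical
  by_contra hcon
  push Not at hcon
  have hfreq : ∀ k : ℕ, ∀ n0 : ℕ, ∃ n ≥ n0, ENNReal.ofReal ε < μ {ω | (k : ℝ) * a n < |X n ω|} := by
    intro k n0
    obtain ⟨n, hn, h'⟩ := (frequently_atTop.1 (hcon k)) n0
    exact ⟨n, hn, by simpa using h'⟩
  choose! g hg hgε using hfreq
  obtain ⟨s, hs0, hs⟩ : ∃ s : ℕ → ℕ, s 0 = g 0 0 ∧ ∀ k, s (k + 1) = g (k + 1) (s k + 1) :=
    ⟨fun k => Nat.rec (g 0 0) (fun k sk => g (k + 1) (sk + 1)) k, rfl, fun k => rfl⟩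
  have hmono : StrictMono s := strictMono_nat_of_lt_succ fun k => by
    rw [hs]; exact hg _ _
  have hsε : ∀ k : ℕ, ENNReal.ofReal ε < μ {ω | (k : ℝ) * a (s k) < |X (s k) ω|} := by
    intro k
    cases k with
    | zero => rw [hs0]; exact hgε 0 0
    | succ k => rw [hs]; exact hgε _ _
  have hex : ∀ n, ∃ k, n ≤ s k := fun n => ⟨n, hmono.id_le n⟩
  -- The generalized inverse of `s`: it tends to infinity and takes the value `k` at `s k`.
  let b : ℕ → ℝ := fun n => ((@Nat.find (fun k => n ≤ s k) (Classical.decPred _) (hex n) : ℕ) : ℝ)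
  have hbs : ∀ k : ℕ, b (s k) = k := by
    intro k
    have : @Nat.find (fun l => s k ≤ s l) (Classical.decPred _) (hex (s k)) = k := by
      exact (@Nat.find_eq_iff _ (fun l => s k ≤ s l) (Classical.decPred _) (hex (s k))).2
        ⟨le_rfl, fun m hm => not_le.2 (hmono hm)⟩
    simp only [b, this]
  have hb : Tendsto b atTop atTop := by
    refine tendsto_natCast_atTop_atTop.comp (tendsto_atTop.2 fun k => ?_)
    filter_upwards [eventually_gt_atTop (s k)] with n hn
    refine (@Nat.le_find_iff (fun l => n ≤ s l) (Classical.decPred _) (hex n) k).2 fun m hm => ?_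
    exact not_le.2 (lt_of_le_of_lt (hmono.monotone hm.le) hn)
  have h1 := h b hb
  rw [eventually_wpo] at h1
  have h2 := h1.comp hmono.tendsto_atTop
  have h3 := h2.eventually (gt_mem_nhds (ENNReal.ofReal_pos.2 hε))
  obtain ⟨k, hk⟩ := h3.exists
  have := hsε k
  simp only [Function.comp_def, not_le, hbs] at hk
  exact absurd hk (not_lt.2 this.le)

theorem Op.mono (hY : Op μ Y a) (h : ∀ᶠ p in wpo μ, |X p| ≤ |Y p|) : Op μ X a := by
  intro b hb
  filter_upwards [h, hY b hb] with p h1 h2 using h1.trans h2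

theorem Op.rate {C : ℝ} (hX : Op μ X a) (h : ∀ᶠ n in atTop, a n ≤ C * c n)
    (hC : 0 < C) : Op μ X c := by
  intro b hb
  have hb' : Tendsto (fun n => b n / C) atTop atTop := hb.atTop_div_const hC
  filter_upwards [hX _ hb', eventually_wpo_of_atTop h,
    eventually_wpo_of_atTop (hb.eventually_ge_atTop 0)] with p h1 h2 h3
  calc |X p| ≤ b p.1 / C * a p.1 := h1
    _ ≤ b p.1 / C * (C * c p.1) := by gcongr
    _ = b p.1 * c p.1 := by field_simp

theorem Op.add (hX : Op μ X a) (hY : Op μ Y a) : Op μ (fun p => X p + Y p) a := by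
  intro b hb
  have hb' : Tendsto (fun n => b n / 2) atTop atTop := hb.atTop_div_const two_pos
  filter_upwards [hX _ hb', hY _ hb'] with p h1 h2
  calc |X p + Y p| ≤ |X p| + |Y p| := abs_add_le _ _
    _ ≤ b p.1 / 2 * a p.1 + b p.1 / 2 * a p.1 := add_le_add h1 h2
    _ = _ := by ring

theorem Op.zero : Op μ (fun _ => 0) (fun n => |a n|) := by
  intro b hb
  filter_upwards [eventually_wpo_of_atTop (hb.eventually_ge_atTop 0)] with p h
  simpa using mul_nonneg h (abs_nonneg _)

theorem Op.sum {ι : Type*} (s : Finset ι) {X : ι → ℕ × Ω → ℝ} (ha : ∀ n, 0 ≤ a n)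
    (h : ∀ i ∈ s, Op μ (X i) a) : Op μ (fun p => ∑ i ∈ s, X i p) a := by
  classical
  induction s using Finset.induction_on with
  | empty =>
    have := Op.zero (μ := μ) (a := a)
    simp only [fun n => abs_of_nonneg (ha n)] at this
    simpa using this
  | insert i s his ih =>
    simp only [Finset.sum_insert his]
    exact (h i (by simp)).add (ih fun k hk => h k (by simp [hk]))

theorem Op.mul (hX : Op μ X a) (hY : Op μ Y c) : Op μ (fun p => X p * Y p)
    (fun n => a n * c n) := by
  intro b hb
  -- The test sequence is shared between the two factors as `√b · √b`.
  have hb' : Tendsto (fun n => Real.sqrt (b n)) atTop atTop := Real.tendsto_sqrt_atTop.comp hb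
  filter_upwards [hX _ hb', hY _ hb', eventually_wpo_of_atTop (hb.eventually_ge_atTop 0)]
    with p h1 h2 h3
  calc |X p * Y p| = |X p| * |Y p| := abs_mul _ _
    _ ≤ (√(b p.1) * a p.1) * (√(b p.1) * c p.1) :=
        mul_le_mul h1 h2 (abs_nonneg _) ((abs_nonneg _).trans h1)
    _ = (√(b p.1) * √(b p.1)) * (a p.1 * c p.1) := by ring
    _ = _ := by rw [Real.mul_self_sqrt h3]

theorem Op.of_bounded {C : ℝ} (h : ∀ᶠ p in wpo μ, |X p| ≤ C) : Op μ X (fun _ => 1) := by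
  intro b hb
  filter_upwards [h, eventually_wpo_of_atTop (hb.eventually_ge_atTop C)] with p h1 h2
  simpa using h1.trans h2

theorem Op.of_tendsto {x : ℝ} (h : Tendsto X (wpo μ) (𝓝 x)) : Op μ X (fun _ => 1) := by
  refine Op.of_bounded (C := |x| + 1) ?_
  filter_upwards [(h.abs).eventually (gt_mem_nhds (lt_add_one |x|))] with p hp using hp.le

theorem Op.of_atTop_le {a' : ℕ → ℝ} (h : ∀ᶠ n in atTop, |a' n| ≤ c n) :
    Op μ (fun p => a' p.1) c := by
  intro b hb
  filter_upwards [eventually_wpo_of_atTop h, eventually_wpo_of_atTop (hb.eventually_ge_atTop 1)]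
    with p h1 h2
  refine h1.trans ?_
  nlinarith [(abs_nonneg _).trans h1]

theorem Op.const (C : ℝ) : Op μ (fun _ => C) (fun _ => 1) :=
  Op.of_bounded (C := |C|) (Eventually.of_forall fun _ => le_rfl)

theorem Op.const_mul (C : ℝ) (hX : Op μ X a) : Op μ (fun p => C * X p) a := by
  simpa using (Op.const (μ := μ) C).mul hX

theorem Op.det_mul {a' : ℕ → ℝ} (hX : Op μ X a) :
    Op μ (fun p => a' p.1 * X p) (fun n => |a' n| * a n) :=
  (Op.of_atTop_le (a' := a') (c := fun n => |a' n|) (Eventually.of_forall fun _ => le_rfl)).mul hX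

/-- The inverse square root of `|a|` would do; the summand `1/(n+1)` keeps it finite where `a`
vanishes. This is how `Op` with a vanishing rate becomes convergence in probability. -/
theorem exists_tendsto_atTop_mul_tendsto_zero (ha : Tendsto a atTop (𝓝 0)) :
    ∃ b : ℕ → ℝ, Tendsto b atTop atTop ∧ Tendsto (fun n => b n * a n) atTop (𝓝 0) := by
  have h1 : Tendsto (fun n : ℕ => |a n| + 1 / ((n : ℝ) + 1)) atTop (𝓝 0) := by
    simpa using ha.abs.add tendsto_one_div_add_atTop_nhds_zero_nat
  have hpos : ∀ n : ℕ, 0 < |a n| + 1 / ((n : ℝ) + 1) := fun n => by positivity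
  have h2 : Tendsto (fun n : ℕ => √(|a n| + 1 / ((n : ℝ) + 1))) atTop (𝓝 0) := by
    simpa [Function.comp_def] using (Real.continuous_sqrt.tendsto 0).comp h1
  refine ⟨fun n => (√(|a n| + 1 / ((n : ℝ) + 1)))⁻¹, ?_, ?_⟩
  · refine Tendsto.inv_tendsto_nhdsGT_zero ?_
    rw [tendsto_nhdsWithin_iff]
    exact ⟨h2, Eventually.of_forall fun n => Real.sqrt_pos.2 (hpos n)⟩
  · refine squeeze_zero_norm (fun n => ?_) h2
    rw [norm_mul, norm_inv, Real.norm_of_nonneg (Real.sqrt_nonneg _), Real.norm_eq_abs,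
      inv_mul_le_iff₀ (Real.sqrt_pos.2 (hpos n)), Real.mul_self_sqrt (hpos n).le]
    have : 0 ≤ 1 / ((n : ℝ) + 1) := by positivity
    linarith

theorem Op.tendsto_zero (hX : Op μ X a) (ha : Tendsto a atTop (𝓝 0)) :
    Tendsto X (wpo μ) (𝓝 0) := by
  obtain ⟨b, hb, hba⟩ := exists_tendsto_atTop_mul_tendsto_zero ha
  refine squeeze_zero_norm' ?_ (hba.comp (tendsto_fst_wpo μ))
  filter_upwards [hX b hb] with p hp using hp

theorem Op.rpow {θ : ℝ} (hX : Op μ X a) (hθ : 0 < θ) (hX0 : ∀ p, 0 ≤ X p) (ha : ∀ n, 0 ≤ a n) :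
    Op μ (fun p => X p ^ θ) (fun n => a n ^ θ) := by
  intro b hb
  have hb' : Tendsto (fun n => b n ^ (θ⁻¹)) atTop atTop :=
    (tendsto_rpow_atTop (inv_pos.2 hθ)).comp hb
  filter_upwards [hX _ hb', eventually_wpo_of_atTop (hb.eventually_ge_atTop 0)] with p h1 h2
  rw [abs_of_nonneg (Real.rpow_nonneg (hX0 p) _)]
  rw [abs_of_nonneg (hX0 p)] at h1
  calc X p ^ θ ≤ (b p.1 ^ θ⁻¹ * a p.1) ^ θ := Real.rpow_le_rpow (hX0 p) h1 hθ.le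
    _ = (b p.1 ^ θ⁻¹) ^ θ * a p.1 ^ θ := Real.mul_rpow (Real.rpow_nonneg h2 _) (ha _)
    _ = _ := by rw [← Real.rpow_mul h2, inv_mul_cancel₀ hθ.ne', Real.rpow_one]

theorem Op.sqrt (hX : Op μ X a) (hX0 : ∀ p, 0 ≤ X p) (ha : ∀ n, 0 ≤ a n) :
    Op μ (fun p => √(X p)) (fun n => √(a n)) := by
  simp only [Real.sqrt_eq_rpow]
  exact hX.rpow (by norm_num) hX0 ha

theorem Op.of_sq (h : Op μ (fun p => X p ^ 2) (fun n => a n ^ 2)) (ha : ∀ n, 0 ≤ a n) :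
    Op μ X a := by
  have h1 := h.sqrt (fun p => sq_nonneg _) (fun n => sq_nonneg _)
  simp only [Real.sqrt_sq_eq_abs, fun n => abs_of_nonneg (ha n)] at h1
  exact h1.mono (Eventually.of_forall fun p => by simp)

/-- Markov's inequality. With integrals in `[0, ∞]` no integrability has to be checked. -/
theorem Op.of_lintegral {M : ℝ} (hm : ∀ n, Measurable fun ω => X (n, ω)) (hX0 : ∀ p, 0 ≤ X p)
    (ha : ∀ᶠ n in atTop, 0 < a n)
    (h : ∀ᶠ n in atTop, ∫⁻ ω, ENNReal.ofReal (X (n, ω)) ∂μ ≤ ENNReal.ofReal (M * a n)) :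
    Op μ X a := by
  intro b hb
  rw [eventually_wpo]
  have hlim : Tendsto (fun n => ENNReal.ofReal (M / b n)) atTop (𝓝 0) := by
    have := ENNReal.tendsto_ofReal (hb.const_div_atTop M)
    simpa using this
  refine tendsto_of_tendsto_of_tendsto_of_le_of_le' tendsto_const_nhds hlim
    (Eventually.of_forall fun _ => zero_le) ?_
  filter_upwards [ha, h, hb.eventually_gt_atTop 0] with n h1 h2 h3
  have hba : 0 < b n * a n := mul_pos h3 h1
  calc μ {ω | ¬ |X (n, ω)| ≤ b n * a n}
      ≤ μ {ω | ENNReal.ofReal (b n * a n) ≤ ENNReal.ofReal (X (n, ω))} := by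
        refine measure_mono fun ω hω => ?_
        simp only [Set.mem_ofPred_eq, not_le, abs_of_nonneg (hX0 _)] at hω
        exact ENNReal.ofReal_le_ofReal hω.le
    _ ≤ (∫⁻ ω, ENNReal.ofReal (X (n, ω)) ∂μ) / ENNReal.ofReal (b n * a n) :=
        meas_ge_le_lintegral_div (hm n).ennreal_ofReal.aemeasurable
          (by simpa using hba) ENNReal.ofReal_ne_top
    _ ≤ ENNReal.ofReal (M * a n) / ENNReal.ofReal (b n * a n) := by gcongr
    _ = ENNReal.ofReal (M / b n) := by
        rw [← ENNReal.ofReal_div_of_pos hba]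
        congr 1
        field_simp

end OpCalculus

/-! ### Euclidean norms and the operator norm -/

section Norms

variable {N k l : ℕ}

theorem enorm2_nonneg (v : Fin k → ℝ) : 0 ≤ enorm2 v := norm_nonneg _

theorem enorm2_sq (v : Fin k → ℝ) : enorm2 v ^ 2 = v ⬝ᵥ v := by
  rw [enorm2, EuclideanSpace.real_norm_sq_eq]
  simp [dotProduct, sq]

theorem enorm2_sq_eq_sum (v : Fin k → ℝ) : enorm2 v ^ 2 = ∑ i, v i ^ 2 := by
  rw [enorm2_sq]
  simp [dotProduct, sq]

theorem enorm2_eq_sqrt (v : Fin k → ℝ) : enorm2 v = √(∑ i, v i ^ 2) := by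
  rw [← enorm2_sq_eq_sum, Real.sqrt_sq (enorm2_nonneg v)]

theorem abs_dotProduct_le (v w : Fin k → ℝ) : |v ⬝ᵥ w| ≤ enorm2 v * enorm2 w := by
  have h : (v ⬝ᵥ w) ^ 2 ≤ (enorm2 v * enorm2 w) ^ 2 := by
    rw [mul_pow, enorm2_sq_eq_sum, enorm2_sq_eq_sum]
    exact Finset.sum_mul_sq_le_sq_mul_sq _ _ _
  exact abs_le_of_sq_le_sq h (mul_nonneg (enorm2_nonneg _) (enorm2_nonneg _))

theorem enorm2_add_le (v w : Fin k → ℝ) : enorm2 (v + w) ≤ enorm2 v + enorm2 w := by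
  unfold enorm2
  rw [WithLp.toLp_add]
  exact norm_add_le _ _

theorem enorm2_sub_le (v w : Fin k → ℝ) : enorm2 (v - w) ≤ enorm2 v + enorm2 w := by
  unfold enorm2
  rw [WithLp.toLp_sub]
  exact norm_sub_le _ _

theorem enorm2_smul (c : ℝ) (v : Fin k → ℝ) : enorm2 (c • v) = |c| * enorm2 v := by
  unfold enorm2
  rw [WithLp.toLp_smul, norm_smul, Real.norm_eq_abs]

theorem enorm2_sum_le {ι : Type*} (s : Finset ι) (v : ι → Fin k → ℝ) :
    enorm2 (∑ i ∈ s, v i) ≤ ∑ i ∈ s, enorm2 (v i) := by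
  unfold enorm2
  rw [WithLp.toLp_sum]
  exact norm_sum_le _ _

theorem enorm2_mulVec_le (A : Matrix (Fin N) (Fin k) ℝ) (v : Fin k → ℝ) :
    enorm2 (A *ᵥ v) ≤ ‖A‖ * enorm2 v :=
  Matrix.l2_opNorm_mulVec A (WithLp.toLp 2 v)

theorem opNorm_le_of_enorm2 (A : Matrix (Fin N) (Fin k) ℝ) {C : ℝ} (hC : 0 ≤ C)
    (h : ∀ v, enorm2 (A *ᵥ v) ≤ C * enorm2 v) : ‖A‖ ≤ C := by
  rw [Matrix.l2_opNorm_def]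
  exact ContinuousLinearMap.opNorm_le_bound _ hC fun x => h (WithLp.ofLp x)

theorem frobSq_nonneg (A : Matrix (Fin N) (Fin k) ℝ) : 0 ≤ frobSq A :=
  Finset.sum_nonneg fun _ _ => Finset.sum_nonneg fun _ _ => sq_nonneg _

theorem frobSq_transpose (A : Matrix (Fin N) (Fin k) ℝ) : frobSq Aᵀ = frobSq A := by
  unfold frobSq
  rw [Finset.sum_comm]
  rfl

theorem frobSq_eq_trace (A : Matrix (Fin N) (Fin k) ℝ) : frobSq A = (Aᵀ * A).trace := by
  rw [← frobSq_transpose]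
  simp [frobSq, Matrix.trace, Matrix.mul_apply, sq]

theorem enorm2_mulVec_sq_le_frobSq (A : Matrix (Fin N) (Fin k) ℝ) (v : Fin k → ℝ) :
    enorm2 (A *ᵥ v) ^ 2 ≤ frobSq A * enorm2 v ^ 2 := by
  rw [enorm2_sq_eq_sum, enorm2_sq_eq_sum, frobSq, Finset.sum_mul]
  exact Finset.sum_le_sum fun i _ => Finset.sum_mul_sq_le_sq_mul_sq Finset.univ (A i) v

theorem norm_sq_le_frobSq (A : Matrix (Fin N) (Fin k) ℝ) : ‖A‖ ^ 2 ≤ frobSq A := by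
  have h : ‖A‖ ≤ √(frobSq A) := by
    refine opNorm_le_of_enorm2 A (Real.sqrt_nonneg _) fun v => ?_
    refine le_of_sq_le_sq ?_ (mul_nonneg (Real.sqrt_nonneg _) (enorm2_nonneg _))
    rw [mul_pow, Real.sq_sqrt (frobSq_nonneg A)]
    exact enorm2_mulVec_sq_le_frobSq A v
  calc ‖A‖ ^ 2 ≤ √(frobSq A) ^ 2 := by gcongr
    _ = _ := Real.sq_sqrt (frobSq_nonneg A)

theorem norm_le_sqrt_frobSq (A : Matrix (Fin N) (Fin k) ℝ) : ‖A‖ ≤ √(frobSq A) :=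
  Real.le_sqrt_of_sq_le (norm_sq_le_frobSq A)

theorem norm_transpose_eq (A : Matrix (Fin N) (Fin k) ℝ) : ‖Aᵀ‖ = ‖A‖ := by
  rw [← Matrix.conjTranspose_eq_transpose_of_trivial, Matrix.l2_opNorm_conjTranspose]

theorem norm_mul_le_opNorm (A : Matrix (Fin N) (Fin k) ℝ) (B : Matrix (Fin k) (Fin l) ℝ) :
    ‖A * B‖ ≤ ‖A‖ * ‖B‖ := Matrix.l2_opNorm_mul A B

theorem norm_transpose_mul_self (A : Matrix (Fin N) (Fin k) ℝ) : ‖Aᵀ * A‖ = ‖A‖ ^ 2 := by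
  rw [← Matrix.conjTranspose_eq_transpose_of_trivial, Matrix.l2_opNorm_conjTranspose_mul_self, sq]

theorem norm_mul_transpose_self (A : Matrix (Fin N) (Fin k) ℝ) : ‖A * Aᵀ‖ = ‖A‖ ^ 2 := by
  have := norm_transpose_mul_self Aᵀ
  rwa [Matrix.transpose_transpose, norm_transpose_eq] at this

theorem abs_entry_le_norm (A : Matrix (Fin N) (Fin k) ℝ) (i : Fin N) (j : Fin k) :
    |A i j| ≤ ‖A‖ := by
  have h1 := enorm2_mulVec_le A (Pi.single j 1)
  have h2 : enorm2 (Pi.single j (1 : ℝ)) = 1 := by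
    rw [enorm2_eq_sqrt]; simp [Pi.single_apply]
  rw [h2, mul_one] at h1
  refine le_trans ?_ h1
  refine abs_le_of_sq_le_sq ?_ (enorm2_nonneg _)
  rw [enorm2_sq_eq_sum]
  have : A i j = (A *ᵥ Pi.single j 1) i := by simp
  rw [this]
  exact Finset.single_le_sum (f := fun i => (A *ᵥ Pi.single j 1) i ^ 2)
    (fun _ _ => sq_nonneg _) (Finset.mem_univ i)

theorem frobSq_mul_le (A : Matrix (Fin N) (Fin k) ℝ) (B : Matrix (Fin k) (Fin l) ℝ) :
    frobSq (A * B) ≤ ‖A‖ ^ 2 * frobSq B := by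
  rw [← frobSq_transpose (A * B), ← frobSq_transpose B, frobSq, frobSq, Finset.mul_sum]
  refine Finset.sum_le_sum fun j _ => ?_
  have h1 := pow_le_pow_left₀ (enorm2_nonneg _) (enorm2_mulVec_le A (Bᵀ j)) 2
  rw [mul_pow, enorm2_sq_eq_sum, enorm2_sq_eq_sum] at h1
  exact h1

theorem frobSq_sub_comm_expand (A B : Matrix (Fin N) (Fin N) ℝ) (hA : Aᵀ = A) (hB : Bᵀ = B) :
    frobSq (A - B) = (A * A).trace - 2 * (A * B).trace + (B * B).trace := by
  rw [frobSq_eq_trace, Matrix.transpose_sub, hA, hB, sub_mul, mul_sub, mul_sub,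
    Matrix.trace_sub, Matrix.trace_sub, Matrix.trace_sub, Matrix.trace_mul_comm B A]
  ring

theorem abs_dotProduct_mulVec_le (A : Matrix (Fin N) (Fin k) ℝ) (v : Fin N → ℝ) (w : Fin k → ℝ) :
    |v ⬝ᵥ A *ᵥ w| ≤ ‖A‖ * enorm2 v * enorm2 w := by
  refine (abs_dotProduct_le _ _).trans ?_
  calc _ ≤ enorm2 v * (‖A‖ * enorm2 w) := by
        gcongr
        · exact enorm2_nonneg _
        · exact enorm2_mulVec_le A w
    _ = _ := by ring

end Norms

/-! ### The Gaussian likelihood of one observation -/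

section Shrink

variable {N k : ℕ} (L : Matrix (Fin N) (Fin k) ℝ) (s : ℝ)

/-- `B = L' L + s I`. -/
def gramB : Matrix (Fin k) (Fin k) ℝ := Lᵀ * L + s • 1

/-- The ridge regression map `x ↦ B⁻¹ L' x`. -/
def coef : Matrix (Fin k) (Fin N) ℝ := (gramB L s)⁻¹ * Lᵀ

/-- The ridge smoother `G = L B⁻¹ L'`. -/
def shrink : Matrix (Fin N) (Fin N) ℝ := L * coef L s

/-- Minus twice the log density, up to an additive constant depending on `N` and `s` only. -/
def cost (x : Fin N → ℝ) : ℝ :=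
  s⁻¹ * (x ⬝ᵥ (1 - shrink L s) *ᵥ x) + Real.log (1 + s⁻¹ • (Lᵀ * L)).det

variable {L s}

theorem posSemidef_transpose_mul_self (A : Matrix (Fin N) (Fin k) ℝ) : (Aᵀ * A).PosSemidef := by
  have := Matrix.posSemidef_conjTranspose_mul_self A
  rwa [Matrix.conjTranspose_eq_transpose_of_trivial] at this

theorem gramB_posDef (hs : 0 < s) : (gramB L s).PosDef := by
  unfold gramB
  exact Matrix.PosDef.posSemidef_add (posSemidef_transpose_mul_self L) (Matrix.PosDef.one.smul hs)

theorem gramB_isUnit_det (hs : 0 < s) : IsUnit (gramB L s).det :=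
  (gramB_posDef hs).det_pos.ne'.isUnit

theorem gramB_transpose : (gramB L s)ᵀ = gramB L s := by
  simp [gramB, Matrix.transpose_mul]

theorem gramB_inv_transpose : ((gramB L s)⁻¹)ᵀ = (gramB L s)⁻¹ := by
  rw [Matrix.transpose_nonsing_inv, gramB_transpose]

theorem gramB_mul_coef (hs : 0 < s) : gramB L s * coef L s = Lᵀ := by
  rw [coef, Matrix.mul_nonsing_inv_cancel_left _ _ (gramB_isUnit_det hs)]

theorem coef_transpose : (coef L s)ᵀ = L * (gramB L s)⁻¹ := by
  rw [coef, Matrix.transpose_mul, gramB_inv_transpose, Matrix.transpose_transpose]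

theorem shrink_transpose : (shrink L s)ᵀ = shrink L s := by
  rw [shrink, Matrix.transpose_mul, coef_transpose, coef, Matrix.mul_assoc]

theorem shrink_eq_coef (hs : 0 < s) : shrink L s = (coef L s)ᵀ * gramB L s * coef L s := by
  rw [Matrix.mul_assoc, gramB_mul_coef hs, coef_transpose, shrink, coef, Matrix.mul_assoc]

/-- The source of all inequalities `0 ≤ G² ≤ G ≤ I` below: the gap between `G` and `G²` is a Gram
matrix, coming from `B - L'L = s I`. -/
theorem shrink_sub_sq (hs : 0 < s) :
    shrink L s - shrink L s * shrink L s = s • ((coef L s)ᵀ * coef L s) := by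
  have h1 : shrink L s = (coef L s)ᵀ * gramB L s * coef L s := shrink_eq_coef hs
  have h2 : shrink L s * shrink L s = (coef L s)ᵀ * (Lᵀ * L) * coef L s := by
    nth_rewrite 1 [← shrink_transpose]
    rw [shrink, Matrix.transpose_mul]
    simp only [Matrix.mul_assoc]
  rw [h2, h1, ← Matrix.sub_mul, ← Matrix.mul_sub]
  simp [gramB]

/-- The decomposition into residual sum of squares and ridge penalty, in matrix form; both summands
are Gram matrices. -/
theorem one_sub_shrink_eq (hs : 0 < s) : 1 - shrink L s =
    (1 - shrink L s)ᵀ * (1 - shrink L s) + s • ((coef L s)ᵀ * coef L s) := by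
  rw [← shrink_sub_sq hs, Matrix.transpose_sub, shrink_transpose, Matrix.transpose_one]
  noncomm_ring

theorem dotProduct_transpose_mul_self (A : Matrix (Fin N) (Fin k) ℝ) (x : Fin k → ℝ) :
    x ⬝ᵥ (Aᵀ * A) *ᵥ x = enorm2 (A *ᵥ x) ^ 2 := by
  rw [enorm2_sq, ← Matrix.mulVec_mulVec, Matrix.dotProduct_mulVec, Matrix.vecMul_transpose]

theorem quad_one_sub_shrink (hs : 0 < s) (x : Fin N → ℝ) : x ⬝ᵥ (1 - shrink L s) *ᵥ x =
    enorm2 ((1 - shrink L s) *ᵥ x) ^ 2 + s * enorm2 (coef L s *ᵥ x) ^ 2 := by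
  nth_rewrite 1 [one_sub_shrink_eq hs]
  rw [Matrix.add_mulVec, dotProduct_add, dotProduct_transpose_mul_self, Matrix.smul_mulVec,
    dotProduct_smul, dotProduct_transpose_mul_self, smul_eq_mul]

theorem quad_one_sub_shrink_nonneg (hs : 0 < s) (x : Fin N → ℝ) :
    0 ≤ x ⬝ᵥ (1 - shrink L s) *ᵥ x := by
  rw [quad_one_sub_shrink hs]
  have := mul_nonneg hs.le (sq_nonneg (enorm2 (coef L s *ᵥ x)))
  positivity

theorem enorm2_shrink_sq_le (hs : 0 < s) (x : Fin N → ℝ) :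
    enorm2 (shrink L s *ᵥ x) ^ 2 ≤ x ⬝ᵥ shrink L s *ᵥ x := by
  have h : shrink L s = (shrink L s)ᵀ * shrink L s + s • ((coef L s)ᵀ * coef L s) := by
    rw [← shrink_sub_sq hs, shrink_transpose]; abel
  have h2 : x ⬝ᵥ shrink L s *ᵥ x =
      enorm2 (shrink L s *ᵥ x) ^ 2 + s * enorm2 (coef L s *ᵥ x) ^ 2 := by
    nth_rewrite 1 [h]
    rw [Matrix.add_mulVec, dotProduct_add, dotProduct_transpose_mul_self, Matrix.smul_mulVec,
      dotProduct_smul, dotProduct_transpose_mul_self, smul_eq_mul]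
  rw [h2]
  have := mul_nonneg hs.le (sq_nonneg (enorm2 (coef L s *ᵥ x)))
  linarith

theorem quad_shrink_nonneg (hs : 0 < s) (x : Fin N → ℝ) : 0 ≤ x ⬝ᵥ shrink L s *ᵥ x :=
  (sq_nonneg _).trans (enorm2_shrink_sq_le hs x)

theorem quad_one_sub (A : Matrix (Fin N) (Fin N) ℝ) (x : Fin N → ℝ) :
    x ⬝ᵥ (1 - A) *ᵥ x = enorm2 x ^ 2 - x ⬝ᵥ A *ᵥ x := by
  rw [Matrix.sub_mulVec, dotProduct_sub, Matrix.one_mulVec, enorm2_sq]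

theorem quad_shrink_le (hs : 0 < s) (x : Fin N → ℝ) :
    x ⬝ᵥ shrink L s *ᵥ x ≤ enorm2 x ^ 2 := by
  have h1 := quad_one_sub_shrink_nonneg (L := L) hs x
  rw [quad_one_sub] at h1
  linarith

/-- The smoother solves the ridge regression problem. -/
theorem ridge_identity (hs : 0 < s) (x : Fin N → ℝ) (h : Fin k → ℝ) :
    enorm2 (x - L *ᵥ h) ^ 2 + s * enorm2 h ^ 2 = x ⬝ᵥ (1 - shrink L s) *ᵥ x +
      (h - coef L s *ᵥ x) ⬝ᵥ gramB L s *ᵥ (h - coef L s *ᵥ x) := by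
  have hB : ∀ u : Fin k → ℝ, u ⬝ᵥ gramB L s *ᵥ u = enorm2 (L *ᵥ u) ^ 2 + s * enorm2 u ^ 2 := by
    intro u
    rw [gramB, Matrix.add_mulVec, dotProduct_add, dotProduct_transpose_mul_self,
      Matrix.smul_mulVec, dotProduct_smul, Matrix.one_mulVec, smul_eq_mul, enorm2_sq u]
  have hc : gramB L s *ᵥ (coef L s *ᵥ x) = Lᵀ *ᵥ x := by
    rw [Matrix.mulVec_mulVec, gramB_mul_coef hs]
  have hG : x ⬝ᵥ shrink L s *ᵥ x = (coef L s *ᵥ x) ⬝ᵥ gramB L s *ᵥ (coef L s *ᵥ x) := by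
    rw [hc, shrink, ← Matrix.mulVec_mulVec, Matrix.dotProduct_mulVec, dotProduct_comm,
      Matrix.mulVec_transpose]
  have hx : ∀ u : Fin k → ℝ, u ⬝ᵥ Lᵀ *ᵥ x = x ⬝ᵥ L *ᵥ u := by
    intro u
    rw [Matrix.dotProduct_mulVec x, dotProduct_comm, ← Matrix.vecMul_transpose,
      Matrix.transpose_transpose]
  have hsym : (coef L s *ᵥ x) ⬝ᵥ gramB L s *ᵥ h = h ⬝ᵥ Lᵀ *ᵥ x := by
    rw [← hc, Matrix.dotProduct_mulVec, dotProduct_comm, ← Matrix.mulVec_transpose,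
      gramB_transpose]
  rw [quad_one_sub, hG, Matrix.mulVec_sub, sub_dotProduct, dotProduct_sub, dotProduct_sub, hsym,
    hc, hB, hx h]
  have : enorm2 (x - L *ᵥ h) ^ 2 = enorm2 x ^ 2 - 2 * (x ⬝ᵥ L *ᵥ h) + enorm2 (L *ᵥ h) ^ 2 := by
    rw [enorm2_sq, enorm2_sq, enorm2_sq, sub_dotProduct, dotProduct_sub, dotProduct_sub,
      dotProduct_comm (L *ᵥ h) x]
    ring
  rw [this, hx]
  ring

theorem quad_le_ridge (hs : 0 < s) (x : Fin N → ℝ) (h : Fin k → ℝ) :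
    x ⬝ᵥ (1 - shrink L s) *ᵥ x ≤ enorm2 (x - L *ᵥ h) ^ 2 + s * enorm2 h ^ 2 := by
  rw [ridge_identity hs]
  have := (gramB_posDef (L := L) hs).posSemidef.dotProduct_mulVec_nonneg (h - coef L s *ᵥ x)
  simp only [star_trivial] at this
  linarith

theorem quad_eq_ridge (hs : 0 < s) (x : Fin N → ℝ) :
    x ⬝ᵥ (1 - shrink L s) *ᵥ x =
      enorm2 (x - L *ᵥ (coef L s *ᵥ x)) ^ 2 + s * enorm2 (coef L s *ᵥ x) ^ 2 := by
  rw [ridge_identity hs]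
  simp

/-- Woodbury's formula, read off from `(LL' + s I) L = L B`. -/
theorem covMat_mul_one_sub_shrink (hs : 0 < s) : covMat L s * (1 - shrink L s) = s • 1 := by
  have h : covMat L s * L = L * gramB L s := by
    simp [covMat, gramB, Matrix.add_mul, Matrix.mul_add, Matrix.mul_assoc]
  rw [Matrix.mul_sub, Matrix.mul_one, shrink, ← Matrix.mul_assoc, h, Matrix.mul_assoc,
    gramB_mul_coef hs, covMat]
  abel

theorem covMat_inv (hs : 0 < s) : (covMat L s)⁻¹ = s⁻¹ • (1 - shrink L s) := by
  refine Matrix.inv_eq_right_inv ?_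
  rw [Matrix.mul_smul, covMat_mul_one_sub_shrink hs, smul_smul, inv_mul_cancel₀ hs.ne', one_smul]

/-- Sylvester's identity moves the determinant from dimension `N` to dimension `k`. -/
theorem covMat_det (hs : 0 < s) :
    (covMat L s).det = s ^ N * (1 + s⁻¹ • (Lᵀ * L)).det := by
  have h : covMat L s = s • (1 + (s⁻¹ • L) * Lᵀ) := by
    rw [covMat, smul_add, Matrix.smul_mul, smul_smul, mul_inv_cancel₀ hs.ne', one_smul, add_comm]
  rw [h, Matrix.det_smul, Fintype.card_fin, Matrix.det_one_add_mul_comm, Matrix.mul_smul]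

theorem posDef_one_add (hs : 0 < s) : (1 + s⁻¹ • (Lᵀ * L)).PosDef :=
  Matrix.PosDef.one.add_posSemidef ((posSemidef_transpose_mul_self L).smul (inv_pos.2 hs).le)

/-- The normalizing constant of the densities that does not depend on the loadings. -/
def densConst (N : ℕ) (s : ℝ) : ℝ := (2 * Real.pi) ^ (-(N : ℝ) / 2) * (s ^ N) ^ (-(1 / 2) : ℝ)

theorem densConst_pos (hs : 0 < s) : 0 < densConst N s := by
  unfold densConst
  positivity

theorem dens_eq (hs : 0 < s) (x : Fin N → ℝ) :
    dens L s x = densConst N s * Real.exp (-(1 / 2) * cost L s x) := by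
  have hd := (posDef_one_add (L := L) hs).det_pos
  rw [dens, densConst, covMat_det hs, Real.mul_rpow (by positivity) hd.le, covMat_inv hs, cost,
    mul_add, Real.exp_add, Real.rpow_def_of_pos hd, Matrix.smul_mulVec, dotProduct_smul,
    smul_eq_mul, mul_comm (Real.log _)]
  ring

theorem dens_pos (hs : 0 < s) (x : Fin N → ℝ) : 0 < dens L s x := by
  rw [dens_eq hs]
  exact mul_pos (densConst_pos hs) (Real.exp_pos _)

/-- From `L'(LL' + s I) = B L'`. It identifies the estimated factors as ridge regression
coefficients. -/
theorem transpose_mul_covMat_inv (hs : 0 < s) (x : Fin N → ℝ) :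
    Lᵀ *ᵥ ((covMat L s)⁻¹ *ᵥ x) = coef L s *ᵥ x := by
  have h1 : coef L s * covMat L s = Lᵀ := by
    have h : Lᵀ * covMat L s = gramB L s * Lᵀ := by
      simp [covMat, gramB, Matrix.add_mul, Matrix.mul_add, Matrix.mul_assoc]
    rw [coef, Matrix.mul_assoc, h, ← Matrix.mul_assoc,
      Matrix.nonsing_inv_mul _ (gramB_isUnit_det hs), Matrix.one_mul]
  have h2 : IsUnit (covMat L s).det := by
    rw [covMat_det hs]
    exact (mul_pos (pow_pos hs _) (posDef_one_add (L := L) hs).det_pos).ne'.isUnit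
  rw [Matrix.mulVec_mulVec, ← h1, Matrix.mul_assoc, Matrix.mul_nonsing_inv _ h2, Matrix.mul_one]

/-- Cyclicity gives `tr G = tr B⁻¹(B - s I) = k - s tr B⁻¹`. The trace plays the role of the rank of
the smoother. -/
theorem trace_shrink_le (hs : 0 < s) : (shrink L s).trace ≤ k := by
  have h1 : (shrink L s).trace = ((gramB L s)⁻¹ * (gramB L s - s • 1)).trace := by
    rw [shrink, coef, Matrix.trace_mul_comm, Matrix.mul_assoc]
    simp [gramB]
  rw [h1, Matrix.mul_sub, Matrix.nonsing_inv_mul _ (gramB_isUnit_det hs), Matrix.trace_sub,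
    Matrix.trace_one, Fintype.card_fin, Matrix.mul_smul, Matrix.mul_one, Matrix.trace_smul]
  have := (gramB_posDef (L := L) hs).inv.posSemidef.trace_nonneg
  have := mul_nonneg hs.le this
  rw [smul_eq_mul]
  linarith

theorem trace_shrink_sq_le (hs : 0 < s) : (shrink L s * shrink L s).trace ≤ (shrink L s).trace := by
  have h := congrArg Matrix.trace (shrink_sub_sq (L := L) hs)
  rw [Matrix.trace_sub, Matrix.trace_smul, ← frobSq_eq_trace, smul_eq_mul] at h
  have := mul_nonneg hs.le (frobSq_nonneg (coef L s))
  linarith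

theorem norm_shrink_le (hs : 0 < s) : ‖shrink L s‖ ≤ 1 := by
  refine opNorm_le_of_enorm2 _ zero_le_one fun v => ?_
  rw [one_mul]
  exact le_of_sq_le_sq ((enorm2_shrink_sq_le hs v).trans (quad_shrink_le hs v)) (enorm2_nonneg _)

end Shrink

/-! ### The log determinant in the likelihood. -/

section LogDet

variable {N k : ℕ}

/-- Apply `λ ≤ exp(λ - 1)` to each eigenvalue. -/
theorem det_le_exp_trace {C : Matrix (Fin k) (Fin k) ℝ} (hC : C.PosSemidef) :
    C.det ≤ Real.exp (C.trace - k) := by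
  have h1 : C.det = ∏ i, hC.1.eigenvalues i := by
    simpa using hC.1.det_eq_prod_eigenvalues
  have h2 : C.trace = ∑ i, hC.1.eigenvalues i := by
    simpa using hC.1.trace_eq_sum_eigenvalues
  have h3 : C.trace - k = ∑ i, (hC.1.eigenvalues i - 1) := by
    rw [h2]; simp
  rw [h1, h3, Real.exp_sum]
  refine Finset.prod_le_prod (fun i _ => hC.eigenvalues_nonneg i) fun i _ => ?_
  have := Real.add_one_le_exp (hC.1.eigenvalues i - 1)
  linarith

/-- The tangent inequality for the concave function `log det`, at a diagonal matrix. -/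
theorem log_det_le_tangent {A : Matrix (Fin k) (Fin k) ℝ} (hA : A.PosDef) {a : Fin k → ℝ}
    (ha : ∀ i, 0 < a i) :
    Real.log A.det ≤ Real.log (diagonal a).det +
      ((diagonal a)⁻¹ * (A - diagonal a)).trace := by
  -- Congruence by `a^{-1/2}` moves the point of tangency to the identity, where the claim is `det C
  -- ≤ exp(tr C - k)`.
  set R : Matrix (Fin k) (Fin k) ℝ := diagonal fun i => (√(a i))⁻¹ with hR
  have hsq : ∀ i, (√(a i))⁻¹ * (√(a i))⁻¹ = (a i)⁻¹ := fun i => by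
    rw [← mul_inv, Real.mul_self_sqrt (ha i).le]
  have hinv : (diagonal a)⁻¹ = diagonal fun i => (a i)⁻¹ := by
    refine Matrix.inv_eq_right_inv ?_
    rw [diagonal_mul_diagonal, ← diagonal_one]
    congr 1
    funext i
    exact mul_inv_cancel₀ (ha i).ne'
  have hRR : R * R = (diagonal a)⁻¹ := by
    rw [hR, diagonal_mul_diagonal, hinv]
    simp only [hsq]
  have hC : (R * A * R).PosSemidef := by
    have := hA.posSemidef.mul_mul_conjTranspose_same R
    rwa [Matrix.conjTranspose_eq_transpose_of_trivial, hR, diagonal_transpose] at this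
  have hdet : (R * A * R).det = A.det / (diagonal a).det := by
    have h1 : (R * R).det = ((diagonal a).det)⁻¹ := by
      rw [hRR, hinv, det_diagonal, det_diagonal, Finset.prod_inv_distrib]
    rw [det_mul] at h1
    rw [det_mul, det_mul, mul_right_comm, h1]
    ring
  have htr : (R * A * R).trace = ((diagonal a)⁻¹ * A).trace := by
    rw [Matrix.trace_mul_comm, ← Matrix.mul_assoc, hRR]
  have hpos : 0 < (diagonal a).det := by
    rw [det_diagonal]; exact Finset.prod_pos fun i _ => ha i
  have h := det_le_exp_trace hC
  rw [hdet, htr] at h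
  have h2 := Real.log_le_log (div_pos hA.det_pos hpos) h
  rw [Real.log_exp, Real.log_div hA.det_pos.ne' hpos.ne'] at h2
  rw [Matrix.mul_sub, Matrix.nonsing_inv_mul _ hpos.ne'.isUnit, Matrix.trace_sub,
    Matrix.trace_one, Fintype.card_fin]
  linarith

/-- A crude bound by the Leibniz formula. It suffices because at the true loadings, where `‖L‖² =
O(N)`, it grows only like `log N`, against a fit of order `N`. -/
theorem log_det_one_add_le {L : Matrix (Fin N) (Fin k) ℝ} {s : ℝ} (hs : 0 < s) :
    Real.log (1 + s⁻¹ • (Lᵀ * L)).det ≤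
      Real.log (k.factorial : ℝ) + k * Real.log (1 + s⁻¹ * ‖L‖ ^ 2) := by
  have hb : 0 < 1 + s⁻¹ * ‖L‖ ^ 2 := by positivity
  have h := Matrix.det_le (A := 1 + s⁻¹ • (Lᵀ * L)) (abv := AbsoluteValue.abs)
    (x := 1 + s⁻¹ * ‖L‖ ^ 2) fun i j => by
      rw [AbsoluteValue.abs_apply, Matrix.add_apply, Matrix.smul_apply, smul_eq_mul]
      refine (abs_add_le _ _).trans (add_le_add ?_ ?_)
      · rw [Matrix.one_apply]; split_ifs <;> simp
      · rw [abs_mul, abs_of_pos (inv_pos.2 hs), ← norm_transpose_mul_self]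
        gcongr
        exact abs_entry_le_norm _ _ _
  have hd := (posDef_one_add (L := L) hs).det_pos
  rw [AbsoluteValue.abs_apply, abs_of_pos hd, Fintype.card_fin, nsmul_eq_mul] at h
  have h2 := Real.log_le_log hd h
  have hf : (0 : ℝ) < k.factorial := by exact_mod_cast k.factorial_pos
  rwa [Real.log_mul hf.ne' (pow_pos hb _).ne', Real.log_pow] at h2

/-- The Gram matrix of `L` is diagonal. -/
def GramDiag (L : Matrix (Fin N) (Fin k) ℝ) : Prop := ∀ a b, a ≠ b → (Lᵀ * L) a b = 0

theorem GramDiag.eq_diagonal {L : Matrix (Fin N) (Fin k) ℝ} (h : GramDiag L) :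
    Lᵀ * L = diagonal fun a => (Lᵀ * L) a a := by
  ext a b
  by_cases hab : a = b
  · subst hab; simp
  · rw [h a b hab, diagonal_apply_ne _ hab]

theorem gram_diag_nonneg (L : Matrix (Fin N) (Fin k) ℝ) (a : Fin k) : 0 ≤ (Lᵀ * L) a a := by
  simp only [Matrix.mul_apply, Matrix.transpose_apply]
  exact Finset.sum_nonneg fun i _ => mul_self_nonneg _

theorem GramDiag.one_add_eq {L : Matrix (Fin N) (Fin k) ℝ} (h : GramDiag L) (s : ℝ) :
    1 + s⁻¹ • (Lᵀ * L) = diagonal fun a => 1 + s⁻¹ * (Lᵀ * L) a a := by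
  rw [h.eq_diagonal, ← diagonal_one, ← diagonal_smul, diagonal_add]
  simp

theorem GramDiag.gramB_eq {L : Matrix (Fin N) (Fin k) ℝ} (h : GramDiag L) (s : ℝ) :
    gramB L s = diagonal fun a => (Lᵀ * L) a a + s := by
  rw [gramB, h.eq_diagonal, ← diagonal_one, ← diagonal_smul, diagonal_add]
  simp

theorem GramDiag.log_det_nonneg {L : Matrix (Fin N) (Fin k) ℝ} (h : GramDiag L) {s : ℝ}
    (hs : 0 < s) : 0 ≤ Real.log (1 + s⁻¹ • (Lᵀ * L)).det := by
  refine Real.log_nonneg ?_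
  rw [h.one_add_eq, det_diagonal]
  calc (1 : ℝ) = ∏ _a : Fin k, (1 : ℝ) := by simp
    _ ≤ _ := by
      refine Finset.prod_le_prod (fun _ _ => zero_le_one) fun a _ => ?_
      have := mul_nonneg (inv_pos.2 hs).le (gram_diag_nonneg L a)
      linarith

end LogDet

/-! ### First-order condition for the loadings of one regime. -/

section FirstOrder

variable {N k : ℕ}

theorem eq_zero_of_forall_quadratic_nonneg {a b : ℝ} (h : ∀ ε : ℝ, 0 ≤ ε * a + ε ^ 2 * b) :
    a = 0 := by
  have h1 : ∀ x : ℝ, 0 ≤ |b| * (x * x) + a * x + 0 := by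
    intro x
    have := h x
    have h2 : x ^ 2 * b ≤ |b| * (x * x) := by
      nlinarith [le_abs_self b, mul_self_nonneg x]
    linarith
  have h3 := discrim_le_zero h1
  rw [discrim] at h3
  nlinarith [sq_nonneg a]

/-- The matrix `∑ p_t x_t x_t'`. -/
def wSecond {T : ℕ} (p : Fin T → ℝ) (x : Fin T → Fin N → ℝ) : Matrix (Fin N) (Fin N) ℝ :=
  ∑ t, p t • vecMulVec (x t) (x t)

/-- First-order condition for a minimizer of a weighted average of costs. -/
theorem first_order_condition {T : ℕ} {L : Matrix (Fin N) (Fin k) ℝ} (hL : GramDiag L) {s : ℝ}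
    (hs : 0 < s) {p : Fin T → ℝ} (hp : ∀ t, 0 ≤ p t) {x : Fin T → Fin N → ℝ}
    (hmin : ∀ K : Matrix (Fin N) (Fin k) ℝ, ∑ t, p t * cost L s (x t) ≤ ∑ t, p t * cost K s (x t)) :
    wSecond p x * L = (∑ t, p t) • (L * gramB L s) := by
  -- A majorant of the cost, quadratic in `K` and exact at `K = L`: the ridge objective is evaluated
  -- at the coefficients belonging to `L`, and the log determinant is replaced by its tangent. The
  -- cost itself is never differentiated.
  have hcost : ∀ (K : Matrix (Fin N) (Fin k) ℝ) (y : Fin N → ℝ),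
      cost K s y - cost L s y ≤ s⁻¹ * (enorm2 (y - K *ᵥ (coef L s *ᵥ y)) ^ 2 -
        enorm2 (y - L *ᵥ (coef L s *ᵥ y)) ^ 2) + ((gramB L s)⁻¹ * (Kᵀ * K - Lᵀ * L)).trace := by
    intro K y
    have h1 := quad_le_ridge (L := K) hs y (coef L s *ᵥ y)
    have h2 := quad_eq_ridge (L := L) hs y
    have ha : ∀ a, 0 < 1 + s⁻¹ * (Lᵀ * L) a a := fun a => by
      have := mul_nonneg (inv_pos.2 hs).le (gram_diag_nonneg L a)
      linarith
    have h3 := log_det_le_tangent (posDef_one_add (L := K) hs) ha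
    rw [← hL.one_add_eq] at h3
    have h4 : (1 + s⁻¹ • (Lᵀ * L))⁻¹ * (1 + s⁻¹ • (Kᵀ * K) - (1 + s⁻¹ • (Lᵀ * L))) =
        (gramB L s)⁻¹ * (Kᵀ * K - Lᵀ * L) := by
      have h5 : gramB L s = s • (1 + s⁻¹ • (Lᵀ * L)) := by
        rw [smul_add, smul_smul, mul_inv_cancel₀ hs.ne', one_smul, gramB, add_comm]
      have h6 : (gramB L s)⁻¹ = s⁻¹ • (1 + s⁻¹ • (Lᵀ * L))⁻¹ := by
        refine Matrix.inv_eq_right_inv ?_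
        rw [h5, Matrix.smul_mul, Matrix.mul_smul, smul_smul, mul_inv_cancel₀ hs.ne', one_smul,
          Matrix.mul_nonsing_inv _ (posDef_one_add (L := L) hs).det_pos.ne'.isUnit]
      rw [h6, add_sub_add_left_eq_sub, ← smul_sub, Matrix.smul_mul, Matrix.mul_smul]
    rw [h4] at h3
    have h5 : s⁻¹ * (y ⬝ᵥ (1 - shrink K s) *ᵥ y) ≤
        s⁻¹ * (enorm2 (y - K *ᵥ (coef L s *ᵥ y)) ^ 2 + s * enorm2 (coef L s *ᵥ y) ^ 2) :=
      mul_le_mul_of_nonneg_left h1 (inv_pos.2 hs).le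
    have h6 : cost L s y = s⁻¹ * (enorm2 (y - L *ᵥ (coef L s *ᵥ y)) ^ 2 +
        s * enorm2 (coef L s *ᵥ y) ^ 2) + Real.log (1 + s⁻¹ • (Lᵀ * L)).det := by
      rw [cost, h2]
    rw [h6, cost]
    linarith
  -- Along `L + ε D` the averaged majorant minus the minimum is `ε` times the left side plus `ε²`
  -- times a constant. It is nonnegative for both signs of `ε`, so the linear term vanishes.
  have hlin : ∀ D : Matrix (Fin N) (Fin k) ℝ,
      ∑ t, p t * (-2 * s⁻¹ * (((1 - shrink L s) *ᵥ x t) ⬝ᵥ D *ᵥ (coef L s *ᵥ x t)) +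
        2 * (coef L s * D).trace) = 0 := by
    intro D
    refine eq_zero_of_forall_quadratic_nonneg (b := ∑ t, p t * (s⁻¹ *
      enorm2 (D *ᵥ (coef L s *ᵥ x t)) ^ 2 + ((gramB L s)⁻¹ * (Dᵀ * D)).trace)) fun ε => ?_
    have h1 := hmin (L + ε • D)
    have h2 : 0 ≤ ∑ t, p t * (cost (L + ε • D) s (x t) - cost L s (x t)) := by
      simp only [mul_sub, Finset.sum_sub_distrib]
      linarith
    refine h2.trans ?_
    rw [Finset.mul_sum, Finset.mul_sum, ← Finset.sum_add_distrib]
    refine Finset.sum_le_sum fun t _ => ?_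
    have h3 := mul_le_mul_of_nonneg_left (hcost (L + ε • D) (x t)) (hp t)
    refine h3.trans (le_of_eq ?_)
    set h := coef L s *ᵥ x t with hh
    have hres : x t - L *ᵥ h = (1 - shrink L s) *ᵥ x t := by
      rw [Matrix.sub_mulVec, Matrix.one_mulVec, shrink, hh, Matrix.mulVec_mulVec]
    have e1 : x t - (L + ε • D) *ᵥ h = (1 - shrink L s) *ᵥ x t - ε • D *ᵥ h := by
      rw [← hres, Matrix.add_mulVec, Matrix.smul_mulVec]
      abel
    have e2 : enorm2 ((1 - shrink L s) *ᵥ x t - ε • D *ᵥ h) ^ 2 =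
        enorm2 ((1 - shrink L s) *ᵥ x t) ^ 2 - 2 * ε * (((1 - shrink L s) *ᵥ x t) ⬝ᵥ D *ᵥ h) +
          ε ^ 2 * enorm2 (D *ᵥ h) ^ 2 := by
      rw [enorm2_sq, enorm2_sq, enorm2_sq, sub_dotProduct, dotProduct_sub, dotProduct_sub,
        dotProduct_comm (ε • D *ᵥ h) ((1 - shrink L s) *ᵥ x t), dotProduct_smul, dotProduct_smul,
        smul_dotProduct]
      simp only [smul_eq_mul]
      ring
    have e3 : ((gramB L s)⁻¹ * ((L + ε • D)ᵀ * (L + ε • D) - Lᵀ * L)).trace =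
        2 * ε * (coef L s * D).trace + ε ^ 2 * ((gramB L s)⁻¹ * (Dᵀ * D)).trace := by
      have e4 : (L + ε • D)ᵀ * (L + ε • D) - Lᵀ * L =
          ε • (Lᵀ * D) + ε • (Dᵀ * L) + (ε * ε) • (Dᵀ * D) := by
        rw [Matrix.transpose_add, Matrix.transpose_smul, Matrix.add_mul, Matrix.mul_add,
          Matrix.mul_add, Matrix.mul_smul, Matrix.smul_mul, Matrix.smul_mul, Matrix.mul_smul,
          smul_smul]
        abel
      have e5 : ((gramB L s)⁻¹ * (Dᵀ * L)).trace = (coef L s * D).trace := by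
        rw [← Matrix.trace_transpose, Matrix.transpose_mul, Matrix.transpose_mul,
          Matrix.transpose_transpose, gramB_inv_transpose, Matrix.trace_mul_comm, coef,
          Matrix.mul_assoc]
      rw [e4, Matrix.mul_add, Matrix.mul_add, Matrix.mul_smul, Matrix.mul_smul, Matrix.mul_smul,
        Matrix.trace_add, Matrix.trace_add, Matrix.trace_smul, Matrix.trace_smul,
        Matrix.trace_smul, e5, ← Matrix.mul_assoc, ← coef]
      simp only [smul_eq_mul]
      ring
    rw [e1, hres, e2, e3]
    ring
  -- The directions `D` with a single nonzero entry read off the gradient entry by entry.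
  have hfoc : (1 - shrink L s) * wSecond p x * (coef L s)ᵀ = (s * ∑ t, p t) • (coef L s)ᵀ := by
    ext i a
    have h1 := hlin (Matrix.single i a (1 : ℝ))
    have h2 : ∀ t, ((1 - shrink L s) *ᵥ x t) ⬝ᵥ Matrix.single i a (1 : ℝ) *ᵥ (coef L s *ᵥ x t) =
        ((1 - shrink L s) *ᵥ x t) i * (coef L s *ᵥ x t) a := by
      intro t
      rw [Matrix.single_mulVec, one_mul]
      exact dotProduct_single _ _ _
    have h3 : (coef L s * Matrix.single i a (1 : ℝ)).trace = coef L s a i := by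
      simp [Matrix.trace_mul_single]
    simp only [h2, h3] at h1
    have h4 : ((1 - shrink L s) * wSecond p x * (coef L s)ᵀ : Matrix (Fin N) (Fin k) ℝ) i a =
        ∑ t, p t * (((1 - shrink L s) *ᵥ x t) i * (coef L s *ᵥ x t) a) := by
      rw [wSecond, Matrix.mul_sum, Matrix.sum_mul, Matrix.sum_apply]
      refine Finset.sum_congr rfl fun t _ => ?_
      rw [Matrix.mul_smul, Matrix.smul_mul, Matrix.smul_apply, Matrix.mul_vecMulVec,
        Matrix.vecMulVec_mul, Matrix.vecMul_transpose, Matrix.vecMulVec_apply, smul_eq_mul]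
    rw [h4, Matrix.smul_apply, Matrix.transpose_apply, smul_eq_mul]
    have h5 : ∑ t, p t * (-2 * s⁻¹ * (((1 - shrink L s) *ᵥ x t) i * (coef L s *ᵥ x t) a) +
        2 * coef L s a i) = -2 * s⁻¹ * (∑ t, p t * (((1 - shrink L s) *ᵥ x t) i *
          (coef L s *ᵥ x t) a)) + 2 * coef L s a i * ∑ t, p t := by
      rw [Finset.mul_sum, Finset.mul_sum, ← Finset.sum_add_distrib]
      exact Finset.sum_congr rfl fun t _ => by ring
    rw [h5] at h1
    have hss : s * s⁻¹ = 1 := mul_inv_cancel₀ hs.ne'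
    linear_combination (-(s / 2)) * h1 - (∑ t, p t * (((1 - shrink L s) *ᵥ x t) i *
      (coef L s *ᵥ x t) a)) * hss
  -- Multiplying by the covariance matrix on the left and by `B` on the right removes both inverses
  -- and leaves the eigenvalue equation.
  have hR := congrArg (fun A => covMat L s * A * gramB L s) hfoc
  have hc : (coef L s)ᵀ * gramB L s = L := by
    rw [coef_transpose, Matrix.mul_assoc, Matrix.nonsing_inv_mul _ (gramB_isUnit_det hs),
      Matrix.mul_one]
  have hcL : covMat L s * L = L * gramB L s := by
    simp [covMat, gramB, Matrix.add_mul, Matrix.mul_add, Matrix.mul_assoc]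
  have hl : covMat L s * ((1 - shrink L s) * wSecond p x * (coef L s)ᵀ) * gramB L s =
      s • (wSecond p x * L) := by
    calc _ = (covMat L s * (1 - shrink L s)) * wSecond p x * ((coef L s)ᵀ * gramB L s) := by
          simp only [Matrix.mul_assoc]
      _ = _ := by
          rw [covMat_mul_one_sub_shrink hs, hc, Matrix.smul_mul, Matrix.one_mul, Matrix.smul_mul]
  have hr : covMat L s * ((s * ∑ t, p t) • (coef L s)ᵀ) * gramB L s =
      (s * ∑ t, p t) • (L * gramB L s) := by
    rw [Matrix.mul_smul, Matrix.smul_mul, Matrix.mul_assoc, hc, hcL]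
  simp only [hl, hr] at hR
  rw [mul_smul] at hR
  exact smul_right_injective _ hs.ne' hR

end FirstOrder

/-! ### The mixture likelihood -/

section Mixture

variable {J N : ℕ} {r : Fin J → ℕ} {L K : (j : Fin J) → Matrix (Fin N) (Fin (r j)) ℝ}
  {s c : ℝ} {q : Fin J → ℝ}

theorem mixture_pos (hs : 0 < s) (hq : ∀ j, 0 < q j) (j : Fin J) (x : Fin N → ℝ) :
    0 < ∑ k, q k * dens (L k) s x :=
  Finset.sum_pos (fun k _ => mul_pos (hq k) (dens_pos hs x)) ⟨j, Finset.mem_univ j⟩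

theorem post_nonneg (hs : 0 < s) (hq : ∀ j, 0 < q j) (x : Fin N → ℝ) (j : Fin J) :
    0 ≤ post L s q x j :=
  div_nonneg (mul_pos (hq j) (dens_pos hs x)).le (mixture_pos hs hq j x).le

theorem sum_post (hs : 0 < s) (hq : ∀ j, 0 < q j) (x : Fin N → ℝ) (j : Fin J) :
    ∑ k, post L s q x k = 1 := by
  unfold post
  rw [← Finset.sum_div, div_self (mixture_pos hs hq j x).ne']

theorem post_le_one (hs : 0 < s) (hq : ∀ j, 0 < q j) (x : Fin N → ℝ) (j : Fin J) :
    post L s q x j ≤ 1 := by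
  rw [← sum_post (L := L) hs hq x j]
  exact Finset.single_le_sum (fun k _ => post_nonneg hs hq x k) (Finset.mem_univ j)

/-- A weighted mean of densities is at most the largest of them. -/
theorem log_mixture_le (hs : 0 < s) (hq : ∀ j, 0 < q j) (hsum : ∑ j, q j = 1) (x : Fin N → ℝ)
    (j : Fin J) (hj : ∀ k, cost (L j) s x ≤ cost (L k) s x) :
    Real.log (∑ k, q k * dens (L k) s x) ≤
      Real.log (densConst N s) - 1 / 2 * cost (L j) s x := by
  have h : ∑ k, q k * dens (L k) s x ≤ densConst N s * Real.exp (-(1 / 2) * cost (L j) s x) := by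
    calc _ ≤ ∑ k, q k * (densConst N s * Real.exp (-(1 / 2) * cost (L j) s x)) := by
          refine Finset.sum_le_sum fun k _ => mul_le_mul_of_nonneg_left ?_ (hq k).le
          rw [dens_eq hs]
          refine mul_le_mul_of_nonneg_left (Real.exp_le_exp.2 ?_) (densConst_pos hs).le
          linarith [hj k]
      _ = _ := by rw [← Finset.sum_mul, hsum, one_mul]
  have h2 := Real.log_le_log (mixture_pos hs hq j x) h
  rw [Real.log_mul (densConst_pos hs).ne' (Real.exp_pos _).ne', Real.log_exp] at h2
  linarith

/-- One component alone, with weight at least `c`, already bounds the mixture from below. -/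
theorem le_log_mixture (hs : 0 < s) (hc : 0 < c) (hq : ∀ j, c ≤ q j) (x : Fin N → ℝ)
    (j : Fin J) : Real.log c + Real.log (densConst N s) - 1 / 2 * cost (L j) s x ≤
      Real.log (∑ k, q k * dens (L k) s x) := by
  have h : c * (densConst N s * Real.exp (-(1 / 2) * cost (L j) s x)) ≤
      ∑ k, q k * dens (L k) s x := by
    rw [← dens_eq hs]
    calc _ ≤ q j * dens (L j) s x := mul_le_mul_of_nonneg_right (hq j) (dens_pos hs x).le
      _ ≤ _ := Finset.single_le_sum (f := fun k => q k * dens (L k) s x)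
          (fun k _ => mul_nonneg (hc.le.trans (hq k)) (dens_pos hs x).le) (Finset.mem_univ j)
  have hd := densConst_pos (N := N) hs
  have h2 := Real.log_le_log (by positivity) h
  rw [Real.log_mul hc.ne' (by positivity), Real.log_mul hd.ne' (Real.exp_pos _).ne',
    Real.log_exp] at h2
  linarith

/-- A maximizer of the likelihood fits, up to `O (T)`, at least as well as any other loadings with
any assignment `z` of the observations to regimes. -/
theorem sum_cost_le_of_maximal {x : ℕ → Fin N → ℝ} {T : ℕ} (hs : 0 < s) (hc : 0 < c)
    (hq : ∀ j, c ≤ q j) (hsum : ∑ j, q j = 1) (hmax : logLik x T K s q ≤ logLik x T L s q)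
    (z κ : ℕ → Fin J) (hκ : ∀ t k, cost (L (κ t)) s (x t) ≤ cost (L k) s (x t)) :
    ∑ t ∈ Finset.range T, cost (L (κ t)) s (x t) ≤
      ∑ t ∈ Finset.range T, cost (K (z t)) s (x t) + T * (-2 * Real.log c) := by
  have h1 : logLik x T L s q ≤ ∑ t ∈ Finset.range T,
      (Real.log (densConst N s) - 1 / 2 * cost (L (κ t)) s (x t)) :=
    Finset.sum_le_sum fun t _ =>
      log_mixture_le hs (fun j => hc.trans_le (hq j)) hsum (x t) (κ t) (hκ t)
  have h2 : ∑ t ∈ Finset.range T, (Real.log c + Real.log (densConst N s) -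
      1 / 2 * cost (K (z t)) s (x t)) ≤ logLik x T K s q :=
    Finset.sum_le_sum fun t _ => le_log_mixture hs hc hq (x t) (z t)
  have h3 := h2.trans (hmax.trans h1)
  simp only [Finset.sum_sub_distrib, Finset.sum_add_distrib, Finset.sum_const, Finset.card_range,
    nsmul_eq_mul, ← Finset.mul_sum] at h3
  linarith

/-- Jensen's inequality for `exp` with weights `1 - p` and `p`. The last two alternatives cover `p`
outside `[0, 1]` and are excluded where the inequality is used. -/
theorem mul_le_log_one_add {p y : ℝ} : p * y ≤ Real.log (1 - p + p * Real.exp y) ∨ p < 0 ∨ 1 < p := by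
  by_cases h0 : p < 0
  · exact Or.inr (Or.inl h0)
  by_cases h1 : 1 < p
  · exact Or.inr (Or.inr h1)
  left
  push Not at h0 h1
  have h := convexOn_exp.2 (Set.mem_univ (0 : ℝ)) (Set.mem_univ y) (sub_nonneg.2 h1) h0 (by ring)
  simp only [smul_eq_mul, mul_zero, zero_add, Real.exp_zero, mul_one] at h
  rw [← Real.log_exp (p * y)]
  exact Real.log_le_log (Real.exp_pos _) h

/-- By concavity of the logarithm, each block of a maximizer of the mixture likelihood minimizes
the average cost with weights given by the conditional probabilities of the regime. -/
theorem sum_post_cost_le {x : ℕ → Fin N → ℝ} {T : ℕ} (hs : 0 < s) (hq : ∀ j, 0 < q j)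
    (hmax : ∀ K : (j : Fin J) → Matrix (Fin N) (Fin (r j)) ℝ,
      logLik x T K s q ≤ logLik x T L s q) (j : Fin J) (A : Matrix (Fin N) (Fin (r j)) ℝ) :
    ∑ t : Fin T, post L s q (x t) j * cost (L j) s (x t) ≤
      ∑ t : Fin T, post L s q (x t) j * cost A s (x t) := by
  have h1 := hmax (Function.update L j A)
  unfold logLik at h1
  rw [Finset.sum_range, Finset.sum_range, ← sub_nonneg, ← Finset.sum_sub_distrib] at h1
  -- Exchanging block `j` multiplies the mixture at `x t` by `1 - p + p exp(-Δ/2)`, where `Δ` is the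
  -- change of cost and `p` the posterior probability; Jensen bounds its logarithm below by `-p
  -- Δ/2`.
  have h2 : ∀ t : Fin T, Real.log (∑ k, q k * dens (L k) s (x t)) -
      Real.log (∑ k, q k * dens (Function.update L j A k) s (x t)) ≤
      1 / 2 * (post L s q (x t) j * cost A s (x t) - post L s q (x t) j * cost (L j) s (x t)) := by
    intro t
    set S := ∑ k, q k * dens (L k) s (x t) with hS
    set p := post L s q (x t) j with hp
    have hSpos : 0 < S := mixture_pos hs hq j (x t)
    have hpS : q j * dens (L j) s (x t) = p * S := by
      rw [hp, post, div_mul_cancel₀ _ hSpos.ne']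
    have hdA : dens A s (x t) = dens (L j) s (x t) *
        Real.exp (-(1 / 2) * (cost A s (x t) - cost (L j) s (x t))) := by
      rw [dens_eq hs, dens_eq hs, mul_assoc, ← Real.exp_add]
      congr 2
      ring
    have hsum : ∑ k, q k * dens (Function.update L j A k) s (x t) =
        S * (1 - p + p * Real.exp (-(1 / 2) * (cost A s (x t) - cost (L j) s (x t)))) := by
      rw [← Finset.add_sum_erase _ _ (Finset.mem_univ j), Function.update_self]
      have h3 : ∑ k ∈ Finset.univ.erase j, q k * dens (Function.update L j A k) s (x t) =
          ∑ k ∈ Finset.univ.erase j, q k * dens (L k) s (x t) :=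
        Finset.sum_congr rfl fun k hk => by
          rw [Function.update_of_ne (Finset.ne_of_mem_erase hk)]
      have h4 := Finset.add_sum_erase Finset.univ (fun k => q k * dens (L k) s (x t))
        (Finset.mem_univ j)
      simp only [hpS, ← hS] at h4
      rw [h3, hdA, ← mul_assoc, hpS]
      linear_combination h4
    have hpos := mixture_pos (L := Function.update L j A) hs hq j (x t)
    rw [hsum] at hpos ⊢
    have hpos2 := pos_of_mul_pos_right hpos hSpos.le
    rw [Real.log_mul hSpos.ne' hpos2.ne']
    rcases mul_le_log_one_add (p := p) (y := -(1 / 2) * (cost A s (x t) - cost (L j) s (x t)))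
      with h | h | h
    · linarith
    · exact absurd h (not_lt.2 (post_nonneg hs hq _ _))
    · exact absurd h (not_lt.2 (post_le_one hs hq _ _))
  have h3 := h1.trans (Finset.sum_le_sum fun t _ => h2 t)
  rw [← Finset.mul_sum, Finset.sum_sub_distrib] at h3
  linarith

/-- The estimated loadings of a regime are eigenvectors of the weighted second moment matrix. -/
theorem wSecond_mul_eq {x : ℕ → Fin N → ℝ} {T : ℕ} (hs : 0 < s) (hq : ∀ j, 0 < q j)
    (hmax : ∀ K : (j : Fin J) → Matrix (Fin N) (Fin (r j)) ℝ,
      logLik x T K s q ≤ logLik x T L s q) (j : Fin J) (hL : GramDiag (L j)) :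
    wSecond (fun t : Fin T => post L s q (x t) j) (fun t => x t) * L j =
      (∑ t : Fin T, post L s q (x t) j) • (L j * gramB (L j) s) :=
  first_order_condition hL hs (fun _ => post_nonneg hs hq _ _)
    (sum_post_cost_le hs hq hmax j)

/-- The denominator is at least its `j`-th term; the weights contribute at most `1/c` to the ratio
of the two components. -/
theorem post_le_of_cost (hs : 0 < s) (hc : 0 < c) (hq : ∀ j, c ≤ q j) (hsum : ∑ j, q j = 1)
    (x : Fin N → ℝ) (j k : Fin J) :
    post L s q x k ≤ c⁻¹ * Real.exp (-(1 / 2) * (cost (L k) s x - cost (L j) s x)) := by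
  have hq' : ∀ j, 0 < q j := fun j => hc.trans_le (hq j)
  have hqk : q k ≤ 1 := by
    rw [← hsum]
    exact Finset.single_le_sum (fun i _ => (hq' i).le) (Finset.mem_univ k)
  have h1 : c * dens (L j) s x ≤ ∑ i, q i * dens (L i) s x :=
    (mul_le_mul_of_nonneg_right (hq j) (dens_pos hs x).le).trans
      (Finset.single_le_sum (f := fun k => q k * dens (L k) s x)
        (fun k _ => mul_nonneg (hq' k).le (dens_pos hs x).le) (Finset.mem_univ j))
  have hd : dens (L k) s x = dens (L j) s x *
      Real.exp (-(1 / 2) * (cost (L k) s x - cost (L j) s x)) := by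
    rw [dens_eq hs, dens_eq hs, mul_assoc, ← Real.exp_add]
    congr 2
    ring
  rw [post, div_le_iff₀ (mixture_pos hs hq' j x), hd]
  set e := Real.exp (-(1 / 2) * (cost (L k) s x - cost (L j) s x)) with he
  have hepos : 0 < e := Real.exp_pos _
  have hdp := dens_pos (L := L j) hs x
  calc q k * (dens (L j) s x * e) ≤ 1 * (dens (L j) s x * e) := by gcongr
    _ = c⁻¹ * e * (c * dens (L j) s x) := by field_simp
    _ ≤ c⁻¹ * e * ∑ i, q i * dens (L i) s x := by gcongr

end Mixture

/-! ### Distances between column spaces -/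

section Defect

variable {N k l : ℕ}

/-- `tr (Λ' (I - G) Λ)`: the part of `Λ` not explained by `G`. -/
def defect (Lam : Matrix (Fin N) (Fin l) ℝ) (G : Matrix (Fin N) (Fin N) ℝ) : ℝ :=
  (Lamᵀ * ((1 - G) * Lam)).trace

/-- `P_Λ = Λ (Λ' Λ)⁻¹ Λ'`. -/
def proj (Lam : Matrix (Fin N) (Fin l) ℝ) : Matrix (Fin N) (Fin N) ℝ :=
  Lam * ((Lamᵀ * Lam)⁻¹ * Lamᵀ)

theorem annihilator_eq (Lam : Matrix (Fin N) (Fin l) ℝ) : annihilator Lam = 1 - proj Lam := by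
  rw [annihilator, proj, Matrix.mul_assoc]

theorem proj_transpose (Lam : Matrix (Fin N) (Fin l) ℝ) : (proj Lam)ᵀ = proj Lam := by
  rw [proj, Matrix.transpose_mul, Matrix.transpose_mul, Matrix.transpose_transpose,
    Matrix.transpose_nonsing_inv, Matrix.transpose_mul, Matrix.transpose_transpose,
    Matrix.mul_assoc]

/-- No rank condition is needed: a singular Gram matrix has inverse zero by convention, and the
projection is then zero. -/
theorem proj_mul_self (Lam : Matrix (Fin N) (Fin l) ℝ) : proj Lam * proj Lam = proj Lam := by
  by_cases h : IsUnit (Lamᵀ * Lam).det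
  · have h1 : proj Lam * proj Lam =
        Lam * ((Lamᵀ * Lam)⁻¹ * ((Lamᵀ * Lam) * ((Lamᵀ * Lam)⁻¹ * Lamᵀ))) := by
      simp only [proj, Matrix.mul_assoc]
    rw [h1, Matrix.mul_nonsing_inv_cancel_left _ _ h, proj]
  · simp [proj, Matrix.nonsing_inv_apply_not_isUnit _ h]

theorem trace_proj_le (Lam : Matrix (Fin N) (Fin l) ℝ) : (proj Lam).trace ≤ l := by
  rw [proj, Matrix.trace_mul_comm, Matrix.mul_assoc]
  by_cases h : IsUnit (Lamᵀ * Lam).det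
  · rw [Matrix.nonsing_inv_mul _ h, Matrix.trace_one, Fintype.card_fin]
  · rw [Matrix.nonsing_inv_apply_not_isUnit _ h]; simp

theorem trace_proj {Lam : Matrix (Fin N) (Fin l) ℝ} (h : IsUnit (Lamᵀ * Lam).det) :
    (proj Lam).trace = l := by
  rw [proj, Matrix.trace_mul_comm, Matrix.mul_assoc, Matrix.nonsing_inv_mul _ h, Matrix.trace_one,
    Fintype.card_fin]

theorem proj_mul {Lam : Matrix (Fin N) (Fin l) ℝ} (h : IsUnit (Lamᵀ * Lam).det) :
    proj Lam * Lam = Lam := by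
  rw [proj, Matrix.mul_assoc, Matrix.mul_assoc, Matrix.nonsing_inv_mul _ h, Matrix.mul_one]

theorem annihilator_transpose (Lam : Matrix (Fin N) (Fin l) ℝ) :
    (annihilator Lam)ᵀ = annihilator Lam := by
  rw [annihilator_eq, Matrix.transpose_sub, proj_transpose, Matrix.transpose_one]

theorem annihilator_mul_self (Lam : Matrix (Fin N) (Fin l) ℝ) :
    annihilator Lam * annihilator Lam = annihilator Lam := by
  rw [annihilator_eq, sub_mul, mul_sub, mul_sub, proj_mul_self]
  simp

theorem annihilator_eq_gram (Lam : Matrix (Fin N) (Fin l) ℝ) :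
    annihilator Lam = (annihilator Lam)ᵀ * annihilator Lam := by
  rw [annihilator_transpose, annihilator_mul_self]

theorem quad_annihilator (Lam : Matrix (Fin N) (Fin l) ℝ) (x : Fin N → ℝ) :
    x ⬝ᵥ annihilator Lam *ᵥ x = enorm2 (annihilator Lam *ᵥ x) ^ 2 := by
  nth_rewrite 1 [annihilator_eq_gram]
  rw [dotProduct_transpose_mul_self]

theorem quad_proj (Lam : Matrix (Fin N) (Fin l) ℝ) (x : Fin N → ℝ) :
    x ⬝ᵥ proj Lam *ᵥ x = enorm2 (proj Lam *ᵥ x) ^ 2 := by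
  rw [← dotProduct_transpose_mul_self, proj_transpose, proj_mul_self]

theorem enorm2_annihilator_le (Lam : Matrix (Fin N) (Fin l) ℝ) (x : Fin N → ℝ) :
    enorm2 (annihilator Lam *ᵥ x) ≤ enorm2 x := by
  refine le_of_sq_le_sq ?_ (enorm2_nonneg _)
  have h := quad_one_sub (proj Lam) x
  rw [← annihilator_eq, quad_annihilator, quad_proj] at h
  have := sq_nonneg (enorm2 (proj Lam *ᵥ x))
  linarith

theorem enorm2_proj_le (Lam : Matrix (Fin N) (Fin l) ℝ) (x : Fin N → ℝ) :
    enorm2 (proj Lam *ᵥ x) ≤ enorm2 x := by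
  refine le_of_sq_le_sq ?_ (enorm2_nonneg _)
  have h := quad_one_sub (proj Lam) x
  rw [← annihilator_eq, quad_annihilator, quad_proj] at h
  have := sq_nonneg (enorm2 (annihilator Lam *ᵥ x))
  linarith

theorem defect_proj (L : Matrix (Fin N) (Fin k) ℝ) (Lam : Matrix (Fin N) (Fin l) ℝ) :
    defect Lam (proj L) = frobSq (annihilator L * Lam) := by
  rw [defect, ← annihilator_eq, frobSq_eq_trace, Matrix.transpose_mul, annihilator_transpose,
    Matrix.mul_assoc, ← Matrix.mul_assoc (annihilator L), annihilator_mul_self]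

theorem defect_shrink {L : Matrix (Fin N) (Fin k) ℝ} {s : ℝ} (hs : 0 < s)
    (Lam : Matrix (Fin N) (Fin l) ℝ) : defect Lam (shrink L s) =
      frobSq ((1 - shrink L s) * Lam) + s * frobSq (coef L s * Lam) := by
  rw [defect]
  nth_rewrite 1 [one_sub_shrink_eq hs]
  rw [Matrix.add_mul, Matrix.mul_add, Matrix.trace_add, frobSq_eq_trace, frobSq_eq_trace,
    Matrix.smul_mul, Matrix.mul_smul, Matrix.trace_smul, smul_eq_mul, Matrix.transpose_mul,
    Matrix.transpose_mul]
  simp only [Matrix.mul_assoc]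

theorem trace_conj_eq_sum (A : Matrix (Fin N) (Fin N) ℝ) (Lam : Matrix (Fin N) (Fin l) ℝ) :
    (Lamᵀ * (A * Lam)).trace = ∑ a, Lamᵀ a ⬝ᵥ A *ᵥ Lamᵀ a := by
  rw [Matrix.trace]
  refine Finset.sum_congr rfl fun a _ => ?_
  rw [Matrix.diag_apply, Matrix.mul_apply']
  congr 1

theorem sum_enorm2_col_sq (Lam : Matrix (Fin N) (Fin l) ℝ) :
    ∑ a, enorm2 (Lamᵀ a) ^ 2 = frobSq Lam := by
  rw [← frobSq_transpose, frobSq]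
  exact Finset.sum_congr rfl fun a _ => enorm2_sq_eq_sum _

theorem abs_trace_conj_le (A : Matrix (Fin N) (Fin N) ℝ) (Lam : Matrix (Fin N) (Fin l) ℝ) :
    |(Lamᵀ * (A * Lam)).trace| ≤ ‖A‖ * frobSq Lam := by
  rw [trace_conj_eq_sum, ← sum_enorm2_col_sq, Finset.mul_sum]
  refine (Finset.abs_sum_le_sum_abs _ _).trans (Finset.sum_le_sum fun a _ => ?_)
  have := abs_dotProduct_mulVec_le A (Lamᵀ a) (Lamᵀ a)
  linarith

theorem defect_sub_le (A B : Matrix (Fin N) (Fin N) ℝ) (Lam : Matrix (Fin N) (Fin l) ℝ) :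
    defect Lam B ≤ defect Lam A + ‖A - B‖ * frobSq Lam := by
  have h : defect Lam B - defect Lam A = (Lamᵀ * ((A - B) * Lam)).trace := by
    rw [defect, defect, ← Matrix.trace_sub, ← Matrix.mul_sub, ← Matrix.sub_mul]
    congr 3
    abel
  have := (le_abs_self _).trans (abs_trace_conj_le (A - B) Lam)
  linarith

/-- Least squares minimizes the residual over the column space, so its residual is at most that of
the ridge fit, even before the penalty is added. -/
theorem defect_proj_le_defect_shrink {L : Matrix (Fin N) (Fin k) ℝ} {s : ℝ} (hs : 0 < s)
    (hL : IsUnit (Lᵀ * L).det) (Lam : Matrix (Fin N) (Fin l) ℝ) :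
    defect Lam (proj L) ≤ defect Lam (shrink L s) := by
  rw [defect, defect, trace_conj_eq_sum, trace_conj_eq_sum]
  refine Finset.sum_le_sum fun a _ => ?_
  set x := Lamᵀ a
  rw [← annihilator_eq, quad_annihilator, quad_eq_ridge hs]
  set h := coef L s *ᵥ x
  have h1 : annihilator L *ᵥ x = annihilator L *ᵥ (x - L *ᵥ h) := by
    rw [Matrix.mulVec_sub, Matrix.mulVec_mulVec, annihilator_eq, Matrix.sub_mul, proj_mul hL]
    simp
  have h2 := enorm2_annihilator_le L (x - L *ᵥ h)
  rw [← h1] at h2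
  have h3 := pow_le_pow_left₀ (enorm2_nonneg _) h2 2
  have := mul_nonneg hs.le (sq_nonneg (enorm2 h))
  linarith

theorem isUnit_gram_det_of_lower {Lam : Matrix (Fin N) (Fin l) ℝ} {c : ℝ} (hc : 0 < c)
    (h : ∀ u, c * enorm2 u ^ 2 ≤ enorm2 (Lam *ᵥ u) ^ 2) : IsUnit (Lamᵀ * Lam).det := by
  refine Ne.isUnit (Matrix.PosDef.det_pos ?_).ne'
  refine Matrix.PosDef.of_dotProduct_mulVec_pos (posSemidef_transpose_mul_self Lam).1
    fun u hu => ?_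
  rw [star_trivial, dotProduct_transpose_mul_self]
  refine lt_of_lt_of_le (mul_pos hc ?_) (h u)
  rw [enorm2_sq]
  exact lt_of_le_of_ne (by rw [← enorm2_sq]; positivity)
    (fun h0 => hu (dotProduct_self_eq_zero.1 h0.symm))

/-- For the least squares coefficients `β` of `v`, `c‖β‖² ≤ ‖Λβ‖² = ‖Pv‖² ≤ ‖v‖²`. -/
theorem norm_proj_coef_sq_le {Lam : Matrix (Fin N) (Fin l) ℝ} {c : ℝ} (hc : 0 < c)
    (h : ∀ u, c * enorm2 u ^ 2 ≤ enorm2 (Lam *ᵥ u) ^ 2) :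
    ‖(Lamᵀ * Lam)⁻¹ * Lamᵀ‖ ^ 2 ≤ c⁻¹ := by
  have h1 : ‖(Lamᵀ * Lam)⁻¹ * Lamᵀ‖ ≤ √(c⁻¹) := by
    refine opNorm_le_of_enorm2 _ (Real.sqrt_nonneg _) fun v => ?_
    refine le_of_sq_le_sq ?_ (mul_nonneg (Real.sqrt_nonneg _) (enorm2_nonneg _))
    rw [mul_pow, Real.sq_sqrt (inv_pos.2 hc).le]
    have h2 := h (((Lamᵀ * Lam)⁻¹ * Lamᵀ) *ᵥ v)
    rw [Matrix.mulVec_mulVec, ← proj] at h2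
    have h3 := pow_le_pow_left₀ (enorm2_nonneg _) (enorm2_proj_le Lam v) 2
    rw [← div_eq_inv_mul, le_div_iff₀ hc]
    linarith
  calc _ ≤ √(c⁻¹) ^ 2 := by gcongr
    _ = _ := Real.sq_sqrt (inv_pos.2 hc).le

/-- The projection on the true loading space is close to any smoother with a small defect. -/
theorem frobSq_sub_proj_le {Lam : Matrix (Fin N) (Fin l) ℝ} {c : ℝ} (hc : 0 < c)
    (h : ∀ u, c * enorm2 u ^ 2 ≤ enorm2 (Lam *ᵥ u) ^ 2) {G : Matrix (Fin N) (Fin N) ℝ}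
    (hG : (1 - G).PosSemidef) (hG2 : (G * G).trace ≤ G.trace) :
    frobSq (G - proj Lam) ≤ G.trace - l + 2 * (c⁻¹ * defect Lam G) := by
  have hu := isUnit_gram_det_of_lower hc h
  have hGt : Gᵀ = G := by
    have h1 : (1 - G)ᵀ = 1 - G := by
      rw [← Matrix.conjTranspose_eq_transpose_of_trivial]; exact hG.1
    rw [Matrix.transpose_sub, Matrix.transpose_one] at h1
    exact sub_right_injective h1
  rw [frobSq_sub_comm_expand _ _ hGt (proj_transpose _), proj_mul_self, trace_proj hu]
  -- With `I - G = Y'Y` the defect is `‖YΛ‖²` and `tr (I - G)P = ‖YP‖² ≤ ‖YΛ‖²/c`, all in Frobenius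
  -- norm. The rest is the expansion of `‖G - P‖²` with `tr G² ≤ tr G`.
  obtain ⟨Y, hY⟩ : ∃ Y : Matrix (Fin N) (Fin N) ℝ, 1 - G = Yᵀ * Y := by
    obtain ⟨Y, hY⟩ := CStarAlgebra.nonneg_iff_eq_star_mul_self.1 hG.nonneg
    exact ⟨Y, by rw [hY, Matrix.star_eq_conjTranspose,
      Matrix.conjTranspose_eq_transpose_of_trivial]⟩
  have h1 : defect Lam G = frobSq (Y * Lam) := by
    rw [defect, hY, frobSq_eq_trace, Matrix.transpose_mul]
    simp only [Matrix.mul_assoc]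
  have h2 : ((1 - G) * proj Lam).trace = frobSq (Y * proj Lam) := by
    rw [frobSq_eq_trace, Matrix.transpose_mul, proj_transpose, Matrix.mul_assoc,
      Matrix.trace_mul_comm (proj Lam), hY]
    simp only [Matrix.mul_assoc, proj_mul_self]
  have h3 : frobSq (Y * proj Lam) ≤ c⁻¹ * frobSq (Y * Lam) := by
    rw [proj, ← Matrix.mul_assoc, ← frobSq_transpose, Matrix.transpose_mul,
      ← frobSq_transpose (Y * Lam)]
    refine (frobSq_mul_le _ _).trans ?_
    rw [norm_transpose_eq]
    exact mul_le_mul_of_nonneg_right (norm_proj_coef_sq_le hc h) (frobSq_nonneg _)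
  rw [Matrix.sub_mul, Matrix.one_mul, Matrix.trace_sub, trace_proj hu] at h2
  rw [h1]
  linarith

theorem posSemidef_one_sub_shrink {L : Matrix (Fin N) (Fin k) ℝ} {s : ℝ} (hs : 0 < s) :
    (1 - shrink L s).PosSemidef := by
  rw [one_sub_shrink_eq hs]
  exact (posSemidef_transpose_mul_self _).add ((posSemidef_transpose_mul_self _).smul hs.le)

theorem posSemidef_one_sub_proj (L : Matrix (Fin N) (Fin k) ℝ) :
    (1 - proj L).PosSemidef := by
  rw [← annihilator_eq, annihilator_eq_gram]
  exact posSemidef_transpose_mul_self _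

/-- A vanishing diagonal entry of `L'L` contributes `s · s⁻¹ = 1` to `s tr B⁻¹`, so a full unit of
trace is lost. In the matching this excludes estimated loadings of deficient rank. -/
theorem GramDiag.trace_shrink_le_of_singular {L : Matrix (Fin N) (Fin k) ℝ} (hL : GramDiag L)
    {s : ℝ} (hs : 0 < s) (h : ¬ IsUnit (Lᵀ * L).det) : (shrink L s).trace ≤ (k : ℝ) - 1 := by
  have h1 : (shrink L s).trace = ((gramB L s)⁻¹ * (gramB L s - s • 1)).trace := by
    rw [shrink, coef, Matrix.trace_mul_comm, Matrix.mul_assoc]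
    simp [gramB]
  obtain ⟨a, ha⟩ : ∃ a, (Lᵀ * L) a a = 0 := by
    by_contra hcon
    push Not at hcon
    apply h
    rw [hL.eq_diagonal, det_diagonal]
    exact (Finset.prod_ne_zero_iff.2 fun a _ => hcon a).isUnit
  have hpos : ∀ b, 0 < (Lᵀ * L) b b + s := fun b => by
    have := gram_diag_nonneg L b
    linarith
  have hinv : (gramB L s)⁻¹ = diagonal fun b => ((Lᵀ * L) b b + s)⁻¹ := by
    rw [hL.gramB_eq]
    refine Matrix.inv_eq_right_inv ?_
    rw [diagonal_mul_diagonal, ← diagonal_one]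
    congr 1
    funext b
    exact mul_inv_cancel₀ (hpos b).ne'
  rw [h1, Matrix.mul_sub, Matrix.nonsing_inv_mul _ (gramB_isUnit_det hs), Matrix.trace_sub,
    Matrix.trace_one, Fintype.card_fin, Matrix.mul_smul, Matrix.mul_one, Matrix.trace_smul, hinv,
    trace_diagonal, smul_eq_mul]
  have h2 : s⁻¹ ≤ ∑ b, ((Lᵀ * L) b b + s)⁻¹ := by
    refine le_trans (le_of_eq ?_) (Finset.single_le_sum
      (f := fun b => ((Lᵀ * L) b b + s)⁻¹) (fun b _ => (inv_pos.2 (hpos b)).le) (Finset.mem_univ a))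
    simp [ha]
  have h3 : s * s⁻¹ ≤ s * ∑ b, ((Lᵀ * L) b b + s)⁻¹ := mul_le_mul_of_nonneg_left h2 hs.le
  rw [mul_inv_cancel₀ hs.ne'] at h3
  linarith

end Defect

/-! ### Matching estimated and true regimes -/

section Matching

/-- A relation between true and estimated regimes under which an estimated regime is at least as
large as the true one, and determines it when it is not larger, contains only rank-preserving
bijections. -/
theorem rank_eq_of_matching {J : ℕ} {r : Fin J → ℕ} {R : Fin J → Fin J → Prop}
    (h1 : ∀ j k, R j k → r j ≤ r k) (h2 : ∀ i j k, R j k → R i k → r k ≤ r j → i = j)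
    {π : Fin J → Fin J} (hπ : ∀ j, R j (π j)) : (∀ j, r (π j) = r j) ∧ Function.Injective π := by
  -- Induction downwards from the largest rank: `d` bounds the distance of `r j` from the maximum.
  have key : ∀ d : ℕ, ∀ j, Finset.univ.sup r ≤ r j + d → r (π j) = r j := by
    intro d
    induction d with
    | zero =>
      intro j hj
      refine le_antisymm ?_ (h1 _ _ (hπ j))
      exact (Finset.le_sup (f := r) (Finset.mem_univ (π j))).trans hj
    | succ d ih =>
      intro j hj
      by_contra hne
      have hlt : r j < r (π j) := lt_of_le_of_ne (h1 _ _ (hπ j)) (Ne.symm hne)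
      -- On the regimes of rank above `r j`, `π` preserves ranks by induction; hence it is an
      -- injective map of this finite set into itself, and so onto. If `r (π j) > r j`, then `π j`
      -- is already the image of some `i` in the set, which the second hypothesis identifies with
      -- `j`, a contradiction.
      let S := {i : Fin J // r j < r i}
      have hS : ∀ i : S, r (π i.1) = r i.1 := fun i => ih i.1 (by have := i.2; omega)
      let g : S → S := fun i => ⟨π i.1, by rw [hS i]; exact i.2⟩
      have hg : Function.Injective g := by
        intro a b hab
        have hab' : π a.1 = π b.1 := congrArg Subtype.val hab
        refine Subtype.ext (h2 a.1 b.1 (π b.1) (hπ _) (hab' ▸ hπ a.1) (hS b).le)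
      obtain ⟨i, hi⟩ := (Finite.surjective_of_injective hg) ⟨π j, hlt⟩
      have hi' : π i.1 = π j := congrArg Subtype.val hi
      have : j = i.1 := h2 j i.1 (π i.1) (hπ _) (hi' ▸ hπ j) (hS i).le
      have h3 := i.2
      rw [← this] at h3
      exact lt_irrefl _ h3
  have hr : ∀ j, r (π j) = r j := fun j => key (Finset.univ.sup r) j (by omega)
  exact ⟨hr, fun a b hab => h2 a b (π b) (hπ b) (hab ▸ hπ a) (hr b).le⟩

variable {J N : ℕ} {r : Fin J → ℕ}

/-- With correct labelling, estimated loading spaces that contain the true ones approximately are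
matched by the identity. -/
theorem matching_eq_id {Lam L : (j : Fin J) → Matrix (Fin N) (Fin (r j)) ℝ}
    {s c C c' η : ℝ} (hN : 0 < N) (hs : 0 < s) (hc : 0 < c) (hη : 0 ≤ η)
    (hlow : ∀ j u, c * N * enorm2 u ^ 2 ≤ enorm2 (Lam j *ᵥ u) ^ 2)
    (hup : ∀ j, frobSq (Lam j) ≤ C * N)
    (hsep : ∀ i j, i ≠ j → c' * N ≤ frobSq (annihilator (Lam j) * Lam i))
    (hdiag : ∀ j, GramDiag (L j))
    (hlab : ∀ σ : Equiv.Perm (Fin J), (∀ j, r (σ j) = r j) →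
      ∑ j, frobSq (annihilator (L j) * Lam j) ≤ ∑ j, frobSq (annihilator (L (σ j)) * Lam j))
    (hsmall1 : 2 * (c⁻¹ * (J * η)) < 1)
    (hsmall2 : J * η + √(2 * (c⁻¹ * (J * η))) * C < c')
    {π : Fin J → Fin J} (hπ : ∀ j, defect (Lam j) (shrink (L (π j)) s) ≤ η * N) (j : Fin J) :
    π j = j := by
  have hNr : (0 : ℝ) < N := by exact_mod_cast hN
  have hcN : 0 < c * N := mul_pos hc hNr
  have hJ : (1 : ℝ) ≤ J := by exact_mod_cast (Fin.pos j)
  have hηJ : η ≤ J * η := by nlinarith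
  have hJη : 0 ≤ J * η := by positivity
  have hscale : ∀ d : ℝ, d ≤ J * η * N → 2 * ((c * N)⁻¹ * d) ≤ 2 * (c⁻¹ * (J * η)) := by
    intro d hd
    have : (c * N)⁻¹ * d ≤ (c * N)⁻¹ * (J * η * N) :=
      mul_le_mul_of_nonneg_left hd (inv_pos.2 hcN).le
    have h2 : (c * N)⁻¹ * (J * η * N) = c⁻¹ * (J * η) := by field_simp
    linarith
  -- a smoother close to the loadings of one regime
  have hrank : ∀ (i : Fin J) (G : Matrix (Fin N) (Fin N) ℝ), (1 - G).PosSemidef →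
      (G * G).trace ≤ G.trace → defect (Lam i) G ≤ J * η * N → (r i : ℝ) < G.trace + 1 := by
    intro i G h1 h2 h3
    have h4 := frobSq_sub_proj_le hcN (hlow i) h1 h2
    have h5 := hscale _ h3
    have h6 := frobSq_nonneg (G - proj (Lam i))
    linarith
  -- A smoother of trace at most `r i` that explains `Lam i` is close to the projection on `Lam i`;
  -- if it explains `Lam i'` as well, so does this projection, against the separation of the two.
  have hsame : ∀ (i i' : Fin J) (G : Matrix (Fin N) (Fin N) ℝ), (1 - G).PosSemidef →
      (G * G).trace ≤ G.trace → G.trace ≤ r i → defect (Lam i) G ≤ J * η * N →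
      defect (Lam i') G ≤ J * η * N → i' = i := by
    intro i i' G h1 h2 h3 h4 h5
    by_contra hne
    have h6 := frobSq_sub_proj_le hcN (hlow i) h1 h2
    have h7 := hscale _ h4
    have h8 : ‖G - proj (Lam i)‖ ≤ √(2 * (c⁻¹ * (J * η))) :=
      (norm_le_sqrt_frobSq _).trans (Real.sqrt_le_sqrt (by linarith))
    have h9 := defect_sub_le G (proj (Lam i)) (Lam i')
    rw [defect_proj] at h9
    have h10 := hsep i' i hne
    have h11 : ‖G - proj (Lam i)‖ * frobSq (Lam i') ≤ √(2 * (c⁻¹ * (J * η))) * (C * N) :=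
      mul_le_mul h8 (hup i') (frobSq_nonneg _) (Real.sqrt_nonneg _)
    have h12 : c' * N ≤ (J * η + √(2 * (c⁻¹ * (J * η))) * C) * N := by linarith
    exact absurd (le_of_mul_le_mul_right h12 hNr) (not_le.2 hsmall2)
  have hηN : η * N ≤ J * η * N := mul_le_mul_of_nonneg_right hηJ hNr.le
  obtain ⟨hr, hinj⟩ := rank_eq_of_matching (r := r)
    (R := fun i k => defect (Lam i) (shrink (L k) s) ≤ J * η * N)
    (fun i k h => by
      have h1 := hrank i _ (posSemidef_one_sub_shrink hs) (trace_shrink_sq_le hs) h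
      have h2 := trace_shrink_le (L := L k) hs
      have h3 : (r i : ℝ) < r k + 1 := by linarith
      have h4 : r i < r k + 1 := by exact_mod_cast h3
      omega)
    (fun i i' k h h' hk => hsame i' i _ (posSemidef_one_sub_shrink hs) (trace_shrink_sq_le hs)
      ((trace_shrink_le hs).trans (by exact_mod_cast hk)) h h')
    (π := π) (fun i => (hπ i).trans hηN)
  -- A singular Gram matrix would push the trace to `r i - 1`, below what explaining `Lam i`
  -- requires.
  have hunit : ∀ i, IsUnit ((L (π i))ᵀ * L (π i)).det := by
    intro i
    by_contra hcon
    have h1 := hrank i _ (posSemidef_one_sub_shrink hs) (trace_shrink_sq_le hs)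
      ((hπ i).trans hηN)
    have h2 := (hdiag (π i)).trace_shrink_le_of_singular hs hcon
    have h3 : (r (π i) : ℝ) = r i := by rw [hr i]
    linarith
  have hproj : ∀ i, defect (Lam i) (proj (L (π i))) ≤ η * N := fun i =>
    (defect_proj_le_defect_shrink hs (hunit i) _).trans (hπ i)
  let σ : Equiv.Perm (Fin J) := Equiv.ofBijective π (Finite.injective_iff_bijective.1 hinj)
  have hl := hlab σ hr
  have hl2 : ∑ i, frobSq (annihilator (L (σ i)) * Lam i) ≤ J * η * N := by
    calc _ ≤ ∑ _i : Fin J, η * N := Finset.sum_le_sum fun i _ => by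
          have := hproj i
          rwa [defect_proj] at this
      _ = _ := by simp; ring
  -- The labelling rule compares sums over all regimes, so under the identity each single defect is
  -- at most the whole sum under `π`; this is why `J * η` and not `η` appears throughout.
  have hid : ∀ i, defect (Lam i) (proj (L i)) ≤ J * η * N := fun i => by
    rw [defect_proj]
    exact (Finset.single_le_sum (f := fun i => frobSq (annihilator (L i) * Lam i))
      (fun _ _ => frobSq_nonneg _) (Finset.mem_univ i)).trans (hl.trans hl2)
  have hsq : ∀ i, (proj (L i) * proj (L i)).trace ≤ (proj (L i)).trace := fun i => by
    rw [proj_mul_self]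
  -- The projection on `L (π j)` explains `Lam (π j)` by the labelling and `Lam j` by the choice of
  -- `π`.
  exact (hsame (π j) j (proj (L (π j))) (posSemidef_one_sub_proj _) (hsq _)
    (trace_proj_le _) (hid _) ((hproj j).trans hηN)).symm

end Matching

/-! ### Goodness of fit of the estimated loadings -/

section Fit

variable {N k T : ℕ}

theorem frobSq_mul_le' {l : ℕ} (A : Matrix (Fin N) (Fin k) ℝ) (B : Matrix (Fin k) (Fin l) ℝ) :
    frobSq (A * B) ≤ frobSq A * ‖B‖ ^ 2 := by
  rw [← frobSq_transpose, Matrix.transpose_mul, ← frobSq_transpose A, mul_comm,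
    ← norm_transpose_eq B]
  exact frobSq_mul_le _ _

theorem sum_enorm2_mulVec_sq {l : ℕ} (A : Matrix (Fin k) (Fin N) ℝ) (B : Matrix (Fin N) (Fin l) ℝ) :
    ∑ t, enorm2 (A *ᵥ fun i => B i t) ^ 2 = frobSq (A * B) := by
  rw [← sum_enorm2_col_sq]
  rfl

/-- The sum is `tr E'GE`, at most `tr G` times `‖E‖²`. A smoother of trace at most `k` can absorb
only this much of the errors, uniformly in the loadings, however they depend on the data. -/
theorem sum_quad_shrink_le {L : Matrix (Fin N) (Fin k) ℝ} {s : ℝ} (hs : 0 < s)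
    (E : Matrix (Fin N) (Fin T) ℝ) :
    ∑ t, (fun i => E i t) ⬝ᵥ shrink L s *ᵥ (fun i => E i t) ≤ k * ‖E‖ ^ 2 := by
  have h : shrink L s = (shrink L s)ᵀ * shrink L s + s • ((coef L s)ᵀ * coef L s) := by
    rw [← shrink_sub_sq hs, shrink_transpose]; abel
  have h2 : ∀ x, x ⬝ᵥ shrink L s *ᵥ x =
      enorm2 (shrink L s *ᵥ x) ^ 2 + s * enorm2 (coef L s *ᵥ x) ^ 2 := by
    intro x
    nth_rewrite 1 [h]
    rw [Matrix.add_mulVec, dotProduct_add, dotProduct_transpose_mul_self, Matrix.smul_mulVec,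
      dotProduct_smul, dotProduct_transpose_mul_self, smul_eq_mul]
  simp only [h2]
  rw [Finset.sum_add_distrib, ← Finset.mul_sum, sum_enorm2_mulVec_sq, sum_enorm2_mulVec_sq]
  have h3 := frobSq_mul_le' (shrink L s) E
  have h4 := mul_le_mul_of_nonneg_left (frobSq_mul_le' (coef L s) E) hs.le
  have h5 : (shrink L s).trace = frobSq (shrink L s) + s * frobSq (coef L s) := by
    nth_rewrite 1 [h]
    rw [Matrix.trace_add, Matrix.trace_smul, ← frobSq_eq_trace, ← frobSq_eq_trace, smul_eq_mul]
  calc _ ≤ (frobSq (shrink L s) + s * frobSq (coef L s)) * ‖E‖ ^ 2 := by linarith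
    _ ≤ _ := by
      rw [← h5]
      exact mul_le_mul_of_nonneg_right (trace_shrink_le hs) (sq_nonneg _)

theorem cost_le_of_factor {L : Matrix (Fin N) (Fin k) ℝ} {s : ℝ} (hs : 0 < s) (f : Fin k → ℝ)
    (e : Fin N → ℝ) : cost L s (L *ᵥ f + e) ≤
      s⁻¹ * enorm2 e ^ 2 + enorm2 f ^ 2 + Real.log (1 + s⁻¹ • (Lᵀ * L)).det := by
  have h := mul_le_mul_of_nonneg_left (quad_le_ridge (L := L) hs (L *ᵥ f + e) f) (inv_pos.2 hs).le
  rw [add_sub_cancel_left, mul_add, ← mul_assoc, inv_mul_cancel₀ hs.ne', one_mul] at h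
  rw [cost]
  linarith

variable {J : ℕ} {r : Fin J → ℕ}

theorem quad_one_sub_shrink_add {L : Matrix (Fin N) (Fin k) ℝ} {s : ℝ} (y e : Fin N → ℝ) :
    (y + e) ⬝ᵥ (1 - shrink L s) *ᵥ (y + e) = y ⬝ᵥ (1 - shrink L s) *ᵥ y +
      2 * (y ⬝ᵥ e) - 2 * (y ⬝ᵥ shrink L s *ᵥ e) + enorm2 e ^ 2 - e ⬝ᵥ shrink L s *ᵥ e := by
  have hsym : e ⬝ᵥ shrink L s *ᵥ y = y ⬝ᵥ shrink L s *ᵥ e := by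
    rw [Matrix.dotProduct_mulVec, dotProduct_comm, ← Matrix.mulVec_transpose, shrink_transpose]
  rw [quad_one_sub, quad_one_sub, Matrix.mulVec_add, add_dotProduct, dotProduct_add,
    dotProduct_add, hsym, enorm2_sq, enorm2_sq, enorm2_sq, add_dotProduct, dotProduct_add,
    dotProduct_add, dotProduct_comm e y]
  ring

/-- The part of the common component that is not explained by the estimated loadings, together
with the log determinants, is controlled by the errors. -/
theorem sum_unexplained_le {Lam L : (j : Fin J) → Matrix (Fin N) (Fin (r j)) ℝ} {s ld c0 : ℝ}
    (hs : 0 < s) {z κ : ℕ → Fin J} {f : (t : ℕ) → Fin (r (z t)) → ℝ} {e : ℕ → Fin N → ℝ}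
    (hld : ∀ j, Real.log (1 + s⁻¹ • ((Lam j)ᵀ * Lam j)).det ≤ ld)
    (hcmp : ∑ t ∈ Finset.range T, cost (L (κ t)) s (Lam (z t) *ᵥ f t + e t) ≤
      ∑ t ∈ Finset.range T, cost (Lam (z t)) s (Lam (z t) *ᵥ f t + e t) + T * c0) :
    ∑ t ∈ Finset.range T, ((Lam (z t) *ᵥ f t) ⬝ᵥ (1 - shrink (L (κ t)) s) *ᵥ (Lam (z t) *ᵥ f t) +
        s * Real.log (1 + s⁻¹ • ((L (κ t))ᵀ * L (κ t))).det) ≤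
      (∑ j, (r j : ℝ)) * ‖Matrix.of fun (i : Fin N) (t : Fin T) => e t i‖ ^ 2 +
      2 * ∑ t ∈ Finset.range T, |(Lam (z t) *ᵥ f t) ⬝ᵥ e t| +
      2 * (√(∑ t ∈ Finset.range T, enorm2 (Lam (z t) *ᵥ f t) ^ 2) *
        √((∑ j, (r j : ℝ)) * ‖Matrix.of fun (i : Fin N) (t : Fin T) => e t i‖ ^ 2)) +
      s * ∑ t ∈ Finset.range T, enorm2 (f t) ^ 2 + s * (T * (ld + c0)) := by
  set y : ℕ → Fin N → ℝ := fun t => Lam (z t) *ᵥ f t with hy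
  set Em := Matrix.of fun (i : Fin N) (t : Fin T) => e t i with hE
  set g : ℕ → ℝ := fun t => e t ⬝ᵥ shrink (L (κ t)) s *ᵥ e t with hg
  -- The assignment `κ` depends on the data; summing over all regimes at every date removes this
  -- dependence.
  have hgsum : ∑ t ∈ Finset.range T, g t ≤ (∑ j, (r j : ℝ)) * ‖Em‖ ^ 2 := by
    calc ∑ t ∈ Finset.range T, g t
        ≤ ∑ t ∈ Finset.range T, ∑ j, e t ⬝ᵥ shrink (L j) s *ᵥ e t :=
          Finset.sum_le_sum fun t _ => Finset.single_le_sum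
            (f := fun j => e t ⬝ᵥ shrink (L j) s *ᵥ e t)
            (fun j _ => quad_shrink_nonneg hs _) (Finset.mem_univ (κ t))
      _ = ∑ j, ∑ t : Fin T, (fun i => Em i t) ⬝ᵥ shrink (L j) s *ᵥ (fun i => Em i t) := by
          rw [Finset.sum_comm]
          refine Finset.sum_congr rfl fun j _ => ?_
          rw [Finset.sum_range]
          rfl
      _ ≤ ∑ j, (r j : ℝ) * ‖Em‖ ^ 2 := Finset.sum_le_sum fun j _ => sum_quad_shrink_le hs Em
      _ = _ := by rw [Finset.sum_mul]
  -- Cauchy–Schwarz at each date and over the dates, with `‖Ge‖² ≤ e'Ge`.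
  have hcross : ∑ t ∈ Finset.range T, |y t ⬝ᵥ shrink (L (κ t)) s *ᵥ e t| ≤
      √(∑ t ∈ Finset.range T, enorm2 (y t) ^ 2) * √((∑ j, (r j : ℝ)) * ‖Em‖ ^ 2) := by
    calc _ ≤ ∑ t ∈ Finset.range T, enorm2 (y t) * √(g t) := by
          refine Finset.sum_le_sum fun t _ => (abs_dotProduct_le _ _).trans ?_
          refine mul_le_mul_of_nonneg_left ?_ (enorm2_nonneg _)
          exact Real.le_sqrt_of_sq_le (enorm2_shrink_sq_le hs _)
      _ ≤ √(∑ t ∈ Finset.range T, enorm2 (y t) ^ 2) * √(∑ t ∈ Finset.range T, √(g t) ^ 2) :=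
          Real.sum_mul_le_sqrt_mul_sqrt _ _ _
      _ ≤ _ := by
          refine mul_le_mul_of_nonneg_left (Real.sqrt_le_sqrt ?_) (Real.sqrt_nonneg _)
          refine le_trans (le_of_eq (Finset.sum_congr rfl fun t _ => ?_)) hgsum
          exact Real.sq_sqrt (quad_shrink_nonneg hs _)
  have hup : ∑ t ∈ Finset.range T, cost (Lam (z t)) s (y t + e t) ≤
      ∑ t ∈ Finset.range T, (s⁻¹ * enorm2 (e t) ^ 2 + enorm2 (f t) ^ 2 + ld) :=
    Finset.sum_le_sum fun t _ => (cost_le_of_factor hs (f t) (e t)).trans (by linarith [hld (z t)])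
  -- After multiplication by `s` the squared errors appear with coefficient one on both sides and
  -- cancel.
  have h1 := mul_le_mul_of_nonneg_left (hcmp.trans (add_le_add_left hup _)) hs.le
  have h2 : ∀ t, s * cost (L (κ t)) s (y t + e t) = y t ⬝ᵥ (1 - shrink (L (κ t)) s) *ᵥ y t +
      s * Real.log (1 + s⁻¹ • ((L (κ t))ᵀ * L (κ t))).det + 2 * (y t ⬝ᵥ e t) -
      2 * (y t ⬝ᵥ shrink (L (κ t)) s *ᵥ e t) + enorm2 (e t) ^ 2 - g t := by
    intro t
    rw [cost, quad_one_sub_shrink_add, mul_add, ← mul_assoc, mul_inv_cancel₀ hs.ne']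
    ring
  have h3 : ∀ t, s * (s⁻¹ * enorm2 (e t) ^ 2 + enorm2 (f t) ^ 2 + ld) =
      enorm2 (e t) ^ 2 + s * enorm2 (f t) ^ 2 + s * ld := by
    intro t
    rw [mul_add, mul_add, ← mul_assoc, mul_inv_cancel₀ hs.ne']
    ring
  rw [mul_add, Finset.mul_sum, Finset.mul_sum] at h1
  simp only [h3] at h1
  rw [Finset.sum_congr rfl fun t _ => h2 t] at h1
  simp only [Finset.sum_add_distrib, Finset.sum_sub_distrib, ← Finset.mul_sum,
    Finset.sum_const, Finset.card_range, nsmul_eq_mul] at h1 ⊢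
  have h4 : -∑ t ∈ Finset.range T, |y t ⬝ᵥ e t| ≤ ∑ t ∈ Finset.range T, y t ⬝ᵥ e t := by
    rw [← Finset.sum_neg_distrib]
    exact Finset.sum_le_sum fun t _ => neg_abs_le _
  have h5 : ∑ t ∈ Finset.range T, y t ⬝ᵥ shrink (L (κ t)) s *ᵥ e t ≤
      ∑ t ∈ Finset.range T, |y t ⬝ᵥ shrink (L (κ t)) s *ᵥ e t| :=
    Finset.sum_le_sum fun t _ => le_abs_self _
  simp only [hy] at h4 h5 h1 hcross ⊢
  linarith

/-- If the second moments of the factors over a set of dates are bounded below, then the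
unexplained parts over these dates bound the defect. -/
theorem defect_le_of_subset {l : ℕ} {Lam : Matrix (Fin N) (Fin l) ℝ} {L : Matrix (Fin N) (Fin k) ℝ}
    {s κ0 : ℝ} (hs : 0 < s) {f : ℕ → Fin l → ℝ} {A : Finset ℕ}
    (hA : ∀ u : Fin l → ℝ, κ0 * ∑ a, u a ^ 2 ≤ ∑ t ∈ A, (u ⬝ᵥ f t) ^ 2) :
    κ0 * defect Lam (shrink L s) ≤
      ∑ t ∈ A, (Lam *ᵥ f t) ⬝ᵥ (1 - shrink L s) *ᵥ (Lam *ᵥ f t) := by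
  -- The hypothesis applied to every row of `B` in the place of `u`.
  have key : ∀ {n : ℕ} (B : Matrix (Fin n) (Fin l) ℝ),
      κ0 * frobSq B ≤ ∑ t ∈ A, enorm2 (B *ᵥ f t) ^ 2 := by
    intro n B
    simp only [enorm2_sq_eq_sum]
    rw [Finset.sum_comm, frobSq, Finset.mul_sum]
    exact Finset.sum_le_sum fun i _ => hA (B i)
  simp only [quad_one_sub_shrink hs]
  rw [Finset.sum_add_distrib, ← Finset.mul_sum, defect_shrink hs]
  have h1 := key ((1 - shrink L s) * Lam)
  have h2 := mul_le_mul_of_nonneg_left (key (coef L s * Lam)) hs.le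
  simp only [Matrix.mulVec_mulVec]
  linarith

end Fit

/-! ### Classification of one observation -/

section Classify

variable {N k l : ℕ}

/-- The projection sees the errors only through `Λ'e`. Since `Λ'e` has order `√N` and `c` will be of
order `N`, the projected error is of order one, whereas `‖e‖` is of order `√N`. -/
theorem enorm2_proj_mulVec_le {Lam : Matrix (Fin N) (Fin l) ℝ} {c : ℝ} (hc : 0 < c)
    (h : ∀ u, c * enorm2 u ^ 2 ≤ enorm2 (Lam *ᵥ u) ^ 2) (e : Fin N → ℝ) :
    enorm2 (proj Lam *ᵥ e) ≤ √(c⁻¹) * enorm2 (Lamᵀ *ᵥ e) := by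
  have h1 : proj Lam = ((Lamᵀ * Lam)⁻¹ * Lamᵀ)ᵀ * Lamᵀ := by
    rw [← proj_transpose, proj, Matrix.transpose_mul]
  rw [h1, ← Matrix.mulVec_mulVec]
  refine (enorm2_mulVec_le _ _).trans (mul_le_mul_of_nonneg_right ?_ (enorm2_nonneg _))
  rw [norm_transpose_eq]
  exact Real.le_sqrt_of_sq_le (norm_proj_coef_sq_le hc h)

theorem quad_proj_add (Lam : Matrix (Fin N) (Fin l) ℝ) (y e : Fin N → ℝ) :
    (y + e) ⬝ᵥ (1 - proj Lam) *ᵥ (y + e) = enorm2 (annihilator Lam *ᵥ y) ^ 2 + 2 * (y ⬝ᵥ e) -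
      2 * (y ⬝ᵥ proj Lam *ᵥ e) + enorm2 e ^ 2 - enorm2 (proj Lam *ᵥ e) ^ 2 := by
  have hsym : e ⬝ᵥ proj Lam *ᵥ y = y ⬝ᵥ proj Lam *ᵥ e := by
    rw [Matrix.dotProduct_mulVec, dotProduct_comm, ← Matrix.mulVec_transpose, proj_transpose]
  rw [← quad_annihilator, annihilator_eq, ← quad_proj, quad_one_sub, quad_one_sub,
    Matrix.mulVec_add, add_dotProduct, dotProduct_add,
    dotProduct_add, hsym, enorm2_sq, enorm2_sq, enorm2_sq, add_dotProduct, dotProduct_add,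
    dotProduct_add, dotProduct_comm e y]
  ring

/-- The cost of a wrong regime exceeds the cost of the right one. -/
theorem cost_gap {Lj : Matrix (Fin N) (Fin k) ℝ} {Lk : Matrix (Fin N) (Fin l) ℝ}
    {Lamj : Matrix (Fin N) (Fin k) ℝ} {Lamk : Matrix (Fin N) (Fin l) ℝ} {s ρ : ℝ} (hs : 0 < s)
    (hdk : GramDiag Lk) (hj : ‖shrink Lj s - proj Lamj‖ ≤ ρ) (hk : ‖shrink Lk s - proj Lamk‖ ≤ ρ)
    (hu : IsUnit (Lamjᵀ * Lamj).det) (f : Fin k → ℝ) (e : Fin N → ℝ) :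
    s⁻¹ * (enorm2 (annihilator Lamk *ᵥ (Lamj *ᵥ f)) ^ 2
        - 2 * ρ * enorm2 (Lamj *ᵥ f + e) ^ 2 - 2 * |(Lamj *ᵥ f) ⬝ᵥ e|
        - 2 * (enorm2 (Lamj *ᵥ f) * enorm2 (proj Lamk *ᵥ e)) - enorm2 (proj Lamk *ᵥ e) ^ 2)
      - Real.log (1 + s⁻¹ • (Ljᵀ * Lj)).det ≤
      cost Lk s (Lamj *ᵥ f + e) - cost Lj s (Lamj *ᵥ f + e) := by
  set y := Lamj *ᵥ f with hy
  set x := y + e with hx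
  have hdet := hdk.log_det_nonneg hs
  -- Replacing a smoother by the corresponding true projection changes the quadratic form by at most
  -- `ρ‖x‖²`.
  have hdiff : ∀ (A B : Matrix (Fin N) (Fin N) ℝ), ‖A - B‖ ≤ ρ →
      |x ⬝ᵥ (1 - A) *ᵥ x - x ⬝ᵥ (1 - B) *ᵥ x| ≤ ρ * enorm2 x ^ 2 := by
    intro A B hAB
    have h1 : x ⬝ᵥ (1 - A) *ᵥ x - x ⬝ᵥ (1 - B) *ᵥ x = -(x ⬝ᵥ (A - B) *ᵥ x) := by
      rw [quad_one_sub, quad_one_sub, Matrix.sub_mulVec, dotProduct_sub]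
      ring
    rw [h1, abs_neg]
    refine (abs_dotProduct_mulVec_le _ _ _).trans ?_
    rw [mul_assoc, ← sq]
    exact mul_le_mul_of_nonneg_right hAB (sq_nonneg _)
  have h1 := (abs_le.1 (hdiff _ _ hk)).1
  have h2 := (abs_le.1 (hdiff _ _ hj)).2
  -- The residual projection of the right regime removes the common component entirely.
  have h3 : x ⬝ᵥ (1 - proj Lamj) *ᵥ x ≤ enorm2 e ^ 2 := by
    have h4 : annihilator Lamj *ᵥ x = annihilator Lamj *ᵥ e := by
      rw [hx, Matrix.mulVec_add, hy, Matrix.mulVec_mulVec, annihilator_eq, Matrix.sub_mul,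
        proj_mul hu]
      simp
    rw [← annihilator_eq, quad_annihilator, h4]
    exact pow_le_pow_left₀ (enorm2_nonneg _) (enorm2_annihilator_le _ _) 2
  have h4 := quad_proj_add Lamk y e
  rw [← hx] at h4
  have h5 := abs_dotProduct_le y (proj Lamk *ᵥ e)
  have h6 := (le_abs_self _).trans h5
  have h7 := neg_abs_le (y ⬝ᵥ e)
  have h8 : enorm2 (annihilator Lamk *ᵥ y) ^ 2 - 2 * ρ * enorm2 x ^ 2 - 2 * |y ⬝ᵥ e|
      - 2 * (enorm2 y * enorm2 (proj Lamk *ᵥ e)) - enorm2 (proj Lamk *ᵥ e) ^ 2 ≤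
      x ⬝ᵥ (1 - shrink Lk s) *ᵥ x - x ⬝ᵥ (1 - shrink Lj s) *ᵥ x := by linarith
  have h9 := mul_le_mul_of_nonneg_left h8 (inv_pos.2 hs).le
  rw [cost, cost]
  linarith

end Classify

/-! ### Moments of the data -/

section Moments

variable {μ : Measure Ω}

theorem lintegral_ofReal_sum_le {ι : Type*} (s : Finset ι) {Y : ι → Ω → ℝ} {M : ι → ℝ}
    (hm : ∀ i, Measurable (Y i)) (h0 : ∀ i ω, 0 ≤ Y i ω) (hM : ∀ i ∈ s, 0 ≤ M i)
    (h : ∀ i ∈ s, ∫⁻ ω, ENNReal.ofReal (Y i ω) ∂μ ≤ ENNReal.ofReal (M i)) :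
    ∫⁻ ω, ENNReal.ofReal (∑ i ∈ s, Y i ω) ∂μ ≤ ENNReal.ofReal (∑ i ∈ s, M i) := by
  have h1 : ∀ ω, ENNReal.ofReal (∑ i ∈ s, Y i ω) = ∑ i ∈ s, ENNReal.ofReal (Y i ω) := fun ω =>
    ENNReal.ofReal_sum_of_nonneg fun i _ => h0 i ω
  simp only [h1]
  rw [lintegral_finsetSum _ fun i _ => (hm i).ennreal_ofReal, ENNReal.ofReal_sum_of_nonneg hM]
  exact Finset.sum_le_sum h

theorem lintegral_ofReal_const_mul {Y : Ω → ℝ} {M c : ℝ} (hc : 0 ≤ c)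
    (h : ∫⁻ ω, ENNReal.ofReal (Y ω) ∂μ ≤ ENNReal.ofReal M) :
    ∫⁻ ω, ENNReal.ofReal (c * Y ω) ∂μ ≤ ENNReal.ofReal (c * M) := by
  simp only [ENNReal.ofReal_mul hc]
  rw [lintegral_const_mul' _ _ ENNReal.ofReal_ne_top]
  gcongr

theorem lintegral_ofReal_mono {Y Z : Ω → ℝ} {M : ℝ} (hYZ : ∀ ω, Y ω ≤ Z ω)
    (h : ∫⁻ ω, ENNReal.ofReal (Z ω) ∂μ ≤ ENNReal.ofReal M) :
    ∫⁻ ω, ENNReal.ofReal (Y ω) ∂μ ≤ ENNReal.ofReal M :=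
  (lintegral_mono fun ω => ENNReal.ofReal_le_ofReal (hYZ ω)).trans h

theorem lintegral_ofReal_add_le {Y Z : Ω → ℝ} {M M' : ℝ} (hm : Measurable Y)
    (hM : 0 ≤ M) (hM' : 0 ≤ M')
    (h : ∫⁻ ω, ENNReal.ofReal (Y ω) ∂μ ≤ ENNReal.ofReal M)
    (h' : ∫⁻ ω, ENNReal.ofReal (Z ω) ∂μ ≤ ENNReal.ofReal M') :
    ∫⁻ ω, ENNReal.ofReal (Y ω + Z ω) ∂μ ≤ ENNReal.ofReal (M + M') := by
  calc _ ≤ ∫⁻ ω, (ENNReal.ofReal (Y ω) + ENNReal.ofReal (Z ω)) ∂μ :=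
        lintegral_mono fun ω => ENNReal.ofReal_add_le
    _ = _ := lintegral_add_left hm.ennreal_ofReal _
    _ ≤ _ := by rw [ENNReal.ofReal_add hM hM']; gcongr

theorem lintegral_ofReal_const_le [IsProbabilityMeasure μ] (c : ℝ) :
    ∫⁻ _ω, ENNReal.ofReal c ∂μ ≤ ENNReal.ofReal c := by
  simp

theorem MomentLE.abs_bound {X : Ω → ℝ} {p M : ℝ} (h : MomentLE μ X p M) :
    ∫⁻ ω, ENNReal.ofReal (|X ω| ^ p) ∂μ ≤ ENNReal.ofReal |M| :=
  le_trans h (ENNReal.ofReal_le_ofReal (le_abs_self M))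

theorem MomentLE.sq_le {X : Ω → ℝ} {M : ℝ} (h : MomentLE μ X 2 M) :
    ∫⁻ ω, ENNReal.ofReal (X ω ^ 2) ∂μ ≤ ENNReal.ofReal |M| := by
  have := h.abs_bound
  simpa using this

theorem sq_le_one_add_rpow {x p : ℝ} (hx : 0 ≤ x) (hp : 2 ≤ p) : x ^ 2 ≤ 1 + x ^ p := by
  rcases le_total x 1 with h | h
  · have h1 : x ^ 2 ≤ 1 := pow_le_one₀ hx h
    have := Real.rpow_nonneg hx p
    linarith
  · have h1 : x ^ (2 : ℝ) ≤ x ^ p := Real.rpow_le_rpow_of_exponent_le h hp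
    rw [Real.rpow_two] at h1
    linarith

theorem MomentLE.sq_le_of_two_le [IsProbabilityMeasure μ] {X : Ω → ℝ} {p M : ℝ} (hp : 2 ≤ p)
    (h : MomentLE μ X p M) :
    ∫⁻ ω, ENNReal.ofReal (X ω ^ 2) ∂μ ≤ ENNReal.ofReal (1 + |M|) := by
  refine lintegral_ofReal_mono (Z := fun ω => 1 + |X ω| ^ p) (fun ω => ?_)
    (lintegral_ofReal_add_le measurable_const zero_le_one (abs_nonneg M)
      (lintegral_ofReal_const_le 1) h.abs_bound)
  rw [← sq_abs]
  exact sq_le_one_add_rpow (abs_nonneg _) hp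

end Moments

/-! ### The data in matrix form and their measurability. -/

section Data

/-- The vector of errors of date `t`. -/
def Model.errVec (m : Model Ω) (N : ℕ) (ω : Ω) (t : ℕ) : Fin N → ℝ := fun i => m.e i t ω

/-- The factors of date `t` (of the regime of that date). -/
def Model.fz (m : Model Ω) (t : ℕ) (ω : Ω) : Fin (m.r (m.z t ω)) → ℝ := m.f (m.z t ω) t ω

/-- The matrix of errors at the dates of regime `j`. -/
def Model.Emat (m : Model Ω) (N T : ℕ) (ω : Ω) (j : Fin m.J) : Matrix (Fin N) (Fin T) ℝ :=
  Matrix.of fun i t => m.e i t ω * m.ind j t ω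

/-- The matrix of factors at the dates of regime `j`. -/
def Model.Fmat (m : Model Ω) (T : ℕ) (ω : Ω) (j : Fin m.J) : Matrix (Fin T) (Fin (m.r j)) ℝ :=
  Matrix.of fun t a => m.f j t ω a * m.ind j t ω

variable (m : Model Ω)

theorem Model.x_eq (N : ℕ) (ω : Ω) (t : ℕ) :
    m.x N ω t = m.Lam N (m.z t ω) *ᵥ m.fz t ω + m.errVec N ω t := by
  funext i
  simp [Model.x, Model.Lam, Model.fz, Model.errVec, Matrix.mulVec, dotProduct]

theorem Model.ind_mul_ind (j : Fin m.J) (t : ℕ) (ω : Ω) :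
    m.ind j t ω * m.ind j t ω = m.ind j t ω := by
  simp [Model.ind]

theorem Model.abs_ind_le (j : Fin m.J) (t : ℕ) (ω : Ω) : |m.ind j t ω| ≤ 1 := by
  unfold Model.ind; split_ifs <;> norm_num

theorem Model.measurableSet_z (t : ℕ) (j : Fin m.J) : MeasurableSet {ω | m.z t ω = j} :=
  m.measurable_z t (measurableSet_singleton j)

theorem Model.measurable_ind (j : Fin m.J) (t : ℕ) : Measurable (m.ind j t) :=
  Measurable.ite (m.measurableSet_z t j) measurable_const measurable_const

theorem Model.measurable_f_apply (j : Fin m.J) (t : ℕ) (a : Fin (m.r j)) :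
    Measurable fun ω => m.f j t ω a := measurable_pi_iff.1 (m.measurable_f j t) a

theorem Model.measurable_of_z {β : Type*} [MeasurableSpace β] (t : ℕ) {g : Fin m.J → Ω → β}
    (hg : ∀ j, Measurable (g j)) : Measurable fun ω => g (m.z t ω) ω := by
  intro s hs
  have : (fun ω => g (m.z t ω) ω) ⁻¹' s = ⋃ j, ({ω | m.z t ω = j} ∩ g j ⁻¹' s) := by
    ext ω; simp
  rw [this]
  exact MeasurableSet.iUnion fun j => (m.measurableSet_z t j).inter (hg j hs)

theorem measurable_enorm2 {k : ℕ} {g : Ω → Fin k → ℝ} (hg : ∀ a, Measurable fun ω => g ω a) :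
    Measurable fun ω => enorm2 (g ω) := by
  simp only [enorm2_eq_sqrt]
  exact (Finset.measurable_sum _ fun a _ => (hg a).pow_const 2).sqrt

theorem measurable_frobSq {k l : ℕ} {A : Ω → Matrix (Fin k) (Fin l) ℝ}
    (hA : ∀ i a, Measurable fun ω => A ω i a) : Measurable fun ω => frobSq (A ω) := by
  unfold frobSq
  exact Finset.measurable_sum _ fun i _ => Finset.measurable_sum _ fun a _ => (hA i a).pow_const 2

theorem Model.measurable_enorm2_fz (t : ℕ) : Measurable fun ω => enorm2 (m.fz t ω) :=
  m.measurable_of_z t (g := fun j ω => enorm2 (m.f j t ω))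
    fun j => measurable_enorm2 fun a => m.measurable_f_apply j t a

theorem Model.measurable_Emat (N T : ℕ) (j : Fin m.J) (i : Fin N) (t : Fin T) :
    Measurable fun ω => m.Emat N T ω j i t :=
  (m.measurable_e i t).mul (m.measurable_ind j t)

theorem Model.measurable_Fmat (T : ℕ) (j : Fin m.J) (t : Fin T) (a : Fin (m.r j)) :
    Measurable fun ω => m.Fmat T ω j t a :=
  (m.measurable_f_apply j t a).mul (m.measurable_ind j t)

theorem measurable_matrix_mul {k l n : ℕ} {A : Ω → Matrix (Fin k) (Fin l) ℝ}
    {B : Ω → Matrix (Fin l) (Fin n) ℝ} (hA : ∀ i a, Measurable fun ω => A ω i a)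
    (hB : ∀ i a, Measurable fun ω => B ω i a) (i : Fin k) (b : Fin n) :
    Measurable fun ω => (A ω * B ω) i b := by
  simp only [Matrix.mul_apply]
  exact Finset.measurable_sum _ fun a _ => (hA i a).mul (hB a b)

theorem measurable_matrix_mulVec {k l : ℕ} {A : Ω → Matrix (Fin k) (Fin l) ℝ}
    {v : Ω → Fin l → ℝ} (hA : ∀ i a, Measurable fun ω => A ω i a)
    (hv : ∀ a, Measurable fun ω => v ω a) (i : Fin k) :
    Measurable fun ω => (A ω *ᵥ v ω) i := by
  simp only [Matrix.mulVec, dotProduct]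
  exact Finset.measurable_sum _ fun a _ => (hA i a).mul (hv a)

theorem Model.Fmat_transpose_mul (T : ℕ) (ω : Ω) (j : Fin m.J) :
    (m.Fmat T ω j)ᵀ * m.Fmat T ω j = sumFF m T ω j := by
  ext a b
  simp only [Matrix.mul_apply, Matrix.transpose_apply, Model.Fmat, Matrix.of_apply, sumFF]
  rw [Finset.sum_range]
  refine Finset.sum_congr rfl fun t _ => ?_
  linear_combination m.f j t ω a * m.f j t ω b * m.ind_mul_ind j t ω

theorem Model.sum_Emat (N T : ℕ) (ω : Ω) :
    ∑ j, m.Emat N T ω j = Matrix.of fun (i : Fin N) (t : Fin T) => m.errVec N ω t i := by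
  ext i t
  rw [Matrix.sum_apply]
  simp [Model.Emat, Model.ind, Model.errVec]

end Data

/-! ### Orders of magnitude of the data -/

theorem delta_sq (N T : ℕ) : delta N T ^ 2 = min (N : ℝ) T := by
  unfold delta
  rcases le_total (N : ℝ) T with h | h
  · rw [min_eq_left (Real.sqrt_le_sqrt h), min_eq_left h, Real.sq_sqrt (Nat.cast_nonneg _)]
  · rw [min_eq_right (Real.sqrt_le_sqrt h), min_eq_right h, Real.sq_sqrt (Nat.cast_nonneg _)]

theorem delta_nonneg (N T : ℕ) : 0 ≤ delta N T := le_min (Real.sqrt_nonneg _) (Real.sqrt_nonneg _)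

theorem delta_pos {N T : ℕ} (hN : 0 < N) (hT : 0 < T) : 0 < delta N T :=
  lt_min (Real.sqrt_pos.2 (by exact_mod_cast hN)) (Real.sqrt_pos.2 (by exact_mod_cast hT))

section Orders

set_option linter.unusedSectionVars false

variable {μ : Measure Ω} [IsProbabilityMeasure μ] {m : Model Ω} {l : Limits m} {α β : ℝ}
  {N T : ℕ → ℕ}

theorem eventually_pos (hN : Tendsto N atTop atTop) : ∀ᶠ n in atTop, 0 < N n :=
  hN.eventually_gt_atTop 0

theorem op_sum_factor_rpow (hfactor : FactorAssumption m μ l α) (hT : Tendsto T atTop atTop) :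
    Op μ (fun p => ∑ t ∈ Finset.range (T p.1), enorm2 (m.fz t p.2) ^ α) (fun n => (T n : ℝ)) := by
  obtain ⟨M, hM⟩ := hfactor.moment
  have hmeas : ∀ t, Measurable fun ω => enorm2 (m.fz t ω) ^ α := fun t =>
    (m.measurable_enorm2_fz t).pow_const α
  refine Op.of_lintegral (M := |M|) (fun n => by dsimp only; exact Finset.measurable_sum _ fun t _ => hmeas t)
    (fun p => Finset.sum_nonneg fun t _ => Real.rpow_nonneg (enorm2_nonneg _) _)
    ((eventually_pos hT).mono fun n hn => by exact_mod_cast hn) (Eventually.of_forall fun n => ?_)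
  have h := lintegral_ofReal_sum_le (μ := μ) (Finset.range (T n)) (M := fun _ => |M|) hmeas
    (fun t ω => Real.rpow_nonneg (enorm2_nonneg _) _) (fun _ _ => abs_nonneg M) (fun t _ => by
      have := (hM t).abs_bound
      simp only [abs_of_nonneg (enorm2_nonneg _)] at this
      exact this)
  rw [Finset.sum_const, Finset.card_range, nsmul_eq_mul, mul_comm] at h
  exact h

theorem op_sum_factor_sq (hα : 2 ≤ α) (hfactor : FactorAssumption m μ l α)
    (hT : Tendsto T atTop atTop) :
    Op μ (fun p => ∑ t ∈ Finset.range (T p.1), enorm2 (m.fz t p.2) ^ 2) (fun n => (T n : ℝ)) := by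
  have h1 : Op μ (fun p : ℕ × Ω => (T p.1 : ℝ)) (fun n => (T n : ℝ)) :=
    Op.of_atTop_le (a' := fun n => (T n : ℝ)) (Eventually.of_forall fun n => by simp)
  refine (h1.add (op_sum_factor_rpow hfactor hT)).mono (Eventually.of_forall fun p => ?_)
  refine abs_le_abs_of_nonneg (Finset.sum_nonneg fun _ _ => sq_nonneg _) ?_
  calc _ ≤ ∑ t ∈ Finset.range (T p.1), (1 + enorm2 (m.fz t p.2) ^ α) :=
        Finset.sum_le_sum fun t _ => sq_le_one_add_rpow (enorm2_nonneg _) hα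
    _ = _ := by simp [Finset.sum_add_distrib]

theorem op_sum_error_rpow (herror : ErrorAssumption m μ α) (hN : Tendsto N atTop atTop)
    (hT : Tendsto T atTop atTop) :
    Op μ (fun p => ∑ t ∈ Finset.range (T p.1), ∑ i ∈ Finset.range (N p.1), |m.e i t p.2| ^ α)
      (fun n => (N n : ℝ) * T n) := by
  obtain ⟨M, hM⟩ := herror.moment
  have hmeas : ∀ i t, Measurable fun ω => |m.e i t ω| ^ α := fun i t =>
    ((continuous_abs.measurable.comp (m.measurable_e i t))).pow_const α
  refine Op.of_lintegral (M := |M|) (fun n => by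
      dsimp only
      exact Finset.measurable_sum _ fun t _ => Finset.measurable_sum _ fun i _ => hmeas i t)
    (fun p => Finset.sum_nonneg fun t _ => Finset.sum_nonneg fun i _ =>
      Real.rpow_nonneg (abs_nonneg _) _) ?_ (Eventually.of_forall fun n => ?_)
  · filter_upwards [eventually_pos hN, eventually_pos hT] with n h1 h2
    positivity
  have h := lintegral_ofReal_sum_le (μ := μ) (Finset.range (T n)) (M := fun _ => N n * |M|)
    (Y := fun t ω => ∑ i ∈ Finset.range (N n), |m.e i t ω| ^ α)
    (fun t => Finset.measurable_sum _ fun i _ => hmeas i t)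
    (fun t ω => Finset.sum_nonneg fun i _ => Real.rpow_nonneg (abs_nonneg _) _)
    (fun _ _ => by positivity) (fun t _ => by
      have h2 := lintegral_ofReal_sum_le (μ := μ) (Finset.range (N n)) (M := fun _ => |M|)
        (Y := fun i ω => |m.e i t ω| ^ α) (fun i => hmeas i t)
        (fun i ω => Real.rpow_nonneg (abs_nonneg _) _)
        (fun _ _ => abs_nonneg M) (fun i _ => (hM i t).abs_bound)
      simpa using h2)
  rw [Finset.sum_const, Finset.card_range, nsmul_eq_mul] at h
  convert h using 2
  ring

theorem measurable_scaled_loading_error (m : Model Ω) (N : ℕ) (j : Fin m.J) (t : ℕ)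
    (a : Fin (m.r j)) :
    Measurable fun ω => (√(N : ℝ))⁻¹ * ∑ i ∈ Finset.range N, m.lam j i a * m.e i t ω :=
  (Finset.measurable_sum _ fun i _ => (m.measurable_e i t).const_mul _).const_mul _

theorem op_sum_loading_error_rpow (hmoment : MomentAssumption m μ β)
    (hT : Tendsto T atTop atTop) (j : Fin m.J) :
    Op μ (fun p => ∑ t ∈ Finset.range (T p.1), (enorm2 fun a => (√(N p.1 : ℝ))⁻¹ *
      ∑ i ∈ Finset.range (N p.1), m.lam j i a * m.e i t p.2) ^ β) (fun n => (T n : ℝ)) := by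
  obtain ⟨M, hM⟩ := hmoment.cross
  have hmeas : ∀ (N t : ℕ), Measurable fun ω => (enorm2 fun a => (√(N : ℝ))⁻¹ *
      ∑ i ∈ Finset.range N, m.lam j i a * m.e i t ω) ^ β := fun N t =>
    (measurable_enorm2 fun a => measurable_scaled_loading_error m N j t a).pow_const β
  refine Op.of_lintegral (M := |M|) (fun n => by dsimp only; exact Finset.measurable_sum _ fun t _ => hmeas _ t)
    (fun p => Finset.sum_nonneg fun t _ => Real.rpow_nonneg (enorm2_nonneg _) _)
    ((eventually_pos hT).mono fun n hn => by exact_mod_cast hn) (Eventually.of_forall fun n => ?_)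
  have h := lintegral_ofReal_sum_le (μ := μ) (Finset.range (T n)) (M := fun _ => |M|)
    (hmeas (N n))
    (fun t ω => Real.rpow_nonneg (enorm2_nonneg _) _) (fun _ _ => abs_nonneg M) (fun t _ => by
      have := (hM (N n) j t).abs_bound
      simpa only [abs_of_nonneg (enorm2_nonneg _)] using this)
  rw [Finset.sum_const, Finset.card_range, nsmul_eq_mul, mul_comm] at h
  exact h

theorem scaled_loading_error_eq (m : Model Ω) (N : ℕ) (j : Fin m.J) (t : ℕ) (ω : Ω) :
    (fun a => (√(N : ℝ))⁻¹ * ∑ i ∈ Finset.range N, m.lam j i a * m.e i t ω) =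
      (√(N : ℝ))⁻¹ • ((m.Lam N j)ᵀ *ᵥ m.errVec N ω t) := by
  funext a
  simp only [Pi.smul_apply, smul_eq_mul, Matrix.mulVec, dotProduct, Matrix.transpose_apply,
    Model.Lam, Matrix.of_apply, Model.errVec]
  rw [Finset.sum_range]

theorem enorm2_loading_error_sq (m : Model Ω) {N : ℕ} (hN : 0 < N) (j : Fin m.J) (t : ℕ) (ω : Ω) :
    enorm2 ((m.Lam N j)ᵀ *ᵥ m.errVec N ω t) ^ 2 = N * (enorm2 fun a => (√(N : ℝ))⁻¹ *
      ∑ i ∈ Finset.range N, m.lam j i a * m.e i t ω) ^ 2 := by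
  have hN' : (0 : ℝ) < N := by exact_mod_cast hN
  rw [scaled_loading_error_eq, enorm2_smul, mul_pow, sq_abs, inv_pow, Real.sq_sqrt hN'.le]
  field_simp

theorem op_sum_loading_error_sq (hβ : 2 ≤ β) (hmoment : MomentAssumption m μ β)
    (hN : Tendsto N atTop atTop) (hT : Tendsto T atTop atTop) (j : Fin m.J) :
    Op μ (fun p => ∑ t ∈ Finset.range (T p.1),
      enorm2 ((m.Lam (N p.1) j)ᵀ *ᵥ m.errVec (N p.1) p.2 t) ^ 2) (fun n => (N n : ℝ) * T n) := by
  have h1 : Op μ (fun p : ℕ × Ω => (T p.1 : ℝ)) (fun n => (T n : ℝ)) :=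
    Op.of_atTop_le (a' := fun n => (T n : ℝ)) (Eventually.of_forall fun n => by simp)
  have h2 := (h1.add (op_sum_loading_error_rpow (N := N) hmoment hT j)).det_mul
    (a' := fun n => (N n : ℝ))
  simp only [Nat.abs_cast] at h2
  refine h2.mono ?_
  filter_upwards [eventually_wpo_of_atTop (eventually_pos hN)] with p hp
  refine abs_le_abs_of_nonneg (Finset.sum_nonneg fun _ _ => sq_nonneg _) ?_
  simp only [enorm2_loading_error_sq m hp]
  rw [← Finset.mul_sum]
  refine mul_le_mul_of_nonneg_left ?_ (Nat.cast_nonneg _)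
  calc _ ≤ ∑ t ∈ Finset.range (T p.1), (1 + (enorm2 fun a => (√(N p.1 : ℝ))⁻¹ *
        ∑ i ∈ Finset.range (N p.1), m.lam j i a * m.e i t p.2) ^ β) :=
        Finset.sum_le_sum fun t _ => sq_le_one_add_rpow (enorm2_nonneg _) hβ
    _ = _ := by simp [Finset.sum_add_distrib]

end Orders

/-! ### Second moments of products of errors, factors and loadings. -/

section SecondMoments

set_option linter.unusedSectionVars false

variable {μ : Measure Ω} [IsProbabilityMeasure μ] {m : Model Ω} {l : Limits m} {α β : ℝ}
  {N T : ℕ → ℕ}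

theorem enorm2_const_mul_sq {k : ℕ} (c : ℝ) (v : Fin k → ℝ) :
    (enorm2 fun a => c * v a) ^ 2 = c ^ 2 * enorm2 v ^ 2 := by
  simp only [enorm2_sq_eq_sum, mul_pow, Finset.mul_sum]

theorem frobSq_const_mul {k n : ℕ} (c : ℝ) (A : Matrix (Fin k) (Fin n) ℝ) :
    frobSq (Matrix.of fun a b => c * A a b) = c ^ 2 * frobSq A := by
  simp only [frobSq, mul_pow, Finset.mul_sum, Matrix.of_apply]

theorem frobSq_eq_sum_row {k n : ℕ} (A : Matrix (Fin k) (Fin n) ℝ) :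
    frobSq A = ∑ i, enorm2 (A i) ^ 2 := by
  simp only [frobSq, enorm2_sq_eq_sum]

/-- Unscaling of a second moment bound. -/
theorem lintegral_of_scaled_sq {X Y : Ω → ℝ} {c M : ℝ} (hc : 0 < c)
    (hX : ∀ ω, X ω ^ 2 = ((√c)⁻¹) ^ 2 * Y ω) (h : MomentLE μ X 2 M) :
    ∫⁻ ω, ENNReal.ofReal (Y ω) ∂μ ≤ ENNReal.ofReal (c * |M|) := by
  have h1 : ∀ ω, Y ω = c * X ω ^ 2 := fun ω => by
    rw [hX, inv_pow, Real.sq_sqrt hc.le]; field_simp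
  simp only [h1]
  exact lintegral_ofReal_const_mul hc.le h.sq_le

theorem ind_mul_f_of_ne (m : Model Ω) {j : Fin m.J} {t : ℕ} {ω : Ω} :
    enorm2 (fun a => m.f j t ω a * m.ind j t ω) ≤ enorm2 (m.fz t ω) := by
  by_cases h : m.z t ω = j
  · subst h
    simp [Model.ind, Model.fz]
  · simp only [Model.ind, h, if_false, mul_zero]
    have : enorm2 (fun _ : Fin (m.r j) => (0 : ℝ)) = 0 := by simp [enorm2_eq_sqrt]
    rw [this]
    exact enorm2_nonneg _

theorem op_error_factor (hmoment : MomentAssumption m μ β) (hN : Tendsto N atTop atTop)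
    (hT : Tendsto T atTop atTop) (j : Fin m.J) :
    Op μ (fun p => frobSq (m.Emat (N p.1) (T p.1) p.2 j * m.Fmat (T p.1) p.2 j))
      (fun n => (N n : ℝ) * T n) := by
  obtain ⟨M, hM⟩ := hmoment.serial
  have hmeas : ∀ (N T : ℕ) (i : Fin N) (a : Fin (m.r j)),
      Measurable fun ω => (m.Emat N T ω j * m.Fmat T ω j) i a := fun N T =>
    measurable_matrix_mul (fun i t => m.measurable_Emat N T j i t)
      fun t a => m.measurable_Fmat T j t a
  refine Op.of_lintegral (M := |M|) (fun n => measurable_frobSq (hmeas (N n) (T n)))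
    (fun p => frobSq_nonneg _) ?_ ?_
  · filter_upwards [eventually_pos hN, eventually_pos hT] with n h1 h2
    positivity
  filter_upwards [eventually_pos hT] with n hn
  have hn' : (0 : ℝ) < T n := by exact_mod_cast hn
  simp only [frobSq_eq_sum_row]
  refine (lintegral_ofReal_sum_le (M := fun _ => T n * |M|) Finset.univ
    (fun i => (measurable_enorm2 fun a => hmeas (N n) (T n) i a).pow_const 2)
    (fun i ω => sq_nonneg _) (fun _ _ => by positivity) fun i _ => ?_).trans ?_
  · refine lintegral_of_scaled_sq hn' (fun ω => ?_) (hM (T n) j i)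
    rw [enorm2_const_mul_sq]
    congr 3
    funext a
    simp only [Matrix.mul_apply, Model.Emat, Model.Fmat, Matrix.of_apply]
    rw [Finset.sum_range]
    refine Finset.sum_congr rfl fun t _ => ?_
    linear_combination -m.f j t ω a * m.e i t ω * m.ind_mul_ind j t ω
  · rw [Finset.sum_const, Finset.card_univ, Fintype.card_fin, nsmul_eq_mul]
    exact ENNReal.ofReal_le_ofReal (le_of_eq (by ring))

theorem op_loading_error_factor (hdist : DistAssumption m μ l) (hN : Tendsto N atTop atTop)
    (hT : Tendsto T atTop atTop) (j : Fin m.J) :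
    Op μ (fun p => frobSq ((m.Lam (N p.1) j)ᵀ *
      (m.Emat (N p.1) (T p.1) p.2 j * m.Fmat (T p.1) p.2 j))) (fun n => (N n : ℝ) * T n) := by
  obtain ⟨M, hM⟩ := hdist.double_lam_f
  have hmeas : ∀ (N T : ℕ) (i a : Fin (m.r j)),
      Measurable fun ω => ((m.Lam N j)ᵀ * (m.Emat N T ω j * m.Fmat T ω j)) i a := fun N T =>
    measurable_matrix_mul (fun i t => measurable_const) (measurable_matrix_mul
      (fun i t => m.measurable_Emat N T j i t) fun t a => m.measurable_Fmat T j t a)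
  refine Op.of_lintegral (M := |M|) (fun n => measurable_frobSq (hmeas (N n) (T n)))
    (fun p => frobSq_nonneg _) ?_ ?_
  · filter_upwards [eventually_pos hN, eventually_pos hT] with n h1 h2
    positivity
  filter_upwards [eventually_pos hN, eventually_pos hT] with n h1 h2
  have h3 : (0 : ℝ) < N n * T n := by positivity
  rw [mul_comm |M|]
  refine lintegral_of_scaled_sq h3 (fun ω => ?_) (hM (N n) (T n) j)
  rw [Real.sq_sqrt (frobSq_nonneg _)]
  rw [← frobSq_const_mul]
  congr 2
  funext a b
  congr 1
  simp only [Matrix.mul_apply, Model.Emat, Model.Fmat, Matrix.of_apply, Model.Lam,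
    Matrix.transpose_apply]
  rw [Finset.sum_range]
  refine Finset.sum_congr rfl fun i _ => ?_
  rw [Finset.sum_range, Finset.mul_sum]
  refine Finset.sum_congr rfl fun t _ => ?_
  linear_combination -m.lam j i a * m.f j t ω b * m.e i t ω * m.ind_mul_ind j t ω

theorem Model.measurable_centered_sum (m : Model Ω) (T i k : ℕ) (j : Fin m.J) :
    Measurable fun ω => ∑ t ∈ Finset.range T,
      (m.e i t ω * m.e k t ω - m.ecov μ i t k t) * m.ind j t ω :=
  Finset.measurable_sum _ fun t _ =>
    (((m.measurable_e i t).mul (m.measurable_e k t)).sub_const _).mul (m.measurable_ind j t)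

theorem Model.Emat_mul_transpose_apply (m : Model Ω) {N T : ℕ} (ω : Ω) (j : Fin m.J)
    (i k : Fin N) : (m.Emat N T ω j * (m.Emat N T ω j)ᵀ) i k =
      (∑ t ∈ Finset.range T, (m.e i t ω * m.e k t ω - m.ecov μ i t k t) * m.ind j t ω) +
        ∑ t ∈ Finset.range T, m.ecov μ i t k t * m.ind j t ω := by
  rw [← Finset.sum_add_distrib, Finset.sum_range]
  simp only [Matrix.mul_apply, Model.Emat, Matrix.of_apply, Matrix.transpose_apply]
  refine Finset.sum_congr rfl fun t _ => ?_
  linear_combination m.e i t ω * m.e k t ω * m.ind_mul_ind j t ω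

theorem Model.abs_sum_ecov_le (m : Model Ω) {τ : ℕ → ℕ → ℝ}
    (hτ : ∀ i k t, |m.ecov μ i t k t| ≤ τ i k) (T : ℕ) (ω : Ω) (j : Fin m.J) (i k : ℕ) :
    |∑ t ∈ Finset.range T, m.ecov μ i t k t * m.ind j t ω| ≤ T * τ i k := by
  refine (Finset.abs_sum_le_sum_abs _ _).trans ?_
  calc _ ≤ ∑ _t ∈ Finset.range T, τ i k := Finset.sum_le_sum fun t _ => by
        rw [abs_mul]
        calc _ ≤ τ i k * 1 := mul_le_mul (hτ i k t) (m.abs_ind_le j t ω) (abs_nonneg _)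
              ((abs_nonneg _).trans (hτ i k t))
          _ = _ := mul_one _
    _ = _ := by simp

theorem rate_cov_le (N T : ℕ) (hN : 0 < N) (hT : 0 < T) :
    (N : ℝ) ^ 2 * T + T ^ 2 * N ≤ 2 * (N * T / delta N T) ^ 2 := by
  have hN' : (0 : ℝ) < N := by exact_mod_cast hN
  have hT' : (0 : ℝ) < T := by exact_mod_cast hT
  have hd : 0 < min (N : ℝ) T := lt_min hN' hT'
  rw [div_pow, delta_sq, mul_div_assoc', le_div_iff₀ hd]
  have h1 : (N : ℝ) ^ 2 * T * min (N : ℝ) T ≤ (N : ℝ) ^ 2 * T * T := by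
    gcongr; exact min_le_right _ _
  have h2 : (T : ℝ) ^ 2 * N * min (N : ℝ) T ≤ (T : ℝ) ^ 2 * N * N := by
    gcongr; exact min_le_left _ _
  nlinarith

/-- Each of the `N²` entries is a centred sum with second moment `O(T)` plus an expected part of
size at most `T τ i k`. By summability of `τ` the squares of the latter add up to `O(T²)` per row.
The total `N²T + T²N` is of the order of `(NT/δ)²`. -/
theorem op_error_gram (herror : ErrorAssumption m μ α) (hN : Tendsto N atTop atTop)
    (hT : Tendsto T atTop atTop) (j : Fin m.J) :
    Op μ (fun p => frobSq (m.Emat (N p.1) (T p.1) p.2 j * (m.Emat (N p.1) (T p.1) p.2 j)ᵀ))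
      (fun n => ((N n : ℝ) * T n / delta (N n) (T n)) ^ 2) := by
  obtain ⟨M, hM⟩ := herror.products
  obtain ⟨M', τ, hτ, hτM⟩ := herror.cross
  have hτ0 : ∀ i k, 0 ≤ τ i k := fun i k => (abs_nonneg _).trans (hτ i k 0)
  have hmeas : ∀ (N T : ℕ) (i k : Fin N),
      Measurable fun ω => (m.Emat N T ω j * (m.Emat N T ω j)ᵀ) i k := fun N T =>
    measurable_matrix_mul (fun i t => m.measurable_Emat N T j i t)
      fun t i => m.measurable_Emat N T j i t
  refine Op.rate (a := fun n => (N n : ℝ) ^ 2 * T n + T n ^ 2 * N n) (C := 2)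
    (Op.of_lintegral (M := 2 * |M| + 2 * M' ^ 2)
    (fun n => measurable_frobSq (hmeas (N n) (T n))) (fun p => frobSq_nonneg _) ?_ ?_) ?_ two_pos
  · filter_upwards [eventually_pos hN, eventually_pos hT] with n h1 h2
    positivity
  · filter_upwards [eventually_pos hN, eventually_pos hT] with n h1 h2
    have hT' : (0 : ℝ) < T n := by exact_mod_cast h2
    have hstep : ∫⁻ ω, ENNReal.ofReal (∑ i : Fin (N n), ∑ k : Fin (N n),
        (2 * (∑ t ∈ Finset.range (T n), (m.e i t ω * m.e k t ω - m.ecov μ i t k t) *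
          m.ind j t ω) ^ 2 + 2 * (T n * τ i k) ^ 2)) ∂μ ≤
        ENNReal.ofReal (∑ i : Fin (N n), ∑ k : Fin (N n),
          (2 * (T n * |M|) + 2 * (T n * τ i k) ^ 2)) := by
      have hm1 : ∀ i k : Fin (N n), Measurable fun ω => 2 * (∑ t ∈ Finset.range (T n),
          (m.e i t ω * m.e k t ω - m.ecov μ i t k t) * m.ind j t ω) ^ 2 := fun i k =>
        ((m.measurable_centered_sum (T n) i k j).pow_const 2).const_mul 2
      refine lintegral_ofReal_sum_le Finset.univ (fun i => Finset.measurable_sum _ fun k _ =>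
        (hm1 i k).add_const _) (fun i ω => Finset.sum_nonneg fun k _ => by positivity)
        (fun i _ => Finset.sum_nonneg fun k _ => by positivity) fun i _ => ?_
      refine lintegral_ofReal_sum_le Finset.univ (fun k => (hm1 i k).add_const _)
        (fun k ω => by positivity) (fun k _ => by positivity) fun k _ => ?_
      refine lintegral_ofReal_add_le (hm1 i k) (by positivity) (by positivity)
        (lintegral_ofReal_const_mul zero_le_two ?_) (lintegral_ofReal_const_le _)
      exact lintegral_of_scaled_sq hT' (fun ω => by rw [mul_pow]) (hM (T n) i k j)
    refine (lintegral_ofReal_mono (fun ω => ?_) hstep).trans (ENNReal.ofReal_le_ofReal ?_)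
    · unfold frobSq
      refine Finset.sum_le_sum fun i _ => Finset.sum_le_sum fun k _ => ?_
      rw [m.Emat_mul_transpose_apply (μ := μ)]
      set D := ∑ t ∈ Finset.range (T n), (m.e i t ω * m.e k t ω - m.ecov μ i t k t) * m.ind j t ω
      set C := ∑ t ∈ Finset.range (T n), m.ecov μ i t k t * m.ind j t ω with hC
      have h3 : C ^ 2 ≤ (T n * τ i k) ^ 2 :=
        sq_le_sq' (by linarith [(abs_le.1 (m.abs_sum_ecov_le hτ (T n) ω j i k)).1])
          (abs_le.1 (m.abs_sum_ecov_le hτ (T n) ω j i k)).2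
      nlinarith [sq_nonneg (D - C)]
    · have h4 : ∀ i : Fin (N n), ∑ k : Fin (N n), (T n * τ i k) ^ 2 ≤ (T n) ^ 2 * M' ^ 2 := by
        intro i
        simp only [mul_pow]
        rw [← Finset.mul_sum]
        refine mul_le_mul_of_nonneg_left ?_ (sq_nonneg _)
        have h5 := hτM (N n) i i.2
        rw [Finset.sum_range] at h5
        calc ∑ k : Fin (N n), τ i k ^ 2 ≤ (∑ k : Fin (N n), τ i k) ^ 2 :=
              Finset.sum_sq_le_sq_sum_of_nonneg fun k _ => hτ0 _ _
          _ ≤ M' ^ 2 := pow_le_pow_left₀ (Finset.sum_nonneg fun k _ => hτ0 _ _) h5 2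
      calc _ ≤ ∑ i : Fin (N n), (N n * (2 * (T n * |M|)) + 2 * ((T n) ^ 2 * M' ^ 2)) := by
            refine Finset.sum_le_sum fun i _ => ?_
            have := h4 i
            simp only [Finset.sum_add_distrib, ← Finset.mul_sum, Finset.sum_const, Finset.card_univ, Fintype.card_fin, nsmul_eq_mul]
            linarith
        _ = (N n : ℝ) ^ 2 * T n * (2 * |M|) + T n ^ 2 * N n * (2 * M' ^ 2) := by
            simp only [Finset.sum_const, Finset.card_univ, Fintype.card_fin, nsmul_eq_mul]
            ring
        _ ≤ _ := by
            have h6 : 0 ≤ (N n : ℝ) ^ 2 * T n * (2 * M' ^ 2) := by positivity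
            have h7 : 0 ≤ (T n : ℝ) ^ 2 * N n * (2 * |M|) := by positivity
            nlinarith
  · filter_upwards [eventually_pos hN, eventually_pos hT] with n h1 h2
    exact rate_cov_le _ _ h1 h2

/-- Because `‖E‖² = ‖EE'‖`, and the Frobenius norm of the Gram matrix `EE'`, unlike that of `E`, is
small compared with `NT`. -/
theorem op_norm_Emat_sq (herror : ErrorAssumption m μ α) (hN : Tendsto N atTop atTop)
    (hT : Tendsto T atTop atTop) (j : Fin m.J) :
    Op μ (fun p => ‖m.Emat (N p.1) (T p.1) p.2 j‖ ^ 2)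
      (fun n => (N n : ℝ) * T n / delta (N n) (T n)) := by
  have hr : ∀ n, 0 ≤ (N n : ℝ) * T n / delta (N n) (T n) := fun n =>
    div_nonneg (by positivity) (delta_nonneg _ _)
  have h := (op_error_gram herror hN hT j).sqrt (fun _ => frobSq_nonneg _) (fun _ => sq_nonneg _)
  simp only [fun n => Real.sqrt_sq (hr n)] at h
  refine h.mono (Eventually.of_forall fun p => ?_)
  rw [← norm_mul_transpose_self]
  exact abs_le_abs_of_nonneg (norm_nonneg _) (norm_le_sqrt_frobSq _)

theorem op_norm_error_sq (herror : ErrorAssumption m μ α) (hN : Tendsto N atTop atTop)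
    (hT : Tendsto T atTop atTop) :
    Op μ (fun p => ‖Matrix.of fun (i : Fin (N p.1)) (t : Fin (T p.1)) =>
        m.errVec (N p.1) p.2 t i‖ ^ 2) (fun n => (N n : ℝ) * T n / delta (N n) (T n)) := by
  have h := (Op.sum Finset.univ (fun n => div_nonneg (by positivity) (delta_nonneg _ _))
    fun j _ => op_norm_Emat_sq herror hN hT j).const_mul (m.J : ℝ)
  refine h.mono (Eventually.of_forall fun p => ?_)
  rw [← m.sum_Emat]
  refine abs_le_abs_of_nonneg (sq_nonneg _) ?_
  calc ‖∑ j, m.Emat (N p.1) (T p.1) p.2 j‖ ^ 2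
      ≤ (∑ j, ‖m.Emat (N p.1) (T p.1) p.2 j‖) ^ 2 := by
        gcongr; exact norm_sum_le _ _
    _ ≤ (Finset.univ : Finset (Fin m.J)).card * ∑ j, ‖m.Emat (N p.1) (T p.1) p.2 j‖ ^ 2 :=
        sq_sum_le_card_mul_sum_sq
    _ = _ := by simp

theorem abs_le_enorm2 {k : ℕ} (v : Fin k → ℝ) (a : Fin k) : |v a| ≤ enorm2 v := by
  refine abs_le_of_sq_le_sq ?_ (enorm2_nonneg _)
  rw [enorm2_sq_eq_sum]
  exact Finset.single_le_sum (f := fun a => v a ^ 2) (fun _ _ => sq_nonneg _) (Finset.mem_univ a)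

/-- Averaging over the loadings gains a factor `N` over the product of the separate squared norms:
the centred part of a row is a double sum with second moment `O(NT)`, and each entry of its expected
part is `O(T)` by bounded loadings and summable `τ`. -/
theorem op_error_gram_loading (hloading : LoadingAssumption m μ l) (herror : ErrorAssumption m μ α)
    (hdist : DistAssumption m μ l) (hN : Tendsto N atTop atTop)
    (hT : Tendsto T atTop atTop) (j : Fin m.J) :
    Op μ (fun p => frobSq (m.Emat (N p.1) (T p.1) p.2 j * (m.Emat (N p.1) (T p.1) p.2 j)ᵀ *
      m.Lam (N p.1) j)) (fun n => (N n : ℝ) ^ 2 * T n + T n ^ 2 * N n) := by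
  obtain ⟨M, hM⟩ := hdist.double_lam
  obtain ⟨M', τ, hτ, hτM⟩ := herror.cross
  obtain ⟨B, hB⟩ := hloading.bounded
  have hτ0 : ∀ i k, 0 ≤ τ i k := fun i k => (abs_nonneg _).trans (hτ i k 0)
  have hB0 : 0 ≤ B := (enorm2_nonneg _).trans (hB j 0)
  have hmeas : ∀ (N T : ℕ) (i : Fin N) (a : Fin (m.r j)),
      Measurable fun ω => (m.Emat N T ω j * (m.Emat N T ω j)ᵀ * m.Lam N j) i a := fun N T =>
    measurable_matrix_mul (measurable_matrix_mul (fun i t => m.measurable_Emat N T j i t)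
      fun t i => m.measurable_Emat N T j i t) fun _ _ => measurable_const
  refine Op.of_lintegral (M := 2 * |M| + 2 * (m.r j * (B * M') ^ 2))
    (fun n => measurable_frobSq (hmeas (N n) (T n))) (fun p => frobSq_nonneg _) ?_ ?_
  · filter_upwards [eventually_pos hN, eventually_pos hT] with n h1 h2
    positivity
  filter_upwards [eventually_pos hN, eventually_pos hT] with n h1 h2
  have hNT : (0 : ℝ) < N n * T n := by positivity
  let D : Ω → Fin (N n) → Fin (m.r j) → ℝ := fun ω i a => ∑ k ∈ Finset.range (N n),
    ∑ t ∈ Finset.range (T n), m.lam j k a * (m.e i t ω * m.e k t ω - m.ecov μ i t k t) * m.ind j t ω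
  have hDm : ∀ i a, Measurable fun ω => D ω i a := fun i a =>
    Finset.measurable_sum _ fun k _ => Finset.measurable_sum _ fun t _ =>
      ((((m.measurable_e i t).mul (m.measurable_e k t)).sub_const _).const_mul _).mul
        (m.measurable_ind j t)
  let C : Ω → Fin (N n) → Fin (m.r j) → ℝ := fun ω i a => ∑ k : Fin (N n),
    (∑ t ∈ Finset.range (T n), m.ecov μ i t k t * m.ind j t ω) * m.lam j k a
  have hC : ∀ ω i, enorm2 (C ω i) ^ 2 ≤ m.r j * (T n * (B * M')) ^ 2 := by
    intro ω i
    rw [enorm2_sq_eq_sum]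
    have h3 : ∀ a, (C ω i a) ^ 2 ≤ (T n * (B * M')) ^ 2 := by
      intro a
      have h4 : |C ω i a| ≤ T n * (B * M') := by
        refine (Finset.abs_sum_le_sum_abs _ _).trans ?_
        calc _ ≤ ∑ k : Fin (N n), T n * τ i k * B := Finset.sum_le_sum fun k _ => by
              rw [abs_mul]
              exact mul_le_mul (m.abs_sum_ecov_le hτ _ ω j i k)
                ((abs_le_enorm2 _ a).trans (hB j k)) (abs_nonneg _)
                (mul_nonneg (Nat.cast_nonneg _) (hτ0 _ _))
          _ = T n * (B * ∑ k : Fin (N n), τ i k) := by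
              rw [Finset.mul_sum, Finset.mul_sum]
              exact Finset.sum_congr rfl fun k _ => by ring
          _ ≤ _ := by
              have h5 := hτM (N n) i i.2
              rw [Finset.sum_range] at h5
              gcongr
      exact sq_le_sq' (by linarith [(abs_le.1 h4).1]) (abs_le.1 h4).2
    calc _ ≤ ∑ _a : Fin (m.r j), (T n * (B * M')) ^ 2 := Finset.sum_le_sum fun a _ => h3 a
      _ = _ := by simp
  have hsplit : ∀ ω i, (m.Emat (N n) (T n) ω j * (m.Emat (N n) (T n) ω j)ᵀ * m.Lam (N n) j) i =
      D ω i + C ω i := by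
    intro ω i
    funext a
    rw [Matrix.mul_apply]
    simp only [m.Emat_mul_transpose_apply (μ := μ), Pi.add_apply, C, D, add_mul,
      Finset.sum_add_distrib]
    congr 1
    rw [Finset.sum_range]
    refine Finset.sum_congr rfl fun k _ => ?_
    simp only [Model.Lam, Matrix.of_apply]
    rw [Finset.sum_mul]
    exact Finset.sum_congr rfl fun t _ => by ring
  have hstep : ∫⁻ ω, ENNReal.ofReal (∑ i : Fin (N n),
      (2 * enorm2 (D ω i) ^ 2 + 2 * (m.r j * (T n * (B * M')) ^ 2))) ∂μ ≤
      ENNReal.ofReal (∑ i : Fin (N n), (2 * (N n * T n * |M|) +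
        2 * (m.r j * (T n * (B * M')) ^ 2))) := by
    have hm1 : ∀ i : Fin (N n), Measurable fun ω => 2 * enorm2 (D ω i) ^ 2 := fun i =>
      ((measurable_enorm2 fun a => hDm i a).pow_const 2).const_mul 2
    refine lintegral_ofReal_sum_le Finset.univ (fun i => (hm1 i).add_const _)
      (fun i ω => by positivity) (fun i _ => by positivity) fun i _ => ?_
    refine lintegral_ofReal_add_le (hm1 i) (by positivity) (by positivity)
      (lintegral_ofReal_const_mul zero_le_two ?_) (lintegral_ofReal_const_le _)
    exact lintegral_of_scaled_sq hNT (fun ω => enorm2_const_mul_sq _ _) (hM (N n) (T n) j i i.2)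
  refine (lintegral_ofReal_mono (fun ω => ?_) hstep).trans (ENNReal.ofReal_le_ofReal ?_)
  · rw [frobSq_eq_sum_row]
    refine Finset.sum_le_sum fun i _ => ?_
    rw [hsplit]
    have h3 := enorm2_add_le (D ω i) (C ω i)
    have h4 := pow_le_pow_left₀ (enorm2_nonneg _) h3 2
    have h5 := hC ω i
    nlinarith [sq_nonneg (enorm2 (D ω i) - enorm2 (C ω i))]
  · simp only [Finset.sum_const, Finset.card_univ, Fintype.card_fin, nsmul_eq_mul]
    have h6 : 0 ≤ (N n : ℝ) ^ 2 * T n * (m.r j * (B * M') ^ 2) := by positivity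
    have h7 : 0 ≤ (T n : ℝ) ^ 2 * N n * |M| := by positivity
    have h8 : (N n : ℝ) * (2 * (N n * T n * |M|) + 2 * (m.r j * (T n * (B * M')) ^ 2)) =
        2 * ((N n : ℝ) ^ 2 * T n * |M|) + 2 * ((T n : ℝ) ^ 2 * N n * (m.r j * (B * M') ^ 2)) := by
      ring
    rw [h8]
    nlinarith

end SecondMoments

/-! ### Uniform bounds over the dates of the sample -/

section Uniform

set_option linter.unusedSectionVars false

variable {μ : Measure Ω} [IsProbabilityMeasure μ] {m : Model Ω} {l : Limits m} {α β : ℝ}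
  {N T : ℕ → ℕ}

/-- A bound of the factors over the sample. -/
def factorMax (m : Model Ω) (α : ℝ) (T : ℕ) (ω : Ω) : ℝ :=
  (∑ t ∈ Finset.range T, enorm2 (m.fz t ω) ^ α) ^ (1 / α)

/-- A bound of the mean squares of the errors over the sample. -/
def errorMax (m : Model Ω) (α : ℝ) (N T : ℕ) (ω : Ω) : ℝ :=
  ((N : ℝ)⁻¹ * ∑ t ∈ Finset.range T, ∑ i ∈ Finset.range N, |m.e i t ω| ^ α) ^ (2 / α)

/-- A bound of the scaled products of loadings and errors over the sample. -/
def loadingErrorMax (m : Model Ω) (β : ℝ) (N T : ℕ) (ω : Ω) (j : Fin m.J) : ℝ :=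
  (∑ t ∈ Finset.range T, (enorm2 fun a => (√(N : ℝ))⁻¹ *
      ∑ i ∈ Finset.range N, m.lam j i a * m.e i t ω) ^ β) ^ (1 / β)

/-- Maxima over the dates are bounded by sums of powers; a moment of order `a` thus costs a factor
`T^{1/a}`. -/
theorem le_rpow_of_rpow_le {x y a : ℝ} (hx : 0 ≤ x) (ha : 0 < a) (h : x ^ a ≤ y) :
    x ≤ y ^ (1 / a) := by
  have h1 := Real.rpow_le_rpow (Real.rpow_nonneg hx a) h (one_div_pos.2 ha).le
  rwa [← Real.rpow_mul hx, mul_one_div_cancel ha.ne', Real.rpow_one] at h1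

theorem enorm2_fz_le_factorMax (m : Model Ω) (hα : 0 < α) {T t : ℕ} (ht : t < T) (ω : Ω) :
    enorm2 (m.fz t ω) ≤ factorMax m α T ω :=
  le_rpow_of_rpow_le (enorm2_nonneg _) hα
    (Finset.single_le_sum (f := fun t => enorm2 (m.fz t ω) ^ α)
      (fun _ _ => Real.rpow_nonneg (enorm2_nonneg _) _) (Finset.mem_range.2 ht))

/-- The power mean inequality is applied across units before the maximum over dates is taken, so
that the bound grows with `T` alone and not with `NT`. -/
theorem enorm2_errVec_sq_le_errorMax (m : Model Ω) (hα : 2 < α) {N T t : ℕ} (hN : 0 < N)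
    (ht : t < T) (ω : Ω) : enorm2 (m.errVec N ω t) ^ 2 ≤ N * errorMax m α N T ω := by
  have hN' : (0 : ℝ) < N := by exact_mod_cast hN
  have hα0 : 0 < α := by linarith
  set A := ∑ i ∈ Finset.range N, |m.e i t ω| ^ α with hA
  have hA0 : 0 ≤ A := Finset.sum_nonneg fun i _ => Real.rpow_nonneg (abs_nonneg _) _
  have h1 : A ≤ ∑ t ∈ Finset.range T, ∑ i ∈ Finset.range N, |m.e i t ω| ^ α :=
    Finset.single_le_sum (f := fun t => ∑ i ∈ Finset.range N, |m.e i t ω| ^ α)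
      (fun _ _ => Finset.sum_nonneg fun i _ => Real.rpow_nonneg (abs_nonneg _) _)
      (Finset.mem_range.2 ht)
  have h2 : ((N : ℝ)⁻¹ * ∑ i ∈ Finset.range N, |m.e i t ω| ^ 2) ^ (α / 2) ≤ (N : ℝ)⁻¹ * A := by
    have h3 := Real.rpow_arith_mean_le_arith_mean_rpow (Finset.range N) (fun _ => (N : ℝ)⁻¹)
      (fun i => |m.e i t ω| ^ 2) (fun _ _ => by positivity) (by simp [hN'.ne'])
      (fun _ _ => by positivity) (p := α / 2) (by linarith)
    rw [← Finset.mul_sum, ← Finset.mul_sum] at h3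
    refine h3.trans (le_of_eq ?_)
    congr 1
    refine Finset.sum_congr rfl fun i _ => ?_
    rw [← Real.rpow_natCast, ← Real.rpow_mul (abs_nonneg _)]
    congr 1
    push_cast
    ring
  have h4 : enorm2 (m.errVec N ω t) ^ 2 = N * ((N : ℝ)⁻¹ * ∑ i ∈ Finset.range N, |m.e i t ω| ^ 2) := by
    rw [enorm2_sq_eq_sum, Finset.sum_range, ← mul_assoc, mul_inv_cancel₀ hN'.ne', one_mul]
    simp [Model.errVec]
  rw [h4]
  refine mul_le_mul_of_nonneg_left ?_ hN'.le
  have h5 := le_rpow_of_rpow_le (a := α / 2) (by positivity) (by linarith) h2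
  have h6 : 1 / (α / 2) = 2 / α := by field_simp
  rw [h6] at h5
  refine h5.trans (Real.rpow_le_rpow (by positivity) ?_ (by positivity))
  exact mul_le_mul_of_nonneg_left h1 (by positivity)

theorem enorm2_loading_error_le_max (m : Model Ω) (hβ : 0 < β) {N T t : ℕ} (hN : 0 < N)
    (ht : t < T) (ω : Ω) (j : Fin m.J) :
    enorm2 ((m.Lam N j)ᵀ *ᵥ m.errVec N ω t) ≤ √(N : ℝ) * loadingErrorMax m β N T ω j := by
  have hN' : (0 : ℝ) < N := by exact_mod_cast hN
  have h0 : 0 ≤ loadingErrorMax m β N T ω j := Real.rpow_nonneg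
    (Finset.sum_nonneg fun _ _ => Real.rpow_nonneg (enorm2_nonneg _) _) _
  refine le_of_sq_le_sq ?_ (mul_nonneg (Real.sqrt_nonneg _) h0)
  rw [enorm2_loading_error_sq m hN, mul_pow, Real.sq_sqrt hN'.le]
  refine mul_le_mul_of_nonneg_left (pow_le_pow_left₀ (enorm2_nonneg _) ?_ 2) hN'.le
  exact le_rpow_of_rpow_le (enorm2_nonneg _) hβ
    (Finset.single_le_sum (f := fun t => (enorm2 fun a => (√(N : ℝ))⁻¹ *
      ∑ i ∈ Finset.range N, m.lam j i a * m.e i t ω) ^ β)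
      (fun _ _ => Real.rpow_nonneg (enorm2_nonneg _) _) (Finset.mem_range.2 ht))

theorem op_factorMax (hα : 0 < α) (hfactor : FactorAssumption m μ l α)
    (hT : Tendsto T atTop atTop) :
    Op μ (fun p => factorMax m α (T p.1) p.2) (fun n => (T n : ℝ) ^ (1 / α)) :=
  (op_sum_factor_rpow hfactor hT).rpow (one_div_pos.2 hα)
    (fun _ => Finset.sum_nonneg fun _ _ => Real.rpow_nonneg (enorm2_nonneg _) _)
    fun _ => Nat.cast_nonneg _

theorem op_errorMax (hα : 0 < α) (herror : ErrorAssumption m μ α) (hN : Tendsto N atTop atTop)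
    (hT : Tendsto T atTop atTop) :
    Op μ (fun p => errorMax m α (N p.1) (T p.1) p.2) (fun n => (T n : ℝ) ^ (2 / α)) := by
  have h := (op_sum_error_rpow herror hN hT).det_mul (a' := fun n => (N n : ℝ)⁻¹)
  have h2 := (h.rate (c := fun n => (T n : ℝ)) (C := 1) ?_ one_pos).rpow (θ := 2 / α)
    (by positivity) (fun p => mul_nonneg (by positivity) (Finset.sum_nonneg fun _ _ =>
      Finset.sum_nonneg fun _ _ => Real.rpow_nonneg (abs_nonneg _) _))
    fun _ => Nat.cast_nonneg _
  · exact h2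
  · filter_upwards [eventually_pos hN] with n hn
    have hN' : (0 : ℝ) < N n := by exact_mod_cast hn
    rw [abs_of_pos (inv_pos.2 hN'), one_mul, ← mul_assoc, inv_mul_cancel₀ hN'.ne', one_mul]

theorem op_loadingErrorMax (hβ : 0 < β) (hmoment : MomentAssumption m μ β)
    (hT : Tendsto T atTop atTop) (j : Fin m.J) :
    Op μ (fun p => loadingErrorMax m β (N p.1) (T p.1) p.2 j) (fun n => (T n : ℝ) ^ (1 / β)) :=
  (op_sum_loading_error_rpow hmoment hT j).rpow (one_div_pos.2 hβ)
    (fun _ => Finset.sum_nonneg fun _ _ => Real.rpow_nonneg (enorm2_nonneg _) _)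
    fun _ => Nat.cast_nonneg _

end Uniform

/-! ### The matrices of true loadings -/

section Loadings

variable {μ : Measure Ω} {m : Model Ω} {l : Limits m}

theorem tendsto_matrix_iff {ι : Type*} {F : Filter ι} {k n : ℕ}
    {A : ι → Matrix (Fin k) (Fin n) ℝ} {B : Matrix (Fin k) (Fin n) ℝ} :
    Tendsto A F (𝓝 B) ↔ ∀ i j, Tendsto (fun x => A x i j) F (𝓝 (B i j)) := by
  constructor
  · intro h i j
    exact (continuous_apply_apply i j).continuousAt.tendsto.comp h
  · intro h
    exact tendsto_pi_nhds.2 fun i => tendsto_pi_nhds.2 fun j => h i j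

/-- This witness, unlike a minimum, also makes sense for an empty index set. -/
theorem exists_pos_forall_le {ι : Type*} [Fintype ι] {c : ι → ℝ} (h : ∀ i, 0 < c i) :
    ∃ c0 : ℝ, 0 < c0 ∧ ∀ i, c0 ≤ c i := by
  have h0 : 0 ≤ ∑ i, (c i)⁻¹ := Finset.sum_nonneg fun i _ => (inv_pos.2 (h i)).le
  refine ⟨(1 + ∑ i, (c i)⁻¹)⁻¹, by positivity, fun i => ?_⟩
  refine inv_le_of_inv_le₀ (h i) ?_
  have := Finset.single_le_sum (f := fun i => (c i)⁻¹) (fun i _ => (inv_pos.2 (h i)).le)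
    (Finset.mem_univ i)
  linarith

/-- Factor `S = Y'Y` with `Y` invertible and use `‖u‖ ≤ ‖Y⁻¹‖ ‖Yu‖`; the added one covers dimension
zero, where `‖Y⁻¹‖` vanishes. -/
theorem exists_lower_bound_of_posDef {k : ℕ} {S : Matrix (Fin k) (Fin k) ℝ} (hS : S.PosDef) :
    ∃ c : ℝ, 0 < c ∧ ∀ u : Fin k → ℝ, c * enorm2 u ^ 2 ≤ u ⬝ᵥ S *ᵥ u := by
  obtain ⟨Y, hY⟩ : ∃ Y : Matrix (Fin k) (Fin k) ℝ, S = Yᵀ * Y := by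
    obtain ⟨Y, hY⟩ := CStarAlgebra.nonneg_iff_eq_star_mul_self.1 hS.posSemidef.nonneg
    exact ⟨Y, by rw [hY, Matrix.star_eq_conjTranspose,
      Matrix.conjTranspose_eq_transpose_of_trivial]⟩
  have hYu : IsUnit Y.det := by
    have h1 := hS.det_pos
    rw [hY, det_mul, det_transpose] at h1
    have h2 : Y.det ≠ 0 := fun h0 => by simp [h0] at h1
    exact h2.isUnit
  refine ⟨(‖Y⁻¹‖ ^ 2 + 1)⁻¹, by positivity, fun u => ?_⟩
  rw [hY, dotProduct_transpose_mul_self]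
  have h1 : enorm2 u ≤ ‖Y⁻¹‖ * enorm2 (Y *ᵥ u) := by
    have h2 := enorm2_mulVec_le Y⁻¹ (Y *ᵥ u)
    rwa [Matrix.mulVec_mulVec, Matrix.nonsing_inv_mul _ hYu, Matrix.one_mulVec] at h2
  have h3 := pow_le_pow_left₀ (enorm2_nonneg _) h1 2
  rw [inv_mul_le_iff₀ (by positivity)]
  nlinarith [sq_nonneg (enorm2 (Y *ᵥ u))]

theorem LoadingAssumption.tendsto_gram (h : LoadingAssumption m μ l) (j : Fin m.J) :
    Tendsto (fun N : ℕ => (N : ℝ)⁻¹ • ((m.Lam N j)ᵀ * m.Lam N j)) atTop (𝓝 (l.SigL j)) :=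
  tendsto_matrix_iff.2 fun a b => h.lim j a b

theorem LoadingAssumption.exists_lower (h : LoadingAssumption m μ l) :
    ∃ c : ℝ, 0 < c ∧ ∀ᶠ N : ℕ in atTop, ∀ j u,
      c * N * enorm2 u ^ 2 ≤ enorm2 (m.Lam N j *ᵥ u) ^ 2 := by
  choose c hc hcS using fun j => exists_lower_bound_of_posDef (h.posDef j)
  obtain ⟨c0, hc0, hc0'⟩ := exists_pos_forall_le hc
  refine ⟨c0 / 2, by positivity, ?_⟩
  have h1 : ∀ j, ∀ᶠ N : ℕ in atTop,
      ‖(N : ℝ)⁻¹ • ((m.Lam N j)ᵀ * m.Lam N j) - l.SigL j‖ < c0 / 2 := fun j => by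
    have := (h.tendsto_gram j).sub_const (l.SigL j)
    rw [sub_self] at this
    have h2 := this.norm
    rw [norm_zero] at h2
    exact h2.eventually (gt_mem_nhds (by positivity))
  filter_upwards [eventually_all.2 h1, eventually_gt_atTop 0] with N hN hN0 j u
  have hN' : (0 : ℝ) < N := by exact_mod_cast hN0
  have h2 := (abs_le.1 (abs_dotProduct_mulVec_le
    ((N : ℝ)⁻¹ • ((m.Lam N j)ᵀ * m.Lam N j) - l.SigL j) u u)).1
  rw [Matrix.sub_mulVec, dotProduct_sub, Matrix.smul_mulVec, dotProduct_smul,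
    dotProduct_transpose_mul_self, smul_eq_mul] at h2
  have h3 := hcS j u
  have h4 := mul_le_mul_of_nonneg_right (hc0' j) (sq_nonneg (enorm2 u))
  have h5 := mul_le_mul_of_nonneg_right (hN j).le (sq_nonneg (enorm2 u))
  have h6 : c0 / 2 * enorm2 u ^ 2 ≤ (N : ℝ)⁻¹ * enorm2 (m.Lam N j *ᵥ u) ^ 2 := by linarith
  have h7 := mul_le_mul_of_nonneg_left h6 hN'.le
  rw [← mul_assoc, ← mul_assoc, mul_inv_cancel₀ hN'.ne', one_mul] at h7
  linarith

theorem LoadingAssumption.exists_upper (h : LoadingAssumption m μ l) :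
    ∃ C : ℝ, 0 < C ∧ ∀ (N : ℕ) j, frobSq (m.Lam N j) ≤ C * N := by
  obtain ⟨M, hM⟩ := h.bounded
  refine ⟨M ^ 2 + 1, by positivity, fun N j => ?_⟩
  rw [frobSq_eq_sum_row]
  calc _ ≤ ∑ _i : Fin N, M ^ 2 := Finset.sum_le_sum fun i _ =>
        pow_le_pow_left₀ (enorm2_nonneg _) (hM j i) 2
    _ ≤ _ := by
      simp only [Finset.sum_const, Finset.card_univ, Fintype.card_fin, nsmul_eq_mul]
      have : (0 : ℝ) ≤ N := Nat.cast_nonneg _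
      nlinarith

/-- Otherwise all sample frequencies of the regime would vanish almost surely and stay at distance
`q0 j` from their limit. It supplies a sample point at which the separation assumption can be
evaluated. -/
theorem StateAssumption.frequently_ind [IsProbabilityMeasure μ] (h : StateAssumption m μ l)
    (j : Fin m.J) : ∃ᵐ ω ∂μ, ∃ t, m.z t ω = j := by
  intro hcon
  have h1 := tendstoInMeasure_iff_dist.1 (h.freq j) (l.q0 j) (h.pos j)
  have h2 : ∀ T : ℕ, μ {ω | l.q0 j ≤ dist ((T : ℝ)⁻¹ * ∑ t ∈ Finset.range T, m.ind j t ω)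
      (l.q0 j)} = 1 := by
    intro T
    refine le_antisymm prob_le_one ?_
    rw [← measure_univ (μ := μ)]
    refine measure_mono_ae ?_
    filter_upwards [hcon] with ω hω _
    push Not at hω
    have h3 : ∀ t, m.ind j t ω = 0 := fun t => by simp [Model.ind, hω t]
    change l.q0 j ≤ dist ((T : ℝ)⁻¹ * ∑ t ∈ Finset.range T, m.ind j t ω) (l.q0 j)
    simp [h3, Real.dist_eq, abs_of_pos (h.pos j)]
  simp only [h2] at h1
  exact one_ne_zero (tendsto_nhds_unique tendsto_const_nhds h1)

/-- The assumption separates the common components of realized dates. Evaluated at one sample point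
and one date of regime `i`, whose factor does not depend on `N`, it separates the loadings
themselves, since `‖M Λ f‖² ≤ ‖MΛ‖² ‖f‖²`. -/
theorem LoadingAssumption.exists_separation [IsProbabilityMeasure μ]
    (h : LoadingAssumption m μ l) (hstate : StateAssumption m μ l) :
    ∃ c : ℝ, 0 < c ∧ ∀ᶠ N : ℕ in atTop, ∀ i j, i ≠ j →
      c * N ≤ frobSq (annihilator (m.Lam N j) * m.Lam N i) := by
  obtain ⟨C, hC, hsep⟩ := h.separation
  obtain ⟨N0, hN0⟩ := eventually_atTop.1 hsep
  -- Countably many null sets are merged so that the same sample point serves for all `N`.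
  have hae : ∀ᵐ ω ∂μ, ∀ N : ℕ, N0 ≤ N → ∀ t k, k ≠ m.z t ω → C ≤ (N : ℝ)⁻¹ *
      enorm2 (annihilator (m.Lam N k) *ᵥ (m.Lam N (m.z t ω) *ᵥ m.f (m.z t ω) t ω)) ^ 2 :=
    ae_all_iff.2 fun N => by
      by_cases hN : N0 ≤ N
      · filter_upwards [hN0 N hN] with ω hω _ using hω
      · exact Eventually.of_forall fun ω h => absurd h hN
  have hex : ∀ i : Fin m.J, ∃ φ : ℝ, 0 < φ ∧ ∀ N : ℕ, N0 ≤ N → 0 < N → ∀ j, i ≠ j →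
      C / φ * N ≤ frobSq (annihilator (m.Lam N j) * m.Lam N i) := by
    intro i
    obtain ⟨ω, ⟨t, ht⟩, hω⟩ := ((hstate.frequently_ind i).and_eventually hae).exists
    subst ht
    -- The added one gives positivity without a discussion of vanishing factors.
    refine ⟨enorm2 (m.f (m.z t ω) t ω) ^ 2 + 1, by positivity, fun N hN hN1 j hj => ?_⟩
    have hN' : (0 : ℝ) < N := by exact_mod_cast hN1
    have h1 := hω N hN t j (Ne.symm hj)
    rw [Matrix.mulVec_mulVec] at h1
    have h2 := enorm2_mulVec_sq_le_frobSq (annihilator (m.Lam N j) * m.Lam N (m.z t ω))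
      (m.f (m.z t ω) t ω)
    have h3 := mul_le_mul_of_nonneg_left h1 hN'.le
    rw [← mul_assoc, mul_inv_cancel₀ hN'.ne', one_mul] at h3
    rw [div_mul_eq_mul_div, div_le_iff₀ (by positivity)]
    have := frobSq_nonneg (annihilator (m.Lam N j) * m.Lam N (m.z t ω))
    linarith
  choose φ hφ hφs using hex
  obtain ⟨c, hc, hcle⟩ := exists_pos_forall_le fun i => div_pos hC (hφ i)
  refine ⟨c, hc, ?_⟩
  filter_upwards [eventually_ge_atTop N0, eventually_gt_atTop 0] with N h1 h2 i j hij
  exact (mul_le_mul_of_nonneg_right (hcle i) (Nat.cast_nonneg _)).trans (hφs i N h1 h2 j hij)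

end Loadings

/-! ### The assumptions of the theorem, and the data of a fixed date -/

/-- The assumptions of the theorem. -/
structure Setting (μ : Measure Ω) [IsProbabilityMeasure μ] (m : Model Ω) (l : Limits m) (α β : ℝ)
    (E : Estimators m) : Prop where
  hα : 16 < α
  hβ : 2 ≤ β
  indep : StateIndep m μ
  factor : FactorAssumption m μ l α
  loading : LoadingAssumption m μ l
  error : ErrorAssumption m μ α
  state : StateAssumption m μ l
  moment : MomentAssumption m μ β
  eigen : EigenAssumption l
  dist : DistAssumption m μ l
  est : EstimatorAssumption μ l E
  hN : Tendsto E.N atTop atTop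
  hT : Tendsto E.T atTop atTop
  hNT : Tendsto (fun n => √(E.N n : ℝ) / (E.T n : ℝ)) atTop (𝓝 0)
  hTα : Tendsto (fun n => (E.T n : ℝ) ^ (16 / α) / (E.N n : ℝ)) atTop (𝓝 0)
  hTαβ : Tendsto (fun n => (E.T n : ℝ) ^ (2 / α + 2 / β) / (E.N n : ℝ)) atTop (𝓝 0)

section FixedDate

set_option linter.unusedSectionVars false

variable {μ : Measure Ω} [IsProbabilityMeasure μ] {m : Model Ω} {l : Limits m} {α β : ℝ}
  {N T : ℕ → ℕ}

theorem op_fixed_factor (hα : 2 ≤ α) (hfactor : FactorAssumption m μ l α) (t : ℕ) :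
    Op μ (fun p => enorm2 (m.fz t p.2)) (fun _ => 1) := by
  obtain ⟨M, hM⟩ := hfactor.moment
  refine Op.of_sq ?_ fun _ => zero_le_one
  refine Op.of_lintegral (M := 1 + |M|) (fun n => by
      dsimp only; exact (m.measurable_enorm2_fz t).pow_const 2)
    (fun p => sq_nonneg _) (Eventually.of_forall fun n => by norm_num)
    (Eventually.of_forall fun n => ?_)
  have h := (hM t).sq_le_of_two_le hα
  rw [one_pow, mul_one]
  exact h

theorem op_fixed_error (hα : 2 ≤ α) (herror : ErrorAssumption m μ α) (hN : Tendsto N atTop atTop)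
    (t : ℕ) : Op μ (fun p => enorm2 (m.errVec (N p.1) p.2 t)) (fun n => √(N n : ℝ)) := by
  obtain ⟨M, hM⟩ := herror.moment
  refine Op.of_sq ?_ fun _ => Real.sqrt_nonneg _
  simp only [Real.sq_sqrt (Nat.cast_nonneg _)]
  refine Op.of_lintegral (M := 1 + |M|)
    (fun n => by dsimp only; exact (measurable_enorm2 fun i => m.measurable_e i t).pow_const 2)
    (fun p => sq_nonneg _) ((eventually_pos hN).mono fun n hn => by exact_mod_cast hn)
    (Eventually.of_forall fun n => ?_)
  simp only [enorm2_sq_eq_sum]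
  have h := lintegral_ofReal_sum_le (μ := μ) (Finset.univ : Finset (Fin (N n)))
    (M := fun _ => 1 + |M|) (Y := fun i ω => m.errVec (N n) ω t i ^ 2)
    (fun i => (m.measurable_e i t).pow_const 2)
    (fun i ω => sq_nonneg _) (fun _ _ => by positivity)
    (fun i _ => (hM i t).sq_le_of_two_le hα)
  refine h.trans (le_of_eq ?_)
  simp
  ring_nf

theorem op_fixed_loading_error (hβ : 2 ≤ β) (hmoment : MomentAssumption m μ β)
    (hN : Tendsto N atTop atTop) (t : ℕ) (j : Fin m.J) :
    Op μ (fun p => enorm2 ((m.Lam (N p.1) j)ᵀ *ᵥ m.errVec (N p.1) p.2 t))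
      (fun n => √(N n : ℝ)) := by
  obtain ⟨M, hM⟩ := hmoment.cross
  have hm : ∀ N : ℕ, Measurable fun ω => enorm2 ((m.Lam N j)ᵀ *ᵥ m.errVec N ω t) := fun N =>
    measurable_enorm2 (measurable_matrix_mulVec (A := fun _ => (m.Lam N j)ᵀ)
      (fun _ _ => measurable_const) fun i => m.measurable_e i t)
  refine Op.of_sq ?_ fun _ => Real.sqrt_nonneg _
  simp only [Real.sq_sqrt (Nat.cast_nonneg _)]
  refine Op.of_lintegral (M := 1 + |M|) (fun n => by dsimp only; exact (hm (N n)).pow_const 2)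
    (fun p => sq_nonneg _) ((eventually_pos hN).mono fun n hn => by exact_mod_cast hn) ?_
  filter_upwards [eventually_pos hN] with n hn
  simp only [enorm2_loading_error_sq m hn]
  rw [mul_comm]
  refine lintegral_ofReal_const_mul (Nat.cast_nonneg _) ?_
  have h := (hM (N n) j t).sq_le_of_two_le hβ
  simpa [abs_of_nonneg (enorm2_nonneg _)] using h

theorem Model.ecov_comm (m : Model Ω) (i t k s : ℕ) : m.ecov μ i t k s = m.ecov μ k s i t := by
  simp only [Model.ecov, mul_comm]

/-- The vector is the sum of `e_it e_is f_t` over units and dates of the regime. Its centred part is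
`O_p(√(NT))` by assumption; its expected part is at most `N Σ_t γ_st ‖f_t‖`, which is `O_p(N)` by
summability of `γ`. -/
theorem op_fixed_factor_error (hα : 2 ≤ α) (hfactor : FactorAssumption m μ l α)
    (herror : ErrorAssumption m μ α) (hdist : DistAssumption m μ l)
    (hN : Tendsto N atTop atTop) (hT : Tendsto T atTop atTop) (s : ℕ) (j : Fin m.J) :
    Op μ (fun p => enorm2 ((m.Fmat (T p.1) p.2 j)ᵀ *ᵥ ((m.Emat (N p.1) (T p.1) p.2 j)ᵀ *ᵥ
      m.errVec (N p.1) p.2 s))) (fun n => √((N n : ℝ) * T n) + N n) := by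
  obtain ⟨M, hM⟩ := hdist.double_f
  obtain ⟨M', γ, hγ, hγM⟩ := herror.serial
  obtain ⟨M'', hM''⟩ := hfactor.moment
  have hγ0 : ∀ t s, 0 ≤ γ t s := fun t s => (abs_nonneg _).trans (hγ 0 t s)
  have hpos : ∀ᶠ n in atTop, (0 : ℝ) < N n * T n := by
    filter_upwards [eventually_pos hN, eventually_pos hT] with n h1 h2
    positivity
  let D : ℕ → Ω → Fin (m.r j) → ℝ := fun n ω a => ∑ i ∈ Finset.range (N n),
    ∑ t ∈ Finset.range (T n), (m.e i t ω * m.e i s ω - m.ecov μ i t i s) * m.f j t ω a * m.ind j t ω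
  have hD : Op μ (fun p => enorm2 (D p.1 p.2)) (fun n => √((N n : ℝ) * T n)) := by
    refine Op.of_sq ?_ fun _ => Real.sqrt_nonneg _
    simp only [fun n => Real.sq_sqrt (mul_nonneg (Nat.cast_nonneg (α := ℝ) (N n)) (Nat.cast_nonneg (T n)))]
    refine Op.of_lintegral (M := |M|) (fun n => by
      dsimp only
      exact (measurable_enorm2 fun a =>
        Finset.measurable_sum _ fun i _ => Finset.measurable_sum _ fun t _ =>
          ((((m.measurable_e i t).mul (m.measurable_e i s)).sub_const _).mul
            (m.measurable_f_apply j t a)).mul (m.measurable_ind j t)).pow_const 2)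
      (fun p => sq_nonneg _) hpos ?_
    filter_upwards [hpos, hT.eventually_gt_atTop s] with n hn hs
    rw [mul_comm |M|]
    exact lintegral_of_scaled_sq hn (fun ω => enorm2_const_mul_sq _ _) (hM (N n) (T n) j s hs)
  have hC : Op μ (fun p => N p.1 * ∑ t ∈ Finset.range (T p.1), γ s t * enorm2 (m.fz t p.2))
      (fun n => (N n : ℝ)) := by
    have h := (Op.of_lintegral (μ := μ)
      (X := fun p => ∑ t ∈ Finset.range (T p.1), γ s t * enorm2 (m.fz t p.2))
      (a := fun _ => 1) (M := (5 / 4 + |M''|) * M')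
      (fun n => by
        dsimp only
        exact Finset.measurable_sum _ fun t _ => (m.measurable_enorm2_fz t).const_mul _)
      (fun p => Finset.sum_nonneg fun t _ => mul_nonneg (hγ0 _ _) (enorm2_nonneg _))
      (Eventually.of_forall fun n => one_pos) ?_).det_mul (a' := fun n => (N n : ℝ))
    · simpa using h
    · filter_upwards [hT.eventually_gt_atTop s] with n hs
      refine (lintegral_ofReal_sum_le (M := fun t => γ s t * (5 / 4 + |M''|)) (Finset.range (T n))
        (Y := fun t ω => γ s t * enorm2 (m.fz t ω))
        (fun t => (m.measurable_enorm2_fz t).const_mul _)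
        (fun t ω => mul_nonneg (hγ0 _ _) (enorm2_nonneg _))
        (fun t _ => mul_nonneg (hγ0 _ _) (by positivity)) fun t _ => ?_).trans ?_
      · refine lintegral_ofReal_const_mul (hγ0 _ _) ?_
        -- The first moment is bounded through `x ≤ 1/4 + x²`, whence the constant `5/4 + |M''|`.
        have h2 := lintegral_ofReal_add_le (μ := μ) (Y := fun _ => 1 / 4)
          (Z := fun ω => enorm2 (m.fz t ω) ^ 2) (M' := 1 + |M''|) measurable_const
          (by norm_num) (by positivity) (lintegral_ofReal_const_le _)
          ((hM'' t).sq_le_of_two_le hα)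
        have h3 : (1 / 4 : ℝ) + (1 + |M''|) = 5 / 4 + |M''| := by ring
        rw [h3] at h2
        refine lintegral_ofReal_mono (fun ω => ?_) h2
        nlinarith [sq_nonneg (enorm2 (m.fz t ω) - 1 / 2)]
      · rw [← Finset.sum_mul]
        refine ENNReal.ofReal_le_ofReal ?_
        rw [mul_one, mul_comm]
        exact mul_le_mul_of_nonneg_left (hγM _ _ hs) (by positivity)
  have h1 := (hD.rate (c := fun n => √((N n : ℝ) * T n) + N n) (C := 1)
    (Eventually.of_forall fun n => by simp) one_pos).add
    (hC.rate (c := fun n => √((N n : ℝ) * T n) + N n) (C := 1)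
    (Eventually.of_forall fun n => by rw [one_mul]; exact le_add_of_nonneg_left (Real.sqrt_nonneg _))
      one_pos)
  refine h1.mono (Eventually.of_forall fun p => ?_)
  refine abs_le_abs_of_nonneg (enorm2_nonneg _) ?_
  have hsplit : (m.Fmat (T p.1) p.2 j)ᵀ *ᵥ ((m.Emat (N p.1) (T p.1) p.2 j)ᵀ *ᵥ
      m.errVec (N p.1) p.2 s) = D p.1 p.2 + ∑ t ∈ Finset.range (T p.1),
        (∑ i ∈ Finset.range (N p.1), m.ecov μ i t i s) •
          fun a => m.f j t p.2 a * m.ind j t p.2 := by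
    funext a
    rw [Pi.add_apply, Finset.sum_apply]
    simp only [D, Pi.smul_apply, smul_eq_mul, Finset.sum_mul]
    rw [Finset.sum_comm (s := Finset.range (T p.1)), ← Finset.sum_add_distrib]
    simp only [← Finset.sum_add_distrib, Matrix.mulVec, dotProduct, Matrix.transpose_apply,
      Model.Emat, Model.Fmat, Matrix.of_apply, Model.errVec, Finset.mul_sum]
    rw [Finset.sum_comm, Finset.sum_range]
    refine Finset.sum_congr rfl fun i _ => ?_
    rw [Finset.sum_range]
    refine Finset.sum_congr rfl fun t _ => ?_
    linear_combination m.f j t p.2 a * m.e i t p.2 * m.e i s p.2 * m.ind_mul_ind j t p.2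
  rw [hsplit]
  refine (enorm2_add_le _ _).trans (add_le_add le_rfl ?_)
  refine (enorm2_sum_le _ _).trans ?_
  rw [Finset.mul_sum]
  refine Finset.sum_le_sum fun t _ => ?_
  rw [enorm2_smul, ← mul_assoc]
  refine mul_le_mul ?_ (ind_mul_f_of_ne m) (enorm2_nonneg _)
    (mul_nonneg (Nat.cast_nonneg _) (hγ0 _ _))
  refine (Finset.abs_sum_le_sum_abs _ _).trans ?_
  calc _ ≤ ∑ _i ∈ Finset.range (N p.1), γ s t := Finset.sum_le_sum fun i _ => by
        rw [m.ecov_comm]; exact hγ i s t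
    _ = _ := by simp

end FixedDate

/-! ### Comparison of the estimates with the truth -/

/-- The properties of estimators, true loadings and factors that hold with probability
approaching one. -/
structure Regular {m : Model Ω} (l : Limits m) (E : Estimators m) (c C : ℝ) (p : ℕ × Ω) :
    Prop where
  N_pos : 0 < E.N p.1
  T_pos : 0 < E.T p.1
  q_ge : ∀ j, c ≤ E.q p.1 p.2 j
  q_sum : ∑ j, E.q p.1 p.2 j = 1
  s_ge : C⁻¹ ≤ E.s2 p.1 p.2
  s_le : E.s2 p.1 p.2 ≤ C
  mle : IsQuasiMLE m (E.N p.1) (E.T p.1) p.2 (E.L p.1 p.2) (E.s2 p.1 p.2) (E.q p.1 p.2)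
  labelled : IsLabelled m (E.N p.1) (E.L p.1 p.2)
  signed : IsSigned l (E.N p.1) (E.L p.1 p.2)
  lower : ∀ j u, c * E.N p.1 * enorm2 u ^ 2 ≤ enorm2 (m.Lam (E.N p.1) j *ᵥ u) ^ 2
  upper : ∀ j, frobSq (m.Lam (E.N p.1) j) ≤ C * E.N p.1
  distinct : ∀ i j, i ≠ j →
    c * E.N p.1 ≤ frobSq (annihilator (m.Lam (E.N p.1) j) * m.Lam (E.N p.1) i)
  separated : ∀ t k, k ≠ m.z t p.2 → c * E.N p.1 ≤ enorm2 (annihilator (m.Lam (E.N p.1) k) *ᵥ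
    (m.Lam (E.N p.1) (m.z t p.2) *ᵥ m.fz t p.2)) ^ 2

section Comparison

variable {μ : Measure Ω} [IsProbabilityMeasure μ] {m : Model Ω} {l : Limits m} {α β : ℝ}
  {E : Estimators m}

theorem Setting.exists_regular (S : Setting μ m l α β E) :
    ∃ c C : ℝ, 0 < c ∧ c ≤ 1 ∧ 0 < C ∧ (∀ (N : ℕ) j, frobSq (m.Lam N j) ≤ C * N) ∧
      ∀ᶠ p in wpo μ, Regular l E c C p := by
  obtain ⟨c0, hc0, hq⟩ := S.est.weights
  obtain ⟨C1, hC1, hs⟩ := S.est.variance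
  obtain ⟨c2, hc2, hlow⟩ := S.loading.exists_lower
  obtain ⟨C2, hC2, hup⟩ := S.loading.exists_upper
  obtain ⟨c3, hc3, hdis⟩ := S.loading.exists_separation S.state
  obtain ⟨c4, hc4, hsep⟩ := S.loading.separation
  -- The lower constant is taken at most one, so that the penalty `-2 log c` is nonnegative.
  obtain ⟨c1, hc1, hc10, hc11⟩ : ∃ c1 : ℝ, 0 < c1 ∧ c1 ≤ c0 ∧ c1 ≤ 1 :=
    ⟨min c0 1, lt_min hc0 one_pos, min_le_left _ _, min_le_right _ _⟩
  have m1 : min (min c1 c2) (min c3 c4) ≤ c1 := (min_le_left _ _).trans (min_le_left _ _)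
  have m2 : min (min c1 c2) (min c3 c4) ≤ c2 := (min_le_left _ _).trans (min_le_right _ _)
  have m3 : min (min c1 c2) (min c3 c4) ≤ c3 := (min_le_right _ _).trans (min_le_left _ _)
  have m4 : min (min c1 c2) (min c3 c4) ≤ c4 := (min_le_right _ _).trans (min_le_right _ _)
  refine ⟨min (min c1 c2) (min c3 c4), max (C1 ^ 2) C2,
    lt_min (lt_min hc1 hc2) (lt_min hc3 hc4), m1.trans hc11, lt_max_of_lt_right hC2,
    fun N j => (hup N j).trans (by gcongr; exact le_max_right _ _), ?_⟩
  filter_upwards [eventually_wpo_of_atTop (eventually_pos S.hN),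
    eventually_wpo_of_atTop (eventually_pos S.hT),
    eventually_wpo_of_ae (P := fun p => (∀ j, c0 ≤ E.q p.1 p.2 j) ∧ ∑ j, E.q p.1 p.2 j = 1)
      (Eventually.of_forall hq),
    eventually_wpo_of_ae (P := fun p => E.s2 p.1 p.2 ∈ Set.Icc (1 / C1 ^ 2) (C1 ^ 2))
      (Eventually.of_forall hs),
    eventually_wpo_of_ae (P := fun p => IsQuasiMLE m (E.N p.1) (E.T p.1) p.2 (E.L p.1 p.2)
      (E.s2 p.1 p.2) (E.q p.1 p.2)) (Eventually.of_forall S.est.mle),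
    eventually_wpo_of_ae (P := fun p => IsLabelled m (E.N p.1) (E.L p.1 p.2))
      (Eventually.of_forall S.est.labelled),
    eventually_wpo_of_ae (P := fun p => IsSigned l (E.N p.1) (E.L p.1 p.2))
      (Eventually.of_forall S.est.signed),
    eventually_wpo_of_atTop (S.hN.eventually hlow),
    eventually_wpo_of_atTop (S.hN.eventually hdis),
    eventually_wpo_of_ae (P := fun p => ∀ t k, k ≠ m.z t p.2 → c4 ≤ (E.N p.1 : ℝ)⁻¹ *
      enorm2 (annihilator (m.Lam (E.N p.1) k) *ᵥ
        (m.Lam (E.N p.1) (m.z t p.2) *ᵥ m.f (m.z t p.2) t p.2)) ^ 2) (S.hN.eventually hsep)]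
    with p h1 h2 h3 h4 h5 h6 h7 h8 h9 h10
  have hN : (0 : ℝ) < E.N p.1 := by exact_mod_cast h1
  exact {
    N_pos := h1
    T_pos := h2
    q_ge := fun j => m1.trans (hc10.trans (h3.1 j))
    q_sum := h3.2
    s_ge := le_trans (by rw [← one_div]; exact one_div_le_one_div_of_le (by positivity) (le_max_left _ _)) h4.1
    s_le := h4.2.trans (le_max_left _ _)
    mle := h5
    labelled := h6
    signed := h7
    lower := fun j u => le_trans (by gcongr) (h8 j u)
    upper := fun j => (hup _ j).trans (by gcongr; exact le_max_right _ _)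
    distinct := fun i j hij => le_trans (by gcongr) (h9 i j hij)
    separated := fun t k hk => by
      have h := h10 t k hk
      rw [inv_mul_eq_div, le_div_iff₀ hN] at h
      exact le_trans (by gcongr) h }

theorem Regular.s_pos {c C : ℝ} (hC : 0 < C) {p : ℕ × Ω} (h : Regular l E c C p) :
    0 < E.s2 p.1 p.2 := (inv_pos.2 hC).trans_le h.s_ge

theorem Regular.q_pos {c C : ℝ} (hc : 0 < c) {p : ℕ × Ω} (h : Regular l E c C p) (j : Fin m.J) :
    0 < E.q p.1 p.2 j := hc.trans_le (h.q_ge j)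

theorem Regular.c_le_one {c C : ℝ} (hc : 0 < c) {p : ℕ × Ω} (h : Regular l E c C p)
    (j : Fin m.J) : c ≤ 1 := by
  rw [← h.q_sum]
  exact (h.q_ge j).trans (Finset.single_le_sum (f := fun j => E.q p.1 p.2 j)
    (fun j _ => (h.q_pos hc j).le) (Finset.mem_univ j))

theorem Regular.gramDiag {c C : ℝ} {p : ℕ × Ω} (h : Regular l E c C p) (j : Fin m.J) :
    GramDiag (E.L p.1 p.2 j) := fun a b hab => h.mle.diagonal j a b hab

theorem Regular.norm_Lam_sq_le {c C : ℝ} {p : ℕ × Ω} (h : Regular l E c C p) (j : Fin m.J) :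
    ‖m.Lam (E.N p.1) j‖ ^ 2 ≤ C * E.N p.1 := (norm_sq_le_frobSq _).trans (h.upper j)

theorem Regular.isUnit_gram {c C : ℝ} (hc : 0 < c) {p : ℕ × Ω} (h : Regular l E c C p)
    (j : Fin m.J) : IsUnit ((m.Lam (E.N p.1) j)ᵀ * m.Lam (E.N p.1) j).det :=
  isUnit_gram_det_of_lower (mul_pos hc (by exact_mod_cast h.N_pos)) (h.lower j)

theorem Regular.enorm2_Lam_mulVec_sq_le {c C : ℝ} {p : ℕ × Ω} (h : Regular l E c C p)
    (j : Fin m.J) (u : Fin (m.r j) → ℝ) :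
    enorm2 (m.Lam (E.N p.1) j *ᵥ u) ^ 2 ≤ C * E.N p.1 * enorm2 u ^ 2 := by
  have h1 := pow_le_pow_left₀ (enorm2_nonneg _) (enorm2_mulVec_le (m.Lam (E.N p.1) j) u) 2
  rw [mul_pow] at h1
  exact h1.trans (mul_le_mul_of_nonneg_right (h.norm_Lam_sq_le j) (sq_nonneg _))

/-- The matrix of all errors of the sample. -/
def Model.errMat (m : Model Ω) (N T : ℕ) (ω : Ω) : Matrix (Fin N) (Fin T) ℝ :=
  Matrix.of fun i t => m.errVec N ω t i

/-- A bound of the logarithm of the determinants in the likelihood at the true loadings. -/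
def logDetBound (m : Model Ω) (C : ℝ) (N : ℕ) : ℝ :=
  ∑ j, (Real.log ((m.r j).factorial : ℝ) + m.r j * Real.log (1 + C * (C * N)))

/-- A bound of the sum of the squared parts of the factor components that the estimated loadings
do not explain. -/
def slack (m : Model Ω) (c C : ℝ) (N T : ℕ) (ω : Ω) : ℝ :=
  (∑ j, (m.r j : ℝ)) * ‖m.errMat N T ω‖ ^ 2 +
  2 * ∑ t ∈ Finset.range T, |(m.Lam N (m.z t ω) *ᵥ m.fz t ω) ⬝ᵥ m.errVec N ω t| +
  2 * (√(∑ t ∈ Finset.range T, enorm2 (m.Lam N (m.z t ω) *ᵥ m.fz t ω) ^ 2) *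
    √((∑ j, (m.r j : ℝ)) * ‖m.errMat N T ω‖ ^ 2)) +
  C * ∑ t ∈ Finset.range T, enorm2 (m.fz t ω) ^ 2 + C * (T * (logDetBound m C N + -2 * Real.log c))

theorem logDetBound_nonneg {C : ℝ} (hC : 0 < C) (N : ℕ) : 0 ≤ logDetBound m C N := by
  refine Finset.sum_nonneg fun j _ => add_nonneg (Real.log_natCast_nonneg _)
    (mul_nonneg (Nat.cast_nonneg _) (Real.log_nonneg ?_))
  have : 0 ≤ C * (C * N) := by positivity
  linarith

theorem Regular.log_det_Lam_le {c C : ℝ} (hC : 0 < C) {p : ℕ × Ω} (h : Regular l E c C p)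
    (j : Fin m.J) : Real.log (1 + (E.s2 p.1 p.2)⁻¹ •
      ((m.Lam (E.N p.1) j)ᵀ * m.Lam (E.N p.1) j)).det ≤ logDetBound m C (E.N p.1) := by
  have hs := h.s_pos hC
  refine (log_det_one_add_le hs).trans ?_
  have h1 : (E.s2 p.1 p.2)⁻¹ * ‖m.Lam (E.N p.1) j‖ ^ 2 ≤ C * (C * E.N p.1) :=
    mul_le_mul (inv_le_of_inv_le₀ hC h.s_ge) (h.norm_Lam_sq_le j) (sq_nonneg _) hC.le
  have h0 : 0 ≤ (E.s2 p.1 p.2)⁻¹ * ‖m.Lam (E.N p.1) j‖ ^ 2 := by positivity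
  refine le_trans ?_ (Finset.single_le_sum (f := fun j =>
    Real.log ((m.r j).factorial : ℝ) + m.r j * Real.log (1 + C * (C * E.N p.1)))
    (fun j _ => add_nonneg (Real.log_natCast_nonneg _)
      (mul_nonneg (Nat.cast_nonneg _) (Real.log_nonneg (by linarith)))) (Finset.mem_univ j))
  gcongr

/-- The competitor in the likelihood comparison is given by the true loadings and the true regimes;
`σ̂²` is then replaced by its upper bound `C`. -/
theorem Regular.sum_unexplained_le_slack {c C : ℝ} (hc : 0 < c) (hC : 0 < C) {p : ℕ × Ω}
    (h : Regular l E c C p) {κ : ℕ → Fin m.J}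
    (hκ : ∀ t k, cost (E.L p.1 p.2 (κ t)) (E.s2 p.1 p.2) (m.x (E.N p.1) p.2 t) ≤
      cost (E.L p.1 p.2 k) (E.s2 p.1 p.2) (m.x (E.N p.1) p.2 t)) :
    ∑ t ∈ Finset.range (E.T p.1), ((m.Lam (E.N p.1) (m.z t p.2) *ᵥ m.fz t p.2) ⬝ᵥ
        (1 - shrink (E.L p.1 p.2 (κ t)) (E.s2 p.1 p.2)) *ᵥ
          (m.Lam (E.N p.1) (m.z t p.2) *ᵥ m.fz t p.2) +
        E.s2 p.1 p.2 * Real.log (1 + (E.s2 p.1 p.2)⁻¹ •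
          ((E.L p.1 p.2 (κ t))ᵀ * E.L p.1 p.2 (κ t))).det) ≤
      slack m c C (E.N p.1) (E.T p.1) p.2 := by
  have hs := h.s_pos hC
  have hlog : 0 ≤ logDetBound m C (E.N p.1) + -2 * Real.log c := by
    have h1 := Real.log_nonpos hc.le (h.c_le_one hc (κ 0))
    have h2 := logDetBound_nonneg (m := m) hC (E.N p.1)
    linarith
  have hcmp := sum_cost_le_of_maximal hs hc h.q_ge h.q_sum
    (h.mle.maximal (m.Lam (E.N p.1))) (fun t => m.z t p.2) κ hκ
  simp only [m.x_eq] at hcmp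
  refine (sum_unexplained_le hs (h.log_det_Lam_le hC) hcmp).trans ?_
  unfold slack
  have h3 : 0 ≤ ∑ t ∈ Finset.range (E.T p.1), enorm2 (m.fz t p.2) ^ 2 :=
    Finset.sum_nonneg fun _ _ => sq_nonneg _
  have h4 := mul_le_mul_of_nonneg_right h.s_le h3
  have h5 := mul_le_mul_of_nonneg_right h.s_le (mul_nonneg (Nat.cast_nonneg (E.T p.1)) hlog)
  exact add_le_add (add_le_add (le_refl _) h4) h5

/-- Every regime has an estimated counterpart. -/
theorem Regular.exists_counterpart {c C c1 κ0 : ℝ} (hc : 0 < c) (hC : 0 < C) {p : ℕ × Ω}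
    (h : Regular l E c C p) (hc1 : 0 < c1) (j : Fin m.J)
    (hfreq : m.J * c1 ≤ (E.T p.1 : ℝ)⁻¹ * ∑ t ∈ Finset.range (E.T p.1), m.ind j t p.2)
    (hκ0 : 0 ≤ κ0) (hsub : ∀ A ⊆ Finset.range (E.T p.1), (∀ t ∈ A, m.z t p.2 = j) →
      c1 * E.T p.1 ≤ (A.card : ℝ) → ∀ u : Fin (m.r j) → ℝ,
        κ0 * ∑ a, u a ^ 2 ≤ (A.card : ℝ)⁻¹ * ∑ t ∈ A, (u ⬝ᵥ m.f j t p.2) ^ 2) :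
    ∃ k, κ0 * (c1 * E.T p.1) * defect (m.Lam (E.N p.1) j)
        (shrink (E.L p.1 p.2 k) (E.s2 p.1 p.2)) ≤ slack m c C (E.N p.1) (E.T p.1) p.2 ∧
      c1 * E.T p.1 * (E.s2 p.1 p.2 * Real.log (1 + (E.s2 p.1 p.2)⁻¹ •
        ((E.L p.1 p.2 k)ᵀ * E.L p.1 p.2 k)).det) ≤ slack m c C (E.N p.1) (E.T p.1) p.2 := by
  have hs := h.s_pos hC
  have hT : (0 : ℝ) < E.T p.1 := by exact_mod_cast h.T_pos
  have hex : ∀ t, ∃ k0, ∀ k, cost (E.L p.1 p.2 k0) (E.s2 p.1 p.2) (m.x (E.N p.1) p.2 t) ≤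
      cost (E.L p.1 p.2 k) (E.s2 p.1 p.2) (m.x (E.N p.1) p.2 t) := fun t => by
    have : Nonempty (Fin m.J) := ⟨j⟩
    exact Finite.exists_min _
  choose κ hκ using hex
  have hle := h.sum_unexplained_le_slack hc hC hκ
  set a : ℕ → ℝ := fun t => (m.Lam (E.N p.1) (m.z t p.2) *ᵥ m.fz t p.2) ⬝ᵥ
        (1 - shrink (E.L p.1 p.2 (κ t)) (E.s2 p.1 p.2)) *ᵥ
          (m.Lam (E.N p.1) (m.z t p.2) *ᵥ m.fz t p.2) with ha
  set b : Fin m.J → ℝ := fun k => E.s2 p.1 p.2 * Real.log (1 + (E.s2 p.1 p.2)⁻¹ •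
          ((E.L p.1 p.2 k)ᵀ * E.L p.1 p.2 k)).det with hb
  have ha0 : ∀ t, 0 ≤ a t := fun t => quad_one_sub_shrink_nonneg hs _
  have hb0 : ∀ k, 0 ≤ b k := fun k => mul_nonneg hs.le ((h.gramDiag k).log_det_nonneg hs)
  -- The dates of regime `j` that are best fitted by the estimated regime `k`.
  let A : Fin m.J → Finset ℕ := fun k =>
    (Finset.range (E.T p.1)).filter fun t => m.z t p.2 = j ∧ κ t = k
  -- Pigeonhole: if all these sets had fewer than `c1 T` elements, regime `j` would occur at fewer
  -- than `J c1 T` dates.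
  obtain ⟨k, hk⟩ : ∃ k, c1 * E.T p.1 ≤ ((A k).card : ℝ) := by
    by_contra hcon
    push Not at hcon
    have h1 : ∑ k, ((A k).card : ℝ) = ∑ t ∈ Finset.range (E.T p.1), m.ind j t p.2 := by
      simp only [A, Finset.card_filter, Nat.cast_sum, Nat.cast_ite, Nat.cast_one, Nat.cast_zero]
      rw [Finset.sum_comm]
      refine Finset.sum_congr rfl fun t _ => ?_
      by_cases hz : m.z t p.2 = j <;> simp [hz, Model.ind]
    have h2 : ∑ k, ((A k).card : ℝ) < ∑ _k : Fin m.J, c1 * E.T p.1 :=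
      Finset.sum_lt_sum_of_nonempty ⟨j, Finset.mem_univ j⟩ fun k _ => hcon k
    rw [h1, Finset.sum_const, Finset.card_univ, Fintype.card_fin, nsmul_eq_mul] at h2
    rw [inv_mul_eq_div, le_div_iff₀ hT] at hfreq
    linarith
  have hAsub : A k ⊆ Finset.range (E.T p.1) := Finset.filter_subset _ _
  have hAz : ∀ t ∈ A k, m.z t p.2 = j := fun t ht => (Finset.mem_filter.1 ht).2.1
  have hAk : ∀ t ∈ A k, κ t = k := fun t ht => (Finset.mem_filter.1 ht).2.2
  have hcard : (0 : ℝ) < (A k).card := (mul_pos hc1 hT).trans_le hk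
  have hsumA : ∀ g : ℕ → ℝ, (∀ t, 0 ≤ g t) → (∀ t, g t ≤ a t + b (κ t)) →
      ∑ t ∈ A k, g t ≤ slack m c C (E.N p.1) (E.T p.1) p.2 := fun g hg0 hg =>
    (Finset.sum_le_sum_of_subset_of_nonneg hAsub fun t _ _ => hg0 t).trans
      ((Finset.sum_le_sum fun t _ => hg t).trans hle)
  refine ⟨k, ?_, ?_⟩
  · have h1 := defect_le_of_subset (Lam := m.Lam (E.N p.1) j) (L := E.L p.1 p.2 k)
      (κ0 := κ0 * (A k).card) hs (f := fun t => m.f j t p.2) (A := A k) fun u => by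
        have h2 := mul_le_mul_of_nonneg_left (hsub (A k) hAsub hAz hk u) hcard.le
        rw [← mul_assoc, ← mul_assoc, mul_inv_cancel₀ hcard.ne', one_mul] at h2
        linarith
    have h3 : ∑ t ∈ A k, (m.Lam (E.N p.1) j *ᵥ m.f j t p.2) ⬝ᵥ
        (1 - shrink (E.L p.1 p.2 k) (E.s2 p.1 p.2)) *ᵥ (m.Lam (E.N p.1) j *ᵥ m.f j t p.2) =
        ∑ t ∈ A k, a t := by
      refine Finset.sum_congr rfl fun t ht => ?_
      have h4 := hAz t ht
      have h5 := hAk t ht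
      subst h4 h5
      rfl
    rw [h3] at h1
    have h6 := hsumA a ha0 fun t => le_add_of_nonneg_right (hb0 _)
    have h7 : 0 ≤ defect (m.Lam (E.N p.1) j) (shrink (E.L p.1 p.2 k) (E.s2 p.1 p.2)) := by
      rw [defect_shrink hs]
      exact add_nonneg (frobSq_nonneg _) (mul_nonneg hs.le (frobSq_nonneg _))
    refine le_trans ?_ (h1.trans h6)
    gcongr
  · have h1 := hsumA (fun t => b (κ t)) (fun t => hb0 _) fun t => le_add_of_nonneg_left (ha0 t)
    have h2 : ∑ t ∈ A k, b (κ t) = (A k).card * b k := by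
      rw [Finset.sum_congr rfl fun t ht => by rw [hAk t ht], Finset.sum_const, nsmul_eq_mul]
    rw [h2] at h1
    refine le_trans ?_ h1
    exact mul_le_mul_of_nonneg_right hk (hb0 k)

end Comparison

/-! ### The rate of the slack -/

section Slack

variable {μ : Measure Ω} [IsProbabilityMeasure μ] {m : Model Ω} {l : Limits m} {α β : ℝ}
  {E : Estimators m}

theorem delta_sq_le_left (N T : ℕ) : delta N T ^ 2 ≤ N := by rw [delta_sq]; exact min_le_left _ _

theorem delta_sq_le_right (N T : ℕ) : delta N T ^ 2 ≤ T := by rw [delta_sq]; exact min_le_right _ _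

theorem tendsto_delta {N T : ℕ → ℕ} (hN : Tendsto N atTop atTop) (hT : Tendsto T atTop atTop) :
    Tendsto (fun n => delta (N n) (T n)) atTop atTop := by
  have h1 : Tendsto (fun n => √(N n : ℝ)) atTop atTop :=
    Real.tendsto_sqrt_atTop.comp (tendsto_natCast_atTop_atTop.comp hN)
  have h2 : Tendsto (fun n => √(T n : ℝ)) atTop atTop :=
    Real.tendsto_sqrt_atTop.comp (tendsto_natCast_atTop_atTop.comp hT)
  refine tendsto_atTop.2 fun b => ?_
  filter_upwards [tendsto_atTop.1 h1 b, tendsto_atTop.1 h2 b] with n h3 h4 using le_min h3 h4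

/-- The deterministic inequalities between the rates that hold for large samples. -/
theorem eventually_rates {N T : ℕ → ℕ} (hN : Tendsto N atTop atTop) (hT : Tendsto T atTop atTop) :
    ∀ᶠ n in atTop, 1 ≤ delta (N n) (T n) ∧ delta (N n) (T n) ^ 2 ≤ N n ∧
      delta (N n) (T n) ^ 2 ≤ T n :=
  (tendsto_atTop.1 (tendsto_delta hN hT) 1).mono fun _ h =>
    ⟨h, delta_sq_le_left _ _, delta_sq_le_right _ _⟩

/-- Enough to make the log determinants at the true loadings `O(√N)`, which is below the order of
the slack per date. -/
theorem log_one_add_le_sqrt {x : ℝ} (hx : 0 ≤ x) : Real.log (1 + x) ≤ 2 * √x := by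
  have h1 : 1 + x ≤ (1 + √x) ^ 2 := by nlinarith [Real.sq_sqrt hx, Real.sqrt_nonneg x]
  have h2 := Real.log_le_log (by linarith) h1
  rw [Real.log_pow] at h2
  have h3 := Real.log_le_sub_one_of_pos (x := 1 + √x) (by positivity)
  push_cast at h2
  linarith

/-- The rate is that of the mixed term: common components have total square `O_p(NT)`, errors
absorbed by the smoothers `O_p(NT/δ)`, and Cauchy–Schwarz multiplies the roots. The four other terms
are of no larger order. -/
theorem op_slack (S : Setting μ m l α β E) {c C : ℝ} (hc : 0 < c) (hc1 : c ≤ 1) (hC : 0 < C)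
    (hup : ∀ (N : ℕ) j, frobSq (m.Lam N j) ≤ C * N) :
    Op μ (fun p => slack m c C (E.N p.1) (E.T p.1) p.2)
      (fun n => (E.N n : ℝ) * E.T n / √(delta (E.N n) (E.T n))) := by
  have hα : (2 : ℝ) ≤ α := by linarith [S.hα]
  have hrate : ∀ᶠ n in atTop, 1 ≤ √(delta (E.N n) (E.T n)) ∧
      √(delta (E.N n) (E.T n)) ≤ delta (E.N n) (E.T n) ∧
      delta (E.N n) (E.T n) ≤ √(E.N n : ℝ) ∧ √(E.N n : ℝ) ≤ E.N n ∧ (0 : ℝ) < E.N n := by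
    filter_upwards [eventually_rates S.hN S.hT, eventually_pos S.hN] with n h h0
    have h1 : 1 ≤ √(delta (E.N n) (E.T n)) := Real.one_le_sqrt.2 h.1
    refine ⟨h1, ?_, min_le_left _ _, ?_, by exact_mod_cast h0⟩
    · rw [Real.sqrt_le_left (by linarith [h.1])]
      nlinarith [h.1]
    · rw [Real.sqrt_le_left (by positivity)]
      have : (1 : ℝ) ≤ E.N n := by exact_mod_cast h0
      nlinarith
  have hsq : ∀ (N t : ℕ) ω, enorm2 (m.Lam N (m.z t ω) *ᵥ m.fz t ω) ^ 2 ≤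
      C * N * enorm2 (m.fz t ω) ^ 2 := fun N t ω =>
    (enorm2_mulVec_sq_le_frobSq _ _).trans (mul_le_mul_of_nonneg_right (hup N _) (sq_nonneg _))
  have hF := op_sum_factor_sq hα S.factor S.hT
  have hE := (op_norm_error_sq S.error S.hN S.hT).const_mul (∑ j, (m.r j : ℝ))
  have hrr : (0 : ℝ) ≤ ∑ j, (m.r j : ℝ) := Finset.sum_nonneg fun _ _ => Nat.cast_nonneg _
  have hE0 : ∀ p : ℕ × Ω, 0 ≤ (∑ j, (m.r j : ℝ)) *
      ‖m.errMat (E.N p.1) (E.T p.1) p.2‖ ^ 2 := fun p => mul_nonneg hrr (sq_nonneg _)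
  -- the errors
  have h1 := hE.rate (c := fun n => (E.N n : ℝ) * E.T n / √(delta (E.N n) (E.T n))) (C := 1)
    (by
      filter_upwards [hrate] with n h
      rw [one_mul]
      exact div_le_div_of_nonneg_left (by positivity) (by linarith [h.1]) h.2.1) one_pos
  -- the products of factor components and errors
  have h2 : Op μ (fun p => 2 * ∑ t ∈ Finset.range (E.T p.1),
      |(m.Lam (E.N p.1) (m.z t p.2) *ᵥ m.fz t p.2) ⬝ᵥ m.errVec (E.N p.1) p.2 t|)
      (fun n => (E.N n : ℝ) * E.T n / √(delta (E.N n) (E.T n))) := by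
    -- The product `‖f‖ ‖Λ'e‖` is split as `√N ‖f‖² + ‖Λ'e‖²/√N`, which balances total squares of
    -- order `T` and `NT`.
    have ha := (hF.det_mul (a' := fun n => √(E.N n : ℝ)))
    have hb := (Op.sum Finset.univ (fun n => by positivity) fun j _ =>
      op_sum_loading_error_sq S.hβ S.moment S.hN S.hT j).det_mul (a' := fun n => (√(E.N n : ℝ))⁻¹)
    have hab := ((ha.rate (c := fun n => (E.N n : ℝ) * E.T n / √(delta (E.N n) (E.T n)))
      (C := 1) ?_ one_pos).add (hb.rate (C := 1) ?_ one_pos)).const_mul 2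
    · refine hab.mono ?_
      filter_upwards [eventually_wpo_of_atTop (eventually_pos S.hN)] with p hp
      have hN : (0 : ℝ) < √(E.N p.1 : ℝ) := Real.sqrt_pos.2 (by exact_mod_cast hp)
      refine abs_le_abs_of_nonneg (by positivity) ?_
      refine mul_le_mul_of_nonneg_left ?_ zero_le_two
      rw [Finset.sum_comm, Finset.mul_sum, Finset.mul_sum, ← Finset.sum_add_distrib]
      refine Finset.sum_le_sum fun t _ => ?_
      have h3 : (m.Lam (E.N p.1) (m.z t p.2) *ᵥ m.fz t p.2) ⬝ᵥ m.errVec (E.N p.1) p.2 t =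
          m.fz t p.2 ⬝ᵥ (m.Lam (E.N p.1) (m.z t p.2))ᵀ *ᵥ m.errVec (E.N p.1) p.2 t := by
        rw [Matrix.mulVec_transpose, dotProduct_comm, Matrix.dotProduct_mulVec, dotProduct_comm]
      rw [h3]
      refine (abs_dotProduct_le _ _).trans ?_
      have h4 : enorm2 ((m.Lam (E.N p.1) (m.z t p.2))ᵀ *ᵥ m.errVec (E.N p.1) p.2 t) ^ 2 ≤
          ∑ j, enorm2 ((m.Lam (E.N p.1) j)ᵀ *ᵥ m.errVec (E.N p.1) p.2 t) ^ 2 :=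
        Finset.single_le_sum (f := fun j =>
          enorm2 ((m.Lam (E.N p.1) j)ᵀ *ᵥ m.errVec (E.N p.1) p.2 t) ^ 2)
          (fun _ _ => sq_nonneg _) (Finset.mem_univ _)
      have h5 := mul_le_mul_of_nonneg_left h4 (inv_pos.2 hN).le
      refine le_trans ?_ (add_le_add (le_refl _) h5)
      set x := enorm2 (m.fz t p.2)
      set y := enorm2 ((m.Lam (E.N p.1) (m.z t p.2))ᵀ *ᵥ m.errVec (E.N p.1) p.2 t)
      set w := √(E.N p.1 : ℝ)
      have h6 : w * x ^ 2 + w⁻¹ * y ^ 2 - x * y =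
          w⁻¹ * ((w * x - y / 2) ^ 2 + 3 / 4 * y ^ 2) := by field_simp; ring
      have h7 : 0 ≤ w⁻¹ * ((w * x - y / 2) ^ 2 + 3 / 4 * y ^ 2) := by positivity
      linarith
    · filter_upwards [hrate] with n h
      rw [one_mul, le_div_iff₀ (by linarith [h.1]), abs_of_nonneg (Real.sqrt_nonneg _)]
      have h3 : √(E.N n : ℝ) * √(delta (E.N n) (E.T n)) ≤ √(E.N n : ℝ) * √(E.N n : ℝ) :=
        mul_le_mul_of_nonneg_left (h.2.1.trans h.2.2.1) (Real.sqrt_nonneg _)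
      rw [Real.mul_self_sqrt h.2.2.2.2.le] at h3
      have := mul_le_mul_of_nonneg_right h3 (Nat.cast_nonneg (α := ℝ) (E.T n))
      linarith
    · filter_upwards [hrate] with n h
      have hN : (0 : ℝ) < √(E.N n : ℝ) := Real.sqrt_pos.2 h.2.2.2.2
      rw [one_mul, abs_of_pos (inv_pos.2 hN), inv_mul_eq_div]
      exact div_le_div_of_nonneg_left (by positivity) (by linarith [h.1]) (h.2.1.trans h.2.2.1)
  -- the mixed term
  have h3 : Op μ (fun p => 2 * (√(∑ t ∈ Finset.range (E.T p.1),
      enorm2 (m.Lam (E.N p.1) (m.z t p.2) *ᵥ m.fz t p.2) ^ 2) *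
      √((∑ j, (m.r j : ℝ)) * ‖m.errMat (E.N p.1) (E.T p.1) p.2‖ ^ 2)))
      (fun n => (E.N n : ℝ) * E.T n / √(delta (E.N n) (E.T n))) := by
    have ha := hF.det_mul (a' := fun n => C * (E.N n : ℝ))
    have ha2 : Op μ (fun p => ∑ t ∈ Finset.range (E.T p.1),
      enorm2 (m.Lam (E.N p.1) (m.z t p.2) *ᵥ m.fz t p.2) ^ 2) (fun n => (E.N n : ℝ) * E.T n) := by
      refine (ha.rate (c := fun n => (E.N n : ℝ) * E.T n) (C := C) (Eventually.of_forall fun n => ?_)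
        hC).mono (Eventually.of_forall fun p => ?_)
      · rw [abs_of_nonneg (by positivity), mul_assoc]
      · refine abs_le_abs_of_nonneg (Finset.sum_nonneg fun _ _ => sq_nonneg _) ?_
        rw [Finset.mul_sum]
        exact Finset.sum_le_sum fun t _ => hsq _ _ _
    have hab := ((ha2.sqrt (fun p => Finset.sum_nonneg fun _ _ => sq_nonneg _)
      (fun n => by positivity)).mul (hE.sqrt hE0 fun n => div_nonneg (by positivity)
        (delta_nonneg _ _))).const_mul 2
    refine hab.rate (C := 1) ?_ one_pos
    refine Eventually.of_forall fun n => ?_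
    rw [one_mul, Real.sqrt_div (by positivity), mul_div_assoc',
      Real.mul_self_sqrt (by positivity)]
  -- the factors
  have h4 : Op μ (fun p => C * ∑ t ∈ Finset.range (E.T p.1), enorm2 (m.fz t p.2) ^ 2)
      (fun n => (E.N n : ℝ) * E.T n / √(delta (E.N n) (E.T n))) := by
    refine (hF.const_mul C).rate (C := 1) ?_ one_pos
    filter_upwards [hrate] with n h
    rw [one_mul, le_div_iff₀ (by linarith [h.1]), mul_comm]
    exact mul_le_mul_of_nonneg_right (h.2.1.trans (h.2.2.1.trans h.2.2.2.1)) (Nat.cast_nonneg _)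
  -- the penalty
  have h5 : Op μ (fun p => C * (E.T p.1 * (logDetBound m C (E.N p.1) + -2 * Real.log c)))
      (fun n => (E.N n : ℝ) * E.T n / √(delta (E.N n) (E.T n))) := by
    have hlogc : 0 ≤ -2 * Real.log c := by linarith [Real.log_nonpos hc.le hc1]
    set D : ℝ := ∑ j, Real.log ((m.r j).factorial : ℝ)
    have hD : 0 ≤ D := Finset.sum_nonneg fun j _ => Real.log_natCast_nonneg _
    have hbd : ∀ N : ℕ, 1 ≤ √(N : ℝ) → logDetBound m C N + -2 * Real.log c ≤
        (D + (∑ j, (m.r j : ℝ)) * (2 * C) + -2 * Real.log c) * √(N : ℝ) := by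
      intro N hN
      have h6 : Real.log (1 + C * (C * N)) ≤ 2 * C * √(N : ℝ) := by
        refine (log_one_add_le_sqrt (by positivity)).trans (le_of_eq ?_)
        rw [← mul_assoc, Real.sqrt_mul (by positivity), Real.sqrt_mul_self hC.le, mul_assoc]
      have h7 : logDetBound m C N ≤ D + (∑ j, (m.r j : ℝ)) * (2 * C * √(N : ℝ)) := by
        unfold logDetBound
        rw [Finset.sum_add_distrib, ← Finset.sum_mul]
        gcongr
      nlinarith
    refine (Op.of_atTop_le (μ := μ)
      (a' := fun n => C * (E.T n * (logDetBound m C (E.N n) + -2 * Real.log c)))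
      (c := fun n => C * (E.T n *
        ((D + (∑ j, (m.r j : ℝ)) * (2 * C) + -2 * Real.log c) * √(E.N n : ℝ)))) ?_).rate
      (C := C * (D + (∑ j, (m.r j : ℝ)) * (2 * C) + -2 * Real.log c) + 1) ?_ (by positivity)
    · filter_upwards [hrate] with n h
      rw [abs_of_nonneg (mul_nonneg hC.le (mul_nonneg (Nat.cast_nonneg _)
        (add_nonneg (logDetBound_nonneg hC _) hlogc)))]
      have := hbd (E.N n) (h.1.trans (h.2.1.trans h.2.2.1))
      gcongr
    · filter_upwards [hrate] with n h
      rw [mul_div_assoc', le_div_iff₀ (by linarith [h.1])]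
      have h8 : √(E.N n : ℝ) * √(delta (E.N n) (E.T n)) ≤ E.N n := by
        calc _ ≤ √(E.N n : ℝ) * √(E.N n : ℝ) :=
              mul_le_mul_of_nonneg_left (h.2.1.trans h.2.2.1) (Real.sqrt_nonneg _)
          _ = _ := Real.mul_self_sqrt h.2.2.2.2.le
      set K := D + (∑ j, (m.r j : ℝ)) * (2 * C) + -2 * Real.log c
      have hK : 0 ≤ K := by positivity
      calc C * (E.T n * (K * √(E.N n : ℝ))) * √(delta (E.N n) (E.T n))
          = (C * K) * E.T n * (√(E.N n : ℝ) * √(delta (E.N n) (E.T n))) := by ring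
        _ ≤ (C * K) * E.T n * E.N n := by gcongr
        _ ≤ (C * K + 1) * (E.N n * E.T n) := by
          have : (0 : ℝ) ≤ (E.N n : ℝ) * E.T n := by positivity
          nlinarith
  exact (((h1.add h2).add h3).add h4).add h5

end Slack

/-! ### Consistency of the estimated factor spaces -/

section Discrepancy

variable {μ : Measure Ω} [IsProbabilityMeasure μ] {m : Model Ω} {l : Limits m} {α β : ℝ}
  {E : Estimators m}

/-- The square of `ρ` is a multiple of the slack divided by `NT`, of order `δ^{-1/2}`. The same `ρ`
bounds the distance of smoother and projection, the defect and the log determinant. -/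
theorem Setting.exists_discrepancy (S : Setting μ m l α β E) {c C : ℝ} (hc : 0 < c) (hc1 : c ≤ 1)
    (hC : 0 < C) (hup : ∀ (N : ℕ) j, frobSq (m.Lam N j) ≤ C * N)
    (hreg : ∀ᶠ p in wpo μ, Regular l E c C p) :
    ∃ ρ : ℕ × Ω → ℝ, Op μ ρ (fun n => (√(√(delta (E.N n) (E.T n))))⁻¹) ∧
      Tendsto ρ (wpo μ) (𝓝 0) ∧ (∀ p, 0 ≤ ρ p) ∧ ∀ᶠ p in wpo μ, ∀ j,
        ‖shrink (E.L p.1 p.2 j) (E.s2 p.1 p.2) - proj (m.Lam (E.N p.1) j)‖ ≤ ρ p ∧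
        defect (m.Lam (E.N p.1) j) (shrink (E.L p.1 p.2 j) (E.s2 p.1 p.2)) ≤ ρ p ^ 2 * E.N p.1 ∧
        Real.log (1 + (E.s2 p.1 p.2)⁻¹ • ((E.L p.1 p.2 j)ᵀ * E.L p.1 p.2 j)).det ≤
          ρ p ^ 2 * E.N p.1 := by
  have hJ : ∀ _ : Fin m.J, (0 : ℝ) < m.J := fun j => by exact_mod_cast Fin.pos j
  -- The pigeonhole argument over `J` estimated regimes needs `J c1 < q0 j`; half of `q0 j / J`
  -- leaves room for the sample frequencies.
  obtain ⟨c1, hc1pos, hc1le⟩ := exists_pos_forall_le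
    (c := fun j => l.q0 j / (2 * m.J)) fun j => div_pos (S.state.pos j) (by linarith [hJ j])
  have hc1q : ∀ j, m.J * c1 < l.q0 j := fun j => by
    have h1 := hc1le j
    rw [le_div_iff₀ (by linarith [hJ j])] at h1
    have := S.state.pos j
    linarith
  choose κ hκ hsub using fun j => S.factor.subsets j c1 hc1pos
  obtain ⟨κ0, hκ0, hκ0le⟩ := exists_pos_forall_le hκ
  -- The first summand serves the defect; the second serves the log determinant, which enters the
  -- slack with the factor `σ̂² ≥ C⁻¹`.
  set K : ℝ := (κ0 * c1)⁻¹ + C * c1⁻¹ with hK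
  have hKpos : 0 < K := by positivity
  set θ : ℕ × Ω → ℝ := fun p => ((E.N p.1 : ℝ) * E.T p.1)⁻¹ * |slack m c C (E.N p.1) (E.T p.1) p.2|
    with hθ
  have hθ0 : ∀ p, 0 ≤ θ p := fun p => by positivity
  have hθop : Op μ θ (fun n => (√(delta (E.N n) (E.T n)))⁻¹) := by
    have h1 := ((op_slack S hc hc1 hC hup).mono (X := fun p =>
      |slack m c C (E.N p.1) (E.T p.1) p.2|) (Eventually.of_forall fun p => by rw [abs_abs])).det_mul
      (a' := fun n => ((E.N n : ℝ) * E.T n)⁻¹)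
    refine h1.rate (C := 1) ?_ one_pos
    filter_upwards [eventually_pos S.hN, eventually_pos S.hT] with n h2 h3
    have h4 : (0 : ℝ) < (E.N n : ℝ) * E.T n := by positivity
    rw [abs_of_pos (inv_pos.2 h4), one_mul, div_eq_mul_inv, ← mul_assoc, inv_mul_cancel₀ h4.ne',
      one_mul]
  have hsd : Tendsto (fun n => √(delta (E.N n) (E.T n))) atTop atTop :=
    Real.tendsto_sqrt_atTop.comp (tendsto_delta S.hN S.hT)
  have hθlim : Tendsto θ (wpo μ) (𝓝 0) := hθop.tendsto_zero hsd.inv_tendsto_atTop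
  -- `K` covers the defect and the log determinant, `2 c⁻¹ K` the squared Frobenius distance from
  -- the true projection.
  have hρop : Op μ (fun p => √((K + 2 * c⁻¹ * K) * θ p))
      (fun n => (√(√(delta (E.N n) (E.T n))))⁻¹) := by
    have h1 := (hθop.const_mul (K + 2 * c⁻¹ * K)).sqrt (fun p => by positivity)
      (fun n => by positivity)
    simpa only [Real.sqrt_inv] using h1
  refine ⟨fun p => √((K + 2 * c⁻¹ * K) * θ p), hρop, hρop.tendsto_zero
    (Real.tendsto_sqrt_atTop.comp hsd).inv_tendsto_atTop, fun p => Real.sqrt_nonneg _, ?_⟩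
  have hfreq : ∀ᶠ p in wpo μ, ∀ j, m.J * c1 ≤
      (E.T p.1 : ℝ)⁻¹ * ∑ t ∈ Finset.range (E.T p.1), m.ind j t p.2 :=
    eventually_all.2 fun j => (tendsto_wpo_of_tendstoInMeasure (S.state.freq j) S.hT).eventually
      (le_mem_nhds (hc1q j))
  have hsub' : ∀ᶠ p in wpo μ, ∀ j, ∀ A ⊆ Finset.range (E.T p.1), (∀ t ∈ A, m.z t p.2 = j) →
      c1 * E.T p.1 ≤ (A.card : ℝ) → ∀ u : Fin (m.r j) → ℝ,
        κ0 * ∑ a, u a ^ 2 ≤ (A.card : ℝ)⁻¹ * ∑ t ∈ A, (u ⬝ᵥ m.f j t p.2) ^ 2 := by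
    refine eventually_all.2 fun j => eventually_wpo.2 ?_
    refine tendsto_of_tendsto_of_tendsto_of_le_of_le tendsto_const_nhds ((hsub j).comp S.hT)
      (fun _ => zero_le) fun n => measure_mono fun ω hω => ?_
    simp only [Set.mem_ofPred_eq] at hω ⊢
    push Not at hω
    obtain ⟨A, hA1, hA2, hA3, u, hu⟩ := hω
    refine ⟨A, hA1, hA2, hA3, u, hu.trans_le ?_⟩
    exact mul_le_mul_of_nonneg_right (hκ0le j) (Finset.sum_nonneg fun _ _ => sq_nonneg _)
  have hs1 : Tendsto (fun p => 2 * (c⁻¹ * (m.J * (K * θ p)))) (wpo μ) (𝓝 0) := by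
    have := (((hθlim.const_mul K).const_mul (m.J : ℝ)).const_mul c⁻¹).const_mul 2
    simpa using this
  have hs2 : Tendsto (fun p => m.J * (K * θ p) + √(2 * (c⁻¹ * (m.J * (K * θ p)))) * C)
      (wpo μ) (𝓝 0) := by
    have h1 := ((hθlim.const_mul K).const_mul (m.J : ℝ)).add (hs1.sqrt.mul_const C)
    simpa using h1
  filter_upwards [hreg, hfreq, hsub', hs1.eventually (gt_mem_nhds one_pos),
    hs2.eventually (gt_mem_nhds hc)] with p h h1 h2 h3 h4
  have hs := h.s_pos hC
  have hN : (0 : ℝ) < E.N p.1 := by exact_mod_cast h.N_pos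
  have hT : (0 : ℝ) < E.T p.1 := by exact_mod_cast h.T_pos
  choose π hπ using fun j => h.exists_counterpart hc hC hc1pos j (h1 j) hκ0.le (h2 j)
  have hsl : slack m c C (E.N p.1) (E.T p.1) p.2 ≤ θ p * (E.N p.1 * E.T p.1) := by
    rw [hθ]
    dsimp only
    rw [mul_comm, ← mul_assoc, mul_inv_cancel₀ (by positivity), one_mul]
    exact le_abs_self _
  have hdef : ∀ j, defect (m.Lam (E.N p.1) j) (shrink (E.L p.1 p.2 (π j)) (E.s2 p.1 p.2)) ≤
      (κ0 * c1)⁻¹ * θ p * E.N p.1 := fun j => by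
    have h5 := (hπ j).1.trans hsl
    rw [mul_assoc, inv_mul_eq_div, le_div_iff₀ (by positivity)]
    refine le_of_mul_le_mul_right ?_ hT
    linarith
  have hlog : ∀ j, Real.log (1 + (E.s2 p.1 p.2)⁻¹ •
      ((E.L p.1 p.2 (π j))ᵀ * E.L p.1 p.2 (π j))).det ≤ C * c1⁻¹ * θ p * E.N p.1 := fun j => by
    have h5 := (hπ j).2.trans hsl
    set x := Real.log (1 + (E.s2 p.1 p.2)⁻¹ •
      ((E.L p.1 p.2 (π j))ᵀ * E.L p.1 p.2 (π j))).det
    have hx : 0 ≤ x := (h.gramDiag _).log_det_nonneg hs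
    have h6 : c1 * (E.s2 p.1 p.2 * x) ≤ θ p * E.N p.1 := by
      refine le_of_mul_le_mul_right ?_ hT
      linarith
    have h7 : x ≤ C * (E.s2 p.1 p.2 * x) := by
      have h8 := mul_le_mul_of_nonneg_left h.s_ge hC.le
      rw [mul_inv_cancel₀ hC.ne'] at h8
      nlinarith
    have h9 : C * (E.s2 p.1 p.2 * x) = C * c1⁻¹ * (c1 * (E.s2 p.1 p.2 * x)) := by
      field_simp
    rw [h9] at h7
    refine h7.trans ?_
    rw [mul_assoc (C * c1⁻¹)]
    gcongr
  have hKle1 : (κ0 * c1)⁻¹ * θ p * E.N p.1 ≤ K * θ p * E.N p.1 := by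
    have h5 : (κ0 * c1)⁻¹ ≤ K := le_add_of_nonneg_right (by positivity)
    have := hθ0 p
    gcongr
  have hKle2 : C * c1⁻¹ * θ p * E.N p.1 ≤ K * θ p * E.N p.1 := by
    have h5 : C * c1⁻¹ ≤ K := le_add_of_nonneg_left (by positivity)
    have := hθ0 p
    gcongr
  -- Here `c` is both the lower bound of the Gram matrices and the separation constant.
  have hid : ∀ j, π j = j := matching_eq_id (η := K * θ p) (c := c) (C := C) (c' := c) h.N_pos hs hc
    (mul_nonneg hKpos.le (hθ0 p)) h.lower h.upper h.distinct h.gramDiag h.labelled h3 h4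
    fun j => (hdef j).trans hKle1
  intro j
  have hd := (hdef j).trans hKle1
  have hl := (hlog j).trans hKle2
  rw [hid j] at hd hl
  have hρsq : √((K + 2 * c⁻¹ * K) * θ p) ^ 2 = (K + 2 * c⁻¹ * K) * θ p :=
    Real.sq_sqrt (mul_nonneg (by positivity) (hθ0 p))
  have hle : K * θ p * E.N p.1 ≤ √((K + 2 * c⁻¹ * K) * θ p) ^ 2 * E.N p.1 := by
    rw [hρsq]
    have h5 : K ≤ K + 2 * c⁻¹ * K := le_add_of_nonneg_right (by positivity)
    have := hθ0 p
    gcongr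
  refine ⟨?_, hd.trans hle, hl.trans hle⟩
  refine Real.le_sqrt_of_sq_le ((norm_sq_le_frobSq _).trans ?_)
  refine (frobSq_sub_proj_le (mul_pos hc hN) (h.lower j) (posSemidef_one_sub_shrink hs)
    (trace_shrink_sq_le hs)).trans ?_
  have h5 := trace_shrink_le (L := E.L p.1 p.2 j) hs
  have h6 : (c * (E.N p.1 : ℝ))⁻¹ * defect (m.Lam (E.N p.1) j)
      (shrink (E.L p.1 p.2 j) (E.s2 p.1 p.2)) ≤ c⁻¹ * (K * θ p) := by
    rw [mul_inv, mul_assoc]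
    refine mul_le_mul_of_nonneg_left ?_ (by positivity)
    rw [inv_mul_eq_div, div_le_iff₀ hN]
    exact hd
  have h7 : 0 ≤ K * θ p := mul_nonneg hKpos.le (hθ0 p)
  nlinarith

end Discrepancy

/-! ### Classification of the dates -/

section Classification

variable {μ : Measure Ω} [IsProbabilityMeasure μ] {m : Model Ω} {l : Limits m} {α β : ℝ}
  {E : Estimators m}

theorem tendsto_zero_of_pow {ι : Type*} {F : Filter ι} {x : ι → ℝ} {n : ℕ} (hn : n ≠ 0)
    (h0 : ∀ i, 0 ≤ x i) (h : Tendsto (fun i => x i ^ n) F (𝓝 0)) : Tendsto x F (𝓝 0) := by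
  have hn' : (0 : ℝ) < (n : ℝ)⁻¹ := by positivity
  have h1 := h.rpow_const (p := (n : ℝ)⁻¹) (Or.inr hn'.le)
  rw [Real.zero_rpow hn'.ne'] at h1
  exact h1.congr fun i => Real.pow_rpow_inv_natCast (h0 i) hn

/-- The eighth power is `T^{16/α}/min(N, T)`. If `N` is the minimum this is the assumed rate; if `T`
is, it vanishes because `α > 16`. -/
theorem Setting.rate_factor_discrepancy (S : Setting μ m l α β E) :
    Tendsto (fun n => (√(√(delta (E.N n) (E.T n))))⁻¹ * (E.T n : ℝ) ^ (2 / α)) atTop (𝓝 0) := by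
  have hα := S.hα
  have hα0 : 0 < α := by linarith
  refine tendsto_zero_of_pow (n := 8) (by norm_num) (fun n => by positivity) ?_
  have hexp : Tendsto (fun n => (E.T n : ℝ) ^ (-(1 - 16 / α))) atTop (𝓝 0) :=
    (tendsto_rpow_neg_atTop (by rw [sub_pos, div_lt_one hα0]; exact hα)).comp
      (tendsto_natCast_atTop_atTop.comp S.hT)
  have hsum := S.hTα.add hexp
  rw [add_zero] at hsum
  refine tendsto_of_tendsto_of_tendsto_of_le_of_le' tendsto_const_nhds hsum
    (Eventually.of_forall fun n => by positivity) ?_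
  filter_upwards [eventually_pos S.hN, eventually_pos S.hT] with n h1 h2
  have hN : (0 : ℝ) < E.N n := by exact_mod_cast h1
  have hT : (0 : ℝ) < E.T n := by exact_mod_cast h2
  have hd := delta_nonneg (E.N n) (E.T n)
  have h3 : (√(√(delta (E.N n) (E.T n)))) ^ 8 = min (E.N n : ℝ) (E.T n) := by
    rw [← delta_sq]
    calc (√(√(delta (E.N n) (E.T n)))) ^ 8 = ((√(√(delta (E.N n) (E.T n))) ^ 2) ^ 2) ^ 2 := by ring
      _ = _ := by rw [Real.sq_sqrt (Real.sqrt_nonneg _), Real.sq_sqrt hd]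
  have h4 : ((E.T n : ℝ) ^ (2 / α)) ^ 8 = (E.T n : ℝ) ^ (16 / α) := by
    rw [← Real.rpow_natCast, ← Real.rpow_mul hT.le]
    congr 1
    push_cast
    ring
  rw [mul_pow, inv_pow, h3, h4]
  have h5 : (E.T n : ℝ) ^ (-(1 - 16 / α)) = (E.T n : ℝ) ^ (16 / α) / E.T n := by
    rw [neg_sub, Real.rpow_sub hT, Real.rpow_one]
  rw [h5, inv_mul_eq_div]
  have h6 := Real.rpow_nonneg hT.le (16 / α)
  rcases le_total (E.N n : ℝ) (E.T n) with h | h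
  · rw [min_eq_left h]; exact le_add_of_nonneg_right (by positivity)
  · rw [min_eq_right h]; exact le_add_of_nonneg_left (by positivity)

/-- The square is exactly `T^{2/α+2/β}/N`. -/
theorem Setting.rate_factor_loading_error (S : Setting μ m l α β E) :
    Tendsto (fun n => (√(E.N n : ℝ))⁻¹ * ((E.T n : ℝ) ^ (1 / α) * (E.T n : ℝ) ^ (1 / β)))
      atTop (𝓝 0) := by
  refine tendsto_zero_of_pow (n := 2) (by norm_num) (fun n => by positivity) ?_
  refine S.hTαβ.congr' ?_
  filter_upwards [eventually_pos S.hT] with n h2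
  have hT : (0 : ℝ) < E.T n := by exact_mod_cast h2
  rw [mul_pow, inv_pow, Real.sq_sqrt (Nat.cast_nonneg _), inv_mul_eq_div, ← Real.rpow_add hT,
    ← Real.rpow_natCast, ← Real.rpow_mul hT.le]
  congr 2
  push_cast
  ring

theorem Setting.rate_loading_error (S : Setting μ m l α β E) :
    Tendsto (fun n => (E.N n : ℝ)⁻¹ * ((E.T n : ℝ) ^ (1 / β) * (E.T n : ℝ) ^ (1 / β)))
      atTop (𝓝 0) := by
  have hα0 : 0 < α := by linarith [S.hα]
  refine tendsto_of_tendsto_of_tendsto_of_le_of_le' tendsto_const_nhds S.hTαβ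
    (Eventually.of_forall fun n => by positivity) ?_
  filter_upwards [eventually_pos S.hT] with n h2
  have hT : (0 : ℝ) < E.T n := by exact_mod_cast h2
  have hT1 : (1 : ℝ) ≤ E.T n := by exact_mod_cast h2
  rw [inv_mul_eq_div, ← Real.rpow_add hT]
  refine div_le_div_of_nonneg_right ?_ (Nat.cast_nonneg _)
  refine Real.rpow_le_rpow_of_exponent_le hT1 ?_
  have : 0 < 2 / α := by positivity
  linarith [show 1 / β + 1 / β = 2 / β by ring]

/-- The regimes are recognized, with an error that is exponentially small in `N`. -/
theorem Setting.exists_classification (S : Setting μ m l α β E) {c C : ℝ} (hc : 0 < c)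
    (hc1 : c ≤ 1) (hC : 0 < C) (hup : ∀ (N : ℕ) j, frobSq (m.Lam N j) ≤ C * N)
    (hreg : ∀ᶠ p in wpo μ, Regular l E c C p) :
    ∃ a : ℝ, 0 < a ∧ ∀ᶠ p in wpo μ, ∀ t < E.T p.1, ∀ k, k ≠ m.z t p.2 →
      post (E.L p.1 p.2) (E.s2 p.1 p.2) (E.q p.1 p.2) (m.x (E.N p.1) p.2 t) k ≤
        Real.exp (-a * E.N p.1) := by
  have hα0 : 0 < α := by linarith [S.hα]
  have hβ0 : 0 < β := by linarith [S.hβ]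
  obtain ⟨ρ, hρ, hρ0, hρn, hdis⟩ := S.exists_discrepancy hc hc1 hC hup hreg
  set F : ℕ × Ω → ℝ := fun p => factorMax m α (E.T p.1) p.2 with hF
  set Er : ℕ × Ω → ℝ := fun p => errorMax m α (E.N p.1) (E.T p.1) p.2 with hEr
  set Lm : ℕ × Ω → ℝ := fun p => ∑ j, loadingErrorMax m β (E.N p.1) (E.T p.1) p.2 j with hLm
  have hFop : Op μ F _ := op_factorMax hα0 S.factor S.hT
  have hErop : Op μ Er _ := op_errorMax hα0 S.error S.hN S.hT
  have hLop : Op μ Lm (fun n => (E.T n : ℝ) ^ (1 / β)) :=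
    Op.sum Finset.univ (fun n => by positivity) fun j _ => op_loadingErrorMax hβ0 S.moment S.hT j
  have hLj0 : ∀ (p : ℕ × Ω) (j : Fin m.J), 0 ≤ loadingErrorMax m β (E.N p.1) (E.T p.1) p.2 j := fun p j =>
    Real.rpow_nonneg (Finset.sum_nonneg fun _ _ => Real.rpow_nonneg (enorm2_nonneg _) _) _
  have hL0 : ∀ p, 0 ≤ Lm p := fun p => Finset.sum_nonneg fun j _ => hLj0 p j
  have hF0 : ∀ p, 0 ≤ F p := fun p =>
    Real.rpow_nonneg (Finset.sum_nonneg fun _ _ => Real.rpow_nonneg (enorm2_nonneg _) _) _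
  have hg1 : Tendsto (fun p => ρ p * (C * (F p * F p) + Er p)) (wpo μ) (𝓝 0) := by
    have h1 : Op μ (fun p => F p * F p) (fun n => (E.T n : ℝ) ^ (2 / α)) := by
      refine (hFop.mul hFop).rate (C := 1) ?_ one_pos
      filter_upwards [eventually_pos S.hT] with n h2
      have hT : (0 : ℝ) < E.T n := by exact_mod_cast h2
      rw [← Real.rpow_add hT, one_mul]
      exact le_of_eq (by ring_nf)
    exact (hρ.mul ((h1.const_mul C).add hErop)).tendsto_zero S.rate_factor_discrepancy
  have hg2 : Tendsto (fun p => (√(E.N p.1 : ℝ))⁻¹ * (F p * Lm p)) (wpo μ) (𝓝 0) := by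
    refine ((hFop.mul hLop).det_mul (a' := fun n => (√(E.N n : ℝ))⁻¹)).tendsto_zero ?_
    refine S.rate_factor_loading_error.congr fun n => ?_
    rw [abs_of_nonneg (by positivity)]
  have hg3 : Tendsto (fun p => (E.N p.1 : ℝ)⁻¹ * (Lm p * Lm p)) (wpo μ) (𝓝 0) := by
    refine ((hLop.mul hLop).det_mul (a' := fun n => (E.N n : ℝ)⁻¹)).tendsto_zero ?_
    refine S.rate_loading_error.congr fun n => ?_
    rw [abs_of_nonneg (by positivity)]
  -- All perturbations in `cost_gap`, divided by `N`: the terms are `2ρ‖x‖²` with `‖x‖²` at most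
  -- twice the sum of squares, the two cross terms of the common component with `e` and with its
  -- projection, and the squared projection of `e`.
  have hg : Tendsto (fun p => 4 * (ρ p * (C * (F p * F p) + Er p)) +
      (2 + 2 * √(C * c⁻¹)) * ((√(E.N p.1 : ℝ))⁻¹ * (F p * Lm p)) +
      c⁻¹ * ((E.N p.1 : ℝ)⁻¹ * (Lm p * Lm p))) (wpo μ) (𝓝 0) := by
    have := ((hg1.const_mul 4).add (hg2.const_mul (2 + 2 * √(C * c⁻¹)))).add (hg3.const_mul c⁻¹)
    simpa using this
  have hρ2 : Tendsto (fun p => ρ p ^ 2) (wpo μ) (𝓝 0) := by simpa using hρ0.pow 2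
  -- The separation `cN` loses half to the perturbations; division by `σ̂² ≤ C` leaves `cN/(2C)`, of
  -- which the log determinant takes at most half. So the gap of costs is `cN/(4C)`, the posterior
  -- exponent half of it, and one half of that exponent absorbs the factor `1/c`.
  have ha : 0 < c / (16 * C) := by positivity
  have hlarge : ∀ᶠ p in wpo μ, c⁻¹ ≤ Real.exp (c / (16 * C) * E.N p.1) :=
    eventually_wpo_of_atTop ((Real.tendsto_exp_atTop.comp ((tendsto_natCast_atTop_atTop.comp
      S.hN).const_mul_atTop ha)).eventually_ge_atTop c⁻¹)
  refine ⟨c / (16 * C), ha, ?_⟩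
  filter_upwards [hreg, hdis, hg.eventually (gt_mem_nhds (half_pos hc)),
    hρ2.eventually (gt_mem_nhds (show (0 : ℝ) < c / (4 * C) by positivity)), hlarge]
    with p h h1 h2 h3 h4 t ht k hk
  have hs := h.s_pos hC
  have hN : (0 : ℝ) < E.N p.1 := by exact_mod_cast h.N_pos
  have hsN : (0 : ℝ) < √(E.N p.1 : ℝ) := Real.sqrt_pos.2 hN
  set j := m.z t p.2 with hj
  set f := m.fz t p.2 with hf
  set e := m.errVec (E.N p.1) p.2 t with he
  have hx : m.x (E.N p.1) p.2 t = m.Lam (E.N p.1) j *ᵥ f + e := m.x_eq _ _ _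
  have hfF : enorm2 f ≤ F p := enorm2_fz_le_factorMax m hα0 ht p.2
  have heE : enorm2 e ^ 2 ≤ E.N p.1 * Er p :=
    enorm2_errVec_sq_le_errorMax m (by linarith [S.hα]) h.N_pos ht p.2
  have hLe : ∀ i, enorm2 ((m.Lam (E.N p.1) i)ᵀ *ᵥ e) ≤ √(E.N p.1 : ℝ) * Lm p := fun i =>
    (enorm2_loading_error_le_max m hβ0 h.N_pos ht p.2 i).trans
      (mul_le_mul_of_nonneg_left (Finset.single_le_sum (f := fun j =>
        loadingErrorMax m β (E.N p.1) (E.T p.1) p.2 j) (fun j _ => hLj0 p j)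
        (Finset.mem_univ i)) hsN.le)
  have hy2 : enorm2 (m.Lam (E.N p.1) j *ᵥ f) ^ 2 ≤ C * E.N p.1 * (F p * F p) := by
    refine (h.enorm2_Lam_mulVec_sq_le j f).trans ?_
    rw [← pow_two]
    have := enorm2_nonneg f
    gcongr
  have hy : enorm2 (m.Lam (E.N p.1) j *ᵥ f) ≤ √(C * E.N p.1) * F p := by
    refine le_of_sq_le_sq ?_ (mul_nonneg (Real.sqrt_nonneg _) (hF0 p))
    rw [mul_pow, Real.sq_sqrt (by positivity), pow_two (F p)]
    exact hy2
  have hPe : enorm2 (proj (m.Lam (E.N p.1) k) *ᵥ e) ≤ √(c⁻¹) * Lm p := by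
    refine (enorm2_proj_mulVec_le (mul_pos hc hN) (h.lower k) e).trans ?_
    refine (mul_le_mul_of_nonneg_left (hLe k) (Real.sqrt_nonneg _)).trans (le_of_eq ?_)
    rw [mul_inv, Real.sqrt_mul (by positivity), Real.sqrt_inv (E.N p.1 : ℝ)]
    field_simp
  have hx2 : enorm2 (m.Lam (E.N p.1) j *ᵥ f + e) ^ 2 ≤
      2 * E.N p.1 * (C * (F p * F p) + Er p) := by
    have h5 := pow_le_pow_left₀ (enorm2_nonneg _) (enorm2_add_le (m.Lam (E.N p.1) j *ᵥ f) e) 2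
    nlinarith [sq_nonneg (enorm2 (m.Lam (E.N p.1) j *ᵥ f) - enorm2 e)]
  have hye : |(m.Lam (E.N p.1) j *ᵥ f) ⬝ᵥ e| ≤ √(E.N p.1 : ℝ) * (F p * Lm p) := by
    have h5 : (m.Lam (E.N p.1) j *ᵥ f) ⬝ᵥ e = f ⬝ᵥ (m.Lam (E.N p.1) j)ᵀ *ᵥ e := by
      rw [Matrix.mulVec_transpose, dotProduct_comm, Matrix.dotProduct_mulVec, dotProduct_comm]
    rw [h5]
    refine (abs_dotProduct_le _ _).trans ?_
    calc _ ≤ F p * (√(E.N p.1 : ℝ) * Lm p) :=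
          mul_le_mul hfF (hLe j) (enorm2_nonneg _) (hF0 p)
      _ = _ := by ring
  have hyP : enorm2 (m.Lam (E.N p.1) j *ᵥ f) * enorm2 (proj (m.Lam (E.N p.1) k) *ᵥ e) ≤
      √(C * c⁻¹) * (√(E.N p.1 : ℝ) * (F p * Lm p)) := by
    refine (mul_le_mul hy hPe (enorm2_nonneg _)
      (mul_nonneg (Real.sqrt_nonneg _) (hF0 p))).trans (le_of_eq ?_)
    rw [Real.sqrt_mul hC.le, Real.sqrt_mul hC.le]
    ring
  have hP2 : enorm2 (proj (m.Lam (E.N p.1) k) *ᵥ e) ^ 2 ≤ c⁻¹ * (Lm p * Lm p) := by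
    refine (pow_le_pow_left₀ (enorm2_nonneg _) hPe 2).trans (le_of_eq ?_)
    rw [mul_pow, Real.sq_sqrt (by positivity), pow_two (Lm p)]
  have hgap := cost_gap hs (h.gramDiag k) (h1 j).1 (h1 k).1 (h.isUnit_gram hc j) f e
  have hsep := h.separated t k hk
  have hρx := mul_le_mul_of_nonneg_left hx2 (hρn p)
  have hX : c / 2 * E.N p.1 ≤ enorm2 (annihilator (m.Lam (E.N p.1) k) *ᵥ
      (m.Lam (E.N p.1) j *ᵥ f)) ^ 2 - 2 * ρ p * enorm2 (m.Lam (E.N p.1) j *ᵥ f + e) ^ 2 -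
      2 * |(m.Lam (E.N p.1) j *ᵥ f) ⬝ᵥ e| -
      2 * (enorm2 (m.Lam (E.N p.1) j *ᵥ f) * enorm2 (proj (m.Lam (E.N p.1) k) *ᵥ e)) -
      enorm2 (proj (m.Lam (E.N p.1) k) *ᵥ e) ^ 2 := by
    have h5 := mul_lt_mul_of_pos_right h2 hN
    have h6 : (√(E.N p.1 : ℝ))⁻¹ * (F p * Lm p) * E.N p.1 = √(E.N p.1 : ℝ) * (F p * Lm p) := by
      nth_rewrite 2 [← Real.mul_self_sqrt hN.le]
      field_simp
    have h7 : (E.N p.1 : ℝ)⁻¹ * (Lm p * Lm p) * E.N p.1 = Lm p * Lm p := by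
      field_simp
    rw [add_mul, add_mul, mul_assoc (2 + 2 * √(C * c⁻¹)), h6, mul_assoc c⁻¹, h7] at h5
    linarith
  set X := enorm2 (annihilator (m.Lam (E.N p.1) k) *ᵥ
      (m.Lam (E.N p.1) j *ᵥ f)) ^ 2 - 2 * ρ p * enorm2 (m.Lam (E.N p.1) j *ᵥ f + e) ^ 2 -
      2 * |(m.Lam (E.N p.1) j *ᵥ f) ⬝ᵥ e| -
      2 * (enorm2 (m.Lam (E.N p.1) j *ᵥ f) * enorm2 (proj (m.Lam (E.N p.1) k) *ᵥ e)) -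
      enorm2 (proj (m.Lam (E.N p.1) k) *ᵥ e) ^ 2
  have hsX : C⁻¹ * (c / 2 * E.N p.1) ≤ (E.s2 p.1 p.2)⁻¹ * X :=
    mul_le_mul (inv_anti₀ hs h.s_le) hX (by positivity) (inv_pos.2 hs).le
  have hld := (h1 j).2.2
  have hρN := mul_lt_mul_of_pos_right h3 hN
  have hfin : c / (4 * C) * E.N p.1 ≤ cost (E.L p.1 p.2 k) (E.s2 p.1 p.2)
      (m.Lam (E.N p.1) j *ᵥ f + e) - cost (E.L p.1 p.2 j) (E.s2 p.1 p.2)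
        (m.Lam (E.N p.1) j *ᵥ f + e) := by
    have h8 : C⁻¹ * (c / 2 * E.N p.1) = c / (4 * C) * E.N p.1 + c / (4 * C) * E.N p.1 := by
      field_simp; ring
    linarith
  rw [hx]
  refine (post_le_of_cost hs hc h.q_ge h.q_sum _ j k).trans ?_
  calc _ ≤ Real.exp (c / (16 * C) * E.N p.1) *
        Real.exp (-(1 / 2) * (c / (4 * C) * E.N p.1)) := by
        refine mul_le_mul h4 (Real.exp_le_exp.2 ?_) (Real.exp_pos _).le (Real.exp_pos _).le
        linarith
    _ = _ := by
        rw [← Real.exp_add]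
        congr 1
        field_simp
        ring

end Classification

/-! ### The weighted second moment matrices of the observations -/

section SecondMoment

variable {μ : Measure Ω} [IsProbabilityMeasure μ] {m : Model Ω} {l : Limits m} {α β : ℝ}
  {E : Estimators m}

/-- The posterior probability of regime `j` at date `t`. -/
def Estimators.prob (E : Estimators m) (p : ℕ × Ω) (t : ℕ) (j : Fin m.J) : ℝ :=
  post (E.L p.1 p.2) (E.s2 p.1 p.2) (E.q p.1 p.2) (m.x (E.N p.1) p.2 t) j

/-- The mean over the sample of the posterior probabilities of regime `j`. -/
def Estimators.weight (E : Estimators m) (p : ℕ × Ω) (j : Fin m.J) : ℝ :=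
  (E.T p.1 : ℝ)⁻¹ * ∑ t ∈ Finset.range (E.T p.1), E.prob p t j

/-- The second moment matrix of the observations, weighted by the posterior probabilities. -/
def Estimators.second (E : Estimators m) (p : ℕ × Ω) (j : Fin m.J) :
    Matrix (Fin (E.N p.1)) (Fin (E.N p.1)) ℝ :=
  (E.T p.1 : ℝ)⁻¹ • wSecond (fun t : Fin (E.T p.1) => E.prob p t j)
    fun t : Fin (E.T p.1) => m.x (E.N p.1) p.2 t

/-- The second moment matrix of the factors of regime `j`. -/
def Estimators.Phi (E : Estimators m) (p : ℕ × Ω) (j : Fin m.J) :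
    Matrix (Fin (m.r j)) (Fin (m.r j)) ℝ := (E.T p.1 : ℝ)⁻¹ • sumFF m (E.T p.1) p.2 j

/-- The part of the second moment matrix of the observations of regime `j` that is due to the
errors. -/
def Estimators.noise (E : Estimators m) (p : ℕ × Ω) (j : Fin m.J) :
    Matrix (Fin (E.N p.1)) (Fin (E.N p.1)) ℝ :=
  (E.T p.1 : ℝ)⁻¹ • (m.Lam (E.N p.1) j * (m.Emat (E.N p.1) (E.T p.1) p.2 j *
    m.Fmat (E.T p.1) p.2 j)ᵀ + m.Emat (E.N p.1) (E.T p.1) p.2 j * m.Fmat (E.T p.1) p.2 j *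
    (m.Lam (E.N p.1) j)ᵀ + m.Emat (E.N p.1) (E.T p.1) p.2 j * (m.Emat (E.N p.1) (E.T p.1) p.2 j)ᵀ)

/-- The part of the weighted second moment matrix that is due to errors of classification. -/
def Estimators.misfit (E : Estimators m) (p : ℕ × Ω) (j : Fin m.J) :
    Matrix (Fin (E.N p.1)) (Fin (E.N p.1)) ℝ :=
  (E.T p.1 : ℝ)⁻¹ • wSecond (fun t : Fin (E.T p.1) => E.prob p t j - m.ind j t p.2)
    fun t : Fin (E.T p.1) => m.x (E.N p.1) p.2 t

theorem wSecond_apply {N T : ℕ} (w : Fin T → ℝ) (x : Fin T → Fin N → ℝ) (i k : Fin N) :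
    wSecond w x i k = ∑ t, w t * (x t i * x t k) := by
  simp [wSecond, Matrix.sum_apply, Matrix.vecMulVec_apply]

theorem wSecond_add {N T : ℕ} (w w' : Fin T → ℝ) (x : Fin T → Fin N → ℝ) :
    wSecond (fun t => w t + w' t) x = wSecond w x + wSecond w' x := by
  ext i k
  simp only [wSecond_apply, Matrix.add_apply, add_mul, Finset.sum_add_distrib]

theorem norm_vecMulVec_le {N : ℕ} (x : Fin N → ℝ) : ‖Matrix.vecMulVec x x‖ ≤ enorm2 x ^ 2 := by
  refine opNorm_le_of_enorm2 _ (sq_nonneg _) fun v => ?_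
  have h : Matrix.vecMulVec x x *ᵥ v = (x ⬝ᵥ v) • x := by
    funext i
    simp only [Matrix.mulVec, Matrix.vecMulVec_apply, dotProduct, Pi.smul_apply, smul_eq_mul,
      Finset.sum_mul]
    exact Finset.sum_congr rfl fun k _ => by ring
  rw [h, enorm2_smul]
  have := mul_le_mul_of_nonneg_right (abs_dotProduct_le x v) (enorm2_nonneg x)
  nlinarith

theorem norm_wSecond_le {N T : ℕ} {w : Fin T → ℝ} {ε : ℝ} (hw : ∀ t, |w t| ≤ ε)
    (x : Fin T → Fin N → ℝ) : ‖wSecond w x‖ ≤ ε * ∑ t, enorm2 (x t) ^ 2 := by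
  rw [Finset.mul_sum]
  refine (norm_sum_le _ _).trans (Finset.sum_le_sum fun t _ => ?_)
  rw [norm_smul, Real.norm_eq_abs]
  exact mul_le_mul (hw t) (norm_vecMulVec_le _) (norm_nonneg _) ((abs_nonneg _).trans (hw t))

theorem Model.masked_obs (m : Model Ω) (N T : ℕ) (ω : Ω) (j : Fin m.J) (i : Fin N) (t : Fin T) :
    (m.Lam N j * (m.Fmat T ω j)ᵀ + m.Emat N T ω j) i t = m.ind j t ω * m.x N ω t i := by
  by_cases h : m.z t ω = j
  · subst h
    simp [Matrix.mul_apply, Model.Lam, Model.Fmat, Model.Emat, Model.ind, Model.x]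
  · simp [Matrix.mul_apply, Model.Lam, Model.Fmat, Model.Emat, Model.ind, h]

theorem Model.wSecond_ind (m : Model Ω) (N T : ℕ) (ω : Ω) (j : Fin m.J) :
    wSecond (fun t : Fin T => m.ind j t ω) (fun t : Fin T => m.x N ω t) =
      (m.Lam N j * (m.Fmat T ω j)ᵀ + m.Emat N T ω j) *
        (m.Lam N j * (m.Fmat T ω j)ᵀ + m.Emat N T ω j)ᵀ := by
  ext i k
  rw [wSecond_apply, Matrix.mul_apply]
  simp only [Matrix.transpose_apply, m.masked_obs]
  refine Finset.sum_congr rfl fun t _ => ?_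
  linear_combination -m.x N ω t i * m.x N ω t k * m.ind_mul_ind j t ω

/-- Posterior weights are indicators plus differences, and the observations masked by the indicator
form the matrix `ΛF' + E`. Its Gram matrix is the signal plus the noise; the differences make up the
misfit. -/
theorem Estimators.second_eq (E : Estimators m) (p : ℕ × Ω) (j : Fin m.J) :
    E.second p j = m.Lam (E.N p.1) j * E.Phi p j * (m.Lam (E.N p.1) j)ᵀ + E.noise p j +
      E.misfit p j := by
  have h1 : (fun t : Fin (E.T p.1) => E.prob p t j) = fun t : Fin (E.T p.1) =>
      m.ind j t p.2 + (E.prob p t j - m.ind j t p.2) := by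
    funext t; ring
  unfold Estimators.second Estimators.misfit Estimators.noise Estimators.Phi
  rw [h1, wSecond_add, smul_add, m.wSecond_ind, ← m.Fmat_transpose_mul]
  congr 1
  rw [Matrix.mul_smul, Matrix.smul_mul, ← smul_add]
  congr 1
  simp only [Matrix.transpose_add, Matrix.transpose_mul, Matrix.transpose_transpose,
    Matrix.add_mul, Matrix.mul_add, Matrix.mul_assoc]
  abel

theorem Regular.second_mul {c C : ℝ} (hc : 0 < c) (hC : 0 < C) {p : ℕ × Ω}
    (h : Regular l E c C p) (j : Fin m.J) : E.second p j * E.L p.1 p.2 j =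
      E.weight p j • (E.L p.1 p.2 j * gramB (E.L p.1 p.2 j) (E.s2 p.1 p.2)) := by
  have h1 := wSecond_mul_eq (h.s_pos hC) (h.q_pos hc) h.mle.maximal j (h.gramDiag j)
  unfold Estimators.second Estimators.weight
  rw [Matrix.smul_mul, Finset.sum_range, mul_smul]
  congr 1

/-- At the true regime the shortfall from one is the sum of the other probabilities, whence the
factor `J`. -/
theorem Regular.abs_prob_sub_ind_le {c C ε : ℝ} (hc : 0 < c) (hC : 0 < C) {p : ℕ × Ω}
    (h : Regular l E c C p) {t : ℕ} (hε : 0 ≤ ε)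
    (ht : ∀ k, k ≠ m.z t p.2 → E.prob p t k ≤ ε) (j : Fin m.J) :
    |E.prob p t j - m.ind j t p.2| ≤ m.J * ε := by
  have hs := h.s_pos hC
  have hJ : (1 : ℝ) ≤ m.J := by exact_mod_cast Fin.pos j
  have h0 : ∀ k, 0 ≤ E.prob p t k := fun k => post_nonneg hs (h.q_pos hc) _ k
  by_cases hz : m.z t p.2 = j
  · have h1 : m.ind j t p.2 = 1 := by simp [Model.ind, hz]
    have h2 : ∑ k, E.prob p t k = 1 := sum_post hs (h.q_pos hc) _ j
    rw [← Finset.add_sum_erase _ _ (Finset.mem_univ j)] at h2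
    have h3 : ∑ k ∈ Finset.univ.erase j, E.prob p t k ≤ m.J * ε := by
      calc _ ≤ ∑ _k ∈ Finset.univ.erase j, ε := Finset.sum_le_sum fun k hk =>
            ht k (by rw [hz]; exact Finset.ne_of_mem_erase hk)
        _ ≤ ∑ _k : Fin m.J, ε :=
            Finset.sum_le_sum_of_subset_of_nonneg (Finset.erase_subset _ _) fun _ _ _ => hε
        _ = _ := by simp
    have h4 : 0 ≤ ∑ k ∈ Finset.univ.erase j, E.prob p t k := Finset.sum_nonneg fun k _ => h0 k
    rw [h1, abs_le]
    constructor <;> nlinarith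
  · have h1 : m.ind j t p.2 = 0 := by simp [Model.ind, hz]
    rw [h1, sub_zero, abs_of_nonneg (h0 j)]
    refine (ht j (Ne.symm hz)).trans ?_
    nlinarith

theorem enorm2_x_sq_le {C : ℝ} {N : ℕ} (hup : ∀ j, frobSq (m.Lam N j) ≤ C * N) (ω : Ω) (t : ℕ) :
    enorm2 (m.x N ω t) ^ 2 ≤
      2 * (C * N * enorm2 (m.fz t ω) ^ 2) + 2 * enorm2 (m.errVec N ω t) ^ 2 := by
  rw [m.x_eq]
  have h1 := pow_le_pow_left₀ (enorm2_nonneg _)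
    (enorm2_add_le (m.Lam N (m.z t ω) *ᵥ m.fz t ω) (m.errVec N ω t)) 2
  have h2 : enorm2 (m.Lam N (m.z t ω) *ᵥ m.fz t ω) ^ 2 ≤ C * N * enorm2 (m.fz t ω) ^ 2 :=
    (enorm2_mulVec_sq_le_frobSq _ _).trans (mul_le_mul_of_nonneg_right (hup _) (sq_nonneg _))
  nlinarith [sq_nonneg (enorm2 (m.Lam N (m.z t ω) *ᵥ m.fz t ω) - enorm2 (m.errVec N ω t))]

theorem Setting.op_mean_x_sq (S : Setting μ m l α β E) {C : ℝ} (hC : 0 < C)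
    (hup : ∀ (N : ℕ) j, frobSq (m.Lam N j) ≤ C * N) :
    Op μ (fun p => (E.T p.1 : ℝ)⁻¹ * ∑ t ∈ Finset.range (E.T p.1),
      enorm2 (m.x (E.N p.1) p.2 t) ^ 2) (fun n => (E.N n : ℝ)) := by
  have hα : (2 : ℝ) ≤ α := by linarith [S.hα]
  have h1 := ((op_sum_factor_sq hα S.factor S.hT).det_mul
    (a' := fun n => C * (E.N n : ℝ))).rate (c := fun n => (E.N n : ℝ) * E.T n) (C := C)
    (Eventually.of_forall fun n => by rw [abs_of_nonneg (by positivity), mul_assoc]) hC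
  have h2 := op_sum_error_rpow S.error S.hN S.hT
  have h3 : Op μ (fun p : ℕ × Ω => (E.N p.1 : ℝ) * E.T p.1)
      (fun n => (E.N n : ℝ) * E.T n) :=
    Op.of_atTop_le (a' := fun n => (E.N n : ℝ) * E.T n)
      (Eventually.of_forall fun n => by rw [abs_of_nonneg (by positivity)])
  have h4 := ((h1.const_mul 2).add ((h3.add h2).const_mul 2)).det_mul
    (a' := fun n => (E.T n : ℝ)⁻¹)
  refine (h4.rate (c := fun n => (E.N n : ℝ)) (C := 1) ?_ one_pos).mono ?_
  · filter_upwards [eventually_pos S.hT] with n hn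
    have hT : (0 : ℝ) < E.T n := by exact_mod_cast hn
    rw [abs_of_pos (inv_pos.2 hT), one_mul, mul_comm (E.N n : ℝ), ← mul_assoc,
      inv_mul_cancel₀ hT.ne', one_mul]
  · refine Eventually.of_forall fun p => abs_le_abs_of_nonneg
      (mul_nonneg (by positivity) (Finset.sum_nonneg fun _ _ => sq_nonneg _)) ?_
    refine mul_le_mul_of_nonneg_left ?_ (by positivity)
    have h5 : ∀ t, enorm2 (m.errVec (E.N p.1) p.2 t) ^ 2 ≤
        E.N p.1 + ∑ i ∈ Finset.range (E.N p.1), |m.e i t p.2| ^ α := fun t => by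
      rw [enorm2_sq_eq_sum, Finset.sum_range]
      calc _ ≤ ∑ i : Fin (E.N p.1), (1 + |m.e i t p.2| ^ α) := Finset.sum_le_sum fun i _ => by
            have := sq_le_one_add_rpow (abs_nonneg (m.e i t p.2)) hα
            rwa [sq_abs] at this
        _ = _ := by simp [Finset.sum_add_distrib]
    calc _ ≤ ∑ t ∈ Finset.range (E.T p.1), (2 * (C * E.N p.1 * enorm2 (m.fz t p.2) ^ 2) +
          2 * (E.N p.1 + ∑ i ∈ Finset.range (E.N p.1), |m.e i t p.2| ^ α)) :=
          Finset.sum_le_sum fun t _ => (enorm2_x_sq_le (hup _) _ _).trans (by linarith [h5 t])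
      _ = _ := by
          rw [Finset.sum_add_distrib, ← Finset.mul_sum, ← Finset.mul_sum, ← Finset.mul_sum,
            Finset.sum_add_distrib, Finset.sum_const, Finset.card_range, nsmul_eq_mul]
          ring

/-- Polynomials are negligible with respect to exponentials. -/
theorem tendsto_pow_mul_exp_neg {N : ℕ → ℕ} (hN : Tendsto N atTop atTop) {a : ℝ} (ha : 0 < a)
    (k : ℕ) : Tendsto (fun n => (N n : ℝ) ^ k * Real.exp (-a * N n)) atTop (𝓝 0) := by
  have h := (Real.tendsto_pow_mul_exp_neg_atTop_nhds_zero k).comp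
    ((tendsto_natCast_atTop_atTop.comp hN).const_mul_atTop ha)
  have h2 := h.const_mul ((a ^ k)⁻¹)
  rw [mul_zero] at h2
  refine h2.congr fun n => ?_
  simp only [Function.comp_apply, mul_pow, neg_mul]
  field_simp

/-- The norm is at most `J exp(-aN)` times the mean of `‖x_t‖²`, which is `O_p(N)`. It is
exponentially small, but `O_p(1)` is all that is needed. -/
theorem Setting.op_misfit (S : Setting μ m l α β E) {c C a : ℝ} (hc : 0 < c) (hC : 0 < C)
    (hup : ∀ (N : ℕ) j, frobSq (m.Lam N j) ≤ C * N) (hreg : ∀ᶠ p in wpo μ, Regular l E c C p)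
    (ha : 0 < a) (hcl : ∀ᶠ p in wpo μ, ∀ t < E.T p.1, ∀ k, k ≠ m.z t p.2 →
      E.prob p t k ≤ Real.exp (-a * E.N p.1)) (j : Fin m.J) :
    Op μ (fun p => ‖E.misfit p j‖) (fun _ => 1) := by
  have h1 := (S.op_mean_x_sq hC hup).det_mul
    (a' := fun n => m.J * Real.exp (-a * E.N n))
  have h2 : ∀ᶠ n in atTop, |(m.J : ℝ) * Real.exp (-a * E.N n)| * (E.N n : ℝ) ≤ 1 * 1 := by
    have h3 := (tendsto_pow_mul_exp_neg S.hN ha 1).const_mul (m.J : ℝ)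
    rw [mul_zero] at h3
    filter_upwards [h3.eventually (ge_mem_nhds one_pos)] with n hn
    rw [abs_of_nonneg (by positivity)]
    linarith
  refine (h1.rate h2 one_pos).mono ?_
  filter_upwards [hreg, hcl] with p h hp
  refine abs_le_abs_of_nonneg (norm_nonneg _) ?_
  unfold Estimators.misfit
  rw [norm_smul, Real.norm_eq_abs, abs_of_nonneg (by positivity), mul_left_comm]
  refine mul_le_mul_of_nonneg_left ?_ (by positivity)
  rw [Finset.sum_range]
  exact norm_wSecond_le (fun t => h.abs_prob_sub_ind_le hc hC (Real.exp_pos _).le (hp t t.2) j) _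

theorem Setting.tendsto_weight (S : Setting μ m l α β E) {c C a : ℝ} (hc : 0 < c) (hC : 0 < C)
    (hreg : ∀ᶠ p in wpo μ, Regular l E c C p)
    (ha : 0 < a) (hcl : ∀ᶠ p in wpo μ, ∀ t < E.T p.1, ∀ k, k ≠ m.z t p.2 →
      E.prob p t k ≤ Real.exp (-a * E.N p.1)) (j : Fin m.J) :
    Tendsto (fun p => E.weight p j) (wpo μ) (𝓝 (l.q0 j)) := by
  have h1 := tendsto_wpo_of_tendstoInMeasure (S.state.freq j) S.hT
  have h2 : Tendsto (fun p => E.weight p j - (E.T p.1 : ℝ)⁻¹ *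
      ∑ t ∈ Finset.range (E.T p.1), m.ind j t p.2) (wpo μ) (𝓝 0) := by
    have h3 := ((tendsto_pow_mul_exp_neg S.hN ha 0).const_mul (m.J : ℝ)).comp (tendsto_fst_wpo μ)
    rw [mul_zero] at h3
    refine squeeze_zero_norm' ?_ h3
    filter_upwards [hreg, hcl] with p h hp
    have hT : (0 : ℝ) < E.T p.1 := by exact_mod_cast h.T_pos
    simp only [Function.comp_apply, pow_zero, one_mul]
    unfold Estimators.weight
    rw [← mul_sub, ← Finset.sum_sub_distrib, Real.norm_eq_abs, abs_mul, abs_of_pos (inv_pos.2 hT),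
      inv_mul_le_iff₀ hT]
    refine (Finset.abs_sum_le_sum_abs _ _).trans ?_
    calc _ ≤ ∑ _t ∈ Finset.range (E.T p.1), m.J * Real.exp (-a * E.N p.1) :=
          Finset.sum_le_sum fun t ht => h.abs_prob_sub_ind_le hc hC (Real.exp_pos _).le
            (hp t (Finset.mem_range.1 ht)) j
      _ = _ := by simp
  have h3 := h2.add h1
  rw [zero_add] at h3
  exact h3.congr fun p => by ring

theorem Setting.tendsto_Phi (S : Setting μ m l α β E) (j : Fin m.J) :
    Tendsto (fun p => E.Phi p j) (wpo μ) (𝓝 (l.q0 j • l.SigF j)) := by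
  refine tendsto_matrix_iff.2 fun a b => ?_
  have h := (tendsto_wpo_of_tendstoInMeasure (S.factor.plim j a b) S.hT).const_mul (l.q0 j)
  refine h.congr fun p => ?_
  have := (S.state.pos j).ne'
  simp only [Estimators.Phi, Matrix.smul_apply, smul_eq_mul, mul_inv]
  field_simp

end SecondMoment

/-! ### The limits of the estimated factor spaces -/

section MatrixLimits

theorem tendsto_matrix_inv {ι : Type*} {F : Filter ι} {k : ℕ}
    {A : ι → Matrix (Fin k) (Fin k) ℝ} {B : Matrix (Fin k) (Fin k) ℝ} (h : Tendsto A F (𝓝 B))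
    (hB : IsUnit B.det) : Tendsto (fun i => (A i)⁻¹) F (𝓝 B⁻¹) := by
  simp only [Matrix.inv_def, Ring.inverse_eq_inv']
  have h1 : Tendsto (fun i => (A i).det) F (𝓝 B.det) :=
    (Continuous.matrix_det continuous_id).continuousAt.tendsto.comp h
  have h2 : Tendsto (fun i => (A i).adjugate) F (𝓝 B.adjugate) :=
    (Continuous.matrix_adjugate continuous_id).continuousAt.tendsto.comp h
  exact (h1.inv₀ hB.ne_zero).smul h2

theorem eventually_isUnit_of_tendsto {ι : Type*} {F : Filter ι} {k : ℕ}
    {A : ι → Matrix (Fin k) (Fin k) ℝ} {B : Matrix (Fin k) (Fin k) ℝ} (h : Tendsto A F (𝓝 B))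
    (hB : IsUnit B.det) : ∀ᶠ i in F, IsUnit (A i).det := by
  have h1 : Tendsto (fun i => (A i).det) F (𝓝 B.det) :=
    (Continuous.matrix_det continuous_id).continuousAt.tendsto.comp h
  exact (h1.eventually_ne hB.ne_zero).mono fun i hi => isUnit_iff_ne_zero.2 hi

theorem eq_id_of_strictMono_fin {k : ℕ} {π : Fin k → Fin k} (h : StrictMono π) (b : Fin k) :
    π b = b := by
  have h1 : (OrderIso.ofSurjective (OrderEmbedding.ofStrictMono π h)
    (Finite.surjective_of_injective h.injective)) = OrderIso.refl (Fin k) := Subsingleton.elim _ _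
  exact congrArg (fun o : Fin k ≃o Fin k => o b) h1

/-- An orthogonal matrix that intertwines two ordered diagonal matrices, the first one with
distinct entries, is the identity if its diagonal is nonnegative. -/
theorem eq_one_of_intertwining {k : ℕ} {z : Matrix (Fin k) (Fin k) ℝ} {v w : Fin k → ℝ}
    (hz : z * zᵀ = 1) (hvw : diagonal v * z = z * diagonal w) (hv : StrictAnti v)
    (hw : Antitone w) (hd : ∀ a, 0 ≤ z a a) : z = 1 := by
  have hz' : zᵀ * z = 1 := mul_eq_one_comm.1 hz
  -- A nonzero entry equates an entry of `v` with one of `w`; as `v` is injective, every column has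
  -- exactly one nonzero entry.
  have hcomm : ∀ a b, z a b ≠ 0 → v a = w b := fun a b hab => by
    have h := congrFun (congrFun hvw a) b
    rw [diagonal_mul, mul_diagonal, mul_comm] at h
    exact mul_left_cancel₀ hab h
  have hcol : ∀ b, ∃ a, z a b ≠ 0 := fun b => by
    by_contra hcon
    push Not at hcon
    have h := congrFun (congrFun hz' b) b
    simp [Matrix.mul_apply, hcon] at h
  choose π hπ using hcol
  have huniq : ∀ a b, z a b ≠ 0 → a = π b := fun a b hab =>
    hv.injective ((hcomm a b hab).trans (hcomm (π b) b (hπ b)).symm)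
  have hinj : Function.Injective π := by
    refine Finite.injective_iff_surjective.2 fun a => ?_
    by_contra hcon
    push Not at hcon
    have h0 : ∀ b, z a b = 0 := fun b => by
      by_contra hab
      exact hcon b (huniq a b hab).symm
    have h := congrFun (congrFun hz a) a
    simp [Matrix.mul_apply, h0] at h
  -- Both diagonals decrease, so the permutation of positions is monotone and therefore trivial; the
  -- remaining signs are settled by the nonnegative diagonal.
  have hmono : Monotone π := fun b b' hbb => by
    have h := hw hbb
    rw [← hcomm _ _ (hπ b), ← hcomm _ _ (hπ b')] at h
    exact hv.le_iff_ge.1 h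
  have hid := eq_id_of_strictMono_fin (hmono.strictMono_of_injective hinj)
  have hoff : ∀ a b, a ≠ b → z a b = 0 := fun a b hab => by
    by_contra h
    exact hab ((huniq a b h).trans (hid b))
  ext a b
  by_cases hab : a = b
  · subst hab
    have h := congrFun (congrFun hz a) a
    rw [Matrix.mul_apply, Finset.sum_eq_single a (fun b _ hb => by rw [hoff a b (Ne.symm hb), zero_mul])
      (fun h => absurd (Finset.mem_univ _) h), Matrix.transpose_apply, Matrix.one_apply_eq] at h
    rw [Matrix.one_apply_eq]
    nlinarith [hd a]
  · rw [hoff a b hab, Matrix.one_apply_ne hab]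

/-- Convergence of asymptotically orthogonal matrices that asymptotically intertwine ordered
diagonal matrices. -/
theorem tendsto_one_of_intertwining {ι : Type*} {F : Filter ι} {k : ℕ}
    {Z : ι → Matrix (Fin k) (Fin k) ℝ} {w : ι → Fin k → ℝ} {v : Fin k → ℝ} (hv : StrictAnti v)
    (hZ : Tendsto (fun i => Z i * (Z i)ᵀ) F (𝓝 1))
    (hZw : Tendsto (fun i => diagonal v * Z i - Z i * diagonal (w i)) F (𝓝 0))
    (hw : ∀ᶠ i in F, Antitone (w i)) (hd : ∀ᶠ i in F, ∀ a, 0 ≤ Z i a a) :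
    Tendsto Z F (𝓝 1) ∧ Tendsto (fun i => diagonal (w i)) F (𝓝 (diagonal v)) := by
  have hlim : ∀ g : Filter ι, g ≤ F → ∀ Z0, Tendsto Z g (𝓝 Z0) → Z0 * Z0ᵀ = 1 ∨ g = ⊥ := by
    intro g hg Z0 h0
    by_cases hb : g = ⊥
    · exact Or.inr hb
    · have : g.NeBot := ⟨hb⟩
      refine Or.inl (tendsto_nhds_unique ?_ (hZ.mono_left hg))
      exact ((continuous_id.matrix_mul (Continuous.matrix_transpose continuous_id)).tendsto Z0).comp h0
  -- No bound on `w` is assumed: along any filter on which `Z` has a limit, `diag w` is recovered as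
  -- `Z⁻¹ (Z diag w)`.
  have hwlim : ∀ g : Filter ι, g ≤ F → ∀ Z0 : Matrix (Fin k) (Fin k) ℝ, Tendsto Z g (𝓝 Z0) →
      Z0 * Z0ᵀ = 1 →
      Tendsto (fun i => diagonal (w i)) g (𝓝 (Z0ᵀ * (diagonal v * Z0))) := by
    intro g hg Z0 h0 hZ0
    have hu : IsUnit Z0.det := Matrix.isUnit_det_of_right_inverse hZ0
    have hinv : Z0⁻¹ = Z0ᵀ := Matrix.inv_eq_right_inv hZ0
    have h1 := tendsto_matrix_inv h0 hu
    have h2 : Tendsto (fun i => Z i * diagonal (w i)) g (𝓝 (diagonal v * Z0)) := by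
      have h3 := (tendsto_const_nhds (x := diagonal v)).mul h0 |>.sub (hZw.mono_left hg)
      simpa using h3
    have h3 := h1.mul h2
    rw [hinv] at h3
    refine h3.congr' ?_
    filter_upwards [eventually_isUnit_of_tendsto h0 hu] with i hi
    rw [← Matrix.mul_assoc, Matrix.nonsing_inv_mul _ hi, Matrix.one_mul]
  have hmain : Tendsto Z F (𝓝 1) := by
    -- `Z` is eventually bounded, so it converges along every ultrafilter; it remains to identify
    -- the limit, which inherits orthogonality, intertwining, ordering and signs.
    rw [tendsto_iff_ultrafilter]
    intro g hg
    have hbd : ∀ᶠ i in (g : Filter ι), Z i ∈ Metric.closedBall (0 : Matrix (Fin k) (Fin k) ℝ) 2 := by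
      have h1 := (hZ.mono_left hg).norm
      have h2 : ‖(1 : Matrix (Fin k) (Fin k) ℝ)‖ < 4 := by
        have : ‖(1 : Matrix (Fin k) (Fin k) ℝ)‖ ≤ 1 :=
          opNorm_le_of_enorm2 _ zero_le_one fun v => by simp
        linarith
      filter_upwards [h1.eventually (gt_mem_nhds h2)] with i hi
      rw [norm_mul_transpose_self] at hi
      rw [mem_closedBall_zero_iff]
      nlinarith [norm_nonneg (Z i)]
    have : ProperSpace (Matrix (Fin k) (Fin k) ℝ) := FiniteDimensional.proper ℝ _
    obtain ⟨Z0, -, hZ0⟩ := (isCompact_closedBall (0 : Matrix (Fin k) (Fin k) ℝ) 2).ultrafilter_le_nhds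
      (g.map Z) (by rw [le_principal_iff]; exact hbd)
    have hZ0' : Tendsto Z g (𝓝 Z0) := hZ0
    have horth : Z0 * Z0ᵀ = 1 := (hlim g hg Z0 hZ0').resolve_right g.neBot.ne
    have hW := hwlim g hg Z0 hZ0' horth
    have hentry := tendsto_matrix_iff.1 hW
    have hWd : Z0ᵀ * (diagonal v * Z0) = diagonal fun a => (Z0ᵀ * (diagonal v * Z0)) a a := by
      ext a b
      by_cases hab : a = b
      · subst hab; simp
      · rw [diagonal_apply_ne _ hab]
        exact tendsto_nhds_unique (hentry a b)
          (tendsto_const_nhds.congr fun i => by rw [diagonal_apply_ne _ hab])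
    have hWa : Antitone fun a => (Z0ᵀ * (diagonal v * Z0)) a a := fun a b hab => by
      refine le_of_tendsto_of_tendsto (hentry b b) (hentry a a) ?_
      filter_upwards [hg hw] with i hi
      simpa using hi hab
    have hdiag : ∀ a, 0 ≤ Z0 a a := fun a => ge_of_tendsto (tendsto_matrix_iff.1 hZ0' a a)
      (Filter.Eventually.mono (hg hd) fun i hi => hi a)
    have h1 : Z0 = 1 := by
      refine eq_one_of_intertwining (v := v) (w := fun a => (Z0ᵀ * (diagonal v * Z0)) a a) horth ?_
        hv hWa hdiag
      rw [← hWd, ← Matrix.mul_assoc, horth, Matrix.one_mul]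
    rw [h1] at hZ0'
    exact hZ0'
  refine ⟨hmain, ?_⟩
  have h := hwlim F le_rfl 1 hmain (by simp)
  simpa using h

end MatrixLimits

/-! ### Consistency -/

section UnitLoadings

variable {N k : ℕ}

/-- The estimated loadings, scaled to columns of norm almost one. -/
def unitLoadings (L : Matrix (Fin N) (Fin k) ℝ) (s : ℝ) : Matrix (Fin N) (Fin k) ℝ :=
  L * diagonal fun a => (√((Lᵀ * L) a a + s))⁻¹

variable {L : Matrix (Fin N) (Fin k) ℝ} {s : ℝ}

theorem gram_add_pos (L : Matrix (Fin N) (Fin k) ℝ) (hs : 0 < s) (a : Fin k) :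
    0 < (Lᵀ * L) a a + s :=
  add_pos_of_nonneg_of_pos (gram_diag_nonneg L a) hs

theorem GramDiag.gramB_inv (h : GramDiag L) (hs : 0 < s) :
    (gramB L s)⁻¹ = diagonal fun a => ((Lᵀ * L) a a + s)⁻¹ := by
  refine Matrix.inv_eq_right_inv ?_
  rw [h.gramB_eq, diagonal_mul_diagonal, ← diagonal_one]
  congr 1
  funext a
  exact mul_inv_cancel₀ (gram_add_pos L hs a).ne'

/-- The term `s` is included in the scaling so that the product is the ridge smoother exactly and
bounds on the smoother transfer. -/
theorem GramDiag.unitLoadings_mul_transpose (h : GramDiag L) (hs : 0 < s) :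
    unitLoadings L s * (unitLoadings L s)ᵀ = shrink L s := by
  unfold unitLoadings shrink coef
  rw [h.gramB_inv hs, transpose_mul, diagonal_transpose, Matrix.mul_assoc,
    ← Matrix.mul_assoc (diagonal _), diagonal_mul_diagonal]
  congr 3
  funext a
  rw [← mul_inv, Real.mul_self_sqrt (gram_add_pos L hs a).le]

theorem GramDiag.norm_unitLoadings_le (h : GramDiag L) (hs : 0 < s) : ‖unitLoadings L s‖ ≤ 1 := by
  have h1 := norm_shrink_le (L := L) hs
  rw [← h.unitLoadings_mul_transpose hs, norm_mul_transpose_self] at h1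
  nlinarith [norm_nonneg (unitLoadings L s)]

theorem unitLoadings_mul_diagonal (hs : 0 < s) :
    unitLoadings L s * (diagonal fun a => √((Lᵀ * L) a a + s)) = L := by
  unfold unitLoadings
  rw [Matrix.mul_assoc, diagonal_mul_diagonal]
  have : (fun a => (√((Lᵀ * L) a a + s))⁻¹ * √((Lᵀ * L) a a + s)) = fun _ => 1 := by
    funext a
    exact inv_mul_cancel₀ (Real.sqrt_pos.2 (gram_add_pos L hs a)).ne'
  rw [this, diagonal_one, Matrix.mul_one]

theorem GramDiag.mul_unitLoadings (h : GramDiag L) {S : Matrix (Fin N) (Fin N) ℝ}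
    {w : ℝ} (hS : S * L = w • (L * gramB L s)) :
    S * unitLoadings L s = unitLoadings L s * diagonal fun a => w * ((Lᵀ * L) a a + s) := by
  unfold unitLoadings
  rw [← Matrix.mul_assoc, hS, h.gramB_eq, Matrix.smul_mul, Matrix.mul_assoc, Matrix.mul_assoc,
    ← Matrix.mul_smul, diagonal_mul_diagonal, diagonal_mul_diagonal, ← diagonal_smul]
  congr 2
  funext a
  simp only [Pi.smul_apply, smul_eq_mul]
  ring

theorem norm_conj_one_sub_shrink_le {l : ℕ} (hs : 0 < s) (Lam : Matrix (Fin N) (Fin l) ℝ) :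
    ‖Lamᵀ * (1 - shrink L s) * Lam‖ ≤ defect Lam (shrink L s) := by
  have h1 : Lamᵀ * (1 - shrink L s) * Lam = ((1 - shrink L s) * Lam)ᵀ * ((1 - shrink L s) * Lam) +
      s • ((coef L s * Lam)ᵀ * (coef L s * Lam)) := by
    conv_lhs => rw [one_sub_shrink_eq hs]
    simp only [transpose_mul, Matrix.mul_add, Matrix.add_mul, Matrix.mul_smul, Matrix.smul_mul,
      Matrix.mul_assoc]
  rw [h1, defect_shrink hs]
  refine (norm_add_le _ _).trans ?_
  rw [norm_smul, norm_transpose_mul_self, norm_transpose_mul_self, Real.norm_eq_abs, abs_of_pos hs]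
  exact add_le_add (norm_sq_le_frobSq _) (mul_le_mul_of_nonneg_left (norm_sq_le_frobSq _) hs.le)

end UnitLoadings

/-! ### Simultaneous diagonalization of the limit matrices. -/

section LimitMatrices

variable {μ : Measure Ω} {m : Model Ω} {l : Limits m}

theorem LoadingAssumption.root_mul_root (h : LoadingAssumption m μ l) (j : Fin m.J) :
    l.root j * l.root j = l.SigL j :=
  CFC.sqrt_mul_sqrt_self _ (h.posDef j).posSemidef.nonneg

theorem Limits.root_posSemidef (l : Limits m) (j : Fin m.J) : (l.root j).PosSemidef :=
  Matrix.nonneg_iff_posSemidef.1 (CFC.sqrt_nonneg _)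

theorem Limits.root_transpose (l : Limits m) (j : Fin m.J) : (l.root j)ᵀ = l.root j := by
  have h := (l.root_posSemidef j).isHermitian
  rwa [Matrix.IsHermitian, conjTranspose_eq_transpose_of_trivial] at h

theorem LoadingAssumption.isUnit_root (h : LoadingAssumption m μ l) (j : Fin m.J) :
    IsUnit (l.root j).det := by
  have h1 := (h.posDef j).det_pos
  rw [← h.root_mul_root j, det_mul] at h1
  refine isUnit_iff_ne_zero.2 fun h0 => ?_
  simp [h0] at h1

theorem EigenAssumption.Ups_mul_transpose (h : EigenAssumption l) (j : Fin m.J) :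
    l.Ups j * (l.Ups j)ᵀ = 1 := mul_eq_one_comm.1 (h.orthogonal j)

/-- The limit of the rotations `H`. -/
def Limits.Hlim (l : Limits m) (j : Fin m.J) : Matrix (Fin (m.r j)) (Fin (m.r j)) ℝ :=
  (l.root j)⁻¹ * l.Ups j * diagonal fun a => √(l.v j a)

/-- The matrix `Υ' Σ_Λ^{-1/2}`. -/
def Limits.whiten (l : Limits m) (j : Fin m.J) : Matrix (Fin (m.r j)) (Fin (m.r j)) ℝ :=
  (l.Ups j)ᵀ * (l.root j)⁻¹

/-- The inverse of `Limits.whiten`. -/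
def Limits.color (l : Limits m) (j : Fin m.J) : Matrix (Fin (m.r j)) (Fin (m.r j)) ℝ :=
  l.root j * l.Ups j

theorem LoadingAssumption.whiten_mul_color (h : LoadingAssumption m μ l) (he : EigenAssumption l)
    (j : Fin m.J) : l.whiten j * l.color j = 1 := by
  unfold Limits.whiten Limits.color
  rw [Matrix.mul_assoc, ← Matrix.mul_assoc (l.root j)⁻¹, Matrix.nonsing_inv_mul _ (h.isUnit_root j),
    Matrix.one_mul, he.orthogonal]

theorem LoadingAssumption.color_mul_whiten (h : LoadingAssumption m μ l) (he : EigenAssumption l)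
    (j : Fin m.J) : l.color j * l.whiten j = 1 := mul_eq_one_comm.1 (h.whiten_mul_color he j)

theorem LoadingAssumption.whiten_mul_SigL (h : LoadingAssumption m μ l) (j : Fin m.J) :
    l.whiten j * l.SigL j = (l.color j)ᵀ := by
  unfold Limits.whiten Limits.color
  rw [← h.root_mul_root, transpose_mul, l.root_transpose, Matrix.mul_assoc,
    ← Matrix.mul_assoc (l.root j)⁻¹, Matrix.nonsing_inv_mul _ (h.isUnit_root j), Matrix.one_mul]

/-- The basis `Σ_Λ^{1/2} Υ` diagonalizes the form `Σ_F`, while its inverse whitens `Σ_Λ`. In these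
coordinates the limit of the rotations is the identity. -/
theorem EigenAssumption.color_conj (h : EigenAssumption l) (j : Fin m.J) :
    (l.color j)ᵀ * l.SigF j * l.color j = diagonal (l.v j) := by
  unfold Limits.color
  rw [transpose_mul, l.root_transpose]
  calc _ = (l.Ups j)ᵀ * (l.root j * l.SigF j * l.root j) * l.Ups j := by
        simp only [Matrix.mul_assoc]
    _ = ((l.Ups j)ᵀ * l.Ups j) * diagonal (l.v j) * ((l.Ups j)ᵀ * l.Ups j) := by
        rw [h.spectral]; simp only [Matrix.mul_assoc]
    _ = _ := by rw [h.orthogonal, Matrix.one_mul, Matrix.mul_one]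

theorem eigenvalue_pos (h : LoadingAssumption m μ l) (he : EigenAssumption l)
    (hF : ∀ j, (l.SigF j).PosDef) (j : Fin m.J) (a : Fin (m.r j)) : 0 < l.v j a := by
  have hinj : Function.Injective (l.color j).mulVec := fun x y hxy => by
    have h1 := congrArg (fun u => l.whiten j *ᵥ u) hxy
    simpa [Matrix.mulVec_mulVec, h.whiten_mul_color he] using h1
  have h1 := (hF j).conjTranspose_mul_mul_same hinj
  rw [conjTranspose_eq_transpose_of_trivial, he.color_conj] at h1
  exact Matrix.posDef_diagonal_iff.1 h1 a

end LimitMatrices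

/-! ### The sample eigenvalue equation and its limit. -/

section Consistency

variable {μ : Measure Ω} [IsProbabilityMeasure μ] {m : Model Ω} {l : Limits m} {α β : ℝ}
  {E : Estimators m}

/-- The remainder of the weighted second moment matrix. -/
def Estimators.resid (E : Estimators m) (p : ℕ × Ω) (j : Fin m.J) :
    Matrix (Fin (E.N p.1)) (Fin (E.N p.1)) ℝ := E.noise p j + E.misfit p j

/-- The cross terms of loadings and errors are `T⁻¹ · √N · √(NT) = N/√T`; the Gram matrix of the
errors contributes `N/δ`. -/
theorem Setting.op_noise (S : Setting μ m l α β E) {C : ℝ} (hC : 0 < C)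
    (hup : ∀ (N : ℕ) j, frobSq (m.Lam N j) ≤ C * N) (j : Fin m.J) :
    Op μ (fun p => ‖E.noise p j‖) (fun n => (E.N n : ℝ) / delta (E.N n) (E.T n)) := by
  have h1 := (op_error_factor S.moment S.hN S.hT j).sqrt (fun _ => frobSq_nonneg _)
    (fun n => by positivity)
  have h2 := (op_error_gram S.error S.hN S.hT j).sqrt (fun _ => frobSq_nonneg _)
    (fun n => sq_nonneg _)
  have h1' := ((h1.det_mul (a' := fun n => (E.T n : ℝ)⁻¹ * √(C * E.N n))).const_mul 2).rate
    (c := fun n => (E.N n : ℝ) / delta (E.N n) (E.T n)) (C := √C) ?_ (Real.sqrt_pos.2 hC)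
  have h2' := (h2.det_mul (a' := fun n => (E.T n : ℝ)⁻¹)).rate
    (c := fun n => (E.N n : ℝ) / delta (E.N n) (E.T n)) (C := 1) ?_ one_pos
  · refine (h1'.add h2').mono (Eventually.of_forall fun p => ?_)
    refine abs_le_abs_of_nonneg (norm_nonneg _) ?_
    unfold Estimators.noise
    rw [norm_smul, Real.norm_eq_abs, abs_of_nonneg (by positivity)]
    set A := m.Emat (E.N p.1) (E.T p.1) p.2 j * m.Fmat (E.T p.1) p.2 j
    set Λ := m.Lam (E.N p.1) j
    have hΛ : ‖Λ‖ ≤ √(C * E.N p.1) := Real.le_sqrt_of_sq_le ((norm_sq_le_frobSq _).trans (hup _ j))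
    have hA := norm_le_sqrt_frobSq A
    have h3 : ‖Λ * Aᵀ‖ ≤ √(C * E.N p.1) * √(frobSq A) := by
      refine (norm_mul_le_opNorm _ _).trans ?_
      rw [norm_transpose_eq]
      exact mul_le_mul hΛ hA (norm_nonneg _) (Real.sqrt_nonneg _)
    have h4 : ‖A * Λᵀ‖ ≤ √(C * E.N p.1) * √(frobSq A) := by
      have : A * Λᵀ = (Λ * Aᵀ)ᵀ := by rw [transpose_mul, transpose_transpose]
      rw [this, norm_transpose_eq]
      exact h3
    have h5 := norm_le_sqrt_frobSq (m.Emat (E.N p.1) (E.T p.1) p.2 j *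
      (m.Emat (E.N p.1) (E.T p.1) p.2 j)ᵀ)
    have h6 := norm_add₃_le (a := Λ * Aᵀ) (b := A * Λᵀ)
      (c := m.Emat (E.N p.1) (E.T p.1) p.2 j * (m.Emat (E.N p.1) (E.T p.1) p.2 j)ᵀ)
    have hT : (0 : ℝ) ≤ (E.T p.1 : ℝ)⁻¹ := by positivity
    have h7 := mul_le_mul_of_nonneg_left (h6.trans (add_le_add (add_le_add h3 h4) h5)) hT
    refine h7.trans (le_of_eq ?_)
    ring
  · filter_upwards [eventually_pos S.hN, eventually_pos S.hT] with n hn1 hn2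
    have hT : (0 : ℝ) < E.T n := by exact_mod_cast hn2
    have hd := delta_pos hn1 hn2
    rw [abs_of_nonneg (by positivity), Real.sqrt_sq (by positivity)]
    exact le_of_eq (by field_simp)
  · filter_upwards [eventually_pos S.hN, eventually_pos S.hT] with n hn1 hn2
    have hN : (0 : ℝ) < E.N n := by exact_mod_cast hn1
    have hT : (0 : ℝ) < E.T n := by exact_mod_cast hn2
    have hd := delta_pos hn1 hn2
    have hsT : 0 < √(E.T n : ℝ) := Real.sqrt_pos.2 hT
    rw [abs_of_nonneg (by positivity), Real.sqrt_mul hC.le, Real.sqrt_mul hN.le]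
    have h8 : (E.T n : ℝ)⁻¹ * (√C * √(E.N n : ℝ)) * (√(E.N n : ℝ) * √(E.T n : ℝ)) =
        √C * (E.N n / √(E.T n : ℝ)) := by
      have h9 := Real.mul_self_sqrt hN.le
      have h10 := Real.mul_self_sqrt hT.le
      have h11 : (E.T n : ℝ)⁻¹ * √(E.T n : ℝ) = (√(E.T n : ℝ))⁻¹ := by
        nth_rewrite 1 [← h10]
        field_simp
      calc _ = √C * (√(E.N n : ℝ) * √(E.N n : ℝ)) * ((E.T n : ℝ)⁻¹ * √(E.T n : ℝ)) := by ring
        _ = _ := by rw [h9, h11]; ring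
    rw [h8]
    have : delta (E.N n) (E.T n) ≤ √(E.T n : ℝ) := min_le_right _ _
    gcongr

theorem Setting.op_resid (S : Setting μ m l α β E) {C : ℝ} (hC : 0 < C)
    (hup : ∀ (N : ℕ) j, frobSq (m.Lam N j) ≤ C * N) (j : Fin m.J)
    (hmis : Op μ (fun p => ‖E.misfit p j‖) (fun _ => 1)) :
    Op μ (fun p => ‖E.resid p j‖) (fun n => (E.N n : ℝ) / delta (E.N n) (E.T n)) := by
  have h1 := hmis.rate (c := fun n => (E.N n : ℝ) / delta (E.N n) (E.T n)) (C := 1) (by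
    filter_upwards [eventually_rates S.hN S.hT] with n h
    rw [one_mul, one_le_div (by linarith [h.1])]
    nlinarith [h.1, h.2.1]) one_pos
  refine ((S.op_noise hC hup j).add h1).mono (Eventually.of_forall fun p => ?_)
  exact abs_le_abs_of_nonneg (norm_nonneg _) (norm_add_le _ _)

/-- The sample counterpart of the rotation from the true to the estimated factor space. -/
def Estimators.Zmat (l : Limits m) (E : Estimators m) (p : ℕ × Ω) (j : Fin m.J) :
    Matrix (Fin (m.r j)) (Fin (m.r j)) ℝ :=
  (√(E.N p.1 : ℝ))⁻¹ • (l.whiten j * (m.Lam (E.N p.1) j)ᵀ *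
    unitLoadings (E.L p.1 p.2 j) (E.s2 p.1 p.2))

/-- The scaled squared column norms of the estimated loadings, plus `σ̂² / N`. -/
def Estimators.eig (E : Estimators m) (p : ℕ × Ω) (j : Fin m.J) (a : Fin (m.r j)) : ℝ :=
  (E.N p.1 : ℝ)⁻¹ * (((E.L p.1 p.2 j)ᵀ * E.L p.1 p.2 j) a a + E.s2 p.1 p.2)

theorem Setting.tendsto_gram (S : Setting μ m l α β E) (j : Fin m.J) :
    Tendsto (fun p : ℕ × Ω => (E.N p.1 : ℝ)⁻¹ • ((m.Lam (E.N p.1) j)ᵀ * m.Lam (E.N p.1) j))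
      (wpo μ) (𝓝 (l.SigL j)) :=
  (S.loading.tendsto_gram j).comp (S.hN.comp (tendsto_fst_wpo μ))

/-- `ZZ'` is the whitened `N⁻¹ Λ'GΛ`. Replacing `G` by the identity costs at most the defect divided
by `N`, and the whitened Gram matrix of the true loadings tends to the identity. -/
theorem Setting.tendsto_Z_mul_transpose (S : Setting μ m l α β E) {c C : ℝ} (hC : 0 < C)
    (hreg : ∀ᶠ p in wpo μ, Regular l E c C p) {ρ : ℕ × Ω → ℝ} (hρ : Tendsto ρ (wpo μ) (𝓝 0))
    (j : Fin m.J) (hdef : ∀ᶠ p in wpo μ, defect (m.Lam (E.N p.1) j)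
      (shrink (E.L p.1 p.2 j) (E.s2 p.1 p.2)) ≤ ρ p ^ 2 * E.N p.1) :
    Tendsto (fun p => E.Zmat l p j * (E.Zmat l p j)ᵀ) (wpo μ) (𝓝 1) := by
  have h1 : Tendsto (fun p : ℕ × Ω => l.whiten j * ((E.N p.1 : ℝ)⁻¹ •
      ((m.Lam (E.N p.1) j)ᵀ * m.Lam (E.N p.1) j)) * (l.whiten j)ᵀ) (wpo μ) (𝓝 1) := by
    have h2 := ((tendsto_const_nhds (x := l.whiten j)).mul (S.tendsto_gram j)).mul
      (tendsto_const_nhds (x := (l.whiten j)ᵀ))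
    rw [S.loading.whiten_mul_SigL, ← transpose_mul, S.loading.whiten_mul_color S.eigen,
      transpose_one] at h2
    exact h2
  have h3 : Tendsto (fun p : ℕ × Ω => (E.N p.1 : ℝ)⁻¹ • ((m.Lam (E.N p.1) j)ᵀ *
      (1 - shrink (E.L p.1 p.2 j) (E.s2 p.1 p.2)) * m.Lam (E.N p.1) j)) (wpo μ) (𝓝 0) := by
    have hρ2 : Tendsto (fun p => ρ p ^ 2) (wpo μ) (𝓝 0) := by simpa using hρ.pow 2
    refine squeeze_zero_norm' ?_ hρ2
    filter_upwards [hreg, hdef] with p h hd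
    have hN : (0 : ℝ) < E.N p.1 := by exact_mod_cast h.N_pos
    rw [norm_smul, Real.norm_eq_abs, abs_of_pos (inv_pos.2 hN), inv_mul_le_iff₀ hN]
    refine (norm_conj_one_sub_shrink_le (h.s_pos hC) _).trans (hd.trans (le_of_eq (mul_comm _ _)))
  have h4 := h1.sub (((tendsto_const_nhds (x := l.whiten j)).mul h3).mul
      (tendsto_const_nhds (x := (l.whiten j)ᵀ)))
  simp only [Matrix.mul_zero, Matrix.zero_mul, sub_zero] at h4
  refine h4.congr' ?_
  filter_upwards [hreg] with p h
  have hN : (0 : ℝ) < E.N p.1 := by exact_mod_cast h.N_pos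
  have h5 : (√(E.N p.1 : ℝ))⁻¹ * (√(E.N p.1 : ℝ))⁻¹ = (E.N p.1 : ℝ)⁻¹ := by
    rw [← mul_inv, Real.mul_self_sqrt hN.le]
  have h6 := (h.gramDiag j).unitLoadings_mul_transpose (h.s_pos hC)
  have h7 : E.Zmat l p j * (E.Zmat l p j)ᵀ = (E.N p.1 : ℝ)⁻¹ • (l.whiten j * (m.Lam (E.N p.1) j)ᵀ *
      shrink (E.L p.1 p.2 j) (E.s2 p.1 p.2) * (l.whiten j * (m.Lam (E.N p.1) j)ᵀ)ᵀ) := by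
    unfold Estimators.Zmat
    rw [transpose_smul, Matrix.smul_mul, Matrix.mul_smul, smul_smul, h5,
      transpose_mul _ (unitLoadings _ _), Matrix.mul_assoc (l.whiten j * _),
      ← Matrix.mul_assoc (unitLoadings _ _), h6, ← Matrix.mul_assoc]
  rw [h7]
  simp only [transpose_mul, transpose_transpose, Matrix.mul_smul, Matrix.smul_mul]
  rw [← smul_sub]
  congr 1
  simp only [Matrix.mul_sub, Matrix.sub_mul, Matrix.mul_one, Matrix.mul_assoc]
  abel

theorem Regular.second_mul_unit {c C : ℝ} (hc : 0 < c) (hC : 0 < C) {p : ℕ × Ω}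
    (h : Regular l E c C p) (j : Fin m.J) :
    E.second p j * unitLoadings (E.L p.1 p.2 j) (E.s2 p.1 p.2) =
      (E.N p.1 : ℝ) • (unitLoadings (E.L p.1 p.2 j) (E.s2 p.1 p.2) *
        diagonal fun a => E.weight p j * E.eig p j a) := by
  have hN : (E.N p.1 : ℝ) ≠ 0 := by exact_mod_cast h.N_pos.ne'
  rw [(h.gramDiag j).mul_unitLoadings (h.second_mul hc hC j), ← Matrix.mul_smul, ← diagonal_smul]
  congr 2
  funext a
  simp only [Estimators.eig, Pi.smul_apply, smul_eq_mul]
  field_simp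

/-- The eigenvalue equation is multiplied from the left by the whitened `Λ'` and scaled by
`N^{-3/2}`. The signal becomes `A Z` with `A` tending to `q0 diag v`; the remainder is `O_p(1/δ)`.
-/
theorem Setting.tendsto_intertwining (S : Setting μ m l α β E) {c C : ℝ} (hc : 0 < c)
    (hC : 0 < C) (hup : ∀ (N : ℕ) j, frobSq (m.Lam N j) ≤ C * N)
    (hreg : ∀ᶠ p in wpo μ, Regular l E c C p) (j : Fin m.J)
    (hmis : Op μ (fun p => ‖E.misfit p j‖) (fun _ => 1))
    (hZ : Tendsto (fun p => E.Zmat l p j * (E.Zmat l p j)ᵀ) (wpo μ) (𝓝 1)) :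
    Tendsto (fun p => diagonal (l.v j) * E.Zmat l p j - E.Zmat l p j *
      diagonal fun a => (l.q0 j)⁻¹ * (E.weight p j * E.eig p j a)) (wpo μ) (𝓝 0) := by
  have hq := S.state.pos j
  set A : ℕ × Ω → Matrix (Fin (m.r j)) (Fin (m.r j)) ℝ := fun p =>
    l.whiten j * ((E.N p.1 : ℝ)⁻¹ • ((m.Lam (E.N p.1) j)ᵀ * m.Lam (E.N p.1) j)) * E.Phi p j *
      l.color j with hA
  have hAlim : Tendsto A (wpo μ) (𝓝 (l.q0 j • diagonal (l.v j))) := by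
    have h1 := (((tendsto_const_nhds (x := l.whiten j)).mul (S.tendsto_gram j)).mul
      (S.tendsto_Phi j)).mul (tendsto_const_nhds (x := l.color j))
    rw [S.loading.whiten_mul_SigL, Matrix.mul_smul, Matrix.smul_mul, S.eigen.color_conj] at h1
    exact h1
  have hnZ : ∀ᶠ p in wpo μ, ‖E.Zmat l p j‖ ≤ 2 := by
    have h2 : ‖(1 : Matrix (Fin (m.r j)) (Fin (m.r j)) ℝ)‖ < 4 := by
      have : ‖(1 : Matrix (Fin (m.r j)) (Fin (m.r j)) ℝ)‖ ≤ 1 :=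
        opNorm_le_of_enorm2 _ zero_le_one fun v => by simp
      linarith
    filter_upwards [hZ.norm.eventually (gt_mem_nhds h2)] with p hp
    rw [norm_mul_transpose_self] at hp
    nlinarith [norm_nonneg (E.Zmat l p j)]
  have hB : Tendsto (fun p => (l.q0 j • diagonal (l.v j) - A p) * E.Zmat l p j) (wpo μ) (𝓝 0) := by
    have h1 := (tendsto_const_nhds (x := l.q0 j • diagonal (l.v j))).sub hAlim
    rw [sub_self] at h1
    have h2 := (h1.norm).mul_const 2
    rw [norm_zero, zero_mul] at h2
    refine squeeze_zero_norm' ?_ h2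
    filter_upwards [hnZ] with p hp
    exact (norm_mul_le_opNorm _ _).trans (mul_le_mul_of_nonneg_left hp (norm_nonneg _))
  have hD : Tendsto (fun p => (E.N p.1 : ℝ)⁻¹ • ((√(E.N p.1 : ℝ))⁻¹ • (l.whiten j *
      (m.Lam (E.N p.1) j)ᵀ * E.resid p j * unitLoadings (E.L p.1 p.2 j) (E.s2 p.1 p.2))))
      (wpo μ) (𝓝 0) := by
    have h1 := ((S.op_resid hC hup j hmis).const_mul (‖l.whiten j‖ * √C)).det_mul
      (a' := fun n => (E.N n : ℝ)⁻¹)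
    have h2 := (h1.rate (c := fun n => (delta (E.N n) (E.T n))⁻¹) (C := 1) (by
      filter_upwards [eventually_pos S.hN] with n hn
      have hN : (0 : ℝ) < E.N n := by exact_mod_cast hn
      rw [abs_of_pos (inv_pos.2 hN), one_mul, div_eq_mul_inv, ← mul_assoc, inv_mul_cancel₀ hN.ne',
        one_mul]) one_pos).tendsto_zero (tendsto_delta S.hN S.hT).inv_tendsto_atTop
    refine squeeze_zero_norm' ?_ h2
    filter_upwards [hreg] with p h
    have hN : (0 : ℝ) < E.N p.1 := by exact_mod_cast h.N_pos
    have hsN : 0 < √(E.N p.1 : ℝ) := Real.sqrt_pos.2 hN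
    rw [norm_smul, norm_smul, Real.norm_eq_abs, Real.norm_eq_abs, abs_of_pos (inv_pos.2 hN),
      abs_of_pos (inv_pos.2 hsN)]
    refine mul_le_mul_of_nonneg_left ?_ (inv_pos.2 hN).le
    rw [inv_mul_le_iff₀ hsN]
    have hΛ : ‖(m.Lam (E.N p.1) j)ᵀ‖ ≤ √C * √(E.N p.1 : ℝ) := by
      rw [norm_transpose_eq, ← Real.sqrt_mul hC.le]
      exact Real.le_sqrt_of_sq_le ((norm_sq_le_frobSq _).trans (hup _ j))
    calc _ ≤ ‖l.whiten j‖ * (√C * √(E.N p.1 : ℝ)) * ‖E.resid p j‖ * 1 := by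
          refine (norm_mul_le_opNorm _ _).trans (mul_le_mul ((norm_mul_le_opNorm _ _).trans
            (mul_le_mul_of_nonneg_right ((norm_mul_le_opNorm _ _).trans
              (mul_le_mul_of_nonneg_left hΛ (norm_nonneg _))) (norm_nonneg _)))
            ((h.gramDiag j).norm_unitLoadings_le (h.s_pos hC)) (norm_nonneg _) (by positivity))
      _ = _ := by ring
  have hfin := (hB.sub hD).const_smul (l.q0 j)⁻¹
  rw [sub_zero, smul_zero] at hfin
  refine hfin.congr' ?_
  filter_upwards [hreg] with p h
  have hN : (E.N p.1 : ℝ) ≠ 0 := by exact_mod_cast h.N_pos.ne'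
  set U := unitLoadings (E.L p.1 p.2 j) (E.s2 p.1 p.2) with hU
  set Λ := m.Lam (E.N p.1) j with hΛ
  have hSU := h.second_mul_unit hc hC j
  have hZdef : E.Zmat l p j = (√(E.N p.1 : ℝ))⁻¹ • (l.whiten j * Λᵀ * U) := rfl
  have hZd : E.Zmat l p j * (diagonal fun a => E.weight p j * E.eig p j a) =
      (E.N p.1 : ℝ)⁻¹ • ((√(E.N p.1 : ℝ))⁻¹ • (l.whiten j * Λᵀ * (E.second p j * U))) := by
    rw [hSU, hZdef, Matrix.smul_mul, Matrix.mul_smul, smul_comm (√(E.N p.1 : ℝ))⁻¹ (E.N p.1 : ℝ),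
      smul_smul, inv_mul_cancel₀ hN, one_smul, Matrix.mul_assoc (l.whiten j * Λᵀ)]
  have hAZ : A p * E.Zmat l p j = (E.N p.1 : ℝ)⁻¹ • ((√(E.N p.1 : ℝ))⁻¹ •
      (l.whiten j * Λᵀ * (Λ * E.Phi p j * Λᵀ * U))) := by
    have hcw : l.color j * E.Zmat l p j = (√(E.N p.1 : ℝ))⁻¹ • (Λᵀ * U) := by
      rw [hZdef, Matrix.mul_smul, Matrix.mul_assoc (l.whiten j), ← Matrix.mul_assoc (l.color j),
        S.loading.color_mul_whiten S.eigen, Matrix.one_mul]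
    rw [hA]
    dsimp only
    rw [Matrix.mul_assoc _ (l.color j), hcw]
    simp only [Matrix.mul_smul, Matrix.smul_mul, Matrix.mul_assoc]
    rw [smul_comm]
  have hsecond : E.second p j * U = Λ * E.Phi p j * Λᵀ * U + E.resid p j * U := by
    rw [E.second_eq, add_assoc, Matrix.add_mul]
    rfl
  have hdsmul : (diagonal fun a => (l.q0 j)⁻¹ * (E.weight p j * E.eig p j a)) =
      (l.q0 j)⁻¹ • diagonal fun a => E.weight p j * E.eig p j a := by
    rw [← diagonal_smul]; rfl
  rw [hdsmul, Matrix.mul_smul, hZd, hsecond, Matrix.mul_add, smul_add, smul_add, ← hAZ,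
    Matrix.sub_mul, Matrix.smul_mul, smul_sub, smul_sub, smul_smul, inv_mul_cancel₀ hq.ne', one_smul,
    smul_add, ← Matrix.mul_assoc (l.whiten j * Λᵀ)]
  abel

/-- Consistency of the estimated eigenvalues and of the rotations. -/
theorem Setting.tendsto_Z_eig (S : Setting μ m l α β E) {c C a : ℝ} (hc : 0 < c)
    (hC : 0 < C) (hup : ∀ (N : ℕ) j, frobSq (m.Lam N j) ≤ C * N)
    (hreg : ∀ᶠ p in wpo μ, Regular l E c C p) {ρ : ℕ × Ω → ℝ} (hρ : Tendsto ρ (wpo μ) (𝓝 0))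
    (ha : 0 < a) (hcl : ∀ᶠ p in wpo μ, ∀ t < E.T p.1, ∀ k, k ≠ m.z t p.2 →
      E.prob p t k ≤ Real.exp (-a * E.N p.1))
    (j : Fin m.J) (hdef : ∀ᶠ p in wpo μ, defect (m.Lam (E.N p.1) j)
      (shrink (E.L p.1 p.2 j) (E.s2 p.1 p.2)) ≤ ρ p ^ 2 * E.N p.1) :
    Tendsto (fun p => E.Zmat l p j) (wpo μ) (𝓝 1) ∧
      ∀ b, Tendsto (fun p => E.eig p j b) (wpo μ) (𝓝 (l.v j b)) := by
  have hq := S.state.pos j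
  have hmis := S.op_misfit hc hC hup hreg ha hcl j
  have hZ := S.tendsto_Z_mul_transpose hC hreg hρ j hdef
  have hw := S.tendsto_weight hc hC hreg ha hcl j
  obtain ⟨h1, h2⟩ := tendsto_one_of_intertwining (S.eigen.descending j) hZ
    (S.tendsto_intertwining hc hC hup hreg j hmis hZ) (by
      filter_upwards [hreg, hw.eventually (lt_mem_nhds hq)] with p h hwp b b' hb
      have h3 := h.mle.ordered j hb
      have hN : (0 : ℝ) < E.N p.1 := by exact_mod_cast h.N_pos
      simp only [Estimators.eig] at h3 ⊢
      gcongr) (by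
      -- Scaling columns by positive numbers preserves the sign normalization.
      filter_upwards [hreg] with p h b
      have h3 := h.signed j b
      unfold Estimators.Zmat unitLoadings
      rw [← Matrix.mul_assoc, Matrix.smul_apply, mul_diagonal, smul_eq_mul]
      exact mul_nonneg (by positivity) (mul_nonneg h3 (by positivity)))
  refine ⟨h1, fun b => ?_⟩
  have h3 := tendsto_matrix_iff.1 h2 b b
  simp only [diagonal_apply_eq] at h3
  -- The intertwining identifies the limit of `weight * eig / q0`; the weight, which tends to `q0`,
  -- is divided out.
  have h4 := (h3.const_mul (l.q0 j)).div hw hq.ne'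
  rw [mul_div_cancel_left₀ _ hq.ne'] at h4
  refine h4.congr' ?_
  filter_upwards [hw.eventually (lt_mem_nhds hq)] with p hp
  simp only [Pi.div_apply]
  field_simp

end Consistency

/-- The properties on which the rates of convergence rest. -/
structure Asymptotics (μ : Measure Ω) [IsProbabilityMeasure μ] {m : Model Ω} (l : Limits m)
    (E : Estimators m) (c C a : ℝ) : Prop where
  c_pos : 0 < c
  C_pos : 0 < C
  a_pos : 0 < a
  upper : ∀ (N : ℕ) j, frobSq (m.Lam N j) ≤ C * N
  regular : ∀ᶠ p in wpo μ, Regular l E c C p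
  classified : ∀ᶠ p in wpo μ, ∀ t < E.T p.1, ∀ k, k ≠ m.z t p.2 →
    E.prob p t k ≤ Real.exp (-a * E.N p.1)
  misfit : ∀ j, Op μ (fun p => ‖E.misfit p j‖) (fun _ => 1)
  weight : ∀ j, Tendsto (fun p => E.weight p j) (wpo μ) (𝓝 (l.q0 j))
  rotation : ∀ j, Tendsto (fun p => E.Zmat l p j) (wpo μ) (𝓝 1)
  eig : ∀ j b, Tendsto (fun p => E.eig p j b) (wpo μ) (𝓝 (l.v j b))

/-! ### Limits of the loadings and of the rotations. -/

section RotationLimits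

set_option linter.unusedSectionVars false

variable {μ : Measure Ω} [IsProbabilityMeasure μ] {m : Model Ω} {l : Limits m} {α β : ℝ}
  {E : Estimators m} {c C a : ℝ}

theorem Setting.exists_asymptotics (S : Setting μ m l α β E) :
    ∃ c C a : ℝ, Asymptotics μ l E c C a := by
  obtain ⟨c, C, hc, hc1, hC, hup, hreg⟩ := S.exists_regular
  obtain ⟨ρ, -, hρ, -, hdis⟩ := S.exists_discrepancy hc hc1 hC hup hreg
  obtain ⟨a, ha, hcl⟩ := S.exists_classification hc hc1 hC hup hreg
  have h : ∀ j, _ := fun j => S.tendsto_Z_eig hc hC hup hreg hρ ha hcl j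
    (hdis.mono fun p hp => (hp j).2.1)
  exact ⟨c, C, a, {
    c_pos := hc
    C_pos := hC
    a_pos := ha
    upper := hup
    regular := hreg
    classified := hcl
    misfit := S.op_misfit hc hC hup hreg ha hcl
    weight := S.tendsto_weight hc hC hreg ha hcl
    rotation := fun j => (h j).1
    eig := fun j => (h j).2 }⟩

theorem Asymptotics.tendsto_diagonal_sqrt_eig (A : Asymptotics μ l E c C a) (j : Fin m.J) :
    Tendsto (fun p => diagonal fun b => √(E.eig p j b)) (wpo μ)
      (𝓝 (diagonal fun b => √(l.v j b))) := by
  refine tendsto_matrix_iff.2 fun b b' => ?_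
  by_cases h : b = b'
  · subst h
    simp only [diagonal_apply_eq]
    exact (A.eig j b).sqrt
  · simp only [diagonal_apply_ne _ h]
    exact tendsto_const_nhds

theorem Asymptotics.tendsto_diagonal_eig (A : Asymptotics μ l E c C a) (j : Fin m.J) :
    Tendsto (fun p => diagonal (E.eig p j)) (wpo μ) (𝓝 (diagonal (l.v j))) := by
  refine tendsto_matrix_iff.2 fun b b' => ?_
  by_cases h : b = b'
  · subst h
    simp only [diagonal_apply_eq]
    exact A.eig j b
  · simp only [diagonal_apply_ne _ h]
    exact tendsto_const_nhds

theorem Regular.L_eq (hC : 0 < C) {p : ℕ × Ω} (h : Regular l E c C p) (j : Fin m.J) :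
    E.L p.1 p.2 j = √(E.N p.1 : ℝ) • (unitLoadings (E.L p.1 p.2 j) (E.s2 p.1 p.2) *
      diagonal fun b => √(E.eig p j b)) := by
  have hN : (0 : ℝ) < E.N p.1 := by exact_mod_cast h.N_pos
  conv_lhs => rw [← unitLoadings_mul_diagonal (L := E.L p.1 p.2 j) (h.s_pos hC)]
  rw [← Matrix.mul_smul, ← diagonal_smul]
  congr 2
  funext b
  rw [Pi.smul_apply, smul_eq_mul, ← Real.sqrt_mul hN.le]
  congr 1
  unfold Estimators.eig
  rw [← mul_assoc, mul_inv_cancel₀ hN.ne', one_mul]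

theorem Regular.gramB_eq_eig {p : ℕ × Ω} (h : Regular l E c C p) (j : Fin m.J) :
    gramB (E.L p.1 p.2 j) (E.s2 p.1 p.2) = (E.N p.1 : ℝ) • diagonal (E.eig p j) := by
  have hN : (E.N p.1 : ℝ) ≠ 0 := by exact_mod_cast h.N_pos.ne'
  rw [(h.gramDiag j).gramB_eq, ← diagonal_smul]
  congr 1
  funext b
  simp only [Estimators.eig, Pi.smul_apply, smul_eq_mul]
  rw [← mul_assoc, mul_inv_cancel₀ hN, one_mul]

/-- `W_j` at the sample point `p`. -/
def Estimators.W (E : Estimators m) (p : ℕ × Ω) (j : Fin m.J) :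
    Matrix (Fin (m.r j)) (Fin (m.r j)) ℝ :=
  Wmat m (E.N p.1) (E.T p.1) p.2 (E.L p.1 p.2) (E.s2 p.1 p.2) (E.q p.1 p.2) j

theorem Regular.W_eq {p : ℕ × Ω} (h : Regular l E c C p) (j : Fin m.J) :
    E.W p j = E.weight p j • diagonal (E.eig p j) := by
  have hN : (E.N p.1 : ℝ) ≠ 0 := by exact_mod_cast h.N_pos.ne'
  have h1 : (E.N p.1 : ℝ)⁻¹ • gramB (E.L p.1 p.2 j) (E.s2 p.1 p.2) = diagonal (E.eig p j) := by
    rw [h.gramB_eq_eig, smul_smul, inv_mul_cancel₀ hN, one_smul]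
  rw [← h1]
  unfold gramB Estimators.W Wmat Estimators.weight
  rw [smul_add ((E.N p.1 : ℝ)⁻¹), smul_smul ((E.N p.1 : ℝ)⁻¹) (E.s2 p.1 p.2), inv_mul_eq_div (E.N p.1 : ℝ)]
  rfl

theorem Asymptotics.tendsto_W (A : Asymptotics μ l E c C a) (j : Fin m.J) :
    Tendsto (fun p => E.W p j) (wpo μ) (𝓝 (l.q0 j • diagonal (l.v j))) := by
  refine ((A.weight j).smul (A.tendsto_diagonal_eig j)).congr' ?_
  filter_upwards [A.regular] with p h using (h.W_eq j).symm

theorem Asymptotics.tendsto_cross (S : Setting μ m l α β E) (A : Asymptotics μ l E c C a)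
    (j : Fin m.J) : Tendsto (fun p => (E.N p.1 : ℝ)⁻¹ • ((m.Lam (E.N p.1) j)ᵀ * E.L p.1 p.2 j))
      (wpo μ) (𝓝 (l.color j * diagonal fun b => √(l.v j b))) := by
  have h1 := ((tendsto_const_nhds (x := l.color j)).mul (A.rotation j)).mul
    (A.tendsto_diagonal_sqrt_eig j)
  rw [Matrix.mul_one] at h1
  refine h1.congr' ?_
  filter_upwards [A.regular] with p h
  have hN : (0 : ℝ) < E.N p.1 := by exact_mod_cast h.N_pos
  have h2 : (E.N p.1 : ℝ)⁻¹ * √(E.N p.1 : ℝ) = (√(E.N p.1 : ℝ))⁻¹ := by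
    nth_rewrite 1 [← Real.mul_self_sqrt hN.le]
    have := (Real.sqrt_pos.2 hN).ne'
    field_simp
  unfold Estimators.Zmat
  conv_rhs => rw [h.L_eq A.C_pos j]
  rw [Matrix.mul_smul, Matrix.mul_smul, smul_smul, h2, Matrix.smul_mul,
    Matrix.mul_assoc (l.whiten j), ← Matrix.mul_assoc (l.color j),
    S.loading.color_mul_whiten S.eigen, Matrix.one_mul, Matrix.mul_assoc]

theorem Setting.eigenvalue_pos (S : Setting μ m l α β E) (j : Fin m.J) (b : Fin (m.r j)) :
    0 < l.v j b :=
  SwitchingFactor.eigenvalue_pos S.loading S.eigen S.factor.posDef j b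

theorem Setting.isUnit_limit_W (S : Setting μ m l α β E) (j : Fin m.J) :
    IsUnit (l.q0 j • diagonal (l.v j)).det := by
  rw [det_smul, det_diagonal]
  exact isUnit_iff_ne_zero.2 (mul_ne_zero (pow_ne_zero _ (S.state.pos j).ne')
    (Finset.prod_ne_zero_iff.2 fun b _ => (S.eigenvalue_pos j b).ne'))

theorem Setting.isUnit_Hlim (S : Setting μ m l α β E) (j : Fin m.J) : IsUnit (l.Hlim j).det := by
  unfold Limits.Hlim
  rw [det_mul, det_mul, det_diagonal]
  refine ((Matrix.isUnit_nonsing_inv_det _ (S.loading.isUnit_root j)).mul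
    (Matrix.isUnit_det_of_left_inverse (S.eigen.orthogonal j))).mul ?_
  exact isUnit_iff_ne_zero.2 (Finset.prod_ne_zero_iff.2 fun b _ =>
    (Real.sqrt_pos.2 (S.eigenvalue_pos j b)).ne')

/-- The spectral decomposition gives `Σ_F Σ_Λ^{1/2} Υ = Σ_Λ^{-1/2} Υ V`; the factor `V` and the
frequency `q0` cancel against the limit of `W`. -/
theorem Setting.Hlim_eq (S : Setting μ m l α β E) (j : Fin m.J) :
    (l.q0 j • l.SigF j) * (l.color j * diagonal fun b => √(l.v j b)) *
      (l.q0 j • diagonal (l.v j))⁻¹ = l.Hlim j := by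
  have hq := (S.state.pos j).ne'
  have h1 : l.SigF j * l.color j = (l.root j)⁻¹ * l.Ups j * diagonal (l.v j) := by
    have h2 := S.eigen.color_conj j
    have h3 : (l.root j)⁻¹ * l.Ups j * (l.color j)ᵀ = 1 := by
      unfold Limits.color
      rw [transpose_mul, l.root_transpose, Matrix.mul_assoc, ← Matrix.mul_assoc (l.Ups j),
        S.eigen.Ups_mul_transpose, Matrix.one_mul, Matrix.nonsing_inv_mul _ (S.loading.isUnit_root j)]
    rw [← h2, ← Matrix.mul_assoc, ← Matrix.mul_assoc, h3, Matrix.one_mul]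
  have hcomm : diagonal (l.v j) * (diagonal fun b => √(l.v j b)) =
      (diagonal fun b => √(l.v j b)) * diagonal (l.v j) := by
    rw [diagonal_mul_diagonal, diagonal_mul_diagonal]
    congr 1; funext b; ring
  have h4 : (l.q0 j • l.SigF j) * (l.color j * diagonal fun b => √(l.v j b)) =
      l.Hlim j * (l.q0 j • diagonal (l.v j)) := by
    unfold Limits.Hlim
    rw [Matrix.smul_mul, ← Matrix.mul_assoc, h1, Matrix.mul_smul, Matrix.mul_assoc _ (diagonal _),
      hcomm, ← Matrix.mul_assoc]
  rw [h4, Matrix.mul_assoc, Matrix.mul_nonsing_inv _ (S.isUnit_limit_W j), Matrix.mul_one]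

theorem Asymptotics.tendsto_H (S : Setting μ m l α β E) (A : Asymptotics μ l E c C a)
    (j : Fin m.J) : Tendsto (fun p : ℕ × Ω => E.H p.1 p.2 j) (wpo μ) (𝓝 (l.Hlim j)) := by
  have h := ((S.tendsto_Phi j).mul (A.tendsto_cross S j)).mul
    (tendsto_matrix_inv (A.tendsto_W j) (S.isUnit_limit_W j))
  rw [S.Hlim_eq] at h
  exact h

/-- The part of the estimated loadings that is not a rotation of the true loadings. -/
def Estimators.Dev (E : Estimators m) (p : ℕ × Ω) (j : Fin m.J) :
    Matrix (Fin (E.N p.1)) (Fin (m.r j)) ℝ :=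
  E.L p.1 p.2 j - m.Lam (E.N p.1) j * E.H p.1 p.2 j

/-- By the eigenvalue equation `L̂ = N⁻¹ S L̂ W⁻¹`, and the signal part of the right side is `ΛH`:
this is what the definition of `H` is made for. Only noise and misfit are left. -/
theorem Regular.Dev_eq (hc : 0 < c) (hC : 0 < C) {p : ℕ × Ω} (h : Regular l E c C p) (j : Fin m.J)
    (hW : IsUnit (E.W p j).det) :
    E.Dev p j = (E.N p.1 : ℝ)⁻¹ • (E.resid p j * E.L p.1 p.2 j * (E.W p j)⁻¹) := by
  have hN : (E.N p.1 : ℝ) ≠ 0 := by exact_mod_cast h.N_pos.ne'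
  have h1 : E.second p j * E.L p.1 p.2 j = (E.N p.1 : ℝ) • (E.L p.1 p.2 j * E.W p j) := by
    rw [h.second_mul hc hC, h.gramB_eq_eig, h.W_eq, Matrix.mul_smul, Matrix.mul_smul, smul_comm]
  have h2 : E.L p.1 p.2 j = (E.N p.1 : ℝ)⁻¹ • (E.second p j * E.L p.1 p.2 j * (E.W p j)⁻¹) := by
    rw [h1, Matrix.smul_mul, smul_smul, inv_mul_cancel₀ hN, one_smul, Matrix.mul_assoc,
      Matrix.mul_nonsing_inv _ hW, Matrix.mul_one]
  have h3 : E.H p.1 p.2 j = E.Phi p j * ((E.N p.1 : ℝ)⁻¹ • ((m.Lam (E.N p.1) j)ᵀ *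
      E.L p.1 p.2 j)) * (E.W p j)⁻¹ := rfl
  have h4 : E.second p j * E.L p.1 p.2 j = m.Lam (E.N p.1) j * (E.Phi p j *
      ((m.Lam (E.N p.1) j)ᵀ * E.L p.1 p.2 j)) + E.resid p j * E.L p.1 p.2 j := by
    rw [E.second_eq, add_assoc, Matrix.add_mul]
    simp only [Matrix.mul_assoc]
    rfl
  unfold Estimators.Dev
  rw [h3]
  nth_rewrite 1 [h2]
  rw [h4]
  simp only [Matrix.add_mul, smul_add, Matrix.mul_smul, Matrix.smul_mul, Matrix.mul_assoc]
  abel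

theorem op_norm_of_tendsto {k n : ℕ} {X : ℕ × Ω → Matrix (Fin k) (Fin n) ℝ}
    {x : Matrix (Fin k) (Fin n) ℝ} (h : Tendsto X (wpo μ) (𝓝 x)) :
    Op μ (fun p => ‖X p‖) (fun _ => 1) := Op.of_tendsto h.norm

theorem Asymptotics.op_H (S : Setting μ m l α β E) (A : Asymptotics μ l E c C a)
    (j : Fin m.J) : Op μ (fun p : ℕ × Ω => ‖E.H p.1 p.2 j‖) (fun _ => 1) :=
  op_norm_of_tendsto (A.tendsto_H S j)

theorem Asymptotics.tendsto_H_inv (S : Setting μ m l α β E) (A : Asymptotics μ l E c C a)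
    (j : Fin m.J) : Tendsto (fun p : ℕ × Ω => (E.H p.1 p.2 j)⁻¹) (wpo μ) (𝓝 (l.Hlim j)⁻¹) :=
  tendsto_matrix_inv (A.tendsto_H S j) (S.isUnit_Hlim j)

theorem Asymptotics.op_W_inv (S : Setting μ m l α β E) (A : Asymptotics μ l E c C a)
    (j : Fin m.J) : Op μ (fun p : ℕ × Ω => ‖(E.W p j)⁻¹‖) (fun _ => 1) :=
  op_norm_of_tendsto (tendsto_matrix_inv (A.tendsto_W j) (S.isUnit_limit_W j))

theorem Asymptotics.op_L (A : Asymptotics μ l E c C a) (j : Fin m.J) :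
    Op μ (fun p : ℕ × Ω => ‖E.L p.1 p.2 j‖) (fun n => √(E.N n : ℝ)) := by
  have h := (op_norm_of_tendsto (A.tendsto_diagonal_sqrt_eig j)).det_mul
    (a' := fun n => √(E.N n : ℝ))
  refine (h.rate (C := 1) (Eventually.of_forall fun n => by
    rw [abs_of_nonneg (Real.sqrt_nonneg _), mul_one, one_mul]) one_pos).mono ?_
  filter_upwards [A.regular] with p h
  refine abs_le_abs_of_nonneg (norm_nonneg _) ?_
  conv_lhs => rw [h.L_eq A.C_pos j]
  rw [norm_smul, Real.norm_eq_abs, abs_of_nonneg (Real.sqrt_nonneg _)]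
  refine mul_le_mul_of_nonneg_left ?_ (Real.sqrt_nonneg _)
  refine (norm_mul_le_opNorm _ _).trans ?_
  exact mul_le_of_le_one_left (norm_nonneg _) ((h.gramDiag j).norm_unitLoadings_le (h.s_pos A.C_pos))

theorem Asymptotics.op_Lam (A : Asymptotics μ l E c C a) (j : Fin m.J) :
    Op μ (fun p : ℕ × Ω => ‖m.Lam (E.N p.1) j‖) (fun n => √(E.N n : ℝ)) := by
  refine (Op.of_atTop_le (μ := μ) (a' := fun n => ‖m.Lam (E.N n) j‖)
    (c := fun n => √C * √(E.N n : ℝ)) (Eventually.of_forall fun n => ?_)).rate (C := √C)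
    (Eventually.of_forall fun n => le_rfl) (Real.sqrt_pos.2 A.C_pos)
  rw [abs_of_nonneg (norm_nonneg _), ← Real.sqrt_mul A.C_pos.le]
  exact Real.le_sqrt_of_sq_le ((norm_sq_le_frobSq _).trans (A.upper _ j))

/-- The rotations are invertible with probability approaching one. -/
theorem Asymptotics.tendsto_measure_not_isUnit (S : Setting μ m l α β E)
    (A : Asymptotics μ l E c C a) (j : Fin m.J) :
    Tendsto (fun n => μ {ω | ¬ IsUnit (E.H n ω j)}) atTop (𝓝 0) := by
  refine (eventually_wpo (P := fun p => IsUnit (E.H p.1 p.2 j))).1 ?_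
  filter_upwards [eventually_isUnit_of_tendsto (A.tendsto_H S j) (S.isUnit_Hlim j)] with p h
  exact (Matrix.isUnit_iff_isUnit_det _).2 h

end RotationLimits

/-! ### Rates of convergence of the estimated loadings -/

section LoadingRates

set_option linter.unusedSectionVars false

variable {μ : Measure Ω} [IsProbabilityMeasure μ] {m : Model Ω} {l : Limits m} {α β : ℝ}
  {E : Estimators m} {c C a : ℝ}

/-- The product of the errors and the factors of regime `j`. -/
def Estimators.EF (E : Estimators m) (p : ℕ × Ω) (j : Fin m.J) :
    Matrix (Fin (E.N p.1)) (Fin (m.r j)) ℝ :=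
  m.Emat (E.N p.1) (E.T p.1) p.2 j * m.Fmat (E.T p.1) p.2 j

/-- The Gram matrix of the errors of regime `j`. -/
def Estimators.EE (E : Estimators m) (p : ℕ × Ω) (j : Fin m.J) :
    Matrix (Fin (E.N p.1)) (Fin (E.N p.1)) ℝ :=
  m.Emat (E.N p.1) (E.T p.1) p.2 j * (m.Emat (E.N p.1) (E.T p.1) p.2 j)ᵀ

theorem Estimators.noise_eq (E : Estimators m) (p : ℕ × Ω) (j : Fin m.J) :
    E.noise p j = (E.T p.1 : ℝ)⁻¹ • (m.Lam (E.N p.1) j * (E.EF p j)ᵀ +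
      E.EF p j * (m.Lam (E.N p.1) j)ᵀ + E.EE p j) := rfl

theorem Estimators.EE_transpose (E : Estimators m) (p : ℕ × Ω) (j : Fin m.J) :
    (E.EE p j)ᵀ = E.EE p j := by
  unfold Estimators.EE
  rw [transpose_mul, transpose_transpose]

theorem Estimators.noise_transpose (E : Estimators m) (p : ℕ × Ω) (j : Fin m.J) :
    (E.noise p j)ᵀ = E.noise p j := by
  rw [E.noise_eq, transpose_smul, transpose_add, transpose_add, transpose_mul, transpose_mul,
    E.EE_transpose, transpose_transpose, transpose_transpose, add_comm (E.EF p j * _)]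

theorem Setting.eventually_sqrt_rates (S : Setting μ m l α β E) : ∀ᶠ n in atTop,
    1 ≤ delta (E.N n) (E.T n) ∧ delta (E.N n) (E.T n) ≤ √(E.N n : ℝ) ∧
      delta (E.N n) (E.T n) ≤ √(E.T n : ℝ) ∧ (E.N n : ℝ) = √(E.N n : ℝ) * √(E.N n : ℝ) ∧
      (E.T n : ℝ) = √(E.T n : ℝ) * √(E.T n : ℝ) :=
  (tendsto_atTop.1 (tendsto_delta S.hN S.hT) 1).mono fun _ h => ⟨h, min_le_left _ _,
    min_le_right _ _, (Real.mul_self_sqrt (Nat.cast_nonneg _)).symm,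
    (Real.mul_self_sqrt (Nat.cast_nonneg _)).symm⟩

theorem Setting.op_EF (S : Setting μ m l α β E) (j : Fin m.J) :
    Op μ (fun p => ‖E.EF p j‖) (fun n => √(E.N n : ℝ) * √(E.T n : ℝ)) := by
  have h := (op_error_factor S.moment S.hN S.hT j).sqrt (fun _ => frobSq_nonneg _)
    (fun n => by positivity)
  simp only [Real.sqrt_mul (Nat.cast_nonneg _)] at h
  exact h.mono (Eventually.of_forall fun p => abs_le_abs_of_nonneg (norm_nonneg _)
    (norm_le_sqrt_frobSq _))

theorem Setting.op_Lam_EF (S : Setting μ m l α β E) (j : Fin m.J) :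
    Op μ (fun p => ‖(m.Lam (E.N p.1) j)ᵀ * E.EF p j‖) (fun n => √(E.N n : ℝ) * √(E.T n : ℝ)) := by
  have h := (op_loading_error_factor S.dist S.hN S.hT j).sqrt (fun _ => frobSq_nonneg _)
    (fun n => by positivity)
  simp only [Real.sqrt_mul (Nat.cast_nonneg _)] at h
  exact h.mono (Eventually.of_forall fun p => abs_le_abs_of_nonneg (norm_nonneg _)
    (norm_le_sqrt_frobSq _))

theorem Setting.op_EE (S : Setting μ m l α β E) (j : Fin m.J) :
    Op μ (fun p => ‖E.EE p j‖) (fun n => (E.N n : ℝ) * E.T n / delta (E.N n) (E.T n)) := by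
  have h := (op_error_gram S.error S.hN S.hT j).sqrt (fun _ => frobSq_nonneg _)
    (fun n => sq_nonneg _)
  simp only [fun n => Real.sqrt_sq (div_nonneg (mul_nonneg (Nat.cast_nonneg (α := ℝ) (E.N n))
    (Nat.cast_nonneg (E.T n))) (delta_nonneg (E.N n) (E.T n)))] at h
  exact h.mono (Eventually.of_forall fun p => abs_le_abs_of_nonneg (norm_nonneg _)
    (norm_le_sqrt_frobSq _))

theorem Setting.op_EE_Lam (S : Setting μ m l α β E) (j : Fin m.J) :
    Op μ (fun p => ‖E.EE p j * m.Lam (E.N p.1) j‖)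
      (fun n => √(E.N n : ℝ) * √(E.T n : ℝ) * (√(E.N n : ℝ) + √(E.T n : ℝ))) := by
  have h := (op_error_gram_loading S.loading S.error S.dist S.hN S.hT j).sqrt
    (fun _ => frobSq_nonneg _) (fun n => by positivity)
  refine (h.rate (C := 1) ?_ one_pos).mono (Eventually.of_forall fun p =>
    abs_le_abs_of_nonneg (norm_nonneg _) (norm_le_sqrt_frobSq _))
  filter_upwards [S.eventually_sqrt_rates] with n ⟨_, _, _, h1, h2⟩
  rw [one_mul]
  refine Real.sqrt_le_iff.2 ⟨by positivity, ?_⟩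
  rw [h1, h2]
  simp only [Real.sqrt_mul_self (Real.sqrt_nonneg _)]
  set x := √(E.N n : ℝ)
  set y := √(E.T n : ℝ)
  have hx : 0 ≤ x := Real.sqrt_nonneg _
  have hy : 0 ≤ y := Real.sqrt_nonneg _
  have : 0 ≤ x ^ 3 * y ^ 3 := by positivity
  nlinarith

theorem Asymptotics.op_Dev (S : Setting μ m l α β E) (A : Asymptotics μ l E c C a)
    (j : Fin m.J) :
    Op μ (fun p => ‖E.Dev p j‖) (fun n => √(E.N n : ℝ) / delta (E.N n) (E.T n)) := by
  have h := ((S.op_resid A.C_pos A.upper j (A.misfit j)).mul (A.op_L j)).mul (A.op_W_inv S j)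
  have h2 := (h.det_mul (a' := fun n => (E.N n : ℝ)⁻¹)).rate
    (c := fun n => √(E.N n : ℝ) / delta (E.N n) (E.T n)) (C := 1) (by
      filter_upwards [eventually_pos S.hN] with n hn
      have hN : (0 : ℝ) < E.N n := by exact_mod_cast hn
      rw [abs_of_pos (inv_pos.2 hN)]
      exact le_of_eq (by field_simp)) one_pos
  refine h2.mono ?_
  filter_upwards [A.regular, eventually_isUnit_of_tendsto (A.tendsto_W j) (S.isUnit_limit_W j)]
    with p hp hW
  refine abs_le_abs_of_nonneg (norm_nonneg _) ?_
  rw [hp.Dev_eq A.c_pos A.C_pos j hW, norm_smul, Real.norm_eq_abs, abs_of_nonneg (by positivity)]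
  refine mul_le_mul_of_nonneg_left ?_ (by positivity)
  exact (norm_mul_le_opNorm _ _).trans (mul_le_mul_of_nonneg_right (norm_mul_le_opNorm _ _)
    (norm_nonneg _))

theorem Estimators.L_eq_Dev (E : Estimators m) (p : ℕ × Ω) (j : Fin m.J) :
    E.L p.1 p.2 j = m.Lam (E.N p.1) j * E.H p.1 p.2 j + E.Dev p j := by
  unfold Estimators.Dev
  abel

/-- Splitting `L̂ = ΛH + Dev` gains a factor `δ` over the product of norms `√N · √(NT)`: for the
first part because `Λ'EF` is itself of order `√(NT)`, for the second because `Dev` is small. -/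
theorem Asymptotics.op_L_EF (S : Setting μ m l α β E) (A : Asymptotics μ l E c C a)
    (j : Fin m.J) : Op μ (fun p => ‖(E.L p.1 p.2 j)ᵀ * E.EF p j‖)
      (fun n => E.N n * √(E.T n : ℝ) / delta (E.N n) (E.T n)) := by
  have h1 := ((A.op_H S j).mul (S.op_Lam_EF j)).rate
    (c := fun n => E.N n * √(E.T n : ℝ) / delta (E.N n) (E.T n)) (C := 1) (by
      filter_upwards [S.eventually_sqrt_rates] with n ⟨h0, h1, h2, h3, h4⟩
      rw [one_mul, one_mul, le_div_iff₀ (by linarith)]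
      have h5 := mul_le_mul_of_nonneg_left h1
        (mul_nonneg (Real.sqrt_nonneg (E.N n : ℝ)) (Real.sqrt_nonneg (E.T n : ℝ)))
      calc _ ≤ _ := h5
        _ = (√(E.N n : ℝ) * √(E.N n : ℝ)) * √(E.T n : ℝ) := by ring
        _ = _ := by rw [← h3]) one_pos
  have h2 := ((A.op_Dev S j).mul (S.op_EF j)).rate
    (c := fun n => E.N n * √(E.T n : ℝ) / delta (E.N n) (E.T n)) (C := 1) (by
      filter_upwards [S.eventually_sqrt_rates] with n ⟨h0, h1, h2, h3, h4⟩
      refine le_of_eq ?_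
      calc _ = √(E.N n : ℝ) * √(E.N n : ℝ) * √(E.T n : ℝ) / delta (E.N n) (E.T n) := by ring
        _ = _ := by rw [← h3, one_mul]) one_pos
  refine (h1.add h2).mono (Eventually.of_forall fun p => abs_le_abs_of_nonneg (norm_nonneg _) ?_)
  conv_lhs => rw [E.L_eq_Dev, transpose_add, transpose_mul, Matrix.add_mul, Matrix.mul_assoc]
  refine (norm_add_le _ _).trans (add_le_add ?_ ?_)
  · refine (norm_mul_le_opNorm _ _).trans ?_
    rw [norm_transpose_eq]
  · refine (norm_mul_le_opNorm _ _).trans ?_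
    rw [norm_transpose_eq]

/-- The same splitting: against the true loadings the Gram matrix of the errors averages out, and
against `Dev` a second factor `1/δ` is gained. -/
theorem Asymptotics.op_EE_L (S : Setting μ m l α β E) (A : Asymptotics μ l E c C a)
    (j : Fin m.J) : Op μ (fun p => ‖E.EE p j * E.L p.1 p.2 j‖)
      (fun n => √(E.N n : ℝ) * √(E.T n : ℝ) * (√(E.N n : ℝ) + √(E.T n : ℝ)) +
        (E.N n : ℝ) * E.T n / delta (E.N n) (E.T n) * (√(E.N n : ℝ) / delta (E.N n) (E.T n))) := by
  have h1 := ((S.op_EE_Lam j).mul (A.op_H S j)).rate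
    (c := fun n => √(E.N n : ℝ) * √(E.T n : ℝ) * (√(E.N n : ℝ) + √(E.T n : ℝ)) +
      (E.N n : ℝ) * E.T n / delta (E.N n) (E.T n) * (√(E.N n : ℝ) / delta (E.N n) (E.T n)))
    (C := 1) (Eventually.of_forall fun n => by
      rw [mul_one, one_mul]
      have := delta_nonneg (E.N n) (E.T n)
      exact le_add_of_nonneg_right (by positivity)) one_pos
  have h2 := ((S.op_EE j).mul (A.op_Dev S j)).rate
    (c := fun n => √(E.N n : ℝ) * √(E.T n : ℝ) * (√(E.N n : ℝ) + √(E.T n : ℝ)) +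
      (E.N n : ℝ) * E.T n / delta (E.N n) (E.T n) * (√(E.N n : ℝ) / delta (E.N n) (E.T n)))
    (C := 1) (Eventually.of_forall fun n => by
      rw [one_mul]
      exact le_add_of_nonneg_left (by positivity)) one_pos
  refine (h1.add h2).mono (Eventually.of_forall fun p => abs_le_abs_of_nonneg (norm_nonneg _) ?_)
  conv_lhs => rw [E.L_eq_Dev, Matrix.mul_add, ← Matrix.mul_assoc]
  exact (norm_add_le _ _).trans (add_le_add (norm_mul_le_opNorm _ _) (norm_mul_le_opNorm _ _))

theorem norm_mul₃_le {k1 k2 k3 k4 : ℕ} (A : Matrix (Fin k1) (Fin k2) ℝ)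
    (B : Matrix (Fin k2) (Fin k3) ℝ) (D : Matrix (Fin k3) (Fin k4) ℝ) :
    ‖A * (B * D)‖ ≤ ‖A‖ * ‖B‖ * ‖D‖ := by
  rw [mul_assoc]
  exact (norm_mul_le_opNorm _ _).trans
    (mul_le_mul_of_nonneg_left (norm_mul_le_opNorm _ _) (norm_nonneg _))

/-- The product of norms would give only `N/δ`. Expanding `Dev` and using the refined bounds on
`L̂'EF`, `Λ'EF` and `EE Λ` gains the second factor `1/δ`. -/
theorem Asymptotics.op_Lam_Dev (S : Setting μ m l α β E) (A : Asymptotics μ l E c C a)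
    (j : Fin m.J) : Op μ (fun p => ‖(m.Lam (E.N p.1) j)ᵀ * E.Dev p j‖)
      (fun n => E.N n / delta (E.N n) (E.T n) ^ 2) := by
  -- Arithmetic of rates only: `X1`, `X2`, `X3` stand for the three noise terms and `X4` for the
  -- misfit.
  have hinner : ∀ X1 X2 X3 X4 : ℕ × Ω → ℝ,
      Op μ X1 (fun n => √(E.N n : ℝ) * √(E.N n : ℝ) * (E.N n * √(E.T n : ℝ) / delta (E.N n) (E.T n))) →
      Op μ X2 (fun n => √(E.N n : ℝ) * √(E.T n : ℝ) * (√(E.N n : ℝ) * √(E.N n : ℝ))) →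
      Op μ X3 (fun n => √(E.N n : ℝ) * √(E.T n : ℝ) * (√(E.N n : ℝ) + √(E.T n : ℝ)) *
        √(E.N n : ℝ)) →
      Op μ X4 (fun n => √(E.N n : ℝ) * 1 * √(E.N n : ℝ)) →
      Op μ (fun p => (E.N p.1 : ℝ)⁻¹ * ((E.T p.1 : ℝ)⁻¹ * (X1 p + X2 p + X3 p) + X4 p))
        (fun n => E.N n / delta (E.N n) (E.T n) ^ 2) := by
    intro X1 X2 X3 X4 h1 h2 h3 h4
    have hr : ∀ᶠ n in atTop, 0 < delta (E.N n) (E.T n) ∧ 0 < √(E.N n : ℝ) ∧ 0 < √(E.T n : ℝ) ∧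
        delta (E.N n) (E.T n) ≤ √(E.N n : ℝ) ∧
      delta (E.N n) (E.T n) ≤ √(E.T n : ℝ) ∧ (E.N n : ℝ) = √(E.N n : ℝ) * √(E.N n : ℝ) ∧
      (E.T n : ℝ) = √(E.T n : ℝ) * √(E.T n : ℝ) := by
      filter_upwards [S.eventually_sqrt_rates] with n ⟨h0, h1, h2, h3, h4⟩
      exact ⟨by linarith, by linarith, by linarith, h1, h2, h3, h4⟩
    have g1 := (h1.det_mul (a' := fun n => ((E.N n : ℝ) * E.T n)⁻¹)).rate
      (c := fun n => E.N n / delta (E.N n) (E.T n) ^ 2) (C := 1) (by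
        filter_upwards [hr] with n ⟨hd, hx, hy, hdx, hdy, hN, hT⟩
        rw [abs_of_nonneg (by positivity)]
        set x := √(E.N n : ℝ)
        set y := √(E.T n : ℝ)
        set d := delta (E.N n) (E.T n)
        rw [hN, hT, one_mul]
        have e1 : (x * x * (y * y))⁻¹ * (x * x * (x * x * y / d)) = x * x / (y * d) := by
          field_simp
        rw [e1, pow_two]
        gcongr) one_pos
    have g2 := (h2.det_mul (a' := fun n => ((E.N n : ℝ) * E.T n)⁻¹)).rate
      (c := fun n => E.N n / delta (E.N n) (E.T n) ^ 2) (C := 1) (by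
        filter_upwards [hr] with n ⟨hd, hx, hy, hdx, hdy, hN, hT⟩
        rw [abs_of_nonneg (by positivity)]
        set x := √(E.N n : ℝ)
        set y := √(E.T n : ℝ)
        set d := delta (E.N n) (E.T n)
        rw [hN, hT, one_mul]
        have e1 : (x * x * (y * y))⁻¹ * (x * y * (x * x)) = x * x / (x * y) := by
          field_simp
        rw [e1, pow_two]
        gcongr) one_pos
    have g3 := (h3.det_mul (a' := fun n => ((E.N n : ℝ) * E.T n)⁻¹)).rate
      (c := fun n => E.N n / delta (E.N n) (E.T n) ^ 2) (C := 2) (by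
        filter_upwards [hr] with n ⟨hd, hx, hy, hdx, hdy, hN, hT⟩
        rw [abs_of_nonneg (by positivity)]
        set x := √(E.N n : ℝ)
        set y := √(E.T n : ℝ)
        set d := delta (E.N n) (E.T n)
        rw [hN, hT]
        have e1 : (x * x * (y * y))⁻¹ * (x * y * (x + y) * x) = x * x / (x * y) + x * x / (x * x) := by
          field_simp
        rw [e1, pow_two, two_mul]
        gcongr) two_pos
    have g4 := (h4.det_mul (a' := fun n => (E.N n : ℝ)⁻¹)).rate
      (c := fun n => E.N n / delta (E.N n) (E.T n) ^ 2) (C := 1) (by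
        filter_upwards [hr] with n ⟨hd, hx, hy, hdx, hdy, hN, hT⟩
        rw [abs_of_nonneg (by positivity)]
        set x := √(E.N n : ℝ)
        set d := delta (E.N n) (E.T n)
        rw [hN, one_mul]
        have e1 : (x * x)⁻¹ * (x * 1 * x) = x * x / (x * x) := by
          field_simp
        rw [e1, pow_two]
        gcongr) one_pos
    refine (((g1.add g2).add g3).add g4).mono (Eventually.of_forall fun p => le_of_eq ?_)
    rw [mul_inv]
    ring_nf
  have h := (hinner _ _ _ _ (((A.op_Lam j).mul (A.op_Lam j)).mul (A.op_L_EF S j))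
    ((S.op_Lam_EF j).mul ((A.op_Lam j).mul (A.op_L j)))
    ((S.op_EE_Lam j).mul (A.op_L j)) (((A.op_Lam j).mul (A.misfit j)).mul (A.op_L j))).mul
      (A.op_W_inv S j)
  simp only [mul_one] at h
  refine h.mono ?_
  filter_upwards [A.regular, eventually_isUnit_of_tendsto (A.tendsto_W j) (S.isUnit_limit_W j)]
    with p hp hW
  refine abs_le_abs_of_nonneg (norm_nonneg _) ?_
  rw [hp.Dev_eq A.c_pos A.C_pos j hW, Matrix.mul_smul, norm_smul, Real.norm_eq_abs,
    abs_of_nonneg (by positivity), mul_assoc, ← Matrix.mul_assoc]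
  refine mul_le_mul_of_nonneg_left ?_ (by positivity)
  refine (norm_mul_le_opNorm _ _).trans (mul_le_mul_of_nonneg_right ?_ (norm_nonneg _))
  set Λ := m.Lam (E.N p.1) j
  set L := E.L p.1 p.2 j
  -- Products are grouped so that each contains a factor with a refined bound; by symmetry the Gram
  -- matrix of the errors is moved onto the true loadings.
  have e1 : Λᵀ * (E.resid p j * L) = (E.T p.1 : ℝ)⁻¹ • (Λᵀ * (Λ * (Lᵀ * E.EF p j)ᵀ) +
      (Λᵀ * E.EF p j) * (Λᵀ * L) + (E.EE p j * Λ)ᵀ * L) + Λᵀ * (E.misfit p j * L) := by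
    unfold Estimators.resid
    rw [E.noise_eq]
    simp only [transpose_mul, E.EE_transpose, transpose_transpose, Matrix.add_mul, Matrix.mul_add,
      Matrix.smul_mul, Matrix.mul_smul, Matrix.mul_assoc]
    rfl
  rw [e1]
  refine (norm_add_le _ _).trans (add_le_add ?_ ?_)
  · rw [norm_smul, Real.norm_eq_abs, abs_of_nonneg (by positivity)]
    refine mul_le_mul_of_nonneg_left ?_ (by positivity)
    refine norm_add₃_le.trans (add_le_add (add_le_add ?_ ?_) ?_)
    · refine (norm_mul₃_le _ _ _).trans ?_
      rw [norm_transpose_eq, norm_transpose_eq]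
    · refine (norm_mul₃_le _ _ _).trans ?_
      rw [norm_transpose_eq, mul_assoc]
    · refine (norm_mul_le_opNorm _ _).trans ?_
      rw [norm_transpose_eq]
  · refine (norm_mul₃_le _ _ _).trans ?_
    rw [norm_transpose_eq]

theorem Asymptotics.op_L_Dev (S : Setting μ m l α β E) (A : Asymptotics μ l E c C a)
    (j : Fin m.J) : Op μ (fun p => ‖(E.L p.1 p.2 j)ᵀ * E.Dev p j‖)
      (fun n => E.N n / delta (E.N n) (E.T n) ^ 2) := by
  have h1 := (A.op_H S j).mul (A.op_Lam_Dev S j)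
  simp only [one_mul] at h1
  have h2 := ((A.op_Dev S j).mul (A.op_Dev S j)).rate
    (c := fun n => E.N n / delta (E.N n) (E.T n) ^ 2) (C := 1)
    (Eventually.of_forall fun n => by
      rw [div_mul_div_comm, Real.mul_self_sqrt (Nat.cast_nonneg _), one_mul, pow_two]) one_pos
  refine (h1.add h2).mono (Eventually.of_forall fun p => abs_le_abs_of_nonneg (norm_nonneg _) ?_)
  conv_lhs => rw [E.L_eq_Dev, transpose_add, transpose_mul, Matrix.add_mul, Matrix.mul_assoc]
  refine (norm_add_le _ _).trans (add_le_add ?_ ?_)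
  · refine (norm_mul_le_opNorm _ _).trans ?_
    rw [norm_transpose_eq]
  · refine (norm_mul_le_opNorm _ _).trans ?_
    rw [norm_transpose_eq]

/-- The deviation of the estimated loadings is asymptotically orthogonal to the errors of a fixed
date. -/
theorem Asymptotics.tendsto_Dev_error (S : Setting μ m l α β E) (A : Asymptotics μ l E c C a)
    (j : Fin m.J) (t : ℕ) : Tendsto (fun p => (√(E.N p.1 : ℝ))⁻¹ *
      enorm2 ((E.Dev p j)ᵀ *ᵥ m.errVec (E.N p.1) p.2 t)) (wpo μ) (𝓝 0) := by
  have hα : (2 : ℝ) ≤ α := by linarith [S.hα]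
  -- The last summand comes from the expected products of errors at different dates and from
  -- `√N/δ²`; it is where `√N/T → 0` is needed.
  set κ : ℕ → ℝ := fun n => (√(E.N n : ℝ))⁻¹ + (√(E.T n : ℝ))⁻¹ + √(E.N n : ℝ) / E.T n with hκ
  have hκ0 : Tendsto κ atTop (𝓝 0) := by
    have h1 : Tendsto (fun n => (√(E.N n : ℝ))⁻¹) atTop (𝓝 0) :=
      (Real.tendsto_sqrt_atTop.comp (tendsto_natCast_atTop_atTop.comp S.hN)).inv_tendsto_atTop
    have h2 : Tendsto (fun n => (√(E.T n : ℝ))⁻¹) atTop (𝓝 0) :=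
      (Real.tendsto_sqrt_atTop.comp (tendsto_natCast_atTop_atTop.comp S.hT)).inv_tendsto_atTop
    simpa using (h1.add h2).add S.hNT
  have hr : ∀ᶠ n in atTop, 1 ≤ delta (E.N n) (E.T n) ∧ 0 < √(E.N n : ℝ) ∧ 0 < √(E.T n : ℝ) ∧
      delta (E.N n) (E.T n) ^ 2 = min (E.N n : ℝ) (E.T n) ∧
      (E.N n : ℝ) = √(E.N n : ℝ) * √(E.N n : ℝ) ∧
      (E.T n : ℝ) = √(E.T n : ℝ) * √(E.T n : ℝ) := by
    filter_upwards [S.eventually_sqrt_rates] with n ⟨h0, h1, h2, h3, h4⟩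
    exact ⟨by linarith, by linarith, by linarith, delta_sq _ _, h3, h4⟩
  have hinner : ∀ X1 X2 X3 X4 : ℕ × Ω → ℝ,
      Op μ X1 (fun n => √(E.N n : ℝ) * √(E.N n : ℝ) * (√((E.N n : ℝ) * E.T n) + E.N n)) →
      Op μ X2 (fun n => E.N n * √(E.T n : ℝ) / delta (E.N n) (E.T n) * √(E.N n : ℝ)) →
      Op μ X3 (fun n => (√(E.N n : ℝ) * √(E.T n : ℝ) * (√(E.N n : ℝ) + √(E.T n : ℝ)) +
        (E.N n : ℝ) * E.T n / delta (E.N n) (E.T n) * (√(E.N n : ℝ) / delta (E.N n) (E.T n))) *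
          √(E.N n : ℝ)) →
      Op μ X4 (fun n => √(E.N n : ℝ) * 1 * √(E.N n : ℝ)) →
      Op μ (fun p => (√(E.N p.1 : ℝ))⁻¹ * ((E.N p.1 : ℝ)⁻¹ *
        ((E.T p.1 : ℝ)⁻¹ * (X1 p + X2 p + X3 p) + X4 p))) κ := by
    intro X1 X2 X3 X4 h1 h2 h3 h4
    have g1 := (h1.det_mul (a' := fun n => (√(E.N n : ℝ) * (E.N n * E.T n))⁻¹)).rate
      (c := κ) (C := 1) (by
        filter_upwards [hr] with n ⟨hd, hx, hy, hdd, hN, hT⟩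
        rw [abs_of_nonneg (by positivity), Real.sqrt_mul (Nat.cast_nonneg _), one_mul, hκ]
        dsimp only
        set x := √(E.N n : ℝ)
        set y := √(E.T n : ℝ)
        rw [hN, hT]
        have e1 : (x * (x * x * (y * y)))⁻¹ * (x * x * (x * y + x * x)) = y⁻¹ + x / (y * y) := by
          field_simp
        rw [e1]
        have := inv_pos.2 hx
        linarith) one_pos
    have g2 := (h2.det_mul (a' := fun n => (√(E.N n : ℝ) * (E.N n * E.T n))⁻¹)).rate
      (c := κ) (C := 1) (by
        filter_upwards [hr] with n ⟨hd, hx, hy, hdd, hN, hT⟩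
        rw [abs_of_nonneg (by positivity), one_mul, hκ]
        dsimp only
        set x := √(E.N n : ℝ)
        set y := √(E.T n : ℝ)
        set d := delta (E.N n) (E.T n)
        rw [hN, hT]
        have hd0 : 0 < d := by linarith
        have e1 : (x * (x * x * (y * y)))⁻¹ * (x * x * y / d * x) = y⁻¹ * d⁻¹ := by
          field_simp
        rw [e1]
        have h5 : y⁻¹ * d⁻¹ ≤ y⁻¹ := mul_le_of_le_one_right (inv_pos.2 hy).le (inv_le_one_of_one_le₀ hd)
        have := inv_pos.2 hx
        have : 0 < x / (y * y) := by positivity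
        linarith) one_pos
    have g3 := (h3.det_mul (a' := fun n => (√(E.N n : ℝ) * (E.N n * E.T n))⁻¹)).rate
      (c := κ) (C := 2) (by
        filter_upwards [hr] with n ⟨hd, hx, hy, hdd, hN, hT⟩
        rw [abs_of_nonneg (by positivity), hκ]
        dsimp only
        have hdpos : 0 < delta (E.N n) (E.T n) := by linarith
        have e0 : √(E.N n : ℝ) / delta (E.N n) (E.T n) ^ 2 ≤ (√(E.N n : ℝ))⁻¹ + √(E.N n : ℝ) / E.T n := by
          rw [hdd]
          rcases le_total (E.N n : ℝ) (E.T n) with h | h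
          · rw [min_eq_left h]
            nth_rewrite 2 [hN]
            have : √(E.N n : ℝ) / (√(E.N n : ℝ) * √(E.N n : ℝ)) = (√(E.N n : ℝ))⁻¹ := by field_simp
            rw [this]
            exact le_add_of_nonneg_right (by positivity)
          · rw [min_eq_right h]
            exact le_add_of_nonneg_left (by positivity)
        set x := √(E.N n : ℝ)
        set y := √(E.T n : ℝ)
        set d := delta (E.N n) (E.T n)
        rw [hT] at e0
        rw [hN, hT]
        have e1 : (x * (x * x * (y * y)))⁻¹ * ((x * y * (x + y) + x * x * (y * y) / d * (x / d)) * x) =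
            x⁻¹ + y⁻¹ + x / d ^ 2 := by
          field_simp
          ring
        rw [e1]
        have := inv_pos.2 hx
        have := inv_pos.2 hy
        have : 0 < x / (y * y) := by positivity
        linarith) two_pos
    have g4 := (h4.det_mul (a' := fun n => (√(E.N n : ℝ) * E.N n)⁻¹)).rate
      (c := κ) (C := 1) (by
        filter_upwards [hr] with n ⟨hd, hx, hy, hdd, hN, hT⟩
        rw [abs_of_nonneg (by positivity), one_mul, hκ]
        dsimp only
        set x := √(E.N n : ℝ)
        rw [hN]
        have e1 : (x * (x * x))⁻¹ * (x * 1 * x) = x⁻¹ := by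
          field_simp
        rw [e1]
        have := inv_pos.2 hy
        have : 0 ≤ x / (E.T n : ℝ) := by positivity
        linarith) one_pos
    refine (((g1.add g2).add g3).add g4).mono (Eventually.of_forall fun p => le_of_eq ?_)
    simp only [mul_inv]
    ring_nf
  have h := (hinner _ _ _ _ (((A.op_L j).mul (A.op_Lam j)).mul
      (op_fixed_factor_error hα S.factor S.error S.dist S.hN S.hT t j))
    ((A.op_L_EF S j).mul (op_fixed_loading_error S.hβ S.moment S.hN t j))
    ((A.op_EE_L S j).mul (op_fixed_error hα S.error S.hN t))
    (((A.op_L j).mul (A.misfit j)).mul (op_fixed_error hα S.error S.hN t))).mul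
      (A.op_W_inv S j)
  simp only [mul_one] at h
  refine (h.mono ?_).tendsto_zero hκ0
  filter_upwards [A.regular, eventually_isUnit_of_tendsto (A.tendsto_W j) (S.isUnit_limit_W j)]
    with p hp hW
  refine abs_le_abs_of_nonneg (mul_nonneg (by positivity) (enorm2_nonneg _)) ?_
  rw [hp.Dev_eq A.c_pos A.C_pos j hW, mul_assoc]
  refine mul_le_mul_of_nonneg_left ?_ (by positivity)
  set Λ := m.Lam (E.N p.1) j
  set L := E.L p.1 p.2 j
  set e := m.errVec (E.N p.1) p.2 t
  -- In each noise term the fixed error vector is contracted first with the factor for which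
  -- averaging helps: `F'E'e`, `Λ'e`, or, for the Gram matrix, the product `EE L̂`.
  have e1 : ((E.N p.1 : ℝ)⁻¹ • (E.resid p j * L * (E.W p j)⁻¹))ᵀ *ᵥ e =
      (E.N p.1 : ℝ)⁻¹ • (((E.W p j)⁻¹)ᵀ *ᵥ ((E.T p.1 : ℝ)⁻¹ • (Lᵀ *ᵥ (Λ *ᵥ ((E.EF p j)ᵀ *ᵥ e)) +
        (Lᵀ * E.EF p j) *ᵥ (Λᵀ *ᵥ e) + (E.EE p j * L)ᵀ *ᵥ e) +
        Lᵀ *ᵥ ((E.misfit p j)ᵀ *ᵥ e))) := by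
    unfold Estimators.resid
    rw [transpose_smul, Matrix.smul_mulVec, transpose_mul, transpose_mul, transpose_add,
      E.noise_transpose, E.noise_eq, transpose_mul, E.EE_transpose]
    simp only [Matrix.mulVec_mulVec, ← Matrix.smul_mulVec, ← Matrix.add_mulVec, Matrix.mul_add,
      Matrix.mul_smul, Matrix.mul_assoc]
    rfl
  have e2 : (E.EF p j)ᵀ *ᵥ e = (m.Fmat (E.T p.1) p.2 j)ᵀ *ᵥ
      ((m.Emat (E.N p.1) (E.T p.1) p.2 j)ᵀ *ᵥ e) := by
    unfold Estimators.EF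
    rw [transpose_mul, Matrix.mulVec_mulVec]
  rw [e1, enorm2_smul, abs_of_nonneg (by positivity), mul_assoc]
  refine mul_le_mul_of_nonneg_left ?_ (by positivity)
  refine (enorm2_mulVec_le _ _).trans ?_
  rw [norm_transpose_eq, mul_comm]
  refine mul_le_mul_of_nonneg_right ?_ (norm_nonneg _)
  refine (enorm2_add_le _ _).trans (add_le_add ?_ ?_)
  · rw [enorm2_smul, abs_of_nonneg (by positivity)]
    refine mul_le_mul_of_nonneg_left ?_ (by positivity)
    refine (enorm2_add_le _ _).trans (add_le_add ((enorm2_add_le _ _).trans (add_le_add ?_ ?_)) ?_)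
    · rw [← e2, mul_assoc, ← norm_transpose_eq L]
      exact (enorm2_mulVec_le _ _).trans (mul_le_mul_of_nonneg_left (enorm2_mulVec_le _ _)
        (norm_nonneg _))
    · exact enorm2_mulVec_le _ _
    · refine (enorm2_mulVec_le _ _).trans ?_
      rw [norm_transpose_eq]
  · rw [mul_assoc, ← norm_transpose_eq L, ← norm_transpose_eq (E.misfit p j)]
    exact (enorm2_mulVec_le _ _).trans (mul_le_mul_of_nonneg_left (enorm2_mulVec_le _ _)
      (norm_nonneg _))

end LoadingRates

/-! ### The errors of the estimated factors -/

section Pad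

variable {k : ℕ} (R : ℕ)

theorem pad_smul (c : ℝ) (v : Fin k → ℝ) : pad R (c • v) = c • pad R v := by
  ext a
  simp only [pad, PiLp.smul_apply]
  split <;> simp

theorem pad_sub (v w : Fin k → ℝ) : pad R (v - w) = pad R v - pad R w := by
  ext a
  simp only [pad, PiLp.sub_apply]
  split <;> simp

theorem norm_pad {R : ℕ} (h : k ≤ R) (v : Fin k → ℝ) : ‖pad R v‖ = enorm2 v := by
  obtain ⟨d, rfl⟩ := Nat.exists_eq_add_of_le h
  rw [enorm2_eq_sqrt, EuclideanSpace.norm_eq, Fin.sum_univ_add]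
  congr 1
  simp [pad]

theorem continuous_pad : Continuous fun y : EuclideanSpace ℝ (Fin k) => pad R (WithLp.ofLp y) := by
  refine (PiLp.continuous_toLp 2 _).comp (continuous_pi fun a => ?_)
  split
  · fun_prop
  · exact continuous_const

theorem Model.r_le_R (m : Model Ω) (j : Fin m.J) : m.r j ≤ m.R :=
  Finset.le_sup (f := m.r) (Finset.mem_univ j)

end Pad

/-! ### The ridge estimate of the factors of one date. -/

section Ridge

variable {N k : ℕ}

/-- With `g = H⁻¹f` the common component is `Lg - Dev g`. The ridge regression of `Lg` returns `g -
s B⁻¹g`, so that `g` cancels. What is left is the image of the errors, a shrinkage bias and a bias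
from the estimated loadings. -/
theorem coef_mulVec_sub {L Λ Dev : Matrix (Fin N) (Fin k) ℝ} {H : Matrix (Fin k) (Fin k) ℝ}
    {s : ℝ} (hs : 0 < s) (hH : IsUnit H.det) (hDev : Dev = L - Λ * H) (f : Fin k → ℝ)
    (e : Fin N → ℝ) : coef L s *ᵥ (Λ *ᵥ f + e) - H⁻¹ *ᵥ f =
      (gramB L s)⁻¹ *ᵥ (Hᵀ *ᵥ (Λᵀ *ᵥ e) + Devᵀ *ᵥ e -
        (s • (H⁻¹ *ᵥ f) + (Lᵀ * Dev) *ᵥ (H⁻¹ *ᵥ f))) := by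
  have hg : f = H *ᵥ (H⁻¹ *ᵥ f) := by
    rw [Matrix.mulVec_mulVec, Matrix.mul_nonsing_inv _ hH, Matrix.one_mulVec]
  set g := H⁻¹ *ᵥ f with hgdef
  have h1 : g = (gramB L s)⁻¹ *ᵥ (gramB L s *ᵥ g) := by
    rw [Matrix.mulVec_mulVec, Matrix.nonsing_inv_mul _ (gramB_isUnit_det hs), Matrix.one_mulVec]
  have h2 : Λ *ᵥ f = L *ᵥ g - Dev *ᵥ g := by
    rw [hDev, Matrix.sub_mulVec, sub_sub_cancel, ← Matrix.mulVec_mulVec, ← hg]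
  have h3 : Lᵀ *ᵥ e = Hᵀ *ᵥ (Λᵀ *ᵥ e) + Devᵀ *ᵥ e := by
    rw [hDev, Matrix.transpose_sub, Matrix.sub_mulVec, Matrix.transpose_mul, Matrix.mulVec_mulVec]
    abel
  rw [h2, coef, ← Matrix.mulVec_mulVec]
  nth_rewrite 3 [h1]
  rw [← Matrix.mulVec_sub, Matrix.mulVec_add, h3]
  congr 1
  rw [gramB, Matrix.add_mulVec, Matrix.mulVec_sub, Matrix.smul_mulVec, Matrix.one_mulVec,
    ← Matrix.mulVec_mulVec _ Lᵀ L, ← Matrix.mulVec_mulVec _ Lᵀ Dev]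
  abel

theorem enorm2_coef_mulVec_sq_le {L : Matrix (Fin N) (Fin k) ℝ} {s : ℝ} (hs : 0 < s)
    (x : Fin N → ℝ) : s * enorm2 (coef L s *ᵥ x) ^ 2 ≤ enorm2 x ^ 2 := by
  have h1 := quad_one_sub_shrink (L := L) hs x
  have h2 := quad_one_sub (shrink L s) x
  have h3 := quad_shrink_nonneg (L := L) hs x
  have h4 : 0 ≤ enorm2 (x - shrink L s *ᵥ x) ^ 2 := sq_nonneg _
  nlinarith

end Ridge

/-! ### Mean square error of the estimated factors. -/

section FactorError

set_option linter.unusedSectionVars false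

variable {μ : Measure Ω} [IsProbabilityMeasure μ] {m : Model Ω} {l : Limits m} {α β : ℝ}
  {E : Estimators m} {c C a : ℝ}

/-- The error of the estimated factors that is due to errors of classification. -/
def Estimators.crossError (E : Estimators m) (p : ℕ × Ω) (t : ℕ) : EuclideanSpace ℝ (Fin m.R) :=
  ∑ k, (E.prob p t k - m.ind k t p.2) •
    pad m.R (coef (E.L p.1 p.2 k) (E.s2 p.1 p.2) *ᵥ m.x (E.N p.1) p.2 t)

/-- The error of the estimated factors of a date of known regime `j`. -/
def Estimators.coreError (E : Estimators m) (p : ℕ × Ω) (t : ℕ) (j : Fin m.J) :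
    Fin (m.r j) → ℝ :=
  coef (E.L p.1 p.2 j) (E.s2 p.1 p.2) *ᵥ m.x (E.N p.1) p.2 t - (E.H p.1 p.2 j)⁻¹ *ᵥ m.f j t p.2

/-- Replacing posterior weights by indicators selects the ridge estimate of the true regime; the
difference is the misclassification error. -/
theorem Estimators.err_eq (E : Estimators m) (p : ℕ × Ω) (hs : 0 < E.s2 p.1 p.2) (t : ℕ) :
    E.err p.1 t p.2 = pad m.R (E.coreError p t (m.z t p.2)) + E.crossError p t := by
  have h1 : ∑ k, m.ind k t p.2 •
      pad m.R (coef (E.L p.1 p.2 k) (E.s2 p.1 p.2) *ᵥ m.x (E.N p.1) p.2 t) =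
      pad m.R (coef (E.L p.1 p.2 (m.z t p.2)) (E.s2 p.1 p.2) *ᵥ m.x (E.N p.1) p.2 t) := by
    rw [Finset.sum_eq_single (m.z t p.2)]
    · simp [Model.ind]
    · intro k _ hk
      simp [Model.ind, hk.symm]
    · simp
  unfold Estimators.err factorError fhat Estimators.coreError Estimators.crossError
  simp only [sub_smul, Finset.sum_sub_distrib, pad_sub, h1, transpose_mul_covMat_inv hs]
  unfold Estimators.prob Estimators.H
  abel

theorem Regular.norm_crossError_le (hc : 0 < c) (hC : 0 < C) {p : ℕ × Ω} (h : Regular l E c C p)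
    {ε : ℝ} (hε : 0 ≤ ε) {t : ℕ} (ht : ∀ k, k ≠ m.z t p.2 → E.prob p t k ≤ ε) :
    ‖E.crossError p t‖ ≤ (m.J : ℝ) ^ 2 * √C * ε * enorm2 (m.x (E.N p.1) p.2 t) := by
  have hs := h.s_pos hC
  have h1 : ∀ k, enorm2 (coef (E.L p.1 p.2 k) (E.s2 p.1 p.2) *ᵥ m.x (E.N p.1) p.2 t) ≤
      √C * enorm2 (m.x (E.N p.1) p.2 t) := fun k => by
    refine abs_le_of_sq_le_sq' ?_ (mul_nonneg (Real.sqrt_nonneg _) (enorm2_nonneg _)) |>.2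
    rw [mul_pow, Real.sq_sqrt hC.le]
    have h2 := enorm2_coef_mulVec_sq_le (L := E.L p.1 p.2 k) hs (m.x (E.N p.1) p.2 t)
    have h3 : 1 ≤ C * E.s2 p.1 p.2 := by
      have := mul_le_mul_of_nonneg_left h.s_ge hC.le
      rwa [mul_inv_cancel₀ hC.ne'] at this
    have h4 := mul_le_mul_of_nonneg_left h2 hC.le
    nlinarith [sq_nonneg (enorm2 (coef (E.L p.1 p.2 k) (E.s2 p.1 p.2) *ᵥ m.x (E.N p.1) p.2 t))]
  unfold Estimators.crossError
  refine (norm_sum_le _ _).trans ?_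
  calc _ ≤ ∑ _k : Fin m.J, m.J * ε * (√C * enorm2 (m.x (E.N p.1) p.2 t)) := by
        refine Finset.sum_le_sum fun k _ => ?_
        rw [norm_smul, norm_pad (m.r_le_R k), Real.norm_eq_abs]
        exact mul_le_mul (h.abs_prob_sub_ind_le hc hC hε ht k) (h1 k) (enorm2_nonneg _)
          (by positivity)
    _ = _ := by
        rw [Finset.sum_const, Finset.card_univ, Fintype.card_fin, nsmul_eq_mul]
        ring

theorem Setting.isUnit_diagonal_eigenvalues (S : Setting μ m l α β E) (j : Fin m.J) :
    IsUnit (diagonal (l.v j)).det := by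
  rw [det_diagonal]
  exact isUnit_iff_ne_zero.2 (Finset.prod_ne_zero_iff.2 fun b _ => (S.eigenvalue_pos j b).ne')

/-- The inverse of the scaled second moment matrix of the estimated loadings. -/
def Estimators.Ginv (E : Estimators m) (p : ℕ × Ω) (j : Fin m.J) :
    Matrix (Fin (m.r j)) (Fin (m.r j)) ℝ :=
  (E.N p.1 : ℝ) • (gramB (E.L p.1 p.2 j) (E.s2 p.1 p.2))⁻¹

theorem Asymptotics.tendsto_Ginv (S : Setting μ m l α β E) (A : Asymptotics μ l E c C a)
    (j : Fin m.J) : Tendsto (fun p => E.Ginv p j) (wpo μ) (𝓝 (diagonal (l.v j))⁻¹) := by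
  refine (tendsto_matrix_inv (A.tendsto_diagonal_eig j)
    (S.isUnit_diagonal_eigenvalues j)).congr' ?_
  filter_upwards [A.regular] with p hp
  have hN : (E.N p.1 : ℝ) ≠ 0 := by exact_mod_cast hp.N_pos.ne'
  have h1 : diagonal (E.eig p j) = (E.N p.1 : ℝ)⁻¹ • gramB (E.L p.1 p.2 j) (E.s2 p.1 p.2) := by
    rw [hp.gramB_eq_eig, smul_smul, inv_mul_cancel₀ hN, one_smul]
  unfold Estimators.Ginv
  rw [h1]
  refine Matrix.inv_eq_left_inv ?_
  rw [Matrix.smul_mul, Matrix.mul_smul, smul_smul, mul_inv_cancel₀ hN, one_smul,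
    Matrix.nonsing_inv_mul _ (gramB_isUnit_det (hp.s_pos A.C_pos))]

theorem Regular.coreError_eq (hC : 0 < C) {p : ℕ × Ω} (h : Regular l E c C p) {t : ℕ}
    {j : Fin m.J} (hH : IsUnit (E.H p.1 p.2 j).det) (hz : m.z t p.2 = j) :
    E.coreError p t j = (E.N p.1 : ℝ)⁻¹ • (E.Ginv p j *ᵥ
      ((E.H p.1 p.2 j)ᵀ *ᵥ ((m.Lam (E.N p.1) j)ᵀ *ᵥ m.errVec (E.N p.1) p.2 t) +
        (E.Dev p j)ᵀ *ᵥ m.errVec (E.N p.1) p.2 t -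
        (E.s2 p.1 p.2 • ((E.H p.1 p.2 j)⁻¹ *ᵥ m.f j t p.2) +
          ((E.L p.1 p.2 j)ᵀ * E.Dev p j) *ᵥ ((E.H p.1 p.2 j)⁻¹ *ᵥ m.f j t p.2)))) := by
  have hN : (E.N p.1 : ℝ) ≠ 0 := by exact_mod_cast h.N_pos.ne'
  subst hz
  unfold Estimators.coreError Estimators.Ginv
  rw [m.x_eq, Matrix.smul_mulVec, smul_smul, inv_mul_cancel₀ hN, one_smul]
  exact coef_mulVec_sub (h.s_pos hC) hH rfl _ _

theorem Regular.enorm2_ridge_le (hC : 0 < C) {p : ℕ × Ω} (h : Regular l E c C p) {t : ℕ}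
    {j : Fin m.J} (hz : m.z t p.2 = j) :
    enorm2 (E.s2 p.1 p.2 • ((E.H p.1 p.2 j)⁻¹ *ᵥ m.f j t p.2) +
      ((E.L p.1 p.2 j)ᵀ * E.Dev p j) *ᵥ ((E.H p.1 p.2 j)⁻¹ *ᵥ m.f j t p.2)) ≤
      (C + ‖(E.L p.1 p.2 j)ᵀ * E.Dev p j‖) * (‖(E.H p.1 p.2 j)⁻¹‖ * enorm2 (m.fz t p.2)) := by
  have hf : enorm2 (m.f j t p.2) = enorm2 (m.fz t p.2) := by subst hz; rfl
  have h3 := enorm2_mulVec_le (E.H p.1 p.2 j)⁻¹ (m.f j t p.2)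
  rw [hf] at h3
  refine (enorm2_add_le _ _).trans ?_
  rw [enorm2_smul, abs_of_pos (h.s_pos hC)]
  refine le_trans ?_ (mul_le_mul_of_nonneg_left h3 (by positivity))
  rw [add_mul]
  exact add_le_add (mul_le_mul_of_nonneg_right h.s_le (enorm2_nonneg _)) (enorm2_mulVec_le _ _)

theorem Regular.enorm2_coreError_le (hC : 0 < C) {p : ℕ × Ω} (h : Regular l E c C p) {t : ℕ}
    {j : Fin m.J} (hH : IsUnit (E.H p.1 p.2 j).det) (hz : m.z t p.2 = j) :
    enorm2 (E.coreError p t j) ≤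
      (E.N p.1 : ℝ)⁻¹ * (‖E.Ginv p j‖ * ‖E.H p.1 p.2 j‖) *
          enorm2 ((m.Lam (E.N p.1) j)ᵀ *ᵥ m.errVec (E.N p.1) p.2 t) +
        (E.N p.1 : ℝ)⁻¹ * (‖E.Ginv p j‖ * ‖E.Dev p j‖) * enorm2 (m.errVec (E.N p.1) p.2 t) +
        (E.N p.1 : ℝ)⁻¹ * (‖E.Ginv p j‖ * ((C + ‖(E.L p.1 p.2 j)ᵀ * E.Dev p j‖) *
          ‖(E.H p.1 p.2 j)⁻¹‖)) * enorm2 (m.fz t p.2) := by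
  rw [h.coreError_eq hC hH hz, enorm2_smul, abs_of_nonneg (by positivity)]
  have h1 := enorm2_mulVec_le (E.H p.1 p.2 j)ᵀ
    ((m.Lam (E.N p.1) j)ᵀ *ᵥ m.errVec (E.N p.1) p.2 t)
  have h2 := enorm2_mulVec_le (E.Dev p j)ᵀ (m.errVec (E.N p.1) p.2 t)
  rw [norm_transpose_eq] at h1 h2
  have h4 := h.enorm2_ridge_le hC hz
  have h5 := (enorm2_mulVec_le (E.Ginv p j) _).trans (mul_le_mul_of_nonneg_left
    ((enorm2_sub_le _ _).trans (add_le_add ((enorm2_add_le _ _).trans (add_le_add h1 h2)) h4))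
    (norm_nonneg _))
  refine (mul_le_mul_of_nonneg_left h5 (by positivity)).trans (le_of_eq ?_)
  ring

/-- The mean square of the errors of the observations. -/
theorem Setting.op_mean_error_sq (S : Setting μ m l α β E) :
    Op μ (fun p => (E.T p.1 : ℝ)⁻¹ * ∑ t ∈ Finset.range (E.T p.1),
      enorm2 (m.errVec (E.N p.1) p.2 t) ^ 2) (fun n => (E.N n : ℝ)) := by
  have hα : (2 : ℝ) ≤ α := by linarith [S.hα]
  have h3 : Op μ (fun p : ℕ × Ω => (E.N p.1 : ℝ) * E.T p.1)
      (fun n => (E.N n : ℝ) * E.T n) :=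
    Op.of_atTop_le (a' := fun n => (E.N n : ℝ) * E.T n)
      (Eventually.of_forall fun n => by rw [abs_of_nonneg (by positivity)])
  refine (((h3.add (op_sum_error_rpow S.error S.hN S.hT)).det_mul
    (a' := fun n => (E.T n : ℝ)⁻¹)).rate (c := fun n => (E.N n : ℝ)) (C := 1) ?_ one_pos).mono ?_
  · filter_upwards [eventually_pos S.hT] with n hn
    have hT : (0 : ℝ) < E.T n := by exact_mod_cast hn
    rw [abs_of_pos (inv_pos.2 hT), one_mul, mul_comm (E.N n : ℝ), ← mul_assoc,
      inv_mul_cancel₀ hT.ne', one_mul]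
  · refine Eventually.of_forall fun p => abs_le_abs_of_nonneg
      (mul_nonneg (by positivity) (Finset.sum_nonneg fun _ _ => sq_nonneg _)) ?_
    refine mul_le_mul_of_nonneg_left ?_ (by positivity)
    have h5 : ∀ t, enorm2 (m.errVec (E.N p.1) p.2 t) ^ 2 ≤
        E.N p.1 + ∑ i ∈ Finset.range (E.N p.1), |m.e i t p.2| ^ α := fun t => by
      rw [enorm2_sq_eq_sum, Finset.sum_range]
      calc _ ≤ ∑ i : Fin (E.N p.1), (1 + |m.e i t p.2| ^ α) := Finset.sum_le_sum fun i _ => by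
            have := sq_le_one_add_rpow (abs_nonneg (m.e i t p.2)) hα
            rwa [sq_abs] at this
        _ = _ := by simp [Finset.sum_add_distrib]
    calc _ ≤ ∑ t ∈ Finset.range (E.T p.1),
          (E.N p.1 + ∑ i ∈ Finset.range (E.N p.1), |m.e i t p.2| ^ α) :=
          Finset.sum_le_sum fun t _ => h5 t
      _ = _ := by
          rw [Finset.sum_add_distrib, Finset.sum_const, Finset.card_range, nsmul_eq_mul]
          ring

theorem Setting.op_mean_factor_sq (S : Setting μ m l α β E) :
    Op μ (fun p => (E.T p.1 : ℝ)⁻¹ * ∑ t ∈ Finset.range (E.T p.1), enorm2 (m.fz t p.2) ^ 2)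
      (fun _ => 1) := by
  refine ((op_sum_factor_sq (by linarith [S.hα]) S.factor S.hT).det_mul
    (a' := fun n => (E.T n : ℝ)⁻¹)).rate (C := 1) ?_ one_pos
  filter_upwards [eventually_pos S.hT] with n hn
  have hT : (0 : ℝ) < E.T n := by exact_mod_cast hn
  rw [abs_of_pos (inv_pos.2 hT), inv_mul_cancel₀ hT.ne', one_mul]

theorem Setting.op_mean_loading_error_sq (S : Setting μ m l α β E) (j : Fin m.J) :
    Op μ (fun p => (E.T p.1 : ℝ)⁻¹ * ∑ t ∈ Finset.range (E.T p.1),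
      enorm2 ((m.Lam (E.N p.1) j)ᵀ *ᵥ m.errVec (E.N p.1) p.2 t) ^ 2) (fun n => (E.N n : ℝ)) := by
  refine ((op_sum_loading_error_sq S.hβ S.moment S.hN S.hT j).det_mul
    (a' := fun n => (E.T n : ℝ)⁻¹)).rate (C := 1) ?_ one_pos
  filter_upwards [eventually_pos S.hT] with n hn
  have hT : (0 : ℝ) < E.T n := by exact_mod_cast hn
  rw [abs_of_pos (inv_pos.2 hT), one_mul, mul_comm (E.N n : ℝ), ← mul_assoc,
    inv_mul_cancel₀ hT.ne', one_mul]

theorem Asymptotics.op_H_inv (S : Setting μ m l α β E) (A : Asymptotics μ l E c C a)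
    (j : Fin m.J) : Op μ (fun p : ℕ × Ω => ‖(E.H p.1 p.2 j)⁻¹‖) (fun _ => 1) :=
  op_norm_of_tendsto (A.tendsto_H_inv S j)

theorem Asymptotics.op_Ginv (S : Setting μ m l α β E) (A : Asymptotics μ l E c C a)
    (j : Fin m.J) : Op μ (fun p => ‖E.Ginv p j‖) (fun _ => 1) :=
  op_norm_of_tendsto (A.tendsto_Ginv S j)

theorem op_inv_N (μ : Measure Ω) [IsProbabilityMeasure μ] (E : Estimators m) :
    Op μ (fun p : ℕ × Ω => (E.N p.1 : ℝ)⁻¹) (fun n => (E.N n : ℝ)⁻¹) :=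
  Op.of_atTop_le (a' := fun n => (E.N n : ℝ)⁻¹)
    (Eventually.of_forall fun n => by rw [abs_of_nonneg (by positivity)])

/-- The shrinkage bias `C` is dominated by the order `N/δ² ≥ 1` of `L̂'Dev`. -/
theorem Asymptotics.op_ridge (S : Setting μ m l α β E) (A : Asymptotics μ l E c C a)
    (j : Fin m.J) : Op μ (fun p => (E.N p.1 : ℝ)⁻¹ * (‖E.Ginv p j‖ *
        ((C + ‖(E.L p.1 p.2 j)ᵀ * E.Dev p j‖) * ‖(E.H p.1 p.2 j)⁻¹‖)))
      (fun n => (delta (E.N n) (E.T n) ^ 2)⁻¹) := by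
  have h1 := ((((Op.const (μ := μ) C).rate (c := fun n => (E.N n : ℝ) / delta (E.N n) (E.T n) ^ 2)
    (C := 1) (by
      filter_upwards [eventually_rates S.hN S.hT] with n ⟨h0, h1, h2⟩
      rw [one_mul, le_div_iff₀ (by positivity), one_mul]
      exact h1) one_pos).add (A.op_L_Dev S j)).mul (A.op_H_inv S j))
  have h2 := (op_inv_N μ E).mul ((A.op_Ginv S j).mul h1)
  refine h2.rate (C := 1) ?_ one_pos
  filter_upwards [eventually_pos S.hN] with n hn
  have hN : (E.N n : ℝ) ≠ 0 := by exact_mod_cast hn.ne'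
  refine le_of_eq ?_
  field_simp

/-- The mean square error of the estimated factors. -/
theorem Asymptotics.op_mean_err_sq (S : Setting μ m l α β E) (A : Asymptotics μ l E c C a) :
    Op μ (fun p => (E.T p.1 : ℝ)⁻¹ * ∑ t ∈ Finset.range (E.T p.1), ‖E.err p.1 t p.2‖ ^ 2)
      (fun n => (delta (E.N n) (E.T n) ^ 2)⁻¹) := by
  have hr : ∀ᶠ n in atTop, 1 ≤ delta (E.N n) (E.T n) ∧ delta (E.N n) (E.T n) ^ 2 ≤ E.N n ∧
      (0 : ℝ) < E.N n ∧ (E.N n : ℝ) = √(E.N n : ℝ) ^ 2 := by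
    filter_upwards [eventually_rates S.hN S.hT, eventually_pos S.hN] with n ⟨h0, h1, h2⟩ hn
    exact ⟨h0, h1, by exact_mod_cast hn, (Real.sq_sqrt (Nat.cast_nonneg _)).symm⟩
  -- The `X` do not depend on the date and the `Y` carry no estimates, so that averages over dates
  -- factor. Summing over all regimes avoids the regime of the date.
  let X1 : Fin m.J → ℕ × Ω → ℝ := fun j p => (E.N p.1 : ℝ)⁻¹ * (‖E.Ginv p j‖ * ‖E.H p.1 p.2 j‖)
  let X2 : Fin m.J → ℕ × Ω → ℝ := fun j p => (E.N p.1 : ℝ)⁻¹ * (‖E.Ginv p j‖ * ‖E.Dev p j‖)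
  let X3 : Fin m.J → ℕ × Ω → ℝ := fun j p => (E.N p.1 : ℝ)⁻¹ * (‖E.Ginv p j‖ *
    ((C + ‖(E.L p.1 p.2 j)ᵀ * E.Dev p j‖) * ‖(E.H p.1 p.2 j)⁻¹‖))
  let X4 : ℕ × Ω → ℝ := fun p => (m.J : ℝ) ^ 2 * √C * Real.exp (-a * E.N p.1)
  let Y1 : Fin m.J → ℕ × Ω → ℕ → ℝ := fun j p t =>
    enorm2 ((m.Lam (E.N p.1) j)ᵀ *ᵥ m.errVec (E.N p.1) p.2 t)
  let Y2 : ℕ × Ω → ℕ → ℝ := fun p t => enorm2 (m.errVec (E.N p.1) p.2 t)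
  let Y3 : ℕ × Ω → ℕ → ℝ := fun p t => enorm2 (m.fz t p.2)
  let Y4 : ℕ × Ω → ℕ → ℝ := fun p t => enorm2 (m.x (E.N p.1) p.2 t)
  have op1 : ∀ j, Op μ (fun p => X1 j p * X1 j p * ((E.T p.1 : ℝ)⁻¹ *
      ∑ t ∈ Finset.range (E.T p.1), Y1 j p t ^ 2)) (fun n => (delta (E.N n) (E.T n) ^ 2)⁻¹) := by
    intro j
    have h1 : Op μ (X1 j) _ := (op_inv_N μ E).mul ((A.op_Ginv S j).mul (A.op_H S j))
    refine ((h1.mul h1).mul (S.op_mean_loading_error_sq j)).rate (C := 1) ?_ one_pos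
    filter_upwards [hr] with n ⟨h0, h1, hN, h3⟩
    have h4 : (E.N n : ℝ)⁻¹ ≤ (delta (E.N n) (E.T n) ^ 2)⁻¹ := inv_anti₀ (by positivity) h1
    refine le_trans (le_of_eq ?_) (h4.trans (one_mul _).symm.le)
    field_simp
  have op2 : ∀ j, Op μ (fun p => X2 j p * X2 j p * ((E.T p.1 : ℝ)⁻¹ *
      ∑ t ∈ Finset.range (E.T p.1), Y2 p t ^ 2)) (fun n => (delta (E.N n) (E.T n) ^ 2)⁻¹) := by
    intro j
    have h1 : Op μ (X2 j) _ := (op_inv_N μ E).mul ((A.op_Ginv S j).mul (A.op_Dev S j))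
    refine ((h1.mul h1).mul S.op_mean_error_sq).rate (C := 1) ?_ one_pos
    filter_upwards [hr] with n ⟨h0, h1, hN, h3⟩
    refine le_of_eq ?_
    have h5 : delta (E.N n) (E.T n) ≠ 0 := by positivity
    calc _ = (E.N n : ℝ)⁻¹ * ((E.N n : ℝ)⁻¹ * √(E.N n : ℝ) ^ 2) * E.N n *
          (delta (E.N n) (E.T n) ^ 2)⁻¹ := by field_simp
      _ = _ := by rw [← h3, inv_mul_cancel₀ hN.ne', mul_one, inv_mul_cancel₀ hN.ne']
  have op3 : ∀ j, Op μ (fun p => X3 j p * X3 j p * ((E.T p.1 : ℝ)⁻¹ *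
      ∑ t ∈ Finset.range (E.T p.1), Y3 p t ^ 2)) (fun n => (delta (E.N n) (E.T n) ^ 2)⁻¹) := by
    intro j
    refine (((A.op_ridge S j).mul (A.op_ridge S j)).mul S.op_mean_factor_sq).rate (C := 1) ?_ one_pos
    filter_upwards [hr] with n ⟨h0, h1, hN, h3⟩
    have h4 : (delta (E.N n) (E.T n) ^ 2)⁻¹ ≤ 1 := inv_le_one_of_one_le₀ (one_le_pow₀ h0)
    have h5 : 0 ≤ (delta (E.N n) (E.T n) ^ 2)⁻¹ := by positivity
    nlinarith
  have op4 : Op μ (fun p => X4 p * X4 p * ((E.T p.1 : ℝ)⁻¹ *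
      ∑ t ∈ Finset.range (E.T p.1), Y4 p t ^ 2)) (fun n => (delta (E.N n) (E.T n) ^ 2)⁻¹) := by
    have h1 : Op μ X4 (fun n => (m.J : ℝ) ^ 2 * √C * Real.exp (-a * E.N n)) :=
      Op.of_atTop_le (a' := fun n => (m.J : ℝ) ^ 2 * √C * Real.exp (-a * E.N n))
        (Eventually.of_forall fun n => by rw [abs_of_nonneg (by positivity)])
    refine ((h1.mul h1).mul (S.op_mean_x_sq A.C_pos A.upper)).rate (C := 1) ?_ one_pos
    have h2 := ((tendsto_pow_mul_exp_neg S.hN A.a_pos 1).const_mul ((m.J : ℝ) ^ 2 * √C))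
    rw [mul_zero] at h2
    filter_upwards [hr, h2.eventually (ge_mem_nhds one_pos)] with n ⟨h0, h1, hN, h3⟩ h5
    have h4 : (E.N n : ℝ)⁻¹ ≤ (delta (E.N n) (E.T n) ^ 2)⁻¹ := inv_anti₀ (by positivity) h1
    refine le_trans ?_ (h4.trans (one_mul _).symm.le)
    rw [pow_one] at h5
    rw [← one_div, le_div_iff₀ hN]
    calc _ = ((m.J : ℝ) ^ 2 * √C * (E.N n * Real.exp (-a * E.N n))) ^ 2 := by ring
      _ ≤ 1 := pow_le_one₀ (by positivity) h5
  have hd : ∀ n, 0 ≤ (delta (E.N n) (E.T n) ^ 2)⁻¹ := fun n => by positivity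
  have hall := ((Op.sum Finset.univ hd fun j _ => ((op1 j).add (op2 j)).add (op3 j)).add
    op4).const_mul 4
  refine hall.mono ?_
  have hunit : ∀ᶠ p in wpo μ, ∀ j, IsUnit (E.H p.1 p.2 j).det :=
    eventually_all.2 fun j => eventually_isUnit_of_tendsto (A.tendsto_H S j) (S.isUnit_Hlim j)
  filter_upwards [A.regular, A.classified, hunit] with p h hcl hH
  have hT0 : (0 : ℝ) ≤ (E.T p.1 : ℝ)⁻¹ := by positivity
  refine abs_le_abs_of_nonneg (mul_nonneg hT0 (Finset.sum_nonneg fun _ _ => sq_nonneg _)) ?_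
  have hpt : ∀ t ∈ Finset.range (E.T p.1), ‖E.err p.1 t p.2‖ ^ 2 ≤
      4 * (∑ j, (X1 j p * X1 j p * Y1 j p t ^ 2 + X2 j p * X2 j p * Y2 p t ^ 2 +
        X3 j p * X3 j p * Y3 p t ^ 2) + X4 p * X4 p * Y4 p t ^ 2) := by
    intro t ht
    have h1 := h.norm_crossError_le A.c_pos A.C_pos (Real.exp_pos _).le
      (hcl t (Finset.mem_range.1 ht))
    have h2 := h.enorm2_coreError_le A.C_pos (hH (m.z t p.2)) rfl
    have h3 : ‖E.err p.1 t p.2‖ ≤ X1 (m.z t p.2) p * Y1 (m.z t p.2) p t +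
        X2 (m.z t p.2) p * Y2 p t + X3 (m.z t p.2) p * Y3 p t + X4 p * Y4 p t := by
      rw [E.err_eq p (h.s_pos A.C_pos)]
      refine (norm_add_le _ _).trans (add_le_add ?_ h1)
      rw [norm_pad (m.r_le_R _)]
      exact h2
    have h4 := Finset.single_le_sum (f := fun j => X1 j p * X1 j p * Y1 j p t ^ 2 +
      X2 j p * X2 j p * Y2 p t ^ 2 + X3 j p * X3 j p * Y3 p t ^ 2)
      (fun j _ => add_nonneg (add_nonneg (mul_nonneg (mul_self_nonneg _) (sq_nonneg _))
        (mul_nonneg (mul_self_nonneg _) (sq_nonneg _)))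
        (mul_nonneg (mul_self_nonneg _) (sq_nonneg _))) (Finset.mem_univ (m.z t p.2))
    refine (pow_le_pow_left₀ (norm_nonneg _) h3 2).trans
      (le_trans ?_ (mul_le_mul_of_nonneg_left (add_le_add_left h4 _) (by norm_num)))
    -- Cauchy–Schwarz for four summands, whence the factor `4`.
    have h5 : ∀ u v w x : ℝ, (u + v + w + x) ^ 2 ≤ 4 * (u ^ 2 + v ^ 2 + w ^ 2 + x ^ 2) :=
      fun u v w x => by
        nlinarith [sq_nonneg (u - v), sq_nonneg (u - w), sq_nonneg (u - x), sq_nonneg (v - w),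
          sq_nonneg (v - x), sq_nonneg (w - x)]
    refine (h5 _ _ _ _).trans (le_of_eq ?_)
    ring
  refine (mul_le_mul_of_nonneg_left (Finset.sum_le_sum hpt) hT0).trans (le_of_eq ?_)
  have e1 : ∀ x y : ℝ, x * ((E.T p.1 : ℝ)⁻¹ * y) = (E.T p.1 : ℝ)⁻¹ * (x * y) :=
    fun x y => mul_left_comm _ _ _
  rw [← Finset.mul_sum, Finset.sum_add_distrib, Finset.sum_comm]
  simp only [Finset.sum_add_distrib, ← Finset.mul_sum, e1]
  ring

end FactorError

/-! ### Measurability of the errors of the estimated factors -/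

section Measurability

theorem measurable_matrix_det {k : ℕ} {A : Ω → Matrix (Fin k) (Fin k) ℝ}
    (hA : ∀ i a, Measurable fun ω => A ω i a) : Measurable fun ω => (A ω).det := by
  simp only [Matrix.det_apply']
  exact Finset.measurable_sum _ fun σ _ =>
    (Finset.measurable_prod _ fun i _ => hA (σ i) i).const_mul _

theorem measurable_matrix_inv {k : ℕ} {A : Ω → Matrix (Fin k) (Fin k) ℝ}
    (hA : ∀ i a, Measurable fun ω => A ω i a) (i a : Fin k) :
    Measurable fun ω => (A ω)⁻¹ i a := by
  simp only [Matrix.inv_def, Ring.inverse_eq_inv', Matrix.smul_apply, smul_eq_mul,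
    Matrix.adjugate_apply]
  refine (measurable_matrix_det hA).inv.mul (measurable_matrix_det fun i' a' => ?_)
  by_cases h : i' = a
  · subst h
    simp only [Matrix.updateRow_self]
    exact measurable_const
  · simp only [Matrix.updateRow_ne h]
    exact hA i' a'

theorem measurable_pad {k R : ℕ} {g : Ω → Fin k → ℝ} (hg : ∀ a, Measurable fun ω => g ω a) :
    Measurable fun ω => pad R (g ω) := by
  refine (PiLp.continuous_toLp 2 _).measurable.comp (measurable_pi_iff.2 fun a => ?_)
  by_cases h : (a : ℕ) < k
  · simp only [h, dif_pos]
    exact hg _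
  · simp only [h, dif_neg, not_false_eq_true]
    exact measurable_const

theorem measurable_covMat {N k : ℕ} {L : Ω → Matrix (Fin N) (Fin k) ℝ} {s : Ω → ℝ}
    (hL : ∀ i a, Measurable fun ω => L ω i a) (hs : Measurable s) (i a : Fin N) :
    Measurable fun ω => covMat (L ω) (s ω) i a := by
  simp only [covMat, Matrix.add_apply, Matrix.smul_apply, smul_eq_mul]
  exact (measurable_matrix_mul hL (fun i a => hL a i) i a).add (hs.mul_const _)

theorem measurable_dens {N k : ℕ} {L : Ω → Matrix (Fin N) (Fin k) ℝ} {s : Ω → ℝ}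
    {x : Ω → Fin N → ℝ} (hL : ∀ i a, Measurable fun ω => L ω i a) (hs : Measurable s)
    (hx : ∀ i, Measurable fun ω => x ω i) : Measurable fun ω => dens (L ω) (s ω) (x ω) := by
  have hc := measurable_covMat hL hs
  unfold dens
  refine (((measurable_matrix_det hc).pow_const _).const_mul _).mul
    (Real.measurable_exp.comp (Measurable.const_mul ?_ _))
  simp only [dotProduct]
  exact Finset.measurable_sum _ fun i _ =>
    (hx i).mul (measurable_matrix_mulVec (measurable_matrix_inv hc) hx i)

variable {m : Model Ω}

theorem Model.measurable_x (m : Model Ω) (N t : ℕ) (i : Fin N) :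
    Measurable fun ω => m.x N ω t i := by
  unfold Model.x
  exact (m.measurable_of_z t (g := fun j ω => ∑ a, m.lam j i a * m.f j t ω a) fun j =>
    Finset.measurable_sum _ fun a _ => (m.measurable_f_apply j t a).const_mul _).add
      (m.measurable_e i t)

theorem Estimators.measurable_post (E : Estimators m) (n t : ℕ) (j : Fin m.J) :
    Measurable fun ω => post (E.L n ω) (E.s2 n ω) (E.q n ω) (m.x (E.N n) ω t) j := by
  have h : ∀ k, Measurable fun ω => E.q n ω k * dens (E.L n ω k) (E.s2 n ω) (m.x (E.N n) ω t) :=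
    fun k => (E.measurable_q n k).mul
      (measurable_dens (E.measurable_L n k) (E.measurable_s2 n) (m.measurable_x _ t))
  unfold post
  exact (h j).div (Finset.measurable_sum _ fun k _ => h k)

theorem Estimators.measurable_H (E : Estimators m) (n : ℕ) (j : Fin m.J) (a b : Fin (m.r j)) :
    Measurable fun ω => E.H n ω j a b := by
  have hL := E.measurable_L n j
  unfold Estimators.H Hmat
  refine measurable_matrix_mul (measurable_matrix_mul (fun a b => ?_) fun a b => ?_)
    (measurable_matrix_inv fun a b => ?_) a b
  · simp only [Matrix.smul_apply, sumFF, Matrix.of_apply, smul_eq_mul]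
    exact (Finset.measurable_sum _ fun t _ => ((m.measurable_f_apply j t a).mul
      (m.measurable_f_apply j t b)).mul (m.measurable_ind j t)).const_mul _
  · simp only [Matrix.smul_apply, smul_eq_mul]
    exact (measurable_matrix_mul (A := fun _ => (m.Lam (E.N n) j)ᵀ) (fun _ _ => measurable_const)
      hL a b).const_mul _
  · simp only [Wmat, Matrix.smul_apply, Matrix.add_apply, smul_eq_mul]
    exact ((Finset.measurable_sum _ fun t _ => E.measurable_post n t j).const_mul _).mul
      (((measurable_matrix_mul (fun i a => hL a i) hL a b).const_mul _).add
        (((E.measurable_s2 n).div_const _).mul_const _))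

theorem Estimators.measurable_err (E : Estimators m) (n t : ℕ) : Measurable (E.err n t) := by
  unfold Estimators.err factorError fhat
  refine (Finset.measurable_sum _ fun j _ => (E.measurable_post n t j).smul
    (measurable_pad fun a => ?_)).sub (m.measurable_of_z t
      (g := fun j ω => pad m.R ((E.H n ω j)⁻¹ *ᵥ m.f j t ω)) fun j => measurable_pad fun a => ?_)
  · exact measurable_matrix_mulVec (fun i a => E.measurable_L n j a i)
      (measurable_matrix_mulVec (measurable_matrix_inv
        (measurable_covMat (E.measurable_L n j) (E.measurable_s2 n))) (m.measurable_x _ t)) a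
  · exact measurable_matrix_mulVec (measurable_matrix_inv (E.measurable_H n j))
      (m.measurable_f_apply j t) a

end Measurability

/-! ### Distributions -/

section Distributions

open scoped RealInnerProductSpace

/-- Comparison of characteristic functions. If `S` is not positive semidefinite the Gaussian is by
convention a point mass; as `Q` is invertible, `QSQ'` is then not positive semidefinite either and
both sides are the point mass at zero. So nothing has to be known about the matrix `Γ`. -/
theorem map_multivariateGaussian_zero {k : ℕ} {Q : Matrix (Fin k) (Fin k) ℝ} (hQ : IsUnit Q)
    (S : Matrix (Fin k) (Fin k) ℝ) :
    (multivariateGaussian 0 S).map (fun y : EuclideanSpace ℝ (Fin k) =>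
      WithLp.toLp 2 (Q *ᵥ WithLp.ofLp y)) = multivariateGaussian 0 (Q * S * Qᵀ) := by
  have hmap : Measurable fun y : EuclideanSpace ℝ (Fin k) =>
      (WithLp.toLp 2 (Q *ᵥ WithLp.ofLp y) : EuclideanSpace ℝ (Fin k)) :=
    (Matrix.toEuclideanCLM (n := Fin k) (𝕜 := ℝ) Q).measurable
  have hiff : (Q * S * Qᵀ).PosSemidef ↔ S.PosSemidef := by
    have h := hQ.posSemidef_star_right_conjugate_iff (x := S)
    rwa [Matrix.star_eq_conjTranspose, conjTranspose_eq_transpose_of_trivial] at h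
  by_cases hS : S.PosSemidef
  · have : IsProbabilityMeasure ((multivariateGaussian 0 S).map
        fun y : EuclideanSpace ℝ (Fin k) => (WithLp.toLp 2 (Q *ᵥ WithLp.ofLp y) :
          EuclideanSpace ℝ (Fin k))) := Measure.isProbabilityMeasure_map hmap.aemeasurable
    refine Measure.ext_of_charFun (funext fun x => ?_)
    have h1 : charFun ((multivariateGaussian 0 S).map fun y : EuclideanSpace ℝ (Fin k) =>
        (WithLp.toLp 2 (Q *ᵥ WithLp.ofLp y) : EuclideanSpace ℝ (Fin k))) x =
        charFun (multivariateGaussian 0 S) (WithLp.toLp 2 (Qᵀ *ᵥ WithLp.ofLp x)) := by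
      rw [charFun_apply, charFun_apply, integral_map hmap.aemeasurable (by fun_prop)]
      refine integral_congr_ae (Eventually.of_forall fun y => ?_)
      have h2 : ⟪(WithLp.toLp 2 (Q *ᵥ WithLp.ofLp y) : EuclideanSpace ℝ (Fin k)), x⟫ =
          ⟪y, WithLp.toLp 2 (Qᵀ *ᵥ WithLp.ofLp x)⟫ := by
        rw [EuclideanSpace.inner_eq_star_dotProduct, EuclideanSpace.inner_eq_star_dotProduct]
        simp only [star_trivial]
        rw [Matrix.dotProduct_mulVec, Matrix.mulVec_transpose]
      simp only [h2]
    rw [h1, charFun_multivariateGaussian hS, charFun_multivariateGaussian (hiff.2 hS)]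
    congr 3
    · simp
    · congr 1
      simp only [← Matrix.mulVec_mulVec]
      rw [Matrix.dotProduct_mulVec _ Q, ← Matrix.mulVec_transpose]
  · rw [multivariateGaussian_of_not_posSemidef _ hS,
      multivariateGaussian_of_not_posSemidef _ (mt hiff.1 hS), Measure.map_dirac' hmap]
    simp

/-- This carries the central limit theorem over to the conditional law given the regime. -/
theorem map_cond_of_indepFun {β γ : Type*} [MeasurableSpace β] [MeasurableSpace γ]
    {μ : Measure Ω} [IsProbabilityMeasure μ] {X : Ω → β} {Y : Ω → γ} (h : IndepFun X Y μ)
    (hX : Measurable X) (hY : Measurable Y) {B : Set β} (hB : MeasurableSet B)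
    (h0 : μ (X ⁻¹' B) ≠ 0) : (μ[|X ⁻¹' B]).map Y = μ.map Y := by
  ext A hA
  rw [Measure.map_apply hY hA, Measure.map_apply hY hA, cond_apply (hX hB),
    h.measure_inter_preimage_eq_mul _ _ hB hA, ← mul_assoc,
    ENNReal.inv_mul_cancel h0 (measure_ne_top _ _), one_mul]

theorem _root_.MeasureTheory.TendstoInDistribution.of_map_eq {Ω₁ Ω₂ Ω₃ Ω₄ F : Type*}
    [MeasurableSpace Ω₁] [MeasurableSpace Ω₂] [MeasurableSpace Ω₃] [MeasurableSpace Ω₄]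
    [TopologicalSpace F] [MeasurableSpace F] [OpensMeasurableSpace F]
    {μ₁ : Measure Ω₁} [IsProbabilityMeasure μ₁] {μ₂ : Measure Ω₂} [IsProbabilityMeasure μ₂]
    {μ₃ : Measure Ω₃} [IsProbabilityMeasure μ₃] {μ₄ : Measure Ω₄} [IsProbabilityMeasure μ₄]
    {X : ℕ → Ω₁ → F} {Y : ℕ → Ω₂ → F} {Z : Ω₃ → F} {W : Ω₄ → F}
    (h : TendstoInDistribution X atTop Z (fun _ => μ₁) μ₃) (hY : ∀ n, AEMeasurable (Y n) μ₂)
    (hW : AEMeasurable W μ₄) (hXY : ∀ n, μ₂.map (Y n) = μ₁.map (X n))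
    (hZW : μ₄.map W = μ₃.map Z) : TendstoInDistribution Y atTop W (fun _ => μ₂) μ₄ where
  forall_aemeasurable := hY
  aemeasurable_limit := hW
  tendsto := by
    have h1 := h.tendsto
    simp only [hXY, hZW]
    exact h1

theorem tendstoInMeasure_cond {F : Type*} [SeminormedAddCommGroup F] {μ : Measure Ω}
    {A : Set Ω} (hA : MeasurableSet A) (h0 : μ A ≠ 0) {X : ℕ → Ω → F}
    (h : ∀ ε : ℝ, 0 < ε → ∀ᶠ p in wpo μ, p.2 ∈ A → ‖X p.1 p.2‖ < ε) :
    TendstoInMeasure (μ[|A]) X atTop 0 := by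
  rw [tendstoInMeasure_iff_norm]
  intro ε hε
  have h1 := ENNReal.Tendsto.const_mul (a := (μ A)⁻¹) (eventually_wpo.1 (h ε hε))
    (Or.inr (ENNReal.inv_ne_top.2 h0))
  rw [mul_zero] at h1
  refine h1.congr fun n => ?_
  rw [cond_apply hA]
  congr 2
  ext ω
  simp

end Distributions

/-! ### Products of a vanishing and a bounded sequence. -/

section OpProduct

/-- The vanishing factor comes without a rate, so the product rule for `Op` does not apply. Instead
the bounded factor is kept below a fixed constant with probability close to one. -/
theorem Op.tendsto_mul_zero {μ : Measure Ω} {X Y : ℕ × Ω → ℝ} (hX : Tendsto X (wpo μ) (𝓝 0))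
    (hY : Op μ Y fun _ => 1) : Tendsto (fun p => X p * Y p) (wpo μ) (𝓝 0) := by
  rw [Metric.tendsto_nhds]
  intro ε hε
  rw [eventually_wpo, ENNReal.tendsto_nhds_zero]
  intro η hη
  obtain ⟨δ, hδ, hδη⟩ := ENNReal.lt_iff_exists_nnreal_btwn.1 hη
  have hδ0 : (0 : ℝ) < δ := by exact_mod_cast hδ
  obtain ⟨K, hK⟩ := Op.isBigOp (X := fun n ω => Y (n, ω)) hY (δ / 2) (by positivity)
  have hX' := Metric.tendsto_nhds.1 hX (ε / (|K| + 1)) (by positivity)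
  rw [eventually_wpo, ENNReal.tendsto_nhds_zero] at hX'
  filter_upwards [hK, hX' (ENNReal.ofReal (δ / 2)) (by simpa using hδ0)] with n h1 h2
  have h3 : {ω | ¬ dist (X (n, ω) * Y (n, ω)) 0 < ε} ⊆
      {ω | K * 1 < |Y (n, ω)|} ∪ {ω | ¬ dist (X (n, ω)) 0 < ε / (|K| + 1)} := by
    intro ω hω
    by_contra hcon
    simp only [Set.mem_union, Set.mem_ofPred_eq, not_or, not_le, not_lt, mul_one, dist_zero_right,
      Real.norm_eq_abs] at hcon hω
    obtain ⟨h4, h5⟩ := hcon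
    rw [lt_div_iff₀ (by positivity)] at h5
    rw [abs_mul] at hω
    have h6 : |X (n, ω)| * |Y (n, ω)| ≤ |X (n, ω)| * (|K| + 1) :=
      mul_le_mul_of_nonneg_left (by linarith [le_abs_self K]) (abs_nonneg _)
    linarith
  refine ((measure_mono h3).trans (measure_union_le _ _)).trans ((add_le_add h1 h2).trans ?_)
  rw [← ENNReal.ofReal_add (by positivity) (by positivity), add_halves, ENNReal.ofReal_coe_nnreal]
  exact hδη.le

end OpProduct

/-! ### The limiting distribution of the errors of the estimated factors -/

section LimitDistribution

set_option linter.unusedSectionVars false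

variable {μ : Measure Ω} [IsProbabilityMeasure μ] {m : Model Ω} {l : Limits m} {α β : ℝ}
  {E : Estimators m} {c C a : ℝ}

/-- The matrix `V^{-1/2} Υ' Σ_Λ^{-1/2}`. -/
def Limits.score (l : Limits m) (j : Fin m.J) : Matrix (Fin (m.r j)) (Fin (m.r j)) ℝ :=
  l.VInvSqrt j * l.whiten j

theorem Limits.root_inv_transpose (l : Limits m) (j : Fin m.J) :
    ((l.root j)⁻¹)ᵀ = (l.root j)⁻¹ := by
  rw [Matrix.transpose_nonsing_inv, l.root_transpose]

theorem Limits.asyCov_eq (l : Limits m) (j : Fin m.J) (t : ℕ) :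
    l.asyCov j t = l.score j * l.Gam j t * (l.score j)ᵀ := by
  have h : (l.VInvSqrt j)ᵀ = l.VInvSqrt j := diagonal_transpose _
  unfold Limits.asyCov Limits.score Limits.whiten
  rw [transpose_mul, transpose_mul, transpose_transpose, h, l.root_inv_transpose]
  simp only [Matrix.mul_assoc]

theorem Setting.isUnit_score (S : Setting μ m l α β E) (j : Fin m.J) : IsUnit (l.score j) := by
  rw [Matrix.isUnit_iff_isUnit_det]
  unfold Limits.score Limits.VInvSqrt
  rw [det_mul, det_diagonal]
  refine (isUnit_iff_ne_zero.2 (Finset.prod_ne_zero_iff.2 fun b _ =>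
    inv_ne_zero (Real.sqrt_pos.2 (S.eigenvalue_pos j b)).ne')).mul ?_
  exact Matrix.isUnit_det_of_right_inverse (S.loading.whiten_mul_color S.eigen j)

/-- `V⁻¹ (Σ_Λ^{-1/2} Υ V^{1/2})' = V^{-1/2} Υ' Σ_Λ^{-1/2}`: the limit of the matrix that maps the
scaled loading-weighted errors to the error of the factors. -/
theorem Setting.score_eq (S : Setting μ m l α β E) (j : Fin m.J) :
    (diagonal (l.v j))⁻¹ * (l.Hlim j)ᵀ = l.score j := by
  have h1 : (diagonal fun b => √(l.v j b)) = diagonal (l.v j) * l.VInvSqrt j := by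
    unfold Limits.VInvSqrt
    rw [diagonal_mul_diagonal]
    congr 1
    funext b
    have h := S.eigenvalue_pos j b
    have h2 := (Real.sqrt_pos.2 h).ne'
    rw [eq_mul_inv_iff_mul_eq₀ h2, Real.mul_self_sqrt h.le]
  unfold Limits.Hlim Limits.score Limits.whiten
  rw [transpose_mul, diagonal_transpose, h1, transpose_mul, l.root_inv_transpose,
    Matrix.mul_assoc, Matrix.nonsing_inv_mul_cancel_left _ _ (S.isUnit_diagonal_eigenvalues j)]

/-- The sum of the loadings of regime `j`, weighted by the errors of date `t` and scaled. -/
def scaledScore (m : Model Ω) (N : ℕ) (j : Fin m.J) (t : ℕ) (ω : Ω) : Fin (m.r j) → ℝ :=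
  (√(N : ℝ))⁻¹ • ((m.Lam N j)ᵀ *ᵥ m.errVec N ω t)

theorem Setting.op_scaledScore (S : Setting μ m l α β E) (j : Fin m.J) (t : ℕ) :
    Op μ (fun p : ℕ × Ω => enorm2 (scaledScore m (E.N p.1) j t p.2)) (fun _ => 1) := by
  have h := (op_fixed_loading_error S.hβ S.moment S.hN t j).det_mul
    (a' := fun n => (√(E.N n : ℝ))⁻¹)
  refine (h.rate (c := fun _ => 1) (C := 1) ?_ one_pos).mono (Eventually.of_forall fun p => ?_)
  · filter_upwards [eventually_pos S.hN] with n hn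
    have hN : 0 < √(E.N n : ℝ) := Real.sqrt_pos.2 (by exact_mod_cast hn)
    rw [abs_of_pos (inv_pos.2 hN), inv_mul_cancel₀ hN.ne', one_mul]
  · rw [scaledScore, enorm2_smul, abs_of_nonneg (a := (√(E.N p.1 : ℝ))⁻¹) (by positivity)]

theorem Setting.op_fixed_x (S : Setting μ m l α β E)
    (hup : ∀ (N : ℕ) j, frobSq (m.Lam N j) ≤ C * N) (t : ℕ) :
    Op μ (fun p : ℕ × Ω => enorm2 (m.x (E.N p.1) p.2 t)) (fun n => √(E.N n : ℝ)) := by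
  have hα : (2 : ℝ) ≤ α := by linarith [S.hα]
  have h1 := (((op_fixed_factor hα S.factor t).det_mul
    (a' := fun n => √(E.N n : ℝ))).const_mul √C).rate (c := fun n => √(E.N n : ℝ)) (C := 1)
    (Eventually.of_forall fun n => by
      rw [abs_of_nonneg (Real.sqrt_nonneg _), mul_one, one_mul]) one_pos
  refine (h1.add (op_fixed_error hα S.error S.hN t)).mono (Eventually.of_forall fun p => ?_)
  refine abs_le_abs_of_nonneg (enorm2_nonneg _) ?_
  rw [m.x_eq]
  refine (enorm2_add_le _ _).trans (add_le_add ((enorm2_mulVec_le _ _).trans ?_) le_rfl)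
  rw [← mul_assoc]
  refine mul_le_mul_of_nonneg_right ((norm_le_sqrt_frobSq _).trans ?_) (enorm2_nonneg _)
  rw [← Real.sqrt_mul' _ (Nat.cast_nonneg _)]
  exact Real.sqrt_le_sqrt (hup _ _)

/-- The quantity is the larger of `1/√N` and `√N/T`. -/
theorem Setting.tendsto_sqrt_div_delta_sq (S : Setting μ m l α β E) :
    Tendsto (fun n => √(E.N n : ℝ) * (delta (E.N n) (E.T n) ^ 2)⁻¹) atTop (𝓝 0) := by
  have h1 : Tendsto (fun n => (√(E.N n : ℝ))⁻¹) atTop (𝓝 0) :=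
    (Real.tendsto_sqrt_atTop.comp (tendsto_natCast_atTop_atTop.comp S.hN)).inv_tendsto_atTop
  have h2 := h1.add S.hNT
  rw [add_zero] at h2
  refine squeeze_zero (fun n => by positivity) (fun n => ?_) h2
  rw [delta_sq]
  rcases le_total (E.N n : ℝ) (E.T n) with h | h
  · rw [min_eq_left h]
    refine le_add_of_le_of_nonneg (le_of_eq ?_) (by positivity)
    rw [← div_eq_mul_inv, Real.sqrt_div_self', one_div]
  · rw [min_eq_right h, div_eq_mul_inv]
    exact le_add_of_nonneg_left (by positivity)

/-- A bound for the distance between the scaled error of an estimated factor and its linearization. -/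
def Estimators.linBound (E : Estimators m) (l : Limits m) (C a : ℝ) (p : ℕ × Ω) (t : ℕ)
    (j : Fin m.J) : ℝ :=
  ‖E.Ginv p j * (E.H p.1 p.2 j)ᵀ - l.score j‖ * enorm2 (scaledScore m (E.N p.1) j t p.2) +
    ‖E.Ginv p j‖ * ((√(E.N p.1 : ℝ))⁻¹ * enorm2 ((E.Dev p j)ᵀ *ᵥ m.errVec (E.N p.1) p.2 t)) +
    √(E.N p.1 : ℝ) * ((E.N p.1 : ℝ)⁻¹ * (‖E.Ginv p j‖ *
      ((C + ‖(E.L p.1 p.2 j)ᵀ * E.Dev p j‖) * ‖(E.H p.1 p.2 j)⁻¹‖))) * enorm2 (m.fz t p.2) +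
    √(E.N p.1 : ℝ) * ((m.J : ℝ) ^ 2 * √C * Real.exp (-a * E.N p.1)) *
      enorm2 (m.x (E.N p.1) p.2 t)

/-- The four summands vanish by, respectively, convergence of the linear map to the score,
asymptotic orthogonality of `Dev` and the errors, the bias of order `√N/δ²`, and exponentially small
misclassification. -/
theorem Asymptotics.tendsto_linBound (S : Setting μ m l α β E) (A : Asymptotics μ l E c C a)
    (t : ℕ) (j : Fin m.J) : Tendsto (fun p => E.linBound l C a p t j) (wpo μ) (𝓝 0) := by
  have t1 : Tendsto (fun p => ‖E.Ginv p j * (E.H p.1 p.2 j)ᵀ - l.score j‖ *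
      enorm2 (scaledScore m (E.N p.1) j t p.2)) (wpo μ) (𝓝 0) := by
    refine Op.tendsto_mul_zero ?_ (S.op_scaledScore j t)
    have hT : Tendsto (fun p => (E.H p.1 p.2 j)ᵀ) (wpo μ) (𝓝 (l.Hlim j)ᵀ) :=
      tendsto_matrix_iff.2 fun b b' => tendsto_matrix_iff.1 (A.tendsto_H S j) b' b
    have h := ((A.tendsto_Ginv S j).mul hT).sub_const (l.score j)
    rw [S.score_eq, sub_self] at h
    simpa using h.norm
  have t2 := (A.tendsto_Ginv S j).norm.mul (A.tendsto_Dev_error S j t)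
  rw [mul_zero] at t2
  have t3 := (((A.op_ridge S j).det_mul (a' := fun n => √(E.N n : ℝ))).mul
    (op_fixed_factor (by linarith [S.hα]) S.factor t)).tendsto_zero (by
      simpa only [abs_of_nonneg (Real.sqrt_nonneg _), mul_one] using S.tendsto_sqrt_div_delta_sq)
  have t4 := ((S.op_fixed_x A.upper t).det_mul (a' := fun n => √(E.N n : ℝ) *
    ((m.J : ℝ) ^ 2 * √C * Real.exp (-a * E.N n)))).tendsto_zero (by
      have h := (tendsto_pow_mul_exp_neg S.hN A.a_pos 1).const_mul ((m.J : ℝ) ^ 2 * √C)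
      rw [mul_zero] at h
      refine h.congr fun n => ?_
      rw [abs_of_nonneg (by positivity), pow_one]
      nth_rewrite 1 [← Real.mul_self_sqrt (Nat.cast_nonneg (α := ℝ) (E.N n))]
      ring)
  have h := ((t1.add t2).add t3).add t4
  simp only [add_zero] at h
  exact h

theorem Asymptotics.eventually_norm_err_sub_le (S : Setting μ m l α β E)
    (A : Asymptotics μ l E c C a) (t : ℕ) (j : Fin m.J) : ∀ᶠ p in wpo μ, m.z t p.2 = j →
      ‖√(E.N p.1 : ℝ) • E.err p.1 t p.2 -
        pad m.R (l.score j *ᵥ scaledScore m (E.N p.1) j t p.2)‖ ≤ E.linBound l C a p t j := by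
  filter_upwards [A.regular, A.classified, eventually_wpo_of_atTop (S.hT.eventually_gt_atTop t),
    eventually_isUnit_of_tendsto (A.tendsto_H S j) (S.isUnit_Hlim j)] with p h hcl ht hH hz
  have hN : (0 : ℝ) < E.N p.1 := by exact_mod_cast h.N_pos
  have hsN : √(E.N p.1 : ℝ) * (E.N p.1 : ℝ)⁻¹ = (√(E.N p.1 : ℝ))⁻¹ := by
    rw [← div_eq_mul_inv, Real.sqrt_div_self', one_div]
  have h1 := h.norm_crossError_le A.c_pos A.C_pos (Real.exp_pos _).le (hcl t ht)
  have h2 := h.enorm2_ridge_le A.C_pos hz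
  rw [E.err_eq p (h.s_pos A.C_pos), hz, smul_add, add_sub_right_comm]
  refine (norm_add_le _ _).trans (add_le_add ?_ ?_)
  · rw [← pad_smul, ← pad_sub, norm_pad (m.r_le_R j), h.coreError_eq A.C_pos hH hz, smul_smul, hsN]
    set g := (E.H p.1 p.2 j)⁻¹ *ᵥ m.f j t p.2
    set rid := E.s2 p.1 p.2 • g + ((E.L p.1 p.2 j)ᵀ * E.Dev p j) *ᵥ g
    have h3 : (√(E.N p.1 : ℝ))⁻¹ • (E.Ginv p j *ᵥ
        ((E.H p.1 p.2 j)ᵀ *ᵥ ((m.Lam (E.N p.1) j)ᵀ *ᵥ m.errVec (E.N p.1) p.2 t) +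
          (E.Dev p j)ᵀ *ᵥ m.errVec (E.N p.1) p.2 t - rid)) -
        l.score j *ᵥ scaledScore m (E.N p.1) j t p.2 =
      (E.Ginv p j * (E.H p.1 p.2 j)ᵀ - l.score j) *ᵥ scaledScore m (E.N p.1) j t p.2 +
        E.Ginv p j *ᵥ ((√(E.N p.1 : ℝ))⁻¹ • ((E.Dev p j)ᵀ *ᵥ m.errVec (E.N p.1) p.2 t)) -
        (√(E.N p.1 : ℝ))⁻¹ • (E.Ginv p j *ᵥ rid) := by
      unfold scaledScore
      rw [Matrix.sub_mulVec, ← Matrix.mulVec_mulVec]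
      simp only [Matrix.mulVec_smul, Matrix.mulVec_add, Matrix.mulVec_sub, smul_add, smul_sub]
      abel
    rw [h3]
    refine (enorm2_sub_le _ _).trans (add_le_add ((enorm2_add_le _ _).trans (add_le_add
      (enorm2_mulVec_le _ _) ((enorm2_mulVec_le _ _).trans (le_of_eq ?_)))) ?_)
    · rw [enorm2_smul, abs_of_nonneg (a := (√(E.N p.1 : ℝ))⁻¹) (by positivity)]
    · rw [enorm2_smul, abs_of_nonneg (a := (√(E.N p.1 : ℝ))⁻¹) (by positivity), ← hsN]
      refine (mul_le_mul_of_nonneg_left ((enorm2_mulVec_le _ _).trans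
        (mul_le_mul_of_nonneg_left h2 (norm_nonneg _))) (by positivity)).trans (le_of_eq ?_)
      ring
  · rw [norm_smul, Real.norm_eq_abs, abs_of_nonneg (Real.sqrt_nonneg _), mul_assoc]
    exact mul_le_mul_of_nonneg_left h1 (Real.sqrt_nonneg _)

theorem measurable_scaledScore (m : Model Ω) (N : ℕ) (j : Fin m.J) (t : ℕ) :
    Measurable fun ω => (WithLp.toLp 2 (scaledScore m N j t ω) :
      EuclideanSpace ℝ (Fin (m.r j))) := by
  refine (PiLp.continuous_toLp 2 _).measurable.comp (measurable_pi_iff.2 fun b => ?_)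
  simp only [scaledScore, Pi.smul_apply, smul_eq_mul]
  exact (measurable_matrix_mulVec (A := fun _ => (m.Lam N j)ᵀ)
    (fun _ _ => measurable_const) (fun i => m.measurable_e i t) b).const_mul _

/-- The loadings are nonrandom, so the score is a function of the errors alone. -/
theorem StateIndep.indepFun_scaledScore (h : StateIndep m μ) (N : ℕ) (j : Fin m.J) (t : ℕ) :
    IndepFun (m.z t) (fun ω => (WithLp.toLp 2 (scaledScore m N j t ω) :
      EuclideanSpace ℝ (Fin (m.r j)))) μ := by
  let ψ : ((j : Fin m.J) → ℕ → Fin (m.r j) → ℝ) × (ℕ → ℕ → ℝ) → EuclideanSpace ℝ (Fin (m.r j)) :=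
    fun y => WithLp.toLp 2 ((√(N : ℝ))⁻¹ • ((m.Lam N j)ᵀ *ᵥ fun i : Fin N => y.2 i t))
  have hψ : Measurable ψ := by
    refine (PiLp.continuous_toLp 2 _).measurable.comp (measurable_pi_iff.2 fun b => ?_)
    simp only [Pi.smul_apply, smul_eq_mul]
    exact (measurable_matrix_mulVec (A := fun _ => (m.Lam N j)ᵀ) (fun _ _ => measurable_const)
      (fun i => (measurable_pi_apply t).comp ((measurable_pi_apply (i : ℕ)).comp measurable_snd))
      b).const_mul _
  exact IndepFun.comp (φ := fun z : ℕ → Fin m.J => z t) (ψ := ψ) h (measurable_pi_apply t) hψ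

theorem Setting.tendstoInDistribution_scaledScore (S : Setting μ m l α β E) (j : Fin m.J) (t : ℕ) :
    TendstoInDistribution (fun n ω => (WithLp.toLp 2 (scaledScore m (E.N n) j t ω) :
      EuclideanSpace ℝ (Fin (m.r j)))) atTop id (fun _ => μ)
      (multivariateGaussian 0 (l.Gam j t)) where
  forall_aemeasurable := fun n => (measurable_scaledScore m _ j t).aemeasurable
  aemeasurable_limit := aemeasurable_id
  tendsto := by
    have h := (S.dist.clt j t).tendsto.comp S.hN
    simp only [scaled_loading_error_eq] at h
    exact h

/-- The limiting distribution of the errors of the estimated factors. -/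
theorem Asymptotics.tendstoInDistribution_err (S : Setting μ m l α β E)
    (A : Asymptotics μ l E c C a) (t : ℕ) (j : Fin m.J) (htj : μ (m.z t ⁻¹' {j}) ≠ 0)
    [IsProbabilityMeasure (μ[|m.z t ⁻¹' {j}])] :
    TendstoInDistribution (fun n ω => √(E.N n : ℝ) • E.err n t ω) atTop
      (fun y : EuclideanSpace ℝ (Fin (m.r j)) => pad m.R (WithLp.ofLp y))
      (fun _ => μ[|m.z t ⁻¹' {j}]) (multivariateGaussian 0 (l.asyCov j t)) := by
  have hz : MeasurableSet (m.z t ⁻¹' {j}) := m.measurableSet_z t j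
  have hscore : Continuous fun y : EuclideanSpace ℝ (Fin (m.r j)) =>
      (WithLp.toLp 2 (l.score j *ᵥ WithLp.ofLp y) : EuclideanSpace ℝ (Fin (m.r j))) :=
    (Matrix.toEuclideanCLM (n := Fin (m.r j)) (𝕜 := ℝ) (l.score j)).continuous
  have hpad := continuous_pad (k := m.r j) m.R
  -- By independence of states and errors, conditioning on the regime leaves the law of the score
  -- unchanged.
  have h1 : TendstoInDistribution (fun n ω => (WithLp.toLp 2 (scaledScore m (E.N n) j t ω) :
      EuclideanSpace ℝ (Fin (m.r j)))) atTop id (fun _ => μ[|m.z t ⁻¹' {j}])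
      (multivariateGaussian 0 (l.Gam j t)) :=
    (S.tendstoInDistribution_scaledScore j t).of_map_eq
      (fun n => (measurable_scaledScore m _ j t).aemeasurable) aemeasurable_id
      (fun n => map_cond_of_indepFun (S.indep.indepFun_scaledScore _ j t) (m.measurable_z t)
        (measurable_scaledScore m _ j t) (measurableSet_singleton j) htj) rfl
  have h2 := h1.continuous_comp (hpad.comp hscore)
  have h3 : TendstoInDistribution (fun n ω => √(E.N n : ℝ) • E.err n t ω) atTop
      (((fun y : EuclideanSpace ℝ (Fin (m.r j)) => pad m.R (WithLp.ofLp y)) ∘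
        fun y : EuclideanSpace ℝ (Fin (m.r j)) => (WithLp.toLp 2 (l.score j *ᵥ WithLp.ofLp y) :
          EuclideanSpace ℝ (Fin (m.r j)))) ∘ id)
      (fun _ => μ[|m.z t ⁻¹' {j}]) (multivariateGaussian 0 (l.Gam j t)) := by
    -- Slutsky: on the event `z t = j` the scaled error differs from its linearization by a quantity
    -- tending to zero in probability.
    refine tendstoInDistribution_of_tendstoInMeasure_sub _ _ h2 ?_
      fun n => ((E.measurable_err n t).const_smul √(E.N n : ℝ)).aemeasurable
    refine tendstoInMeasure_cond hz htj fun ε hε => ?_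
    filter_upwards [A.eventually_norm_err_sub_le S t j,
      (A.tendsto_linBound S t j).eventually (gt_mem_nhds hε)] with p hp1 hp2 hp3
    exact (hp1 hp3).trans_lt hp2
  -- The limit is rewritten as the padded Gaussian whose covariance is `Γ` conjugated by the score.
  refine h3.of_map_eq h3.forall_aemeasurable hpad.aemeasurable (fun _ => rfl) ?_
  rw [l.asyCov_eq, ← map_multivariateGaussian_zero (S.isUnit_score j),
    Measure.map_map hpad.measurable hscore.measurable]
  rfl

end LimitDistribution

end SwitchingFactor

end

theorem theorem5 {Ω : Type*} [MeasurableSpace Ω] (μ : Measure Ω) [IsProbabilityMeasure μ]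
    (m : SwitchingFactor.Model Ω) (l : SwitchingFactor.Limits m) (α β : ℝ)
    (hα : 16 < α) (hβ : 2 ≤ β)
    (hindep : SwitchingFactor.StateIndep m μ)
    (hfactor : SwitchingFactor.FactorAssumption m μ l α)
    (hloading : SwitchingFactor.LoadingAssumption m μ l)
    (herror : SwitchingFactor.ErrorAssumption m μ α)
    (hstate : SwitchingFactor.StateAssumption m μ l)
    (hmoment : SwitchingFactor.MomentAssumption m μ β)
    (heigen : SwitchingFactor.EigenAssumption l)
    (hdist : SwitchingFactor.DistAssumption m μ l)
    (E : SwitchingFactor.Estimators m)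
    (hE : SwitchingFactor.EstimatorAssumption μ l E)
    (hN : Tendsto E.N atTop atTop) (hT : Tendsto E.T atTop atTop)
    (hNT : Tendsto (fun n => Real.sqrt (E.N n) / (E.T n : ℝ)) atTop (𝓝 0))
    (hTα : Tendsto (fun n => (E.T n : ℝ) ^ (16 / α) / (E.N n : ℝ)) atTop (𝓝 0))
    (hTαβ : Tendsto (fun n => (E.T n : ℝ) ^ (2 / α + 2 / β) / (E.N n : ℝ)) atTop (𝓝 0)) :
    (∀ j, Tendsto (fun n => μ {ω | ¬ IsUnit (E.H n ω j)}) atTop (𝓝 0)) ∧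
    SwitchingFactor.IsBigOp μ
      (fun n ω => (E.T n : ℝ)⁻¹ * ∑ t ∈ Finset.range (E.T n), ‖E.err n t ω‖ ^ 2)
      (fun n => (SwitchingFactor.delta (E.N n) (E.T n) ^ 2)⁻¹) ∧
    (∀ (t : ℕ) (j : Fin m.J) (htj : μ (m.z t ⁻¹' {j}) ≠ 0),
      haveI : IsProbabilityMeasure (μ[|m.z t ⁻¹' {j}]) := cond_isProbabilityMeasure htj
      TendstoInDistribution (fun n ω => Real.sqrt (E.N n) • E.err n t ω) atTop
        (fun y : EuclideanSpace ℝ (Fin (m.r j)) => SwitchingFactor.pad m.R (WithLp.ofLp y))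
        (fun _ => μ[|m.z t ⁻¹' {j}]) (multivariateGaussian 0 (l.asyCov j t))) := by
  have S : SwitchingFactor.Setting μ m l α β E :=
    ⟨hα, hβ, hindep, hfactor, hloading, herror, hstate, hmoment, heigen, hdist, hE, hN, hT, hNT,
      hTα, hTαβ⟩
  obtain ⟨c, C, a, A⟩ := S.exists_asymptotics
  refine ⟨A.tendsto_measure_not_isUnit S, SwitchingFactor.Op.isBigOp (X := fun n ω =>
    (E.T n : ℝ)⁻¹ * ∑ t ∈ Finset.range (E.T n), ‖E.err n t ω‖ ^ 2) (A.op_mean_err_sq S),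
    fun t j htj => ?_⟩
  have : IsProbabilityMeasure (μ[|m.z t ⁻¹' {j}]) := cond_isProbabilityMeasure htj
  exact A.tendstoInDistribution_err S t j htj
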